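/- **Setting.** Let $m>1$ be real, $m\neq 2$ (for the dihedral groups, $I_2(2m)$ with $2m\ge 3$ an integer, $2m\ne 4$). The bi-flat $F$-manifold of $I_2(2m)$ with parameter $c$ has, in flat coordinates $(u,v)=(u^1,u^2)$, $u>0$, the vector potential $$A^1=uv-\tfrac{2c}{m+1}u^{m+1},\qquad A^2=\tfrac12v^2+\Big(-\tfrac{2m}{8m-4}c^2+\tfrac{2m}{2m-1}\Big)u^{2m},$$ product $c^i_{jk}=\partial_j\partial_kA^i$, and its $(2,1)$ flow is $u^i_t=\sum_{j,k}c^i_{jk}\,u^j\,u^k_x$. Let $c=2\sigma$ with $\sigma=\pm1$. Let $\Omega\subset\{u>0\}$ be open; all coefficients below are smooth functions of $(u,v)$ on $\Omega$, and $\deg \partial_x^s u^i=s$ for differential polynomials. * A *deformation* (up to $\epsilon^2$) of the $(2,1)$ flow is a system of conservation laws $u^i_t=\partial_x[\alpha^i_0+\epsilon\alpha_1^i+\epsilon^2\alpha_2^i]+O(\epsilon^3)$, with $\alpha_k^i$ a homogeneous differential polynomial of degree $k$, whose $\epsilon^0$ part is the $(2,1)$ flow. * It is *integrable* (up to $\epsilon^2$)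 if every flow $u^i_\tau=S^i_j(u)u^j_x$ commuting with the dispersionless limit extends to a flow $S+\epsilon Q_1+\epsilon^2Q_2$, with $Q_k$ a homogeneous differential polynomial of degree $k+1$, that commutes with the deformed flow modulo $\epsilon^3$. * A *Miura transformation* here is $w^i=u^i+\epsilon X_1^i+\epsilon^2X_2^i$ with $X_k^i$ a homogeneous differential polynomial of degree $k$. It is *conservative* if $X_1^i=\partial_xM^i(u,v)$ and $X_2^i=\partial_xB^i$ with $B^i$ of degree $1$. For functions $F,G,f$ of one variable write $F=F(v-4\sigma u^m)$, $G=G(v-4\sigma u^m)$, $f=f(v)$, and let $F_v,G_v,f_v$ be their derivatives. The *normal form* $\mathcal N(F,G,f)$ is the system $$u_t=\partial_x\Big[-\sigma\tfrac{4m}{m+1}u^{m+1}+uv+\epsilon^2\big(a_{16}v_x^2-4\sigma m u^{m-1}a_{16}u_xv_x\big)\Big],$$ $$v_t=\partial_x\Big[\tfrac12v^2+\epsilon\big(-4\sigma m u^{2m-2}u_x+u^{m-1}v_x\big)F+\epsilon^2\big(a_{23}u_{xx}+a_{24}v_{xx}+a_{25}u_x^2+a_{26}v_x^2+a_{27}u_xv_x\big)\Big],$$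 where $$a_{16}=-\tfrac{m-4}{48m^3}\tfrac{FF_v}{u}-\sigma\tfrac{m-4}{192m^4}\tfrac{F^2}{u^{m+1}}-\tfrac{(m-3)(m-1)(m+1)}{64m^2(m-2)}\tfrac{f}{u^{2m-1}},$$ $$a_{23}=\tfrac{2(m-1)}{3m}u^{2m-3}F^2+u^{3m-3}G,\qquad a_{24}=-\sigma\tfrac{m-1}{6m^2}u^{m-2}F^2-\tfrac{\sigma}{4m}u^{2m-2}G-\tfrac{m+1}{4m}f,$$ $$a_{25}=3(m-1)u^{3m-4}G-4\sigma mu^{4m-4}G_v+\tfrac{8m^2-17m+12}{6m}u^{2m-4}F^2-\tfrac{4\sigma}{3}(m-4)u^{3m-4}FF_v,$$ $$a_{26}=-\sigma\tfrac{m-4}{12m^2}u^{m-2}FF_v-\tfrac{\sigma}{4m}u^{2m-2}G_v-\tfrac{m-4}{96m^3}\tfrac{F^2}{u^2}+\tfrac{m-1}{16m^2}u^{m-2}G-\tfrac{(m+1)(m-3)}{8m(m-2)}f_v-\sigma\tfrac{(m+1)(m-3)(m-1)^2}{16m^2(m-2)}\tfrac{f}{u^m},$$ $$a_{27}=\tfrac{2(m-4)}{3m}u^{2m-3}FF_v+2u^{3m-3}G_v-\sigma\tfrac{2m^2-5m+6}{12m^2}u^{m-3}F^2-\sigma\tfrac{3(m-1)}{4m}u^{2m-3}G+\tfrac{(m-1)(m-3)(m+1)}{4(m-2)}\tfrac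 fu.$$ **Theorem.** 1. Let a deformation of the $(2,1)$ flow with $c=\pm2$ be integrable up to $\epsilon^2$ on $\Omega$. Then every point of $\Omega$ has an open neighbourhood $U\subseteq\Omega$ on which a conservative Miura transformation carries the deformation, modulo $\epsilon^3$, to $\mathcal N(F,G,f)$ for some smooth $F,G$ (on the image of $U$ under $v\mp4u^m$) and smooth $f$ (on the image of $U$ under $v$). 2. Conversely, for all smooth $F,G$ (on the image of $\Omega$ under $v\mp 4u^m$) and smooth $f$ (on the image of $\Omega$ under $v$), $\mathcal N(F,G,f)$ is a deformation of the $(2,1)$ flow that is integrable up to $\epsilon^2$ on $\Omega$. 3. The three functional parameters (one at first order, two more at second order) are essential: if some Miura transformation on $\Omega$ carries $\mathcal N(F,G,f)$ to $\mathcal N(\tilde F,\tilde G,\tilde f)$ modulo $\epsilon^2$, then $F=\tilde F$ on the image of $\Omega$ under $v\mp 4u^m$; if it does so modulo $\epsilon^3$, then moreover $G=\tilde G$ on that image and $f=\tilde f$ on the image of $\Omega$ under $v$. In particular (take $\tilde F=0$) the first-order term cannot be removed unless $F=0$. -/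

import Mathlib

open scoped ContDiff

noncomputable section

namespace CoxeterFlow

/-- Values of the two fields: `p 0 = u`, `p 1 = v`. -/
abbrev Pt := Fin 2 → ℝ

/-- Jets of a pair of functions of `x`: `z s i` is the `s`-th `x`-derivative of the `i`-th field,
so `z 0 = (u, v)`, `z 1 = (u_x, v_x)`, `z 2 = (u_xx, v_xx)`, and so on. -/
abbrev Jet := ℕ → Pt

/-! ### Differential polynomials -/

/-- `f` is, over `Ω`, a homogeneous differential polynomial of degree `d ≤ 3`
(the `s`-th `x`-derivative has degree `s`) with smooth coefficients on `Ω`. -/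
def IsDiffPoly (Ω : Set Pt) (d : Fin 4) (f : Jet → ℝ) : Prop :=
  match d with
  | 0 => ∃ a : Pt → ℝ, ContDiffOn ℝ ∞ a Ω ∧ ∀ z : Jet, z 0 ∈ Ω → f z = a (z 0)
  | 1 => ∃ a : Fin 2 → Pt → ℝ, (∀ j, ContDiffOn ℝ ∞ (a j) Ω) ∧
      ∀ z : Jet, z 0 ∈ Ω → f z = ∑ j, a j (z 0) * z 1 j
  | 2 => ∃ (a : Fin 2 → Pt → ℝ) (b : Fin 2 → Fin 2 → Pt → ℝ),
      (∀ j, ContDiffOn ℝ ∞ (a j) Ω) ∧ (∀ j k, ContDiffOn ℝ ∞ (b j k) Ω) ∧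
      ∀ z : Jet, z 0 ∈ Ω →
        f z = ∑ j, a j (z 0) * z 2 j + ∑ j, ∑ k, b j k (z 0) * z 1 j * z 1 k
  | 3 => ∃ (a : Fin 2 → Pt → ℝ) (b : Fin 2 → Fin 2 → Pt → ℝ)
        (c : Fin 2 → Fin 2 → Fin 2 → Pt → ℝ),
      (∀ j, ContDiffOn ℝ ∞ (a j) Ω) ∧ (∀ j k, ContDiffOn ℝ ∞ (b j k) Ω) ∧
      (∀ j k l, ContDiffOn ℝ ∞ (c j k l) Ω) ∧
      ∀ z : Jet, z 0 ∈ Ω →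
        f z = ∑ j, a j (z 0) * z 3 j + ∑ j, ∑ k, b j k (z 0) * z 2 j * z 1 k +
          ∑ j, ∑ k, ∑ l, c j k l (z 0) * z 1 j * z 1 k * z 1 l

/-! ### Evolutionary vector fields -/

/-- The total derivative `∂_x f = ∑ u^i_(s+1) ∂f/∂u^i_(s)`: the derivative of `f` at the jet `z`
in the direction of the shifted jet. -/
def totalD (f : Jet → ℝ) (z : Jet) : ℝ :=
  deriv (fun t : ℝ => f (z + t • fun s => z (s + 1))) 0

/-- The prolongation `(∂_x^s X^i)` of the evolutionary system `u^i_t = X^i`. -/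
def prolong (X : Jet → Pt) (z : Jet) : Jet :=
  fun s i => (totalD^[s] (fun z' => X z' i)) z

/-- The derivative `∑ (∂_x^s X^i) ∂f/∂u^i_(s)` of `f` along the system `u^i_t = X^i`. -/
def evol (X : Jet → Pt) (f : Jet → ℝ) (z : Jet) : ℝ :=
  deriv (fun t : ℝ => f (z + t • prolong X z)) 0

/-- The commutator of the systems `u_t = X` and `u_τ = Y`. -/
def bracket (X Y : Jet → Pt) (z : Jet) : Pt :=
  fun i => evol X (fun z' => Y z' i) z - evol Y (fun z' => X z' i) z

/-- A family `K : Fin 3 → Jet → Pt` stands for the system `u_t = K 0 + ε K 1 + ε² K 2 + O(ε³)`.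
Over `Ω`, two such systems commute modulo `ε³`. -/
def Commute (Ω : Set Pt) (K Q : Fin 3 → Jet → Pt) : Prop :=
  ∀ n : Fin 3, ∀ z : Jet, z 0 ∈ Ω → ∀ i : Fin 2,
    ∑ ab : Fin 3 × Fin 3 with ab.1.val + ab.2.val = n.val,
      bracket (K ab.1) (Q ab.2) z i = 0

/-- Integrability up to order `ε²` over `Ω`: every symmetry of hydrodynamic type
`u^i_τ = S^i_j(u) u^j_x` of the dispersionless limit `u_t = K 0` extends to a symmetry
`u_τ = S + ε Q 1 + ε² Q 2 + O(ε³)` of the full system modulo `ε³`. -/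
def Integrable (Ω : Set Pt) (K : Fin 3 → Jet → Pt) : Prop :=
  ∀ S : Jet → Pt, (∀ i, IsDiffPoly Ω 1 (fun z => S z i)) →
    (∀ z : Jet, z 0 ∈ Ω → ∀ i, bracket (K 0) S z i = 0) →
    ∃ Q : Fin 3 → Jet → Pt,
      (∀ (n : Fin 3) (i : Fin 2), IsDiffPoly Ω n.succ (fun z => Q n z i)) ∧
      (∀ z : Jet, z 0 ∈ Ω → Q 0 z = S z) ∧ Commute Ω K Q

/-! ### Miura transformations -/

/-- `w = u + ε X 1 + ε² X 2` is, over `Ω`, a Miura transformation with identical leading term: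
`X n` is a differential polynomial of degree `n`. -/
def IsMiura (Ω : Set Pt) (X : Fin 3 → Jet → Pt) : Prop :=
  (∀ z : Jet, X 0 z = z 0) ∧
    ∀ (n : Fin 3) (i : Fin 2), IsDiffPoly Ω n.castSucc (fun z => X n z i)

/-- The Miura transformation has the form `w^i = u^i + ε ∂_x M^i + ε² ∂_x B^i`, with `M^i` a
function of the fields and `B^i` a differential polynomial of degree one. Such transformations
preserve the form of conservation laws. -/
def IsConservativeMiura (Ω : Set Pt) (X : Fin 3 → Jet → Pt) : Prop :=
  IsMiura Ω X ∧ ∃ M B : Jet → Pt,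
    (∀ i, IsDiffPoly Ω 0 (fun z => M z i)) ∧ (∀ i, IsDiffPoly Ω 1 (fun z => B z i)) ∧
    ∀ z : Jet, z 0 ∈ Ω → ∀ i,
      X 1 z i = totalD (fun z' => M z' i) z ∧ X 2 z i = totalD (fun z' => B z' i) z

/-- The jet of `w = X 0 + ε X 1 + ε² X 2` in terms of the jet of `u`. -/
def miuraJet (X : Fin 3 → Jet → Pt) (ε : ℝ) (z : Jet) : Jet :=
  ∑ n : Fin 3, ε ^ n.val • prolong (X n) z

/-- Over `Ω`, the transformation `w = X 0 + ε X 1 + ε² X 2` carries the system `u_t = K` to the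
system `w_t = L`, modulo `ε^(N+1)`: the `t`-derivative of `w` along `u_t = K` agrees with
`L` evaluated on the jet of `w` up to `o(ε^N)`. -/
def Carries (N : ℕ) (Ω : Set Pt) (X K L : Fin 3 → Jet → Pt) : Prop :=
  ∀ z : Jet, z 0 ∈ Ω → ∀ i : Fin 2,
    (fun ε : ℝ =>
      (∑ n : Fin 3, ε ^ n.val * L n (miuraJet X ε z) i) -
        ∑ a : Fin 3, ∑ b : Fin 3, ε ^ (a.val + b.val) * evol (K a) (fun z' => X b z' i) z)
      =o[nhds 0] fun ε : ℝ => ε ^ N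

/-! ### The dispersionless flow -/

/-- The vector potential of the bi-flat `F`-manifold of `I_2(2m)` with parameter `c`,
in the flat coordinates `(u, v)`. -/
def potential (m c : ℝ) : Fin 2 → Pt → ℝ :=
  ![fun p => p 0 * p 1 - 2 * c / (m + 1) * p 0 ^ (m + 1),
    fun p => p 1 ^ 2 / 2 +
      (-(2 * m / (4 * (2 * m) - 4)) * c ^ 2 + 2 * m / (2 * m - 1)) * p 0 ^ (2 * m)]

/-- Partial derivative in the `j`-th coordinate. -/
def pderiv (j : Fin 2) (f : Pt → ℝ) (p : Pt) : ℝ := fderiv ℝ f p (Pi.single j 1)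

/-- The structure constants `c^i_{jk} = ∂_j ∂_k A^i` of the product. -/
def structureConst (m c : ℝ) (i j k : Fin 2) (p : Pt) : ℝ :=
  pderiv j (pderiv k (potential m c i)) p

/-- The flow `(2,1)` of the principal hierarchy, `u_t = X ∘ u_x`. Here `X = (u, v)`
is obtained from the flat unit field `e = ∂_v` by the recursion `∇ X = e ∘`. -/
def flow21 (m c : ℝ) (z : Jet) : Pt :=
  fun i => ∑ j, ∑ k, structureConst m c i j k (z 0) * z 0 j * z 1 k

/-- Over `Ω`, the system `u_t = K` is a deformation up to order `ε²`, in the form of conservation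
laws, of the flow `(2,1)`: `K n = ∂_x (α n)` with `α n` a differential polynomial of degree `n`,
and `K 0` is the flow `(2,1)`. -/
def IsDeformation (m c : ℝ) (Ω : Set Pt) (K : Fin 3 → Jet → Pt) : Prop :=
  (∀ z : Jet, z 0 ∈ Ω → K 0 z = flow21 m c z) ∧
  ∃ α : Fin 3 → Jet → Pt,
    (∀ (n : Fin 3) (i : Fin 2), IsDiffPoly Ω n.castSucc (fun z => α n z i)) ∧
    ∀ (n : Fin 3) (z : Jet), z 0 ∈ Ω → ∀ i, K n z i = totalD (fun z' => α n z' i) z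

/-! ### The normal form -/

/-- The Riemann invariant `w = v ∓ 4 u^m` (with `σ = ±1` for `c = ±2`). The other one is `v`. -/
def riemannInv (m σ : ℝ) (p : Pt) : ℝ := p 1 - σ * 4 * p 0 ^ m

section NormalForm

variable (m σ : ℝ) (F G f : ℝ → ℝ) (p : Pt)

def a16 : ℝ :=
  let u := p 0;
  let Fw := F (riemannInv m σ p);
  let Fv := deriv F (riemannInv m σ p);
  -(1 / 48) * ((m - 4) / m ^ 3) * (Fw * Fv / u)
    - σ * (1 / 192) * ((m - 4) / m ^ 4) * (Fw ^ 2 / u ^ (m + 1))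
    - 1 / 64 * ((m - 3) * (m - 1) * (m + 1) / (m ^ 2 * (m - 2))) * (f (p 1) / u ^ (2 * m - 1))

def a23 : ℝ :=
  let u := p 0;
  let Fw := F (riemannInv m σ p);
  let Gw := G (riemannInv m σ p);
  2 / 3 * ((m - 1) / m) * u ^ (2 * m - 3) * Fw ^ 2 + u ^ (3 * m - 3) * Gw

def a24 : ℝ :=
  let u := p 0;
  let Fw := F (riemannInv m σ p);
  let Gw := G (riemannInv m σ p);
  -σ * (1 / 6) * ((m - 1) / m ^ 2) * u ^ (m - 2) * Fw ^ 2
    - σ * (1 / (4 * m)) * u ^ (2 * m - 2) * Gw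
    - 1 / 4 * ((m + 1) / m) * f (p 1)

def a25 : ℝ :=
  let u := p 0;
  let Fw := F (riemannInv m σ p);
  let Fv := deriv F (riemannInv m σ p);
  let Gw := G (riemannInv m σ p);
  let Gv := deriv G (riemannInv m σ p);
  3 * (m - 1) * u ^ (3 * m - 4) * Gw
    - σ * 4 * m * u ^ (4 * m - 4) * Gv
    + 1 / 6 * ((8 * m ^ 2 - 17 * m + 12) / m) * u ^ (2 * m - 4) * Fw ^ 2
    - σ * (4 / 3) * (m - 4) * u ^ (3 * m - 4) * (Fw * Fv)

def a26 : ℝ :=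
  let u := p 0;
  let Fw := F (riemannInv m σ p);
  let Fv := deriv F (riemannInv m σ p);
  let Gw := G (riemannInv m σ p);
  let Gv := deriv G (riemannInv m σ p);
  -σ * (1 / 12) * ((m - 4) / m ^ 2) * u ^ (m - 2) * (Fw * Fv)
    - σ * (1 / (4 * m)) * u ^ (2 * m - 2) * Gv
    - 1 / 96 * ((m - 4) / m ^ 3) * (Fw ^ 2 / u ^ 2)
    + 1 / 16 * ((m - 1) / m ^ 2) * u ^ (m - 2) * Gw
    - 1 / 8 * ((m + 1) * (m - 3) / (m * (m - 2))) * deriv f (p 1)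
    - σ * (1 / 16) * ((m + 1) * (m - 3) * (m - 1) ^ 2 / (m ^ 2 * (m - 2))) * (f (p 1) / u ^ m)

def a27 : ℝ :=
  let u := p 0;
  let Fw := F (riemannInv m σ p);
  let Fv := deriv F (riemannInv m σ p);
  let Gw := G (riemannInv m σ p);
  let Gv := deriv G (riemannInv m σ p);
  2 / 3 * ((m - 4) / m) * u ^ (2 * m - 3) * (Fw * Fv)
    + 2 * u ^ (3 * m - 3) * Gv
    - σ * (1 / 12) * ((2 * m ^ 2 - 5 * m + 6) / m ^ 2) * u ^ (m - 3) * Fw ^ 2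
    - σ * (3 / 4) * ((m - 1) / m) * u ^ (2 * m - 3) * Gw
    + 1 / 4 * ((m - 1) * (m - 3) * (m + 1) / (m - 2)) * (f (p 1) / u)

end NormalForm

/-- The currents of the normal form, at the orders `1`, `ε`, `ε²`. -/
def normalCurrent (m σ : ℝ) (F G f : ℝ → ℝ) : Fin 3 → Jet → Pt :=
  ![fun z => ![-(σ * 4 * m * z 0 0 ^ (m + 1) / (m + 1)) + z 0 0 * z 0 1, z 0 1 ^ 2 / 2],
    fun z => ![0,
      (-(σ * 4 * m * z 0 0 ^ (2 * m - 2)) * z 1 0 + z 0 0 ^ (m - 1) * z 1 1)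
        * F (riemannInv m σ (z 0))],
    fun z => ![
      a16 m σ F f (z 0) * z 1 1 ^ 2
        - σ * 4 * m * z 0 0 ^ (m - 1) * a16 m σ F f (z 0) * z 1 0 * z 1 1,
      a23 m σ F G (z 0) * z 2 0 + a24 m σ F G f (z 0) * z 2 1
        + a25 m σ F G (z 0) * z 1 0 ^ 2 + a26 m σ F G f (z 0) * z 1 1 ^ 2
        + a27 m σ F G f (z 0) * z 1 0 * z 1 1]]

/-- The normal form `u_t = ∂_x (normalCurrent)`. -/
def normalForm (m σ : ℝ) (F G f : ℝ → ℝ) : Fin 3 → Jet → Pt :=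
  fun n z i => totalD (fun z' => normalCurrent m σ F G f n z' i) z

/-- The functional parameters are smooth on the sets where the normal form evaluates them:
`F`, `G` on the values of `v ∓ 4 u^m` and `f` on the values of `v`. -/
def SmoothParams (m σ : ℝ) (Ω : Set Pt) (F G f : ℝ → ℝ) : Prop :=
  ContDiffOn ℝ ∞ F (riemannInv m σ '' Ω) ∧ ContDiffOn ℝ ∞ G (riemannInv m σ '' Ω) ∧
    ContDiffOn ℝ ∞ f ((fun p : Pt => p 1) '' Ω)

end CoxeterFlow

end

open scoped ContDiff
open Filter Topology TopologicalSpace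
set_option linter.unusedSectionVars false
set_option linter.unusedSimpArgs false

noncomputable section

namespace CoxeterFlow

/-! For `c = ±2` the coefficient of `u^(2m)` in the potential vanishes, and in the Riemann
invariants `w = v - 4σu^m` and `v` the flow `(2,1)` becomes triangular: `w_t = λ w_x`, `v_t = v v_x`
with `λ = v - m (v - w)`. Comparing coefficients shows that its hydrodynamic symmetries are exactly
`w_τ = μ w_x`, `v_τ = g v_x`, where `g` depends on `v` alone and `∂_v μ = -(1 - 1/m) (g - μ)/(v -
w)` (`exists_isSymm`, `brk_baseFlow_symmFlow`). The last equation is closedness of `(g dv - μ dw) /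
(4σm u^(m-1))`. Bracketing with a symmetry therefore preserves systems of conservation laws and acts
on their currents by an explicit operator (`IsSymm.brk_consFlow`). All computations take place in
the algebra of smooth functions of finite jets, where `∂_x` and evolutionary systems are
derivations.

Integrability of the normal form. One set of formulas in `(g - μ)/(v - w)`, in the `w`-derivatives
of `μ` and in the derivatives of `g` deforms every symmetry `(μ, g)`, and the normal form is the
case `(λ, v)`. Commutation splits into a part linear in `F` at order `ε` and, at order `ε²`, parts
quadratic in `F`, linear in `G` and linear in `f`. Each part is a polynomial identity
(`symmCurA_lin`, `symmCurA_quad`, `symmCurA_disp`, `symmCurA_scal` and the companions for the other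
current), and `deformed_commute` adds them up.

Reduction to the normal form. The single symmetry `w_τ = u^(m-1) w_x`, `v_τ = 0` is enough.
Eliminating the unknown correction of this symmetry from the commutation relation leaves conditions
on the deformation. At order `ε` (`first_order`) a leading coefficient divided by `u^(m-1)` is a
function of `w`, which becomes `F`; the remaining freedom is removed by solving equations `∂_w M =
...` and `∂_v N = ...` near a point. The flow has no symmetries of degree two
(`eq_zero_of_brk_baseFlow`), so the first correction of the symmetry is the one belonging to the
normal form. The difference from any normal form with the same `F` then satisfies a homogeneous
linear problem at order `ε²`. By `second_order` two of its leading coefficients are governed by a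
function of `w` and a function of `v`; choosing `G` and `f` cancels them, and what is left is a
bracket with the flow `(2,1)`, that is, the effect of a conservative Miura transformation.

Miura transformations act modulo `ε³` by a Lie series (`carries_two_iff`), which preserves
commutation relations by the Jacobi identity.

Uniqueness of the parameters. Brackets with the flow `(2,1)` do not contribute to the diagonal
top-order coefficients. The coefficients of `w_xx` in the `w`-equation at order `ε`, and of `w_xxx`
in the `w`-equation and `v_xxx` in the `v`-equation at order `ε²`, therefore determine `F`, `G` and
`f` in turn. -/

section

/-! ### Smooth functions of finite jets -/

/-- The jets whose base point lies in `Ω`. -/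
abbrev JetDom (Ω : Opens Pt) := {z : Jet // z 0 ∈ (Ω : Set Pt)}

/-- The truncation of a jet at order `N`. -/
def trunc (N : ℕ) (z : Jet) : Fin (N + 1) → Pt := fun s => z s

/-- The truncated jets over `Ω`. -/
def truncDom (Ω : Opens Pt) (N : ℕ) : Set (Fin (N + 1) → Pt) := {y | y 0 ∈ (Ω : Set Pt)}

lemma isOpen_truncDom (Ω : Opens Pt) (N : ℕ) : IsOpen (truncDom Ω N) :=
  Ω.isOpen.preimage (continuous_apply (0 : Fin (N + 1)))

lemma trunc_mem {Ω : Opens Pt} (N : ℕ) (z : JetDom Ω) : trunc N z.1 ∈ truncDom Ω N := z.2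

/-- A function of jets over `Ω` that is a smooth function of finitely many derivatives. -/
def IsJetFun (Ω : Opens Pt) (f : JetDom Ω → ℝ) : Prop :=
  ∃ (N : ℕ) (g : (Fin (N + 1) → Pt) → ℝ), ContDiffOn ℝ ∞ g (truncDom Ω N) ∧
    ∀ z, f z = g (trunc N z.1)

lemma exists_trunc_le {Ω : Opens Pt} {N N' : ℕ} (h : N ≤ N') {f : JetDom Ω → ℝ}
    {g : (Fin (N + 1) → Pt) → ℝ} (hg : ContDiffOn ℝ ∞ g (truncDom Ω N))
    (hf : ∀ z, f z = g (trunc N z.1)) :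
    ∃ g' : (Fin (N' + 1) → Pt) → ℝ, ContDiffOn ℝ ∞ g' (truncDom Ω N') ∧
      ∀ z, f z = g' (trunc N' z.1) := by
  refine ⟨fun y => g fun s => y (Fin.castLE (by omega) s), ?_, fun z => hf z⟩
  have h1 : ContDiff ℝ ∞ fun (y : Fin (N' + 1) → Pt) (s : Fin (N + 1)) =>
      y (Fin.castLE (by omega) s) := by fun_prop
  exact hg.comp h1.contDiffOn fun y hy => hy

lemma IsJetFun.comp₂ {Ω : Opens Pt} {f f' : JetDom Ω → ℝ} (hf : IsJetFun Ω f)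
    (hf' : IsJetFun Ω f') (op : ℝ × ℝ → ℝ) (hop : ContDiff ℝ ∞ op) :
    IsJetFun Ω fun z => op (f z, f' z) := by
  obtain ⟨N, g, hg, h⟩ := hf
  obtain ⟨N', g', hg', h'⟩ := hf'
  obtain ⟨g₁, hg₁, h₁⟩ := exists_trunc_le (le_max_left N N') hg h
  obtain ⟨g₂, hg₂, h₂⟩ := exists_trunc_le (le_max_right N N') hg' h'
  exact ⟨max N N', fun y => op (g₁ y, g₂ y),
    hop.comp_contDiffOn (hg₁.prodMk hg₂), fun z => by simp only [h₁, h₂]⟩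

/-- The algebra of smooth functions of finite jets over `Ω`. -/
def JetAlg (Ω : Opens Pt) : Subalgebra ℝ (JetDom Ω → ℝ) where
  carrier := {f | IsJetFun Ω f}
  mul_mem' hf hg := hf.comp₂ hg (fun q => q.1 * q.2) (by fun_prop)
  add_mem' hf hg := hf.comp₂ hg (fun q => q.1 + q.2) (by fun_prop)
  algebraMap_mem' r := ⟨0, fun _ => r, contDiffOn_const, fun _ => rfl⟩

variable {Ω : Opens Pt}

@[ext] lemma JetAlg.ext {f g : JetAlg Ω} (h : ∀ z, f.1 z = g.1 z) : f = g :=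
  Subtype.ext (funext h)

/-- Evaluation at a jet. -/
def evalAt (z : JetDom Ω) : JetAlg Ω →ₐ[ℝ] ℝ :=
  (Pi.evalAlgHom ℝ (fun _ : JetDom Ω => ℝ) z).comp (JetAlg Ω).val

lemma evalAt_apply (z : JetDom Ω) (f : JetAlg Ω) : evalAt z f = f.1 z := rfl

lemma JetAlg.ext_evalAt {f g : JetAlg Ω} (h : ∀ z, evalAt z f = evalAt z g) : f = g :=
  JetAlg.ext h

/-- Extension by zero to all jets. -/
def jetExt (f : JetAlg Ω) (z : Jet) : ℝ :=
  open Classical in if h : z 0 ∈ (Ω : Set Pt) then f.1 ⟨z, h⟩ else 0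

/-- The function `f` of jets represents the element `f'` of the algebra. -/
def Rep (f : Jet → ℝ) (f' : JetAlg Ω) : Prop := ∀ z : JetDom Ω, f z.1 = f'.1 z

lemma rep_toFun (f : JetAlg Ω) : Rep (jetExt f) f := fun z => by
  simp only [jetExt, z.2, dif_pos]

/-- Jets form an infinite product without a norm, so differentiability along a line is taken from
the finite-order representative `g`. Openness of `Ω` keeps the line over `Ω` for small times. -/
lemma hasDerivAt_line {N : ℕ} {f : Jet → ℝ} {g : (Fin (N + 1) → Pt) → ℝ}
    (hg : ContDiffOn ℝ ∞ g (truncDom Ω N)) (hf : ∀ z : JetDom Ω, f z.1 = g (trunc N z.1))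
    (z : JetDom Ω) (W : Jet) :
    HasDerivAt (fun t : ℝ => f (z.1 + t • W)) (fderiv ℝ g (trunc N z.1) (trunc N W)) 0 := by
  have h1 : HasFDerivAt g (fderiv ℝ g (trunc N z.1)) (trunc N z.1 + (0 : ℝ) • trunc N W) := by
    rw [zero_smul, add_zero]
    exact ((hg.contDiffAt ((isOpen_truncDom Ω N).mem_nhds (trunc_mem N z))).differentiableAt
      (by simp)).hasFDerivAt
  have h2 : HasDerivAt (fun t : ℝ => trunc N z.1 + t • trunc N W) (trunc N W) 0 := by
    simpa using ((hasDerivAt_id (0 : ℝ)).smul_const (trunc N W)).const_add (trunc N z.1)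
  have h3 := h1.comp_hasDerivAt (0 : ℝ) h2
  refine h3.congr_of_eventuallyEq ?_
  have h4 : ∀ᶠ t : ℝ in 𝓝 0, z.1 0 + t • W 0 ∈ (Ω : Set Pt) := by
    have : ContinuousAt (fun t : ℝ => z.1 0 + t • W 0) 0 := by fun_prop
    refine this.preimage_mem_nhds (Ω.isOpen.mem_nhds ?_)
    simpa using z.2
  filter_upwards [h4] with t ht
  exact hf ⟨z.1 + t • W, ht⟩

lemma trunc_eq_sum (N : ℕ) (W : Jet) :
    trunc N W = ∑ s : Fin (N + 1), ∑ i : Fin 2, W s i •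
      (Pi.single s (Pi.single i 1) : Fin (N + 1) → Pt) := by
  funext s i
  simp only [trunc, Finset.sum_apply, Pi.smul_apply, smul_eq_mul]
  rw [Finset.sum_eq_single s, Finset.sum_eq_single i]
  · simp
  · intro j _ hj; simp [Ne.symm hj]
  · simp
  · intro t _ ht
    refine Finset.sum_eq_zero fun j _ => ?_
    rw [Pi.single_eq_of_ne (Ne.symm ht)]; simp
  · simp

/-- A representative in terms of truncated jets, with partial derivatives. -/
lemma exists_partials (f : JetAlg Ω) : ∃ (N : ℕ) (g : (Fin (N + 1) → Pt) → ℝ)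
    (P : Fin (N + 1) → Fin 2 → JetAlg Ω), ContDiffOn ℝ ∞ g (truncDom Ω N) ∧
    (∀ z, f.1 z = g (trunc N z.1)) ∧
    ∀ s i z, (P s i).1 z = fderiv ℝ g (trunc N z.1) (Pi.single s (Pi.single i 1)) := by
  obtain ⟨N, g, hg, h⟩ := f.2
  have hd : ContDiffOn ℝ ∞ (fderiv ℝ g) (truncDom Ω N) :=
    hg.fderiv_of_isOpen (isOpen_truncDom Ω N) (by simp)
  exact ⟨N, g, fun s i => ⟨fun z => fderiv ℝ g (trunc N z.1) (Pi.single s (Pi.single i 1)),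
    N, fun y => fderiv ℝ g y (Pi.single s (Pi.single i 1)),
    hd.clm_apply contDiffOn_const, fun _ => rfl⟩, hg, h, fun _ _ _ => rfl⟩

/-- The value of a family of jet functions at a jet. -/
def jetOf (V : ℕ → Fin 2 → JetAlg Ω) (z : JetDom Ω) : Jet := fun s i => (V s i).1 z

lemma hasDerivAt_toFun_line {f : JetAlg Ω} {N : ℕ} {g : (Fin (N + 1) → Pt) → ℝ}
    (hg : ContDiffOn ℝ ∞ g (truncDom Ω N)) (hf : ∀ z : JetDom Ω, f.1 z = g (trunc N z.1))
    (z : JetDom Ω) (W : Jet) :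
    HasDerivAt (fun t : ℝ => jetExt f (z.1 + t • W)) (fderiv ℝ g (trunc N z.1) (trunc N W)) 0 :=
  hasDerivAt_line hg (fun z => (rep_toFun f z).trans (hf z)) z W

lemma differentiableAt_toFun_line (f : JetAlg Ω) (z : JetDom Ω) (W : Jet) :
    DifferentiableAt ℝ (fun t : ℝ => jetExt f (z.1 + t • W)) 0 := by
  obtain ⟨N, g, hg, h⟩ := f.2
  exact (hasDerivAt_toFun_line hg h z W).differentiableAt

lemma deriv_toFun_line_eq_sum {f : JetAlg Ω} {N : ℕ} {g : (Fin (N + 1) → Pt) → ℝ}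
    {P : Fin (N + 1) → Fin 2 → JetAlg Ω} (hg : ContDiffOn ℝ ∞ g (truncDom Ω N))
    (hf : ∀ z, f.1 z = g (trunc N z.1))
    (hP : ∀ s i z, (P s i).1 z = fderiv ℝ g (trunc N z.1) (Pi.single s (Pi.single i 1)))
    (V : ℕ → Fin 2 → JetAlg Ω) (z : JetDom Ω) :
    deriv (fun t : ℝ => jetExt f (z.1 + t • jetOf V z)) 0 =
      (∑ s, ∑ i, P s i * V s i : JetAlg Ω).1 z := by
  rw [(hasDerivAt_toFun_line hg hf z _).deriv, trunc_eq_sum N (jetOf V z), map_sum, ← evalAt_apply, map_sum]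
  refine Finset.sum_congr rfl fun s _ => ?_
  rw [map_sum, map_sum]
  refine Finset.sum_congr rfl fun i _ => ?_
  rw [map_smul, map_mul, evalAt_apply, evalAt_apply, hP, smul_eq_mul, mul_comm]
  rfl

lemma eventually_toFun (z : JetDom Ω) (W : Jet) :
    ∀ᶠ t : ℝ in 𝓝 0, (z.1 + t • W) 0 ∈ (Ω : Set Pt) := by
  have : ContinuousAt (fun t : ℝ => z.1 0 + t • W 0) 0 := by fun_prop
  exact this.preimage_mem_nhds (Ω.isOpen.mem_nhds (by simpa using z.2))

/-- The vector field `∑ V s i ∂/∂u^i_(s)` as a derivation. -/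
def vf (V : ℕ → Fin 2 → JetAlg Ω) : Derivation ℝ (JetAlg Ω) (JetAlg Ω) :=
  Derivation.mk'
    { toFun := fun f => ⟨fun z => deriv (fun t : ℝ => jetExt f (z.1 + t • jetOf V z)) 0, by
        obtain ⟨N, g, P, hg, h, hP⟩ := exists_partials f
        rw [funext (deriv_toFun_line_eq_sum hg h hP V)]
        exact (∑ s, ∑ i, P s i * V s i : JetAlg Ω).2⟩
      map_add' := fun f f' => JetAlg.ext fun z => by
        have h : (fun t : ℝ => jetExt (f + f') (z.1 + t • jetOf V z)) =ᶠ[𝓝 0]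
            fun t => jetExt f (z.1 + t • jetOf V z) + jetExt f' (z.1 + t • jetOf V z) := by
          filter_upwards [eventually_toFun z (jetOf V z)] with t ht
          simp only [jetExt, ht, dif_pos]; rfl
        refine h.deriv_eq.trans ?_
        exact deriv_add (differentiableAt_toFun_line f z _) (differentiableAt_toFun_line f' z _)
      map_smul' := fun c f => JetAlg.ext fun z => by
        have h : (fun t : ℝ => jetExt (c • f) (z.1 + t • jetOf V z)) =ᶠ[𝓝 0]
            fun t => c * jetExt f (z.1 + t • jetOf V z) := by
          filter_upwards [eventually_toFun z (jetOf V z)] with t ht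
          simp only [jetExt, ht, dif_pos]; rfl
        refine h.deriv_eq.trans ?_
        exact deriv_const_mul c (differentiableAt_toFun_line f z _) }
    fun f f' => JetAlg.ext fun z => by
      have h : (fun t : ℝ => jetExt (f * f') (z.1 + t • jetOf V z)) =ᶠ[𝓝 0]
          fun t => jetExt f (z.1 + t • jetOf V z) * jetExt f' (z.1 + t • jetOf V z) := by
        filter_upwards [eventually_toFun z (jetOf V z)] with t ht
        simp only [jetExt, ht, dif_pos]; rfl
      refine h.deriv_eq.trans ?_
      have h2 := deriv_fun_mul (differentiableAt_toFun_line f z (jetOf V z))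
        (differentiableAt_toFun_line f' z (jetOf V z))
      rw [h2]
      have e : ∀ f : JetAlg Ω, jetExt f (z.1 + (0 : ℝ) • jetOf V z) = f.1 z := fun f => by
        rw [zero_smul, add_zero]; exact rep_toFun f z
      rw [e, e]
      change _ = f.1 z * _ + f'.1 z * _
      rw [mul_comm _ (f'.1 z), add_comm]
      rfl

lemma vf_apply (V : ℕ → Fin 2 → JetAlg Ω) (f : JetAlg Ω) (z : JetDom Ω) :
    (vf V f).1 z = deriv (fun t : ℝ => jetExt f (z.1 + t • jetOf V z)) 0 := rfl

lemma deriv_line_eq {f : Jet → ℝ} {f' : JetAlg Ω} (hf : Rep f f') (V : ℕ → Fin 2 → JetAlg Ω)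
    (z : JetDom Ω) : deriv (fun t : ℝ => f (z.1 + t • jetOf V z)) 0 = (vf V f').1 z := by
  refine Filter.EventuallyEq.deriv_eq ?_
  filter_upwards [eventually_toFun z (jetOf V z)] with t ht
  exact (hf ⟨_, ht⟩).trans (rep_toFun f' ⟨_, ht⟩).symm

/-- The derivation is defined by differentiation along lines and so does not depend on a
representative. This coordinate form, valid for any representative, is what makes it linear in the
components `V`. -/
lemma vf_eq_sum {f : JetAlg Ω} {N : ℕ} {g : (Fin (N + 1) → Pt) → ℝ}
    {P : Fin (N + 1) → Fin 2 → JetAlg Ω} (hg : ContDiffOn ℝ ∞ g (truncDom Ω N))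
    (hf : ∀ z, f.1 z = g (trunc N z.1))
    (hP : ∀ s i z, (P s i).1 z = fderiv ℝ g (trunc N z.1) (Pi.single s (Pi.single i 1)))
    (V : ℕ → Fin 2 → JetAlg Ω) : vf V f = ∑ s, ∑ i, P s i * V s i :=
  JetAlg.ext fun z => deriv_toFun_line_eq_sum hg hf hP V z

lemma exists_partials_of {N : ℕ} {g : (Fin (N + 1) → Pt) → ℝ}
    (hg : ContDiffOn ℝ ∞ g (truncDom Ω N)) : ∃ P : Fin (N + 1) → Fin 2 → JetAlg Ω,
    ∀ s i z, (P s i).1 z = fderiv ℝ g (trunc N z.1) (Pi.single s (Pi.single i 1)) := by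
  have hd : ContDiffOn ℝ ∞ (fderiv ℝ g) (truncDom Ω N) :=
    hg.fderiv_of_isOpen (isOpen_truncDom Ω N) (by simp)
  exact ⟨fun s i => ⟨fun z => fderiv ℝ g (trunc N z.1) (Pi.single s (Pi.single i 1)),
    N, fun y => fderiv ℝ g y (Pi.single s (Pi.single i 1)),
    hd.clm_apply contDiffOn_const, fun _ => rfl⟩, fun _ _ _ => rfl⟩

/-- Second derivatives along vector fields. -/
lemma vf_vf {f : JetAlg Ω} {N : ℕ} {g : (Fin (N + 1) → Pt) → ℝ}
    (hg : ContDiffOn ℝ ∞ g (truncDom Ω N)) (h : ∀ z, f.1 z = g (trunc N z.1))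
    (V W : ℕ → Fin 2 → JetAlg Ω) (z : JetDom Ω) :
    (vf V (vf W f)).1 z =
      fderiv ℝ (fderiv ℝ g) (trunc N z.1) (trunc N (jetOf V z)) (trunc N (jetOf W z)) +
        (vf (fun s i => vf V (W s i)) f).1 z := by
  obtain ⟨P, hP⟩ := exists_partials_of hg
  have hd : ContDiffOn ℝ ∞ (fderiv ℝ g) (truncDom Ω N) :=
    hg.fderiv_of_isOpen (isOpen_truncDom Ω N) (by simp)
  have hsec : ∀ s i, (vf V (P s i)).1 z =
      fderiv ℝ (fderiv ℝ g) (trunc N z.1) (trunc N (jetOf V z))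
        (Pi.single s (Pi.single i 1)) := by
    intro s i
    have h1 : ContDiffOn ℝ ∞ (fun y => fderiv ℝ g y (Pi.single s (Pi.single i 1)))
      (truncDom Ω N) := hd.clm_apply contDiffOn_const
    rw [vf_apply, (hasDerivAt_toFun_line h1 (hP s i) z _).deriv]
    have h2 : DifferentiableAt ℝ (fderiv ℝ g) (trunc N z.1) :=
      (hd.contDiffAt ((isOpen_truncDom Ω N).mem_nhds (trunc_mem N z))).differentiableAt
        (by simp)
    rw [fderiv_clm_apply h2 (differentiableAt_const _)]
    simp
  have hsum : (∑ s : Fin (N + 1), ∑ i, (vf V (P s i)).1 z * (W s i).1 z) =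
      fderiv ℝ (fderiv ℝ g) (trunc N z.1) (trunc N (jetOf V z)) (trunc N (jetOf W z)) := by
    conv_rhs => rw [trunc_eq_sum N (jetOf W z)]
    simp only [map_sum, map_smul, hsec, smul_eq_mul]
    exact Finset.sum_congr rfl fun s _ => Finset.sum_congr rfl fun i _ => mul_comm _ _
  rw [vf_eq_sum hg h hP W, ← hsum, vf_eq_sum hg h hP fun s i => vf V (W s i), ← evalAt_apply,
    ← evalAt_apply]
  simp only [map_sum, Derivation.leibniz, smul_eq_mul, map_add, map_mul, evalAt_apply,
    Finset.sum_add_distrib]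
  rw [add_comm]
  congr 1
  exact Finset.sum_congr rfl fun s _ => Finset.sum_congr rfl fun i _ => mul_comm _ _

lemma vf_sub_field (V W : ℕ → Fin 2 → JetAlg Ω) : vf (V - W) = vf V - vf W := by
  refine Derivation.ext fun f => ?_
  obtain ⟨N, g, P, hg, h, hP⟩ := exists_partials f
  rw [Derivation.sub_apply, vf_eq_sum hg h hP, vf_eq_sum hg h hP, vf_eq_sum hg h hP]
  simp [mul_sub, Finset.sum_sub_distrib]

/-- The commutator of two vector fields. -/
theorem vf_lie (V W : ℕ → Fin 2 → JetAlg Ω) :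
    ⁅vf V, vf W⁆ = vf fun s i => vf V (W s i) - vf W (V s i) := by
  refine Derivation.ext fun f => JetAlg.ext fun z => ?_
  obtain ⟨N, g, hg, h⟩ := f.2
  -- The Hessian terms produced by `vf_vf` for the two orders of differentiation agree, so only the
  -- first-order terms survive in the commutator.
  have hsymm : fderiv ℝ (fderiv ℝ g) (trunc N z.1) (trunc N (jetOf V z)) (trunc N (jetOf W z)) =
      fderiv ℝ (fderiv ℝ g) (trunc N z.1) (trunc N (jetOf W z)) (trunc N (jetOf V z)) :=
    ((hg.contDiffAt ((isOpen_truncDom Ω N).mem_nhds (trunc_mem N z))).isSymmSndFDerivAt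
      (by rw [minSmoothness_of_isRCLikeNormedField]; exact WithTop.coe_le_coe.2 le_top)) _ _
  have hs : vf (fun s i => vf V (W s i) - vf W (V s i)) =
      vf (fun s i => vf V (W s i)) - vf fun s i => vf W (V s i) := vf_sub_field _ _
  rw [hs, Derivation.commutator_apply, Derivation.sub_apply, ← evalAt_apply, ← evalAt_apply,
    map_sub, map_sub, evalAt_apply, evalAt_apply, vf_vf hg h, vf_vf hg h, hsymm]
  simp only [evalAt_apply]
  ring

/-! ### The total derivative and evolutionary vector fields -/

/-- The coordinate `u^i_(s)`. -/
def jetCoord (s : ℕ) (i : Fin 2) : JetAlg Ω :=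
  ⟨fun z => z.1 s i, s, fun y => y (Fin.last s) i, by
    have : ContDiff ℝ ∞ fun y : Fin (s + 1) → Pt => y (Fin.last s) i := by fun_prop
    exact this.contDiffOn, fun z => rfl⟩

lemma vf_jetCoord (V : ℕ → Fin 2 → JetAlg Ω) (s : ℕ) (i : Fin 2) :
    vf V (jetCoord s i) = V s i := by
  refine JetAlg.ext fun z => ?_
  have h : Rep (fun z : Jet => z s i) (jetCoord s i : JetAlg Ω) := fun z => rfl
  rw [← deriv_line_eq h V z]
  have h2 : HasDerivAt (fun t : ℝ => z.1 s i + t * (V s i).1 z) ((V s i).1 z) 0 := by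
    simpa using ((hasDerivAt_id (0 : ℝ)).mul_const ((V s i).1 z)).const_add (z.1 s i)
  exact h2.deriv

/-- The total derivative. -/
def totD : Derivation ℝ (JetAlg Ω) (JetAlg Ω) := vf fun s i => jetCoord (s + 1) i

/-- The derivation along the evolutionary system `u^i_t = X^i`. -/
def evo (X : Fin 2 → JetAlg Ω) : Derivation ℝ (JetAlg Ω) (JetAlg Ω) :=
  vf fun s i => totD^[s] (X i)

lemma vf_zero : vf (0 : ℕ → Fin 2 → JetAlg Ω) = 0 := by
  refine Derivation.ext fun f => ?_
  obtain ⟨N, g, P, hg, h, hP⟩ := exists_partials f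
  rw [vf_eq_sum hg h hP]
  simp

/-- The prolongation is designed for this: by `vf_lie` the commutator is a vector field whose
component at `u^i_(s)` is `∂_x^(s+1) X^i - ∂_x (∂_x^s X^i) = 0`. -/
theorem evo_totD (X : Fin 2 → JetAlg Ω) (f : JetAlg Ω) : evo X (totD f) = totD (evo X f) := by
  have h : ⁅evo X, (totD : Derivation ℝ (JetAlg Ω) (JetAlg Ω))⁆ = 0 := by
    rw [evo, totD, vf_lie, ← vf_zero]
    congr 1
    funext s i
    rw [vf_jetCoord, Function.iterate_succ_apply']
    exact sub_self _
  have h2 := congrArg (fun d => d f) h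
  rw [Derivation.commutator_apply] at h2
  exact sub_eq_zero.1 h2

lemma evo_totD_iterate (X : Fin 2 → JetAlg Ω) (f : JetAlg Ω) (n : ℕ) :
    evo X (totD^[n] f) = totD^[n] (evo X f) := by
  induction n with
  | zero => rfl
  | succ n ih => rw [Function.iterate_succ_apply', Function.iterate_succ_apply', evo_totD, ih]

lemma totD_iterate_sub (f g : JetAlg Ω) (n : ℕ) :
    totD^[n] (f - g) = totD^[n] f - totD^[n] g := by
  induction n with
  | zero => rfl
  | succ n ih => simp only [Function.iterate_succ_apply', ih, map_sub]

/-- The commutator of two evolutionary systems. -/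
def brk (X Y : Fin 2 → JetAlg Ω) : Fin 2 → JetAlg Ω := fun i => evo X (Y i) - evo Y (X i)

/-- Evolutionary fields commute with `∂_x`, so every component of the commutator is a power of `∂_x`
applied to the component of order zero; the commutator is again evolutionary. -/
theorem evo_lie (X Y : Fin 2 → JetAlg Ω) : ⁅evo X, evo Y⁆ = evo (brk X Y) := by
  rw [evo, evo, vf_lie, evo]
  congr 1
  funext s i
  change evo X (totD^[s] (Y i)) - evo Y (totD^[s] (X i)) = _
  rw [evo_totD_iterate, evo_totD_iterate, brk, totD_iterate_sub]

theorem evo_comm (X Y : Fin 2 → JetAlg Ω) (f : JetAlg Ω) :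
    evo X (evo Y f) - evo Y (evo X f) = evo (brk X Y) f := by
  rw [← evo_lie, Derivation.commutator_apply]

lemma evo_jetCoord_zero (X : Fin 2 → JetAlg Ω) (i : Fin 2) : evo X (jetCoord 0 i) = X i :=
  vf_jetCoord _ _ _

lemma totD_jetCoord (s : ℕ) (i : Fin 2) :
    totD (jetCoord s i : JetAlg Ω) = jetCoord (s + 1) i := vf_jetCoord _ _ _

lemma vf_add_field (V W : ℕ → Fin 2 → JetAlg Ω) : vf (V + W) = vf V + vf W := by
  refine Derivation.ext fun f => ?_
  obtain ⟨N, g, P, hg, h, hP⟩ := exists_partials f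
  rw [Derivation.add_apply, vf_eq_sum hg h hP, vf_eq_sum hg h hP, vf_eq_sum hg h hP]
  simp [mul_add, Finset.sum_add_distrib]

lemma vf_smul_field (c : ℝ) (V : ℕ → Fin 2 → JetAlg Ω) : vf (c • V) = c • vf V := by
  refine Derivation.ext fun f => ?_
  obtain ⟨N, g, P, hg, h, hP⟩ := exists_partials f
  rw [Derivation.smul_apply, vf_eq_sum hg h hP, vf_eq_sum hg h hP]
  simp [Finset.smul_sum]

lemma evo_add_field (X Y : Fin 2 → JetAlg Ω) : evo (X + Y) = evo X + evo Y := by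
  rw [evo, evo, evo, ← vf_add_field]
  congr 1
  funext s i
  exact iterate_map_add totD s (X i) (Y i)

lemma evo_smul_field (c : ℝ) (X : Fin 2 → JetAlg Ω) : evo (c • X) = c • evo X := by
  rw [evo, evo, ← vf_smul_field]
  congr 1
  funext s i
  induction s with
  | zero => rfl
  | succ n ih =>
    rw [Function.iterate_succ_apply', ih, Pi.smul_apply, Pi.smul_apply, Pi.smul_apply,
      Pi.smul_apply, Function.iterate_succ_apply', totD.map_smul]

/-! ### Comparison with the operations on functions of jets -/

lemma Rep.totalD {f : Jet → ℝ} {f' : JetAlg Ω} (hf : Rep f f') : Rep (totalD f) (totD f') :=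
  fun z => deriv_line_eq hf (fun s i => jetCoord (s + 1) i) z

lemma Rep.iterate_totalD {f : Jet → ℝ} {f' : JetAlg Ω} (hf : Rep f f') (n : ℕ) :
    Rep (CoxeterFlow.totalD^[n] f) (totD^[n] f') := by
  induction n with
  | zero => exact hf
  | succ n ih =>
    rw [Function.iterate_succ_apply', Function.iterate_succ_apply']
    exact ih.totalD

/-- The vector-valued function `X` of jets represents the family `X'`. -/
def RepV (X : Jet → Pt) (X' : Fin 2 → JetAlg Ω) : Prop := ∀ i, Rep (fun z => X z i) (X' i)

lemma RepV.prolong {X : Jet → Pt} {X' : Fin 2 → JetAlg Ω} (hX : RepV X X') (z : JetDom Ω) :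
    prolong X z.1 = jetOf (fun s i => totD^[s] (X' i)) z := by
  funext s i
  exact (hX i).iterate_totalD s z

lemma RepV.evol {X : Jet → Pt} {X' : Fin 2 → JetAlg Ω} (hX : RepV X X') {f : Jet → ℝ}
    {f' : JetAlg Ω} (hf : Rep f f') : Rep (evol X f) (evo X' f') := by
  intro z
  rw [CoxeterFlow.evol, hX.prolong z]
  exact deriv_line_eq hf _ z

lemma RepV.bracket {X Y : Jet → Pt} {X' Y' : Fin 2 → JetAlg Ω} (hX : RepV X X')
    (hY : RepV Y Y') : RepV (bracket X Y) (brk X' Y') := fun i z => by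
  change CoxeterFlow.evol X _ z.1 - CoxeterFlow.evol Y _ z.1 = _
  rw [hX.evol (hY i) z, hY.evol (hX i) z]
  rfl

/-! ### Shortcut instances for additive maps on the algebra -/

section Shortcuts

variable {Ω : Opens Pt}

instance : AddMonoidHomClass (Derivation ℝ (JetAlg Ω) (JetAlg Ω)) (JetAlg Ω) (JetAlg Ω) :=
  inferInstance

instance : AddHomClass (Derivation ℝ (JetAlg Ω) (JetAlg Ω)) (JetAlg Ω) (JetAlg Ω) :=
  inferInstance

instance : AddMonoidHomClass (ℝ →+* JetAlg Ω) ℝ (JetAlg Ω) :=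
  inferInstance

instance : AddHomClass (ℝ →+* JetAlg Ω) ℝ (JetAlg Ω) :=
  inferInstance

instance : AddMonoidHomClass (JetAlg Ω →ₐ[ℝ] ℝ) (JetAlg Ω) ℝ :=
  inferInstance

instance : AddHomClass (JetAlg Ω →ₐ[ℝ] ℝ) (JetAlg Ω) ℝ :=
  inferInstance

end Shortcuts

end

/-! ### Riemann invariants as coordinates on functions of the fields -/

section

attribute [-instance] instCharZeroOfIsSemireal IsStrictOrderedRing.toCharZero
  FloorSemiring.instCharZero NumberField.to_charZero SubsemiringClass.instCharZero

variable {Ω : Opens Pt}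

/-! ### Functions of the fields alone -/

/-- `f` is a function of the fields alone. -/
def IsCoef (f : JetAlg Ω) : Prop :=
  ∃ a : Pt → ℝ, ContDiffOn ℝ ∞ a (Ω : Set Pt) ∧ ∀ z, f.1 z = a (z.1 0)

/-- A smooth function of the fields as an element of the algebra. -/
def coef (a : Pt → ℝ) (ha : ContDiffOn ℝ ∞ a (Ω : Set Pt)) : JetAlg Ω :=
  ⟨fun z => a (z.1 0), 0, fun y => a (y 0), by
    have h : ContDiff ℝ ∞ fun y : Fin (0 + 1) → Pt => y 0 := by fun_prop
    exact ha.comp h.contDiffOn fun y hy => hy, fun _ => rfl⟩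

lemma isCoef_coef (a : Pt → ℝ) (ha : ContDiffOn ℝ ∞ a (Ω : Set Pt)) : IsCoef (coef a ha) :=
  ⟨a, ha, fun _ => rfl⟩

lemma IsCoef.add {f g : JetAlg Ω} (hf : IsCoef f) (hg : IsCoef g) : IsCoef (f + g) := by
  obtain ⟨a, ha, h⟩ := hf
  obtain ⟨b, hb, h'⟩ := hg
  exact ⟨_, ha.add hb, fun z => congrArg₂ (· + ·) (h z) (h' z)⟩

lemma IsCoef.mul {f g : JetAlg Ω} (hf : IsCoef f) (hg : IsCoef g) : IsCoef (f * g) := by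
  obtain ⟨a, ha, h⟩ := hf
  obtain ⟨b, hb, h'⟩ := hg
  exact ⟨_, ha.mul hb, fun z => congrArg₂ (· * ·) (h z) (h' z)⟩

lemma isCoef_algebraMap (r : ℝ) : IsCoef (algebraMap ℝ (JetAlg Ω) r) :=
  ⟨fun _ => r, contDiffOn_const, fun _ => rfl⟩

lemma IsCoef.neg {f : JetAlg Ω} (hf : IsCoef f) : IsCoef (-f) := by
  obtain ⟨a, ha, h⟩ := hf
  exact ⟨_, ha.neg, fun z => congrArg (- ·) (h z)⟩

lemma IsCoef.sub {f g : JetAlg Ω} (hf : IsCoef f) (hg : IsCoef g) : IsCoef (f - g) := by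
  rw [sub_eq_add_neg]; exact hf.add hg.neg

lemma IsCoef.pow {f : JetAlg Ω} (hf : IsCoef f) (n : ℕ) : IsCoef (f ^ n) := by
  induction n with
  | zero => rw [pow_zero, ← map_one (algebraMap ℝ (JetAlg Ω))]; exact isCoef_algebraMap 1
  | succ n ih => rw [pow_succ]; exact ih.mul hf

lemma isCoef_jetCoord_zero (i : Fin 2) : IsCoef (jetCoord 0 i : JetAlg Ω) :=
  ⟨fun p => p i, by fun_prop, fun _ => rfl⟩

/-- One pair of gradient components serves every `V`. This uniformity is what allows an arbitrary
vector field to be compared with `dw` and `dv` in the chain rule. -/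
lemma IsCoef.exists_grad {f : JetAlg Ω} (hf : IsCoef f) : ∃ f₀ f₁ : JetAlg Ω,
    IsCoef f₀ ∧ IsCoef f₁ ∧ ∀ V, vf V f = f₀ * V 0 0 + f₁ * V 0 1 := by
  obtain ⟨a, ha, h⟩ := hf
  have hd : ContDiffOn ℝ ∞ (fderiv ℝ a) (Ω : Set Pt) := ha.fderiv_of_isOpen Ω.isOpen (by simp)
  refine ⟨coef _ (hd.clm_apply (contDiffOn_const (c := Pi.single 0 1))),
    coef _ (hd.clm_apply (contDiffOn_const (c := Pi.single 1 1))),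
    isCoef_coef _ _, isCoef_coef _ _, fun V => JetAlg.ext fun z => ?_⟩
  rw [← deriv_line_eq (f := fun z => a (z 0)) (fun z => (h z).symm) V z]
  have h1 : HasFDerivAt a (fderiv ℝ a (z.1 0)) (z.1 0 + (0 : ℝ) • jetOf V z 0) := by
    rw [zero_smul, add_zero]
    exact ((ha.contDiffAt (Ω.isOpen.mem_nhds z.2)).differentiableAt (by simp)).hasFDerivAt
  have h2 : HasDerivAt (fun t : ℝ => z.1 0 + t • jetOf V z 0) (jetOf V z 0) 0 := by
    simpa using ((hasDerivAt_id (0 : ℝ)).smul_const (jetOf V z 0)).const_add (z.1 0)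
  have h3 := (h1.comp_hasDerivAt (0 : ℝ) h2).deriv
  refine h3.trans ?_
  have h4 : jetOf V z 0 = (V 0 0).1 z • Pi.single 0 1 + (V 0 1).1 z • Pi.single 1 1 := by
    funext i; fin_cases i <;> simp [jetOf]
  rw [h4, map_add, map_smul, map_smul, smul_eq_mul, smul_eq_mul, mul_comm, mul_comm ((V 0 1).1 z)]
  rfl

/-! ### Riemann invariants -/

/-- The first field is positive over `Ω`. -/
class PosFst (Ω : Opens Pt) : Prop where
  pos : ∀ p ∈ (Ω : Set Pt), 0 < p 0

variable [hΩ : PosFst Ω]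

/-- The power `u ^ a`. -/
def upow (a : ℝ) : JetAlg Ω := coef (fun p => p 0 ^ a) (by
  have h : ContDiffOn ℝ ∞ (fun p : Pt => p 0) (Ω : Set Pt) := by fun_prop
  exact h.rpow_const_of_ne fun p hp => (hΩ.pos p hp).ne')

lemma evalAt_upow (z : JetDom Ω) (a : ℝ) : evalAt z (upow a) = z.1 0 0 ^ a := rfl

lemma isCoef_upow (a : ℝ) : IsCoef (upow a : JetAlg Ω) := isCoef_coef _ _

lemma upow_mul (a b : ℝ) : (upow a * upow b : JetAlg Ω) = upow (a + b) :=
  JetAlg.ext fun z => (Real.rpow_add (hΩ.pos _ z.2) a b).symm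

lemma upow_zero : (upow 0 : JetAlg Ω) = 1 := JetAlg.ext fun z => Real.rpow_zero _

lemma vf_upow (V : ℕ → Fin 2 → JetAlg Ω) (a : ℝ) :
    vf V (upow a) = algebraMap ℝ _ a * upow (a - 1) * V 0 0 := by
  refine JetAlg.ext fun z => ?_
  rw [← deriv_line_eq (f := fun z => z 0 0 ^ a) (fun z => rfl) V z]
  have h2 : HasDerivAt (fun t : ℝ => z.1 0 0 + t * (V 0 0).1 z) ((V 0 0).1 z) 0 := by
    simpa using ((hasDerivAt_id (0 : ℝ)).mul_const ((V 0 0).1 z)).const_add (z.1 0 0)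
  have h3 := h2.rpow_const (p := a) (Or.inl (by simpa using (hΩ.pos _ z.2).ne'))
  refine h3.deriv.trans ?_
  rw [zero_mul, add_zero, mul_assoc, mul_comm]
  rfl

variable (m σ : ℝ)

/-- The Riemann invariant `v`. -/
def rv : JetAlg Ω := jetCoord 0 1

/-- The Riemann invariant `w = v - 4 σ u ^ m`. -/
def rw' : JetAlg Ω := rv - algebraMap ℝ _ (4 * σ) * upow m

/-- The function `1 / (v - w)`. -/
def hinv : JetAlg Ω := algebraMap ℝ _ (σ / 4) * upow (-m)

/-- The function `u ^ (m - 1)`. -/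
def phi : JetAlg Ω := upow (m - 1)

/-- The function `1 / (4 σ m u ^ (m - 1))`. -/
def rho : JetAlg Ω := algebraMap ℝ _ (σ / (4 * m)) * upow (1 - m)

/-- The derivative `∂/∂w` at constant `v`. -/
def dw : Derivation ℝ (JetAlg Ω) (JetAlg Ω) :=
  vf fun s => if s = 0 then ![-rho m σ, 0] else 0

/-- The derivative `∂/∂v` at constant `w`. -/
def dv : Derivation ℝ (JetAlg Ω) (JetAlg Ω) :=
  vf fun s => if s = 0 then ![rho m σ, 1] else 0

lemma isCoef_rv : IsCoef (rv : JetAlg Ω) := isCoef_jetCoord_zero 1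

lemma isCoef_rw : IsCoef (rw' m σ : JetAlg Ω) :=
  isCoef_rv.sub ((isCoef_algebraMap _).mul (isCoef_upow m))

lemma isCoef_hinv : IsCoef (hinv m σ : JetAlg Ω) := (isCoef_algebraMap _).mul (isCoef_upow _)

lemma isCoef_phi : IsCoef (phi m : JetAlg Ω) := isCoef_upow _

lemma isCoef_rho : IsCoef (rho m σ : JetAlg Ω) := (isCoef_algebraMap _).mul (isCoef_upow _)

lemma vf_rv (V : ℕ → Fin 2 → JetAlg Ω) : vf V rv = V 0 1 := vf_jetCoord _ _ _

lemma vf_algebraMap (V : ℕ → Fin 2 → JetAlg Ω) (r : ℝ) : vf V (algebraMap ℝ _ r) = 0 :=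
  (vf V).map_algebraMap r

lemma vf_rw (V : ℕ → Fin 2 → JetAlg Ω) :
    vf V (rw' m σ) = V 0 1 - algebraMap ℝ _ (4 * σ * m) * phi m * V 0 0 := by
  rw [rw', map_sub, vf_rv, Derivation.leibniz, vf_algebraMap, vf_upow, smul_zero, add_zero,
    smul_eq_mul, phi, map_mul _ (4 * σ) m]
  ring

/-- The admissible parameters: `m > 1` and `σ = ±1`. -/
class Param (m σ : ℝ) : Prop where
  one_lt : 1 < m
  sign : σ = 1 ∨ σ = -1

variable {m σ} [hP : Param m σ]

lemma Param.sq (m : ℝ) [hP : Param m σ] : σ * σ = 1 := by rcases hP.sign with h | h <;> simp [h]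

lemma Param.pos (m σ : ℝ) [hP : Param m σ] : 0 < m := zero_lt_one.trans hP.one_lt

/-- Since `σ² = 1`, the constant `σ / (4m)` is the inverse of `4σm`. -/
lemma rho_mul_phi :
    (algebraMap ℝ (JetAlg Ω) (4 * σ * m) * phi m * rho m σ : JetAlg Ω) = 1 := by
  rw [rho, phi, show algebraMap ℝ (JetAlg Ω) (4 * σ * m) * upow (m - 1) *
    (algebraMap ℝ (JetAlg Ω) (σ / (4 * m)) * upow (1 - m)) = algebraMap ℝ (JetAlg Ω) (4 * σ * m) *
    algebraMap ℝ (JetAlg Ω) (σ / (4 * m)) * (upow (m - 1) * upow (1 - m)) by ring, upow_mul,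
    ← map_mul, show m - 1 + (1 - m) = 0 by ring, upow_zero, mul_one]
  rw [show 4 * σ * m * (σ / (4 * m)) = (σ * σ) * (4 * m / (4 * m)) by ring, Param.sq m,
    div_self (mul_ne_zero four_ne_zero (Param.pos m σ).ne'), one_mul, map_one]

lemma h_mul_hinv : ((rv - rw' m σ) * hinv m σ : JetAlg Ω) = 1 := by
  rw [rw', hinv, show (rv - (rv - algebraMap ℝ (JetAlg Ω) (4 * σ) * upow m)) *
    (algebraMap ℝ (JetAlg Ω) (σ / 4) * upow (-m)) = algebraMap ℝ (JetAlg Ω) (4 * σ) *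
    algebraMap ℝ (JetAlg Ω) (σ / 4) * (upow m * upow (-m)) by ring, upow_mul, ← map_mul,
    add_neg_cancel, upow_zero, mul_one, show 4 * σ * (σ / 4) = σ * σ by ring, Param.sq m, map_one]

/-- The chain rule in the Riemann invariants. -/
lemma IsCoef.vf {f : JetAlg Ω} (hf : IsCoef f) (V : ℕ → Fin 2 → JetAlg Ω) :
    vf V f = dw m σ f * CoxeterFlow.vf V (rw' m σ) + dv m σ f * CoxeterFlow.vf V rv := by
  obtain ⟨f₀, f₁, -, -, h⟩ := hf.exists_grad
  rw [dw, dv, h, h, h, vf_rw, vf_rv]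
  simp only [if_true, Matrix.cons_val_zero, Matrix.cons_val_one]
  linear_combination -(f₀ * V 0 0) * rho_mul_phi (Ω := Ω) (m := m) (σ := σ)

lemma IsCoef.dw {f : JetAlg Ω} (hf : IsCoef f) : IsCoef (dw m σ f) := by
  obtain ⟨f₀, f₁, h0, h1, h⟩ := hf.exists_grad
  rw [CoxeterFlow.dw, h]
  simp only [if_true, Matrix.cons_val_zero, Matrix.cons_val_one, mul_zero, add_zero]
  exact h0.mul (isCoef_rho m σ).neg

lemma IsCoef.dv {f : JetAlg Ω} (hf : IsCoef f) : IsCoef (dv m σ f) := by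
  obtain ⟨f₀, f₁, h0, h1, h⟩ := hf.exists_grad
  rw [CoxeterFlow.dv, h]
  simp only [if_true, Matrix.cons_val_zero, Matrix.cons_val_one, mul_one]
  exact (h0.mul (isCoef_rho m σ)).add h1

lemma dw_rw : dw m σ (rw' m σ : JetAlg Ω) = 1 := by
  rw [dw, vf_rw]
  simp only [if_true, Matrix.cons_val_zero, Matrix.cons_val_one]
  linear_combination rho_mul_phi (Ω := Ω) (m := m) (σ := σ)

lemma dw_rv : dw m σ (rv : JetAlg Ω) = 0 := by
  rw [dw, vf_rv]; simp

lemma dv_rw : dv m σ (rw' m σ : JetAlg Ω) = 0 := by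
  rw [dv, vf_rw]
  simp only [if_true, Matrix.cons_val_zero, Matrix.cons_val_one]
  linear_combination -rho_mul_phi (Ω := Ω) (m := m) (σ := σ)

lemma dv_rv : dv m σ (rv : JetAlg Ω) = 1 := by
  rw [dv, vf_rv]; simp

lemma exists_vf_lie {d e : Derivation ℝ (JetAlg Ω) (JetAlg Ω)} (hd : ∃ V, d = vf V)
    (he : ∃ V, e = vf V) : ∃ V, ⁅d, e⁆ = vf V := by
  obtain ⟨V, rfl⟩ := hd
  obtain ⟨W, rfl⟩ := he
  exact ⟨_, vf_lie V W⟩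

/-- The commutator is a vector field that annihilates both `w` and `v`, hence, by the chain rule,
every function of the fields. -/
lemma dw_dv_comm {f : JetAlg Ω} (hf : IsCoef f) : dw m σ (dv m σ f) = dv m σ (dw m σ f) := by
  obtain ⟨V, hV⟩ : ∃ V, ⁅(dw m σ : Derivation ℝ (JetAlg Ω) (JetAlg Ω)), dv m σ⁆ = vf V :=
    exists_vf_lie ⟨_, dw.eq_1 m σ⟩ ⟨_, dv.eq_1 m σ⟩
  have h : ∀ g : JetAlg Ω, dw m σ (dv m σ g) - dv m σ (dw m σ g) = vf V g := fun g => by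
    rw [← hV, Derivation.commutator_apply]
  have e1 := h (rw' m σ)
  have e2 := h rv
  rw [dv_rw, dw_rw, Derivation.map_one_eq_zero, map_zero, sub_zero] at e1
  rw [dv_rv, dw_rv, Derivation.map_one_eq_zero, map_zero, sub_zero] at e2
  have e3 := h f
  rw [hf.vf (m := m) (σ := σ), ← e1, ← e2, mul_zero, mul_zero, add_zero] at e3
  exact sub_eq_zero.1 e3

lemma dw_upow (a : ℝ) :
    dw m σ (upow a : JetAlg Ω) = -(algebraMap ℝ _ (a / m) * upow a * hinv m σ) := by
  rw [dw, vf_upow]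
  simp only [if_true, Matrix.cons_val_zero]
  rw [rho, hinv]
  have e : (upow (a - 1) * upow (1 - m) : JetAlg Ω) = upow a * upow (-m) := by
    rw [upow_mul, upow_mul]; congr 1; ring
  have e2 : algebraMap ℝ (JetAlg Ω) a * algebraMap ℝ (JetAlg Ω) (σ / (4 * m)) =
      algebraMap ℝ (JetAlg Ω) (a / m) * algebraMap ℝ (JetAlg Ω) (σ / 4) := by
    rw [← map_mul, ← map_mul]; congr 1; ring
  linear_combination -(algebraMap ℝ (JetAlg Ω) a * algebraMap ℝ (JetAlg Ω) (σ / (4 * m))) * e -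
    upow a * upow (-m) * e2

lemma dv_upow (a : ℝ) :
    dv m σ (upow a : JetAlg Ω) = algebraMap ℝ _ (a / m) * upow a * hinv m σ := by
  have h := dw_upow (Ω := Ω) (m := m) (σ := σ) a
  rw [dw, vf_upow] at h
  rw [dv, vf_upow]
  simp only [if_true, Matrix.cons_val_zero] at h ⊢
  linear_combination -h

lemma dw_phi : dw m σ (phi m : JetAlg Ω) = -(algebraMap ℝ _ (1 - 1 / m) * phi m * hinv m σ) := by
  rw [phi, dw_upow, sub_div, div_self (Param.pos m σ).ne']

lemma dv_phi : dv m σ (phi m : JetAlg Ω) = algebraMap ℝ _ (1 - 1 / m) * phi m * hinv m σ := by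
  rw [phi, dv_upow, sub_div, div_self (Param.pos m σ).ne']

lemma dw_hinv : dw m σ (hinv m σ : JetAlg Ω) = hinv m σ ^ 2 := by
  conv_lhs => rw [hinv, Derivation.leibniz, Derivation.map_algebraMap, dw_upow, smul_zero,
    add_zero, smul_eq_mul, neg_div, div_self (Param.pos m σ).ne', map_neg, map_one]
  conv_rhs => rw [sq]
  nth_rewrite 2 [hinv]
  ring

lemma dv_hinv : dv m σ (hinv m σ : JetAlg Ω) = -hinv m σ ^ 2 := by
  conv_lhs => rw [hinv, Derivation.leibniz, Derivation.map_algebraMap, dv_upow, smul_zero,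
    add_zero, smul_eq_mul, neg_div, div_self (Param.pos m σ).ne', map_neg, map_one]
  rw [sq]
  nth_rewrite 2 [hinv]
  ring

/-! ### Jets of the Riemann invariants -/

/-- The `s`-th `x`-derivative of `w`. -/
def wj (m σ : ℝ) (s : ℕ) : JetAlg Ω := totD^[s] (rw' m σ)

/-- The `s`-th `x`-derivative of `v`. -/
def vj (s : ℕ) : JetAlg Ω := totD^[s] rv

lemma totD_wj (s : ℕ) : totD (wj m σ s : JetAlg Ω) = wj m σ (s + 1) :=
  (Function.iterate_succ_apply' _ _ _).symm

lemma totD_vj (s : ℕ) : totD (vj s : JetAlg Ω) = vj (s + 1) :=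
  (Function.iterate_succ_apply' _ _ _).symm

lemma vj_eq (s : ℕ) : (vj s : JetAlg Ω) = jetCoord s 1 := by
  induction s with
  | zero => rfl
  | succ n ih => rw [← totD_vj, ih, totD_jetCoord]

lemma IsCoef.totD {f : JetAlg Ω} (hf : IsCoef f) :
    totD f = CoxeterFlow.dw m σ f * wj m σ 1 + CoxeterFlow.dv m σ f * vj 1 := hf.vf _

lemma IsCoef.evo {f : JetAlg Ω} (hf : IsCoef f) (X : Fin 2 → JetAlg Ω) :
    evo X f = CoxeterFlow.dw m σ f * evo X (rw' m σ) + CoxeterFlow.dv m σ f * evo X rv :=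
  hf.vf _

lemma evo_wj (X : Fin 2 → JetAlg Ω) (s : ℕ) :
    evo X (wj m σ s) = totD^[s] (evo X (rw' m σ)) := evo_totD_iterate X _ s

lemma evo_vj (X : Fin 2 → JetAlg Ω) (s : ℕ) : evo X (vj s) = totD^[s] (evo X rv) :=
  evo_totD_iterate X _ s

/-- The evolutionary system with given evolution of `w` and `v`. -/
def ofFrame (m σ : ℝ) (a b : JetAlg Ω) : Fin 2 → JetAlg Ω := ![rho m σ * (b - a), b]

lemma evo_rv (X : Fin 2 → JetAlg Ω) : evo X rv = X 1 := evo_jetCoord_zero X 1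

lemma evo_rw (X : Fin 2 → JetAlg Ω) :
    evo X (rw' m σ) = X 1 - algebraMap ℝ _ (4 * σ * m) * phi m * X 0 := vf_rw m σ _

lemma evo_ofFrame_rw (a b : JetAlg Ω) : evo (ofFrame m σ a b) (rw' m σ) = a := by
  rw [evo_rw]
  simp only [ofFrame, Matrix.cons_val_zero, Matrix.cons_val_one]
  linear_combination -(b - a) * rho_mul_phi (Ω := Ω) (m := m) (σ := σ)

lemma ofFrame_evo (X : Fin 2 → JetAlg Ω) : ofFrame m σ (evo X (rw' m σ)) (evo X rv) = X := by
  rw [evo_rw, evo_rv]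
  funext i
  fin_cases i
  · simp only [ofFrame, Fin.zero_eta, Matrix.cons_val_zero]
    linear_combination (X 0) * rho_mul_phi (Ω := Ω) (m := m) (σ := σ)
  · rfl

lemma frame_ext {X Y : Fin 2 → JetAlg Ω} (h1 : evo X (rw' m σ) = evo Y (rw' m σ))
    (h2 : evo X rv = evo Y rv) : X = Y := by
  rw [← ofFrame_evo (m := m) (σ := σ) X, ← ofFrame_evo (m := m) (σ := σ) Y, h1, h2]

end

section

attribute [-instance] instCharZeroOfIsSemireal IsStrictOrderedRing.toCharZero
  FloorSemiring.instCharZero NumberField.to_charZero SubsemiringClass.instCharZero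

variable {Ω : Opens Pt} [hΩ : PosFst Ω] {m σ : ℝ} [hP : Param m σ]

/-! ### Symmetries of the dispersionless flow -/

/-- `(μ, g)` are the characteristic speeds, in the Riemann invariants `w` and `v`, of a flow
of hydrodynamic type that commutes with the flow `(2,1)`. -/
structure IsSymm (m σ : ℝ) (μ g : JetAlg Ω) : Prop where
  coef_fst : IsCoef μ
  coef_snd : IsCoef g
  dw_snd : dw m σ g = 0
  dv_fst : dv m σ μ = -(algebraMap ℝ _ (1 - 1 / m) * (g - μ) * hinv m σ)

/-- The flow with characteristic speeds `(μ, g)`. -/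
def symmFlow (m σ : ℝ) (μ g : JetAlg Ω) : Fin 2 → JetAlg Ω :=
  ofFrame m σ (μ * wj m σ 1) (g * vj 1)

/-- The system of conservation laws with currents `(ρ B, A)`. -/
def consFlow (m σ : ℝ) (A B : JetAlg Ω) : Fin 2 → JetAlg Ω :=
  ![totD (rho m σ * B), totD A]

lemma dw_rho : dw m σ (rho m σ : JetAlg Ω) =
    algebraMap ℝ _ (1 - 1 / m) * rho m σ * hinv m σ := by
  conv_lhs => rw [rho, Derivation.leibniz, Derivation.map_algebraMap, dw_upow, smul_zero,
    add_zero, smul_eq_mul, sub_div, div_self (Param.pos m σ).ne']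
  rw [show 1 / m - 1 = -(1 - 1 / m) by ring, map_neg]
  conv_rhs => rw [rho]
  ring

lemma dv_rho : dv m σ (rho m σ : JetAlg Ω) =
    -(algebraMap ℝ _ (1 - 1 / m) * rho m σ * hinv m σ) := by
  conv_lhs => rw [rho, Derivation.leibniz, Derivation.map_algebraMap, dv_upow, smul_zero,
    add_zero, smul_eq_mul, sub_div, div_self (Param.pos m σ).ne']
  rw [show 1 / m - 1 = -(1 - 1 / m) by ring, map_neg]
  conv_rhs => rw [rho]
  ring

lemma totD_rho : totD (rho m σ : JetAlg Ω) =
    -(algebraMap ℝ _ (1 - 1 / m) * rho m σ * hinv m σ * (vj 1 - wj m σ 1)) := by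
  rw [(isCoef_rho m σ).totD (m := m) (σ := σ), dw_rho, dv_rho]; ring

lemma evo_rho (X : Fin 2 → JetAlg Ω) : evo X (rho m σ) =
    -(algebraMap ℝ _ (1 - 1 / m) * rho m σ * hinv m σ * (evo X rv - evo X (rw' m σ))) := by
  rw [(isCoef_rho m σ).evo (m := m) (σ := σ), dw_rho, dv_rho]; ring

lemma evo_consFlow_rv (A B : JetAlg Ω) : evo (consFlow m σ A B) rv = totD A := evo_rv _

/-- This is `w_t = v_t - u_t / ρ` with `v_t = ∂_x A` and `u_t = ∂_x (ρ B)`; the last term is the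
logarithmic derivative of `ρ`. -/
lemma evo_consFlow_rw (A B : JetAlg Ω) : evo (consFlow m σ A B) (rw' m σ) =
    totD A - totD B + algebraMap ℝ _ (1 - 1 / m) * B * (vj 1 - wj m σ 1) * hinv m σ := by
  rw [evo_rw]
  simp only [consFlow, Matrix.cons_val_zero, Matrix.cons_val_one, Derivation.leibniz, totD_rho,
    smul_eq_mul]
  linear_combination (-totD B + algebraMap ℝ _ (1 - 1 / m) * B * (vj 1 - wj m σ 1) * hinv m σ) *
    rho_mul_phi (Ω := Ω) (m := m) (σ := σ)

lemma evo_symmFlow_rv (μ g : JetAlg Ω) : evo (symmFlow m σ μ g) rv = g * vj 1 := evo_rv _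

lemma evo_symmFlow_rw (μ g : JetAlg Ω) :
    evo (symmFlow m σ μ g) (rw' m σ) = μ * wj m σ 1 := evo_ofFrame_rw _ _

lemma evo_wj_one (X : Fin 2 → JetAlg Ω) : evo X (wj m σ 1) = totD (evo X (rw' m σ)) :=
  evo_wj X 1

lemma evo_vj_one (X : Fin 2 → JetAlg Ω) : evo X (vj 1) = totD (evo X rv) := evo_vj X 1

/-- Because `g` is a function of `v` alone, the one-form `g dv` is closed, and the variation of a
closed form along any system is a total derivative. -/
lemma IsSymm.evo_snd {μ g : JetAlg Ω} (h : IsSymm m σ μ g) (Y : Fin 2 → JetAlg Ω) :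
    evo Y (symmFlow m σ μ g 1) = totD (g * evo Y rv) := by
  change evo Y (g * vj 1) = _
  simp only [Derivation.leibniz, evo_vj_one, smul_eq_mul, h.coef_snd.evo (m := m) (σ := σ),
    h.coef_snd.totD (m := m) (σ := σ), h.dw_snd]
  ring

/-- The condition `dv_fst` is precisely the closedness of `ρ (g dv - μ dw)`, which is the
`u`-component of the symmetry; its variation is therefore a total derivative. -/
lemma IsSymm.evo_fst {μ g : JetAlg Ω} (h : IsSymm m σ μ g) (Y : Fin 2 → JetAlg Ω) :
    evo Y (symmFlow m σ μ g 0) =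
      totD (rho m σ * (g * evo Y rv - μ * evo Y (rw' m σ))) := by
  change evo Y (rho m σ * (g * vj 1 - μ * wj m σ 1)) = _
  simp only [Derivation.leibniz, evo_vj_one, evo_wj_one, smul_eq_mul, map_sub, evo_rho, totD_rho,
    h.coef_snd.evo (m := m) (σ := σ), h.coef_snd.totD (m := m) (σ := σ), h.dw_snd,
    h.coef_fst.evo (m := m) (σ := σ), h.coef_fst.totD (m := m) (σ := σ), h.dv_fst]
  ring

/-- The first current of the commutator of a symmetry with a system of conservation laws. -/
def symmCurB (m σ : ℝ) (μ g A B : JetAlg Ω) : JetAlg Ω :=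
  evo (symmFlow m σ μ g) B - μ * totD B - (g - μ) * totD A -
    algebraMap ℝ _ (1 - 1 / m) * ((g - μ) * hinv m σ) * vj 1 * B

/-- The second current of the commutator of a symmetry with a system of conservation laws. -/
def symmCurA (m σ : ℝ) (μ g A : JetAlg Ω) : JetAlg Ω :=
  evo (symmFlow m σ μ g) A - g * totD A

/-- Both terms of each component are total derivatives: one because evolutionary fields commute with
`∂_x`, the other by `evo_fst` and `evo_snd`. Commutation with a symmetry thus becomes an identity
between currents, one order lower than the flows. -/
lemma IsSymm.brk_consFlow {μ g : JetAlg Ω} (h : IsSymm m σ μ g) (A B : JetAlg Ω) :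
    brk (symmFlow m σ μ g) (consFlow m σ A B) =
      consFlow m σ (symmCurA m σ μ g A) (symmCurB m σ μ g A B) := by
  funext i
  fin_cases i
  · change evo _ (totD (rho m σ * B)) - evo (consFlow m σ A B) (symmFlow m σ μ g 0) =
      totD (rho m σ * symmCurB m σ μ g A B)
    rw [h.evo_fst, evo_totD, ← map_sub]
    congr 1
    rw [evo_consFlow_rv, evo_consFlow_rw, Derivation.leibniz, evo_rho, evo_symmFlow_rv,
      evo_symmFlow_rw, symmCurB, smul_eq_mul, smul_eq_mul]
    ring
  · change evo _ (totD A) - evo (consFlow m σ A B) (symmFlow m σ μ g 1) =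
      totD (symmCurA m σ μ g A)
    rw [h.evo_snd, evo_totD, ← map_sub, evo_consFlow_rv, symmCurA]

/-- Systems of conservation laws are closed under the bracket. The last term of the first current is
due to the factor `ρ`, which is differentiated along both systems. -/
lemma brk_consFlow (A B A' B' : JetAlg Ω) :
    brk (consFlow m σ A B) (consFlow m σ A' B') =
      consFlow m σ (evo (consFlow m σ A B) A' - evo (consFlow m σ A' B') A)
        (evo (consFlow m σ A B) B' - evo (consFlow m σ A' B') B -
          algebraMap ℝ _ (1 - 1 / m) * hinv m σ * (B' * (totD B) - B * (totD B'))) := by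
  funext i
  fin_cases i
  · change evo _ (totD (rho m σ * B')) - evo _ (totD (rho m σ * B)) = totD (rho m σ * _)
    rw [evo_totD, evo_totD, ← map_sub]
    congr 1
    simp only [Derivation.leibniz, evo_rho, evo_consFlow_rv, evo_consFlow_rw, smul_eq_mul]
    ring
  · change evo _ (totD A') - evo _ (totD A) = totD _
    rw [evo_totD, evo_totD, ← map_sub]

/-- The characteristic speed of the flow `(2,1)` along `w`. -/
def lam (m σ : ℝ) : JetAlg Ω := rv - algebraMap ℝ _ m * (rv - rw' m σ)

lemma isCoef_lam : IsCoef (lam m σ : JetAlg Ω) :=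
  isCoef_rv.sub ((isCoef_algebraMap _).mul (isCoef_rv.sub (isCoef_rw m σ)))

lemma dw_lam : dw m σ (lam m σ : JetAlg Ω) = algebraMap ℝ _ m := by
  rw [lam]
  simp only [map_sub, Derivation.leibniz, Derivation.map_algebraMap, dw_rw, dw_rv, smul_eq_mul]
  ring

lemma dv_lam : dv m σ (lam m σ : JetAlg Ω) = 1 - algebraMap ℝ _ m := by
  rw [lam]
  simp only [map_sub, Derivation.leibniz, Derivation.map_algebraMap, dv_rw, dv_rv, smul_eq_mul]
  ring

lemma m_mul_inv (m σ : ℝ) [hP : Param m σ] : (algebraMap ℝ (JetAlg Ω) m * algebraMap ℝ (JetAlg Ω) (1 / m) : JetAlg Ω) = 1 := by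
  rw [← map_mul, mul_one_div_cancel (Param.pos m σ).ne', map_one]

lemma isSymm_lam : IsSymm m σ (lam m σ : JetAlg Ω) rv where
  coef_fst := isCoef_lam
  coef_snd := isCoef_rv
  dw_snd := dw_rv
  dv_fst := by
    rw [dv_lam, lam, map_sub, map_one]
    linear_combination (algebraMap ℝ (JetAlg Ω) m - 1) * h_mul_hinv (Ω := Ω) (m := m) (σ := σ) -
      (rv - rw' m σ) * hinv m σ * m_mul_inv (Ω := Ω) m σ

end

section

attribute [-instance] instCharZeroOfIsSemireal IsStrictOrderedRing.toCharZero
  FloorSemiring.instCharZero NumberField.to_charZero SubsemiringClass.instCharZero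

variable {Ω : Opens Pt} [hΩ : PosFst Ω] {m σ : ℝ} [hP : Param m σ]

/-! ### Gradients in the Riemann invariants -/

/-- `f` depends on the fields only, with `∂f/∂w = a` and `∂f/∂v = b`. -/
def HasGrad (m σ : ℝ) (f a b : JetAlg Ω) : Prop :=
  ∀ V : ℕ → Fin 2 → JetAlg Ω, vf V f = a * vf V (rw' m σ) + b * vf V rv

lemma HasGrad.evo {f a b : JetAlg Ω} (h : HasGrad m σ f a b) (X : Fin 2 → JetAlg Ω) :
    evo X f = a * evo X (rw' m σ) + b * evo X rv := h _

lemma HasGrad.totD {f a b : JetAlg Ω} (h : HasGrad m σ f a b) :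
    totD f = a * wj m σ 1 + b * vj 1 := h _

lemma IsCoef.hasGrad {f a b : JetAlg Ω} (hf : IsCoef f) (ha : CoxeterFlow.dw m σ f = a)
    (hb : CoxeterFlow.dv m σ f = b) : HasGrad m σ f a b := fun V => by
  rw [hf.vf (m := m) (σ := σ), ha, hb]

lemma map_ofNat_eq_zero (d : Derivation ℝ (JetAlg Ω) (JetAlg Ω)) (k : ℕ) [k.AtLeastTwo] :
    d ofNat(k) = 0 := d.map_natCast k

variable (m σ) in
/-- The difference quotient `(g - μ) / (v - w)` of the characteristic speeds. -/
def curT (μ g : JetAlg Ω) : JetAlg Ω := (g - μ) * hinv m σ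

/-- The difference quotient of the speeds of the flow `(2,1)` is constant. Together with `∂_w λ = m`
and `∂_w² λ = 0` it turns the formulas for a general symmetry into those of the normal form. -/
lemma curT_lam : curT m σ (lam m σ) rv = algebraMap ℝ (JetAlg Ω) m := by
  rw [curT, lam]
  linear_combination (algebraMap ℝ (JetAlg Ω) m) * h_mul_hinv (Ω := Ω) (m := m) (σ := σ)

lemma algebraMap_one_sub : algebraMap ℝ (JetAlg Ω) (1 - 1 / m) = 1 - algebraMap ℝ _ (1 / m) := by
  rw [map_sub, map_one]

namespace IsSymm

variable {μ g : JetAlg Ω} (h : IsSymm m σ μ g)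
include h

lemma isCoef_curT : IsCoef (curT m σ μ g) := (h.coef_snd.sub h.coef_fst).mul (isCoef_hinv _ _)

lemma dv_mu : dv m σ μ = -((1 - algebraMap ℝ _ (1 / m)) * curT m σ μ g) := by
  rw [h.dv_fst, algebraMap_one_sub, curT]; ring

lemma dw_curT : dw m σ (curT m σ μ g) = (curT m σ μ g - dw m σ μ) * hinv m σ := by
  rw [curT, Derivation.leibniz, map_sub, h.dw_snd, dw_hinv, smul_eq_mul, smul_eq_mul]; ring

lemma dv_curT : dv m σ (curT m σ μ g) =
    (dv m σ g - algebraMap ℝ _ (1 / m) * curT m σ μ g) * hinv m σ := by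
  rw [curT, Derivation.leibniz, map_sub, h.dv_mu, dv_hinv, smul_eq_mul, smul_eq_mul, curT]; ring

/-- Applying `∂_w` to the equation for `∂_v μ` and exchanging the derivatives removes every mixed
derivative of `μ`. Iterating, only pure `w`-derivatives of `μ` and derivatives of `g` remain as
independent symbols. -/
lemma dv_dw : dv m σ (dw m σ μ) =
    -((1 - algebraMap ℝ _ (1 / m)) * (curT m σ μ g - dw m σ μ) * hinv m σ) := by
  rw [← dw_dv_comm h.coef_fst, h.dv_mu, map_neg, Derivation.leibniz, map_sub,
    Derivation.map_one_eq_zero, Derivation.map_algebraMap, h.dw_curT, smul_eq_mul]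
  ring

lemma dv_dw_dw : dv m σ (dw m σ (dw m σ μ)) = -((1 - algebraMap ℝ _ (1 / m)) *
    (2 * (curT m σ μ g - dw m σ μ) * hinv m σ ^ 2 - dw m σ (dw m σ μ) * hinv m σ)) := by
  rw [← dw_dv_comm h.coef_fst.dw, h.dv_dw]
  simp only [map_neg, Derivation.leibniz, map_sub, Derivation.map_one_eq_zero,
    Derivation.map_algebraMap, h.dw_curT, smul_eq_mul, dw_hinv]
  ring

lemma dv_dw_dw_dw : dv m σ (dw m σ (dw m σ (dw m σ μ))) = -((1 - algebraMap ℝ _ (1 / m)) *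
    (6 * (curT m σ μ g - dw m σ μ) * hinv m σ ^ 3 - 3 * dw m σ (dw m σ μ) * hinv m σ ^ 2
      - dw m σ (dw m σ (dw m σ μ)) * hinv m σ)) := by
  rw [← dw_dv_comm h.coef_fst.dw.dw, h.dv_dw_dw]
  simp only [map_neg, Derivation.leibniz, Derivation.leibniz_pow, map_sub,
    Derivation.map_one_eq_zero, Derivation.map_algebraMap, h.dw_curT, smul_eq_mul, dw_hinv,
    map_ofNat_eq_zero, nsmul_eq_mul]
  push_cast
  ring

lemma dw_dv_snd : dw m σ (dv m σ g) = 0 := by rw [dw_dv_comm h.coef_snd, h.dw_snd, map_zero]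

lemma dw_dv_dv_snd : dw m σ (dv m σ (dv m σ g)) = 0 := by
  rw [dw_dv_comm h.coef_snd.dv, h.dw_dv_snd, map_zero]

lemma grad_fst : HasGrad m σ μ (dw m σ μ) (-((1 - algebraMap ℝ _ (1 / m)) * curT m σ μ g)) :=
  h.coef_fst.hasGrad rfl h.dv_mu

lemma grad_snd : HasGrad m σ g 0 (dv m σ g) := h.coef_snd.hasGrad h.dw_snd rfl

lemma grad_dv_snd : HasGrad m σ (dv m σ g) 0 (dv m σ (dv m σ g)) :=
  h.coef_snd.dv.hasGrad h.dw_dv_snd rfl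

lemma grad_dv_dv_snd : HasGrad m σ (dv m σ (dv m σ g)) 0 (dv m σ (dv m σ (dv m σ g))) :=
  h.coef_snd.dv.dv.hasGrad h.dw_dv_dv_snd rfl

lemma grad_curT : HasGrad m σ (curT m σ μ g)
    ((curT m σ μ g - dw m σ μ) * hinv m σ)
    ((dv m σ g - algebraMap ℝ _ (1 / m) * curT m σ μ g) * hinv m σ) := h.isCoef_curT.hasGrad h.dw_curT h.dv_curT

lemma grad_dw : HasGrad m σ (dw m σ μ) (dw m σ (dw m σ μ))
    (-((1 - algebraMap ℝ _ (1 / m)) * (curT m σ μ g - dw m σ μ) * hinv m σ)) :=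
  h.coef_fst.dw.hasGrad rfl h.dv_dw

lemma grad_dw_dw : HasGrad m σ (dw m σ (dw m σ μ)) (dw m σ (dw m σ (dw m σ μ)))
    (-((1 - algebraMap ℝ _ (1 / m)) *
    (2 * (curT m σ μ g - dw m σ μ) * hinv m σ ^ 2 - dw m σ (dw m σ μ) * hinv m σ))) :=
  h.coef_fst.dw.dw.hasGrad rfl h.dv_dw_dw

lemma grad_dw_dw_dw : HasGrad m σ (dw m σ (dw m σ (dw m σ μ)))
    (dw m σ (dw m σ (dw m σ (dw m σ μ))))
    (-((1 - algebraMap ℝ _ (1 / m)) *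
    (6 * (curT m σ μ g - dw m σ μ) * hinv m σ ^ 3 - 3 * dw m σ (dw m σ μ) * hinv m σ ^ 2
      - dw m σ (dw m σ (dw m σ μ)) * hinv m σ))) :=
  h.coef_fst.dw.dw.dw.hasGrad rfl h.dv_dw_dw_dw

/-- Cross-multiplication of `(g - μ)/(v - w)` and `m = (v - λ)/(v - w)`: it links the speeds of a
general symmetry to those of the flow `(2,1)`. -/
lemma rel_curT_fst : (rv - lam m σ) * curT m σ μ g = algebraMap ℝ _ m * (g - μ) := by
  rw [curT, ← curT_lam (Ω := Ω) (m := m) (σ := σ), curT]; ring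

end IsSymm

lemma grad_hinv : HasGrad m σ (hinv m σ : JetAlg Ω) (hinv m σ ^ 2) (-hinv m σ ^ 2) :=
  (isCoef_hinv m σ).hasGrad dw_hinv dv_hinv

lemma grad_phi : HasGrad m σ (phi m : JetAlg Ω)
    (-((1 - algebraMap ℝ _ (1 / m)) * phi m * hinv m σ))
    ((1 - algebraMap ℝ _ (1 / m)) * phi m * hinv m σ) :=
  (isCoef_phi m).hasGrad (by rw [dw_phi, algebraMap_one_sub]) (by rw [dv_phi, algebraMap_one_sub])

lemma grad_lam : HasGrad m σ (lam m σ : JetAlg Ω) (algebraMap ℝ _ m) (1 - algebraMap ℝ _ m) :=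
  isCoef_lam.hasGrad dw_lam dv_lam

end

/-! ### Explicit currents of the deformed symmetries and the identities they satisfy -/

section

attribute [-instance] instCharZeroOfIsSemireal IsStrictOrderedRing.toCharZero
  FloorSemiring.instCharZero NumberField.to_charZero SubsemiringClass.instCharZero

/-! ### Currents of the deformed symmetries -/

section Currents

variable {R : Type*} [CommRing R]

/-- The part of the second current that is linear in `G`. -/
def dispA (n i p F F₁ T M₁ w₁ w₂ v₁ : R) : R :=
  n ^ 2 * p ^ 2 * ((F * T * i * (-2 + 2 * n)) * v₁ * w₁ + (F * M₁ * i * 2 + F * T * i * (2 - 4 *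
    n) + F₁ * T * (-2)) * w₁ ^ 2 + (F * T * (-2)) * w₂)

/-- The part of the first current that is linear in `G`. -/
def dispB (n i p F F₁ T M₁ M₂ w₁ w₂ v₁ : R) : R :=
  n ^ 2 * p ^ 2 * ((F * M₁ * i * (2 - 2 * n) + F * T * i * (-2 + 2 * n)) * v₁ * w₁ + (F * M₁ * i
    * (-2 + 4 * n) + F * M₂ + F * T * i * (2 - 4 * n) + F₁ * M₁ * 2 + F₁ * T * (-2)) * w₁ ^ 2 +
    (F * M₁ * 2 + F * T * (-2)) * w₂)

/-- The part of the second current that is linear in `f`. -/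
def scalA (n M i F F₁ T g₁ g₂ w₁ v₁ v₂ : R) : R :=
  (T * F * i * (6 - 2 * M + 2 * n - 6 * n ^ 2)) * v₁ * w₁ + (F * g₁ * i * (-6 + 2 * M - 2 * n + 6
    * n ^ 2) + F * g₂ * (1 - M + 2 * n) + F₁ * g₁ * (2 - M + 3 * n)) * v₁ ^ 2 + (F * g₁ * (2 - 2
    * M + 4 * n)) * v₂

/-- The part of the first current that is linear in `f`. -/
def scalB (n M i F F₁ T g₁ g₂ w₁ v₁ v₂ : R) : R :=
  (T * F * i * (6 - 2 * M + 2 * n - 6 * n ^ 2)) * v₁ * w₁ + (T * F * i * (-1 + 2 * n + 3 * n ^ 2)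
    + T * F₁ * (1 - 2 * n - 3 * n ^ 2) + F * g₁ * i * (-2 + M - 3 * n) + F * g₂ * (1 - M + 2 * n)
    + F₁ * g₁ * (2 - M + 3 * n)) * v₁ ^ 2 + (T * F * (2 - 2 * n - 4 * n ^ 2) + F * g₁ * (2 - 2 *
    M + 4 * n)) * v₂

/-- The part of the second current that is quadratic in `F`. -/
def quadA (n i p F F₁ T M₁ M₂ g₁ w₁ w₂ v₁ : R) : R :=
  n ^ 2 * p ^ 2 * ((F ^ 2 * M₁ * i ^ 2 * (-6 + 6 * n) + F ^ 2 * T * i ^ 2 * (2 + 2 * n - 4 * n ^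
    2)) * v₁ * w₁ + (F * F₁ * M₁ * i * (-6) + F * F₁ * T * i * (4 + 8 * n) + F ^ 2 * M₁ * i ^ 2 *
    (-2 - 4 * n) + F ^ 2 * M₂ * i * (-6) + F ^ 2 * T * i ^ 2 * (6 - 8 * n + 8 * n ^ 2) + F ^ 2 *
    g₁ * i ^ 2 * 3) * w₁ ^ 2 + (F ^ 2 * M₁ * i * (-6) + F ^ 2 * T * i * (2 + 4 * n)) * w₂)

/-- The part of the first current that is quadratic in `F`. -/
def quadB (n i p F F₁ T M₁ M₂ M₃ g₁ w₁ w₂ v₁ : R) : R :=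
  n ^ 2 * p ^ 2 * ((F * F₁ * T * i * (-2 + 8 * n) + F ^ 2 * M₁ * i ^ 2 * (-2 - 2 * n + 4 * n ^ 2)
    + F ^ 2 * M₂ * i * (-4 + 4 * n) + F ^ 2 * T * i ^ 2 * (2 + 4 * n ^ 2)) * v₁ * w₁ + (F * F₁ *
    M₁ * i * (-4 - 8 * n) + F * F₁ * M₂ * (-6) + F * F₁ * T * i * (4 + 8 * n) + F ^ 2 * M₁ * i ^
    2 * (-9 + 8 * n - 8 * n ^ 2) + F ^ 2 * M₂ * i * (-1 - 5 * n) + F ^ 2 * M₃ * (-3) + F ^ 2 * T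
    * i ^ 2 * (9 - 11 * n + 8 * n ^ 2) + F ^ 2 * g₁ * i ^ 2 * 3) * w₁ ^ 2 + (F ^ 2 * M₁ * i * (-2
    - 4 * n) + F ^ 2 * M₂ * (-4) + F ^ 2 * T * i * (2 + 4 * n)) * w₂)

end Currents

variable {Ω : Opens Pt} [hΩ : PosFst Ω] {m σ : ℝ} [hP : Param m σ]

lemma rel_lam : (rv - lam m σ) * hinv m σ = algebraMap ℝ (JetAlg Ω) m := curT_lam

namespace IsSymm

variable {μ g : JetAlg Ω} (h : IsSymm m σ μ g)
include h

set_option maxHeartbeats 4000000 in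
-- The right side uses the values `T = M₁ = m` of the flow `(2,1)`. The identity therefore says that
-- the parts of `[K₀, Q₂]` and `[K₂, Q₀]` linear in the parameter cancel in the second current. Once
-- gradients are inserted, both sides are polynomials in the jets, in `1/(v - w)` and in the
-- derivatives of `μ` and `g`.
lemma symmCurA_disp {F F₁ F₂ : JetAlg Ω} (hF : HasGrad m σ F F₁ 0) (hF₁ : HasGrad m σ F₁ F₂ 0) :
      symmCurA m σ (lam m σ) rv (dispA (algebraMap ℝ _ (1 / m)) (hinv m σ) (phi m) F F₁ (curT m
      σ μ g) (dw m σ μ) (wj m σ 1) (wj m σ 2) (vj 1)) = symmCurA m σ μ g (dispA (algebraMap ℝ _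
      (1 / m)) (hinv m σ) (phi m) F F₁ (algebraMap ℝ _ m) (algebraMap ℝ _ m) (wj m σ 1) (wj m σ
      2) (vj 1)) := by
  -- The algebra admits no division, so `m` and `1/m` become independent symbols tied by `hM`. The
  -- two sides differ by an element of the ideal generated by `hκ`, `hτ`, `hx` and `hM`, and the
  -- final multipliers exhibit it; the companion identities follow the same pattern.
  have hκ := rel_lam (Ω := Ω) (m := m) (σ := σ)
  have hτ : (g - μ) * hinv m σ = curT m σ μ g := rfl
  have hx := h.rel_curT_fst
  have hM := m_mul_inv (Ω := Ω) m σ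
  have hw1 := totD_wj (Ω := Ω) (m := m) (σ := σ) 1
  have hw2 := totD_wj (Ω := Ω) (m := m) (σ := σ) 2
  have hv0 : totD (rv : JetAlg Ω) = vj 1 := totD_vj 0
  have hv1 := totD_vj (Ω := Ω) 1
  have hv2 := totD_vj (Ω := Ω) 2
  have ew := evo_wj (Ω := Ω) (m := m) (σ := σ)
  have ev := evo_vj (Ω := Ω)
  simp only [symmCurA, algebraMap_one_sub]
  simp only [dispA, dispB, Derivation.leibniz, Derivation.leibniz_pow, map_add, map_sub, map_neg, smul_eq_mul, nsmul_eq_mul,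
    Derivation.map_one_eq_zero, Derivation.map_algebraMap, map_ofNat_eq_zero,
    evo_wj_one, evo_vj_one, ew, ev, Function.iterate_succ_apply', Function.iterate_zero_apply, evo_symmFlow_rv, evo_symmFlow_rw, evo_consFlow_rv, evo_consFlow_rw, hF.totD, hF₁.totD, hF.evo, hF₁.evo,
    h.grad_fst.totD, h.grad_snd.totD,
    h.grad_dv_snd.totD, h.grad_dv_dv_snd.totD, h.grad_curT.totD, h.grad_dw.totD, h.grad_dw_dw.totD, h.grad_dw_dw_dw.totD,
    (grad_hinv (Ω := Ω) (m := m) (σ := σ)).totD, (grad_phi (Ω := Ω) (m := m) (σ := σ)).totD,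
    (grad_lam (Ω := Ω) (m := m) (σ := σ)).totD,
    h.grad_fst.evo, h.grad_snd.evo,
    h.grad_dv_snd.evo, h.grad_dv_dv_snd.evo, h.grad_curT.evo, h.grad_dw.evo, h.grad_dw_dw.evo, h.grad_dw_dw_dw.evo,
    (grad_hinv (Ω := Ω) (m := m) (σ := σ)).evo, (grad_phi (Ω := Ω) (m := m) (σ := σ)).evo,
    (grad_lam (Ω := Ω) (m := m) (σ := σ)).evo, hw1, hw2, hv0, hv1, hv2, map_zero]
  push_cast
  clear hw1 hw2 hv0 hv1 hv2 ew ev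
  generalize dw m σ (dw m σ (dw m σ (dw m σ μ))) = M₄ at *
  generalize dw m σ (dw m σ (dw m σ μ)) = M₃ at *
  generalize dw m σ (dw m σ μ) = M₂ at *
  generalize dw m σ μ = M₁ at *
  generalize dv m σ (dv m σ (dv m σ g)) = g₃ at *
  generalize dv m σ (dv m σ g) = g₂ at *
  generalize dv m σ g = g₁ at *
  generalize curT m σ μ g = T at *
  generalize (hinv m σ : JetAlg Ω) = i at *
  generalize (phi m : JetAlg Ω) = p at *
  generalize (algebraMap ℝ (JetAlg Ω) (1 / m)) = n at *
  generalize (algebraMap ℝ (JetAlg Ω) m) = M at *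
  generalize (wj m σ 1 : JetAlg Ω) = w₁ at *
  generalize (wj m σ 2 : JetAlg Ω) = w₂ at *
  generalize (wj m σ 3 : JetAlg Ω) = w₃ at *
  generalize (vj 1 : JetAlg Ω) = v₁ at *
  generalize (vj 2 : JetAlg Ω) = v₂ at *
  generalize (vj 3 : JetAlg Ω) = v₃ at *
  linear_combination
    (n ^ 2 * p ^ 2 * v₁ * w₁ ^ 2 * (-2 * F * M₁ * i + 2 * F * M₁ * i * n + 4 * F * T * i * n - 4
      * F * T * i * n ^ 2 + 2 * F₁ * T - 2 * F₁ * T * n) + F * T * n ^ 2 * p ^ 2 * v₁ * w₂ * (2 -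
      2 * n) + F * n ^ 2 * p ^ 2 * w₁ * w₂ * (-6 * M₁ - 6 * T + 12 * T * n) + n ^ 2 * p ^ 2 * w₁
      ^ 3 * (4 * F * M₁ * i - 8 * F * M₁ * i * n - 2 * F * M₂ - 4 * F * T * i * n + 8 * F * T * i
      * n ^ 2 - 4 * F₁ * M₁ - 4 * F₁ * T + 8 * F₁ * T * n)) * hκ + (M * n ^ 2 * p ^ 2 * v₁ * w₁ ^
      2 * (2 * F * i - 6 * F * i * n + 4 * F * i * n ^ 2 - 2 * F₁ + 2 * F₁ * n) + F * M * n ^ 2 *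
      p ^ 2 * v₁ * w₂ * (-2 + 2 * n) + F * M * n ^ 2 * p ^ 2 * w₁ * w₂ * (12 - 12 * n) + M * n ^
      2 * p ^ 2 * w₁ ^ 3 * (-4 * F * i + 12 * F * i * n - 8 * F * i * n ^ 2 + 8 * F₁ - 8 * F₁ *
      n)) * hτ + (F₁ * n ^ 2 * p ^ 2 * w₁ * w₂ * 6 + F₂ * n ^ 2 * p ^ 2 * w₁ ^ 3 * 2 + F * n ^ 2
      * p ^ 2 * w₃ * 2) * hx + (n ^ 2 * p ^ 2 * v₁ * w₁ ^ 2 * (-4 * F * M₁ * i - 4 * F * T * i +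
      8 * F * T * i * n + 4 * F₁ * T) + F * T * n ^ 2 * p ^ 2 * v₁ * w₂ * 4 + F * T * i * n ^ 2 *
      p ^ 2 * v₁ ^ 2 * w₁ * (4 - 4 * n) + F * T * n ^ 2 * p ^ 2 * v₂ * w₁ * 2) * hM

set_option maxHeartbeats 4000000 in
lemma symmCurB_disp {F F₁ F₂ : JetAlg Ω} (hF : HasGrad m σ F F₁ 0) (hF₁ : HasGrad m σ F₁ F₂ 0) :
      symmCurB m σ (lam m σ) rv (dispA (algebraMap ℝ _ (1 / m)) (hinv m σ) (phi m) F F₁ (curT m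
      σ μ g) (dw m σ μ) (wj m σ 1) (wj m σ 2) (vj 1)) (dispB (algebraMap ℝ _ (1 / m)) (hinv m σ)
      (phi m) F F₁ (curT m σ μ g) (dw m σ μ) (dw m σ (dw m σ μ)) (wj m σ 1) (wj m σ 2) (vj 1)) =
      symmCurB m σ μ g (dispA (algebraMap ℝ _ (1 / m)) (hinv m σ) (phi m) F F₁ (algebraMap ℝ _
      m) (algebraMap ℝ _ m) (wj m σ 1) (wj m σ 2) (vj 1)) (dispB (algebraMap ℝ _ (1 / m)) (hinv
      m σ) (phi m) F F₁ (algebraMap ℝ _ m) (algebraMap ℝ _ m) 0 (wj m σ 1) (wj m σ 2) (vj 1)) :=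
      by
  have hκ := rel_lam (Ω := Ω) (m := m) (σ := σ)
  have hτ : (g - μ) * hinv m σ = curT m σ μ g := rfl
  have hx := h.rel_curT_fst
  have hM := m_mul_inv (Ω := Ω) m σ
  have hw1 := totD_wj (Ω := Ω) (m := m) (σ := σ) 1
  have hw2 := totD_wj (Ω := Ω) (m := m) (σ := σ) 2
  have hv0 : totD (rv : JetAlg Ω) = vj 1 := totD_vj 0
  have hv1 := totD_vj (Ω := Ω) 1
  have hv2 := totD_vj (Ω := Ω) 2
  have ew := evo_wj (Ω := Ω) (m := m) (σ := σ)
  have ev := evo_vj (Ω := Ω)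
  simp only [symmCurB, algebraMap_one_sub]
  simp only [dispA, dispB, Derivation.leibniz, Derivation.leibniz_pow, map_add, map_sub, map_neg, smul_eq_mul, nsmul_eq_mul,
    Derivation.map_one_eq_zero, Derivation.map_algebraMap, map_ofNat_eq_zero,
    evo_wj_one, evo_vj_one, ew, ev, Function.iterate_succ_apply', Function.iterate_zero_apply, evo_symmFlow_rv, evo_symmFlow_rw, evo_consFlow_rv, evo_consFlow_rw, hF.totD, hF₁.totD, hF.evo, hF₁.evo,
    h.grad_fst.totD, h.grad_snd.totD,
    h.grad_dv_snd.totD, h.grad_dv_dv_snd.totD, h.grad_curT.totD, h.grad_dw.totD, h.grad_dw_dw.totD, h.grad_dw_dw_dw.totD,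
    (grad_hinv (Ω := Ω) (m := m) (σ := σ)).totD, (grad_phi (Ω := Ω) (m := m) (σ := σ)).totD,
    (grad_lam (Ω := Ω) (m := m) (σ := σ)).totD,
    h.grad_fst.evo, h.grad_snd.evo,
    h.grad_dv_snd.evo, h.grad_dv_dv_snd.evo, h.grad_curT.evo, h.grad_dw.evo, h.grad_dw_dw.evo, h.grad_dw_dw_dw.evo,
    (grad_hinv (Ω := Ω) (m := m) (σ := σ)).evo, (grad_phi (Ω := Ω) (m := m) (σ := σ)).evo,
    (grad_lam (Ω := Ω) (m := m) (σ := σ)).evo, hw1, hw2, hv0, hv1, hv2, map_zero]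
  push_cast
  clear hw1 hw2 hv0 hv1 hv2 ew ev
  generalize dw m σ (dw m σ (dw m σ (dw m σ μ))) = M₄ at *
  generalize dw m σ (dw m σ (dw m σ μ)) = M₃ at *
  generalize dw m σ (dw m σ μ) = M₂ at *
  generalize dw m σ μ = M₁ at *
  generalize dv m σ (dv m σ (dv m σ g)) = g₃ at *
  generalize dv m σ (dv m σ g) = g₂ at *
  generalize dv m σ g = g₁ at *
  generalize curT m σ μ g = T at *
  generalize (hinv m σ : JetAlg Ω) = i at *
  generalize (phi m : JetAlg Ω) = p at *
  generalize (algebraMap ℝ (JetAlg Ω) (1 / m)) = n at *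
  generalize (algebraMap ℝ (JetAlg Ω) m) = M at *
  generalize (wj m σ 1 : JetAlg Ω) = w₁ at *
  generalize (wj m σ 2 : JetAlg Ω) = w₂ at *
  generalize (wj m σ 3 : JetAlg Ω) = w₃ at *
  generalize (vj 1 : JetAlg Ω) = v₁ at *
  generalize (vj 2 : JetAlg Ω) = v₂ at *
  generalize (vj 3 : JetAlg Ω) = v₃ at *
  linear_combination
    (n ^ 2 * p ^ 2 * v₁ * w₁ ^ 2 * (-6 * F * M₁ * i + 14 * F * M₁ * i * n - 8 * F * M₁ * i * n ^
      2 + 2 * F * M₂ - 2 * F * M₂ * n + 4 * F * T * i * n - 4 * F * T * i * n ^ 2 + 4 * F₁ * M₁ -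
      4 * F₁ * M₁ * n + 2 * F₁ * T - 2 * F₁ * T * n) + F * n ^ 2 * p ^ 2 * v₁ * w₂ * (4 * M₁ - 4
      * M₁ * n + 2 * T - 2 * T * n) + F * M₁ * i * n ^ 2 * p ^ 2 * v₁ ^ 2 * w₁ * (2 - 6 * n + 4 *
      n ^ 2) + F * M₁ * n ^ 2 * p ^ 2 * v₂ * w₁ * (2 - 2 * n) + F * n ^ 2 * p ^ 2 * w₁ * w₂ * (-6
      * M₁ - 6 * T + 12 * T * n) + n ^ 2 * p ^ 2 * w₁ ^ 3 * (4 * F * M₁ * i - 8 * F * M₁ * i * n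
      - 2 * F * M₂ - 4 * F * T * i * n + 8 * F * T * i * n ^ 2 - 4 * F₁ * M₁ - 4 * F₁ * T + 8 *
      F₁ * T * n)) * hκ + (M * n ^ 2 * p ^ 2 * v₁ * w₁ ^ 2 * (6 * F * i - 18 * F * i * n + 12 * F
      * i * n ^ 2 - 6 * F₁ + 6 * F₁ * n) + F * M * n ^ 2 * p ^ 2 * v₁ * w₂ * (-6 + 6 * n) + F * i
      * M * n ^ 2 * p ^ 2 * v₁ ^ 2 * w₁ * (-2 + 6 * n - 4 * n ^ 2) + F * M * n ^ 2 * p ^ 2 * v₂ *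
      w₁ * (-2 + 2 * n) + F * M * n ^ 2 * p ^ 2 * w₁ * w₂ * (12 - 12 * n) + M * n ^ 2 * p ^ 2 *
      w₁ ^ 3 * (-4 * F * i + 12 * F * i * n - 8 * F * i * n ^ 2 + 8 * F₁ - 8 * F₁ * n)) * hτ +
      (F₁ * n ^ 2 * p ^ 2 * w₁ * w₂ * 6 + F₂ * n ^ 2 * p ^ 2 * w₁ ^ 3 * 2 + F * n ^ 2 * p ^ 2 *
      w₃ * 2) * hx + (n ^ 2 * p ^ 2 * v₁ * w₁ ^ 2 * (4 * F * M₁ * i - 8 * F * M₁ * i * n - 2 * F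
      * M₂ - 4 * F * T * i + 8 * F * T * i * n - 4 * F₁ * M₁ + 4 * F₁ * T) + F * n ^ 2 * p ^ 2 *
      v₁ * w₂ * (-4 * M₁ + 4 * T) + F * i * n ^ 2 * p ^ 2 * v₁ ^ 2 * w₁ * (-4 * M₁ + 4 * M₁ * n +
      4 * T - 4 * T * n) + F * n ^ 2 * p ^ 2 * v₂ * w₁ * (-2 * M₁ + 2 * T)) * hM

set_option maxHeartbeats 4000000 in
-- Here the parameter is a function of `v`, and its terms involve `g'` and `g''`. For the flow
-- `(2,1)` one has `g = v`, hence the values `1` and `0` on the right.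
lemma symmCurA_scal {F F₁ F₂ : JetAlg Ω} (hF : HasGrad m σ F 0 F₁) (hF₁ : HasGrad m σ F₁ 0 F₂) :
      symmCurA m σ (lam m σ) rv (scalA (algebraMap ℝ _ (1 / m)) (algebraMap ℝ _ m) (hinv m σ) F
      F₁ (curT m σ μ g) (dv m σ g) (dv m σ (dv m σ g)) (wj m σ 1) (vj 1) (vj 2)) = symmCurA m σ
      μ g (scalA (algebraMap ℝ _ (1 / m)) (algebraMap ℝ _ m) (hinv m σ) F F₁ (algebraMap ℝ _ m)
      1 0 (wj m σ 1) (vj 1) (vj 2)) := by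
  have hκ := rel_lam (Ω := Ω) (m := m) (σ := σ)
  have hτ : (g - μ) * hinv m σ = curT m σ μ g := rfl
  have hx := h.rel_curT_fst
  have hM := m_mul_inv (Ω := Ω) m σ
  have hw1 := totD_wj (Ω := Ω) (m := m) (σ := σ) 1
  have hw2 := totD_wj (Ω := Ω) (m := m) (σ := σ) 2
  have hv0 : totD (rv : JetAlg Ω) = vj 1 := totD_vj 0
  have hv1 := totD_vj (Ω := Ω) 1
  have hv2 := totD_vj (Ω := Ω) 2
  have ew := evo_wj (Ω := Ω) (m := m) (σ := σ)
  have ev := evo_vj (Ω := Ω)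
  simp only [symmCurA, algebraMap_one_sub]
  simp only [scalA, scalB, Derivation.leibniz, Derivation.leibniz_pow, map_add, map_sub, map_neg, smul_eq_mul, nsmul_eq_mul,
    Derivation.map_one_eq_zero, Derivation.map_algebraMap, map_ofNat_eq_zero,
    evo_wj_one, evo_vj_one, ew, ev, Function.iterate_succ_apply', Function.iterate_zero_apply, evo_symmFlow_rv, evo_symmFlow_rw, evo_consFlow_rv, evo_consFlow_rw, hF.totD, hF₁.totD, hF.evo, hF₁.evo,
    h.grad_fst.totD, h.grad_snd.totD,
    h.grad_dv_snd.totD, h.grad_dv_dv_snd.totD, h.grad_curT.totD, h.grad_dw.totD, h.grad_dw_dw.totD, h.grad_dw_dw_dw.totD,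
    (grad_hinv (Ω := Ω) (m := m) (σ := σ)).totD, (grad_phi (Ω := Ω) (m := m) (σ := σ)).totD,
    (grad_lam (Ω := Ω) (m := m) (σ := σ)).totD,
    h.grad_fst.evo, h.grad_snd.evo,
    h.grad_dv_snd.evo, h.grad_dv_dv_snd.evo, h.grad_curT.evo, h.grad_dw.evo, h.grad_dw_dw.evo, h.grad_dw_dw_dw.evo,
    (grad_hinv (Ω := Ω) (m := m) (σ := σ)).evo, (grad_phi (Ω := Ω) (m := m) (σ := σ)).evo,
    (grad_lam (Ω := Ω) (m := m) (σ := σ)).evo, hw1, hw2, hv0, hv1, hv2, map_zero]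
  push_cast
  clear hw1 hw2 hv0 hv1 hv2 ew ev
  generalize dw m σ (dw m σ (dw m σ (dw m σ μ))) = M₄ at *
  generalize dw m σ (dw m σ (dw m σ μ)) = M₃ at *
  generalize dw m σ (dw m σ μ) = M₂ at *
  generalize dw m σ μ = M₁ at *
  generalize dv m σ (dv m σ (dv m σ g)) = g₃ at *
  generalize dv m σ (dv m σ g) = g₂ at *
  generalize dv m σ g = g₁ at *
  generalize curT m σ μ g = T at *
  generalize (hinv m σ : JetAlg Ω) = i at *
  generalize (phi m : JetAlg Ω) = p at *
  generalize (algebraMap ℝ (JetAlg Ω) (1 / m)) = n at *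
  generalize (algebraMap ℝ (JetAlg Ω) m) = M at *
  generalize (wj m σ 1 : JetAlg Ω) = w₁ at *
  generalize (wj m σ 2 : JetAlg Ω) = w₂ at *
  generalize (wj m σ 3 : JetAlg Ω) = w₃ at *
  generalize (vj 1 : JetAlg Ω) = v₁ at *
  generalize (vj 2 : JetAlg Ω) = v₂ at *
  generalize (vj 3 : JetAlg Ω) = v₃ at *
  linear_combination
    (F * i * v₁ * w₁ ^ 2 * (6 * M₁ - 2 * M₁ * M + 2 * M₁ * n - 6 * M₁ * n ^ 2 - 12 * T + 4 * T *
      M - 4 * T * n + 12 * T * n ^ 2) + T * F * v₁ * w₂ * (-6 + 2 * M - 2 * n + 6 * n ^ 2) + F *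
      g₁ * i * v₁ ^ 2 * w₁ * (6 - 2 * M + 2 * n - 6 * n ^ 2)) * hκ + (F * i * M * v₁ * w₁ ^ 2 *
      (6 - 2 * M + 2 * n - 6 * n ^ 2) + F * M * v₁ * w₂ * (6 - 2 * M + 2 * n - 6 * n ^ 2) + F * i
      * v₁ ^ 2 * w₁ * (-6 + 2 * M - 2 * n + 6 * n ^ 2)) * hτ + (T * F * i * v₁ ^ 2 * w₁ * (-6 + 2
      * M - 2 * n + 6 * n ^ 2)) * hM

set_option maxHeartbeats 4000000 in
lemma symmCurB_scal {F F₁ F₂ : JetAlg Ω} (hF : HasGrad m σ F 0 F₁) (hF₁ : HasGrad m σ F₁ 0 F₂) :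
      symmCurB m σ (lam m σ) rv (scalA (algebraMap ℝ _ (1 / m)) (algebraMap ℝ _ m) (hinv m σ) F
      F₁ (curT m σ μ g) (dv m σ g) (dv m σ (dv m σ g)) (wj m σ 1) (vj 1) (vj 2)) (scalB
      (algebraMap ℝ _ (1 / m)) (algebraMap ℝ _ m) (hinv m σ) F F₁ (curT m σ μ g) (dv m σ g) (dv
      m σ (dv m σ g)) (wj m σ 1) (vj 1) (vj 2)) = symmCurB m σ μ g (scalA (algebraMap ℝ _ (1 /
      m)) (algebraMap ℝ _ m) (hinv m σ) F F₁ (algebraMap ℝ _ m) 1 0 (wj m σ 1) (vj 1) (vj 2))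
      (scalB (algebraMap ℝ _ (1 / m)) (algebraMap ℝ _ m) (hinv m σ) F F₁ (algebraMap ℝ _ m) 1 0
      (wj m σ 1) (vj 1) (vj 2)) := by
  have hκ := rel_lam (Ω := Ω) (m := m) (σ := σ)
  have hτ : (g - μ) * hinv m σ = curT m σ μ g := rfl
  have hx := h.rel_curT_fst
  have hM := m_mul_inv (Ω := Ω) m σ
  have hw1 := totD_wj (Ω := Ω) (m := m) (σ := σ) 1
  have hw2 := totD_wj (Ω := Ω) (m := m) (σ := σ) 2
  have hv0 : totD (rv : JetAlg Ω) = vj 1 := totD_vj 0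
  have hv1 := totD_vj (Ω := Ω) 1
  have hv2 := totD_vj (Ω := Ω) 2
  have ew := evo_wj (Ω := Ω) (m := m) (σ := σ)
  have ev := evo_vj (Ω := Ω)
  simp only [symmCurB, algebraMap_one_sub]
  simp only [scalA, scalB, Derivation.leibniz, Derivation.leibniz_pow, map_add, map_sub, map_neg, smul_eq_mul, nsmul_eq_mul,
    Derivation.map_one_eq_zero, Derivation.map_algebraMap, map_ofNat_eq_zero,
    evo_wj_one, evo_vj_one, ew, ev, Function.iterate_succ_apply', Function.iterate_zero_apply, evo_symmFlow_rv, evo_symmFlow_rw, evo_consFlow_rv, evo_consFlow_rw, hF.totD, hF₁.totD, hF.evo, hF₁.evo,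
    h.grad_fst.totD, h.grad_snd.totD,
    h.grad_dv_snd.totD, h.grad_dv_dv_snd.totD, h.grad_curT.totD, h.grad_dw.totD, h.grad_dw_dw.totD, h.grad_dw_dw_dw.totD,
    (grad_hinv (Ω := Ω) (m := m) (σ := σ)).totD, (grad_phi (Ω := Ω) (m := m) (σ := σ)).totD,
    (grad_lam (Ω := Ω) (m := m) (σ := σ)).totD,
    h.grad_fst.evo, h.grad_snd.evo,
    h.grad_dv_snd.evo, h.grad_dv_dv_snd.evo, h.grad_curT.evo, h.grad_dw.evo, h.grad_dw_dw.evo, h.grad_dw_dw_dw.evo,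
    (grad_hinv (Ω := Ω) (m := m) (σ := σ)).evo, (grad_phi (Ω := Ω) (m := m) (σ := σ)).evo,
    (grad_lam (Ω := Ω) (m := m) (σ := σ)).evo, hw1, hw2, hv0, hv1, hv2, map_zero]
  push_cast
  clear hw1 hw2 hv0 hv1 hv2 ew ev
  generalize dw m σ (dw m σ (dw m σ (dw m σ μ))) = M₄ at *
  generalize dw m σ (dw m σ (dw m σ μ)) = M₃ at *
  generalize dw m σ (dw m σ μ) = M₂ at *
  generalize dw m σ μ = M₁ at *
  generalize dv m σ (dv m σ (dv m σ g)) = g₃ at *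
  generalize dv m σ (dv m σ g) = g₂ at *
  generalize dv m σ g = g₁ at *
  generalize curT m σ μ g = T at *
  generalize (hinv m σ : JetAlg Ω) = i at *
  generalize (phi m : JetAlg Ω) = p at *
  generalize (algebraMap ℝ (JetAlg Ω) (1 / m)) = n at *
  generalize (algebraMap ℝ (JetAlg Ω) m) = M at *
  generalize (wj m σ 1 : JetAlg Ω) = w₁ at *
  generalize (wj m σ 2 : JetAlg Ω) = w₂ at *
  generalize (wj m σ 3 : JetAlg Ω) = w₃ at *
  generalize (vj 1 : JetAlg Ω) = v₁ at *
  generalize (vj 2 : JetAlg Ω) = v₂ at *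
  generalize (vj 3 : JetAlg Ω) = v₃ at *
  linear_combination
    (F * v₁ * v₂ * (-4 * T + 6 * T * n + 10 * T * n ^ 2 + 8 * g₁ - 2 * g₁ * M * n - 6 * g₁ * n -
      12 * g₁ * n ^ 2) + F * i * v₁ * w₁ ^ 2 * (6 * M₁ - 2 * M₁ * M + 2 * M₁ * n - 6 * M₁ * n ^ 2
      - 12 * T + 4 * T * M - 4 * T * n + 12 * T * n ^ 2) + T * F * v₁ * w₂ * (-6 + 2 * M - 2 * n
      + 6 * n ^ 2) + F * i * v₁ ^ 2 * w₁ * (-6 * T + 2 * T * M - 2 * T * M * n + 4 * T * n + 8 *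
      T * n ^ 2 - 6 * T * n ^ 3 + 6 * g₁ - 2 * g₁ * M + 2 * g₁ * n - 6 * g₁ * n ^ 2) + v₁ ^ 3 *
      (2 * T * F * i - 4 * T * F * i * n - 6 * T * F * i * n ^ 2 - 2 * T * F₁ + 4 * T * F₁ * n +
      6 * T * F₁ * n ^ 2 - 3 * F * g₁ * i + F * g₁ * i * M * n + 4 * F * g₁ * i * n + 6 * F * g₁
      * i * n ^ 2 + 3 * F * g₂ - F * g₂ * M * n - 2 * F * g₂ * n - 4 * F * g₂ * n ^ 2 + 3 * F₁ *
      g₁ - F₁ * g₁ * M * n - 4 * F₁ * g₁ * n - 6 * F₁ * g₁ * n ^ 2)) * hκ + (F * v₁ * v₂ * (-6 +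
      4 * M - 6 * M * n - 8 * M * n ^ 2 + 4 * M * n ^ 3 + 4 * n + 8 * n ^ 2) + F * i * M * v₁ *
      w₁ ^ 2 * (6 - 2 * M + 2 * n - 6 * n ^ 2) + F * M * v₁ * w₂ * (6 - 2 * M + 2 * n - 6 * n ^
      2) + F * i * v₁ ^ 2 * w₁ * (-6 + 8 * M - 2 * M ^ 2 - 4 * M * n - 8 * M * n ^ 2 + 6 * M * n
      ^ 3 + 2 * M ^ 2 * n - 2 * n + 6 * n ^ 2) + v₁ ^ 3 * (2 * F * i - 2 * F * i * M + 4 * F * i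
      * M * n + 4 * F * i * M * n ^ 2 - 3 * F * i * M * n ^ 3 - 2 * F * i * n - 3 * F * i * n ^ 2
      - 2 * F₁ + 2 * F₁ * M - 4 * F₁ * M * n - 4 * F₁ * M * n ^ 2 + 3 * F₁ * M * n ^ 3 + 2 * F₁ *
      n + 3 * F₁ * n ^ 2)) * hτ + (F₁ * v₁ * v₂ * (4 - 6 * n - 10 * n ^ 2) + F₂ * v₁ ^ 3 * (1 - 2
      * n - 3 * n ^ 2) + F * v₃ * (2 - 2 * n - 4 * n ^ 2)) * hx + (F * v₁ * v₂ * (2 * T * n + 4 *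
      T * n ^ 2 - 2 * g₁ * M) + T * F * i * v₁ ^ 2 * w₁ * (-6 + 2 * M - 2 * n + 6 * n ^ 2) + v₁ ^
      3 * (-2 * T * F * i * n - 3 * T * F * i * n ^ 2 + 2 * T * F₁ * n + 3 * T * F₁ * n ^ 2 + F *
      g₁ * i * M - F * g₂ * M - F₁ * g₁ * M)) * hM

set_option maxHeartbeats 4000000 in
-- The second-current part of the commutation relation at order `ε`. For the flow `(2,1)` the factor
-- `T/m` equals one, which leaves `F φ w_x` on the right.
lemma symmCurA_lin {F F₁ F₂ : JetAlg Ω} (hF : HasGrad m σ F F₁ 0) (hF₁ : HasGrad m σ F₁ F₂ 0) :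
      symmCurA m σ (lam m σ) rv (algebraMap ℝ _ (1 / m) * phi m * F * curT m σ μ g * wj m σ 1) =
      symmCurA m σ μ g (F * phi m * wj m σ 1) := by
  have hκ := rel_lam (Ω := Ω) (m := m) (σ := σ)
  have hτ : (g - μ) * hinv m σ = curT m σ μ g := rfl
  have hx := h.rel_curT_fst
  have hM := m_mul_inv (Ω := Ω) m σ
  have hw1 := totD_wj (Ω := Ω) (m := m) (σ := σ) 1
  have hw2 := totD_wj (Ω := Ω) (m := m) (σ := σ) 2
  have hv0 : totD (rv : JetAlg Ω) = vj 1 := totD_vj 0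
  have hv1 := totD_vj (Ω := Ω) 1
  have hv2 := totD_vj (Ω := Ω) 2
  have ew := evo_wj (Ω := Ω) (m := m) (σ := σ)
  have ev := evo_vj (Ω := Ω)
  simp only [symmCurA, algebraMap_one_sub]
  simp only [quadA, quadB, Derivation.leibniz, Derivation.leibniz_pow, map_add, map_sub, map_neg, smul_eq_mul, nsmul_eq_mul,
    Derivation.map_one_eq_zero, Derivation.map_algebraMap, map_ofNat_eq_zero,
    evo_wj_one, evo_vj_one, ew, ev, Function.iterate_succ_apply', Function.iterate_zero_apply, evo_symmFlow_rv, evo_symmFlow_rw, evo_consFlow_rv, evo_consFlow_rw, hF.totD, hF₁.totD, hF.evo, hF₁.evo,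
    h.grad_fst.totD, h.grad_snd.totD,
    h.grad_dv_snd.totD, h.grad_dv_dv_snd.totD, h.grad_curT.totD, h.grad_dw.totD, h.grad_dw_dw.totD, h.grad_dw_dw_dw.totD,
    (grad_hinv (Ω := Ω) (m := m) (σ := σ)).totD, (grad_phi (Ω := Ω) (m := m) (σ := σ)).totD,
    (grad_lam (Ω := Ω) (m := m) (σ := σ)).totD,
    h.grad_fst.evo, h.grad_snd.evo,
    h.grad_dv_snd.evo, h.grad_dv_dv_snd.evo, h.grad_curT.evo, h.grad_dw.evo, h.grad_dw_dw.evo, h.grad_dw_dw_dw.evo,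
    (grad_hinv (Ω := Ω) (m := m) (σ := σ)).evo, (grad_phi (Ω := Ω) (m := m) (σ := σ)).evo,
    (grad_lam (Ω := Ω) (m := m) (σ := σ)).evo, hw1, hw2, hv0, hv1, hv2, map_zero]
  push_cast
  clear hw1 hw2 hv0 hv1 hv2 ew ev
  generalize dw m σ (dw m σ (dw m σ (dw m σ μ))) = M₄ at *
  generalize dw m σ (dw m σ (dw m σ μ)) = M₃ at *
  generalize dw m σ (dw m σ μ) = M₂ at *
  generalize dw m σ μ = M₁ at *
  generalize dv m σ (dv m σ (dv m σ g)) = g₃ at *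
  generalize dv m σ (dv m σ g) = g₂ at *
  generalize dv m σ g = g₁ at *
  generalize curT m σ μ g = T at *
  generalize (hinv m σ : JetAlg Ω) = i at *
  generalize (phi m : JetAlg Ω) = p at *
  generalize (algebraMap ℝ (JetAlg Ω) (1 / m)) = n at *
  generalize (algebraMap ℝ (JetAlg Ω) m) = M at *
  generalize (wj m σ 1 : JetAlg Ω) = w₁ at *
  generalize (wj m σ 2 : JetAlg Ω) = w₂ at *
  generalize (wj m σ 3 : JetAlg Ω) = w₃ at *
  generalize (vj 1 : JetAlg Ω) = v₁ at *
  generalize (vj 2 : JetAlg Ω) = v₂ at *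
  generalize (vj 3 : JetAlg Ω) = v₃ at *
  linear_combination
    (F * n * p * w₁ ^ 2 * (M₁ - T * n)) * hκ + (F * p * w₁ ^ 2 * (-1 + n)) * hτ + (F₁ * n * p *
      w₁ ^ 2 * (-1) + F * n * p * w₂ * (-1)) * hx + (F * T * p * v₁ * w₁ * (-1) + p * w₁ ^ 2 * (F
      * M₁ + F * T - F * T * n - F₁ * (g - μ)) + F * p * (g - μ) * w₂ * (-1)) * hM

set_option maxHeartbeats 4000000 in
lemma symmCurB_lin {F F₁ F₂ : JetAlg Ω} (hF : HasGrad m σ F F₁ 0) (hF₁ : HasGrad m σ F₁ F₂ 0) :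
      symmCurB m σ (lam m σ) rv (algebraMap ℝ _ (1 / m) * phi m * F * curT m σ μ g * wj m σ 1)
      (algebraMap ℝ _ (1 / m) * phi m * F * (curT m σ μ g - dw m σ μ) * wj m σ 1) = symmCurB m σ
      μ g (F * phi m * wj m σ 1) 0 := by
  have hκ := rel_lam (Ω := Ω) (m := m) (σ := σ)
  have hτ : (g - μ) * hinv m σ = curT m σ μ g := rfl
  have hx := h.rel_curT_fst
  have hM := m_mul_inv (Ω := Ω) m σ
  have hw1 := totD_wj (Ω := Ω) (m := m) (σ := σ) 1
  have hw2 := totD_wj (Ω := Ω) (m := m) (σ := σ) 2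
  have hv0 : totD (rv : JetAlg Ω) = vj 1 := totD_vj 0
  have hv1 := totD_vj (Ω := Ω) 1
  have hv2 := totD_vj (Ω := Ω) 2
  have ew := evo_wj (Ω := Ω) (m := m) (σ := σ)
  have ev := evo_vj (Ω := Ω)
  simp only [symmCurB, algebraMap_one_sub]
  simp only [quadA, quadB, Derivation.leibniz, Derivation.leibniz_pow, map_add, map_sub, map_neg, smul_eq_mul, nsmul_eq_mul,
    Derivation.map_one_eq_zero, Derivation.map_algebraMap, map_ofNat_eq_zero,
    evo_wj_one, evo_vj_one, ew, ev, Function.iterate_succ_apply', Function.iterate_zero_apply, evo_symmFlow_rv, evo_symmFlow_rw, evo_consFlow_rv, evo_consFlow_rw, hF.totD, hF₁.totD, hF.evo, hF₁.evo,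
    h.grad_fst.totD, h.grad_snd.totD,
    h.grad_dv_snd.totD, h.grad_dv_dv_snd.totD, h.grad_curT.totD, h.grad_dw.totD, h.grad_dw_dw.totD, h.grad_dw_dw_dw.totD,
    (grad_hinv (Ω := Ω) (m := m) (σ := σ)).totD, (grad_phi (Ω := Ω) (m := m) (σ := σ)).totD,
    (grad_lam (Ω := Ω) (m := m) (σ := σ)).totD,
    h.grad_fst.evo, h.grad_snd.evo,
    h.grad_dv_snd.evo, h.grad_dv_dv_snd.evo, h.grad_curT.evo, h.grad_dw.evo, h.grad_dw_dw.evo, h.grad_dw_dw_dw.evo,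
    (grad_hinv (Ω := Ω) (m := m) (σ := σ)).evo, (grad_phi (Ω := Ω) (m := m) (σ := σ)).evo,
    (grad_lam (Ω := Ω) (m := m) (σ := σ)).evo, hw1, hw2, hv0, hv1, hv2, map_zero]
  push_cast
  clear hw1 hw2 hv0 hv1 hv2 ew ev
  generalize dw m σ (dw m σ (dw m σ (dw m σ μ))) = M₄ at *
  generalize dw m σ (dw m σ (dw m σ μ)) = M₃ at *
  generalize dw m σ (dw m σ μ) = M₂ at *
  generalize dw m σ μ = M₁ at *
  generalize dv m σ (dv m σ (dv m σ g)) = g₃ at *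
  generalize dv m σ (dv m σ g) = g₂ at *
  generalize dv m σ g = g₁ at *
  generalize curT m σ μ g = T at *
  generalize (hinv m σ : JetAlg Ω) = i at *
  generalize (phi m : JetAlg Ω) = p at *
  generalize (algebraMap ℝ (JetAlg Ω) (1 / m)) = n at *
  generalize (algebraMap ℝ (JetAlg Ω) m) = M at *
  generalize (wj m σ 1 : JetAlg Ω) = w₁ at *
  generalize (wj m σ 2 : JetAlg Ω) = w₂ at *
  generalize (wj m σ 3 : JetAlg Ω) = w₃ at *
  generalize (vj 1 : JetAlg Ω) = v₁ at *
  generalize (vj 2 : JetAlg Ω) = v₂ at *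
  generalize (vj 3 : JetAlg Ω) = v₃ at *
  linear_combination
    (F * M₁ * n * p * v₁ * w₁ * (-1 + n) + F * n * p * w₁ ^ 2 * (M₁ - T * n)) * hκ + (F * p * v₁
      * w₁ * (1 - n) + F * p * w₁ ^ 2 * (-1 + n)) * hτ + (F₁ * n * p * w₁ ^ 2 * (-1) + F * n * p
      * w₂ * (-1)) * hx + (F * p * v₁ * w₁ * (M₁ * n - T) + p * w₁ ^ 2 * (F * T - F * T * n - F₁
      * (g - μ)) + F * p * (g - μ) * w₂ * (-1)) * hM

set_option maxHeartbeats 4000000 in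
-- At order `ε²` the part quadratic in `F` has to absorb the bracket `[K₁, Q₁]` as well; the two
-- `evo` terms are its second current. The factor `6` clears denominators, the actual current being
-- one sixth of `quadA`.
lemma symmCurA_quad {F F₁ F₂ : JetAlg Ω} (hF : HasGrad m σ F F₁ 0) (hF₁ : HasGrad m σ F₁ F₂ 0) :
      symmCurA m σ (lam m σ) rv (quadA (algebraMap ℝ _ (1 / m)) (hinv m σ) (phi m) F F₁ (curT m
      σ μ g) (dw m σ μ) (dw m σ (dw m σ μ)) (dv m σ g) (wj m σ 1) (wj m σ 2) (vj 1)) + 6 * (evo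
      (consFlow m σ (F * phi m * wj m σ 1) 0) (algebraMap ℝ _ (1 / m) * phi m * F * curT m σ μ g
      * wj m σ 1)) = symmCurA m σ μ g (quadA (algebraMap ℝ _ (1 / m)) (hinv m σ) (phi m) F F₁
      (algebraMap ℝ _ m) (algebraMap ℝ _ m) 0 1 (wj m σ 1) (wj m σ 2) (vj 1)) + 6 * (evo
      (consFlow m σ (algebraMap ℝ _ (1 / m) * phi m * F * curT m σ μ g * wj m σ 1) (algebraMap ℝ
      _ (1 / m) * phi m * F * (curT m σ μ g - dw m σ μ) * wj m σ 1)) (F * phi m * wj m σ 1)) :=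
      by
  have hκ := rel_lam (Ω := Ω) (m := m) (σ := σ)
  have hτ : (g - μ) * hinv m σ = curT m σ μ g := rfl
  have hx := h.rel_curT_fst
  have hM := m_mul_inv (Ω := Ω) m σ
  have hw1 := totD_wj (Ω := Ω) (m := m) (σ := σ) 1
  have hw2 := totD_wj (Ω := Ω) (m := m) (σ := σ) 2
  have hv0 : totD (rv : JetAlg Ω) = vj 1 := totD_vj 0
  have hv1 := totD_vj (Ω := Ω) 1
  have hv2 := totD_vj (Ω := Ω) 2
  have ew := evo_wj (Ω := Ω) (m := m) (σ := σ)
  have ev := evo_vj (Ω := Ω)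
  simp only [symmCurA, algebraMap_one_sub]
  simp only [quadA, quadB, Derivation.leibniz, Derivation.leibniz_pow, map_add, map_sub, map_neg, smul_eq_mul, nsmul_eq_mul,
    Derivation.map_one_eq_zero, Derivation.map_algebraMap, map_ofNat_eq_zero,
    evo_wj_one, evo_vj_one, ew, ev, Function.iterate_succ_apply', Function.iterate_zero_apply, evo_symmFlow_rv, evo_symmFlow_rw, evo_consFlow_rv, evo_consFlow_rw, hF.totD, hF₁.totD, hF.evo, hF₁.evo,
    h.grad_fst.totD, h.grad_snd.totD,
    h.grad_dv_snd.totD, h.grad_dv_dv_snd.totD, h.grad_curT.totD, h.grad_dw.totD, h.grad_dw_dw.totD, h.grad_dw_dw_dw.totD,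
    (grad_hinv (Ω := Ω) (m := m) (σ := σ)).totD, (grad_phi (Ω := Ω) (m := m) (σ := σ)).totD,
    (grad_lam (Ω := Ω) (m := m) (σ := σ)).totD,
    h.grad_fst.evo, h.grad_snd.evo,
    h.grad_dv_snd.evo, h.grad_dv_dv_snd.evo, h.grad_curT.evo, h.grad_dw.evo, h.grad_dw_dw.evo, h.grad_dw_dw_dw.evo,
    (grad_hinv (Ω := Ω) (m := m) (σ := σ)).evo, (grad_phi (Ω := Ω) (m := m) (σ := σ)).evo,
    (grad_lam (Ω := Ω) (m := m) (σ := σ)).evo, hw1, hw2, hv0, hv1, hv2, map_zero]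
  push_cast
  clear hw1 hw2 hv0 hv1 hv2 ew ev
  generalize dw m σ (dw m σ (dw m σ (dw m σ μ))) = M₄ at *
  generalize dw m σ (dw m σ (dw m σ μ)) = M₃ at *
  generalize dw m σ (dw m σ μ) = M₂ at *
  generalize dw m σ μ = M₁ at *
  generalize dv m σ (dv m σ (dv m σ g)) = g₃ at *
  generalize dv m σ (dv m σ g) = g₂ at *
  generalize dv m σ g = g₁ at *
  generalize curT m σ μ g = T at *
  generalize (hinv m σ : JetAlg Ω) = i at *
  generalize (phi m : JetAlg Ω) = p at *
  generalize (algebraMap ℝ (JetAlg Ω) (1 / m)) = n at *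
  generalize (algebraMap ℝ (JetAlg Ω) m) = M at *
  generalize (wj m σ 1 : JetAlg Ω) = w₁ at *
  generalize (wj m σ 2 : JetAlg Ω) = w₂ at *
  generalize (wj m σ 3 : JetAlg Ω) = w₃ at *
  generalize (vj 1 : JetAlg Ω) = v₁ at *
  generalize (vj 2 : JetAlg Ω) = v₂ at *
  generalize (vj 3 : JetAlg Ω) = v₃ at *
  linear_combination
    (F * i * n ^ 2 * p ^ 2 * v₁ * w₁ ^ 2 * (2 * F * M₁ * i + 14 * F * M₁ * i * n - 16 * F * M₁ *
      i * n ^ 2 + 6 * F * M₂ - 6 * F * M₂ * n - 2 * F * T * i - 6 * F * T * i * n + 8 * F * T * i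
      * n ^ 3 + 12 * F₁ * M₁ - 12 * F₁ * M₁ * n - 4 * F₁ * T - 4 * F₁ * T * n + 8 * F₁ * T * n ^
      2) + F ^ 2 * i * n ^ 2 * p ^ 2 * v₁ * w₂ * (6 * M₁ - 6 * M₁ * n - 2 * T - 2 * T * n + 4 * T
      * n ^ 2) + F * n ^ 2 * p ^ 2 * w₁ * w₂ * (24 * F * M₁ * i * n + 18 * F * M₂ - 12 * F * T *
      i + 12 * F * T * i * n - 24 * F * T * i * n ^ 2 - 6 * F * g₁ * i + 24 * F₁ * M₁ - 12 * F₁ *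
      T - 24 * F₁ * T * n) + n ^ 2 * p ^ 2 * w₁ ^ 3 * (2 * F * F₁ * M₁ * i + 28 * F * F₁ * M₁ * i
      * n + 18 * F * F₁ * M₂ - 12 * F * F₁ * T * i + 8 * F * F₁ * T * i * n - 32 * F * F₁ * T * i
      * n ^ 2 - 6 * F * F₁ * g₁ * i + 6 * F * F₂ * M₁ - 4 * F * F₂ * T - 8 * F * F₂ * T * n + 6 *
      F ^ 2 * M₁ * i ^ 2 - 4 * F ^ 2 * M₁ * i ^ 2 * n + 16 * F ^ 2 * M₁ * i ^ 2 * n ^ 2 - 4 * F ^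
      2 * M₂ * i + 16 * F ^ 2 * M₂ * i * n + 6 * F ^ 2 * M₃ - 6 * F ^ 2 * T * i ^ 2 - 4 * F ^ 2 *
      T * i ^ 2 * n + 8 * F ^ 2 * T * i ^ 2 * n ^ 2 - 16 * F ^ 2 * T * i ^ 2 * n ^ 3 - 6 * F ^ 2
      * g₁ * i ^ 2 * n + 6 * F₁ ^ 2 * M₁ - 4 * F₁ ^ 2 * T - 8 * F₁ ^ 2 * T * n) + F ^ 2 * n ^ 2 *
      p ^ 2 * w₃ * (6 * M₁ - 2 * T - 4 * T * n)) * hκ + (F * i * M * n ^ 2 * p ^ 2 * v₁ * w₁ ^ 2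
      * (-8 * F * i * n + 16 * F * i * n ^ 2 - 8 * F * i * n ^ 3 - 8 * F₁ + 16 * F₁ * n - 8 * F₁
      * n ^ 2) + F ^ 2 * i * M * n ^ 2 * p ^ 2 * v₁ * w₂ * (-4 + 8 * n - 4 * n ^ 2) + F * n ^ 2 *
      p ^ 2 * w₁ * w₂ * (6 * F * i + 12 * F * i * M - 36 * F * i * M * n + 24 * F * i * M * n ^ 2
      - 12 * F₁ * M + 24 * F₁ * M * n) + n ^ 2 * p ^ 2 * w₁ ^ 3 * (6 * F * F₁ * i + 10 * F * F₁ *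
      i * M - 36 * F * F₁ * i * M * n + 32 * F * F₁ * i * M * n ^ 2 - 2 * F * F₂ * M + 8 * F * F₂
      * M * n + 8 * F ^ 2 * i ^ 2 * M * n - 24 * F ^ 2 * i ^ 2 * M * n ^ 2 + 16 * F ^ 2 * i ^ 2 *
      M * n ^ 3 + 6 * F ^ 2 * i ^ 2 * n - 2 * F₁ ^ 2 * M + 8 * F₁ ^ 2 * M * n) + F ^ 2 * M * n ^
      2 * p ^ 2 * w₃ * (-4 + 4 * n)) * hτ + (F * i * n * p ^ 2 * v₁ * w₁ ^ 2 * (12 * F * M₁ * i +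
      4 * F * M₁ * i * n - 4 * F * M₁ * i * n ^ 2 + 18 * F * M₂ - 6 * F * M₂ * n - 12 * F * T * i
      - 12 * F * T * i * n + 28 * F * T * i * n ^ 2 - 16 * F * T * i * n ^ 3 - 6 * F * g₁ * i +
      24 * F₁ * M₁ - 12 * F₁ * M₁ * n - 24 * F₁ * T + 16 * F₁ * T * n - 16 * F₁ * T * n ^ 2) + F
      ^ 2 * i * n * p ^ 2 * v₁ * w₂ * (18 * M₁ - 6 * M₁ * n - 18 * T + 14 * T * n - 8 * T * n ^
      2) + F ^ 2 * i ^ 2 * n * p ^ 2 * v₁ ^ 2 * w₁ * (6 * M₁ - 6 * M₁ * n - 6 * T + 14 * T * n -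
      16 * T * n ^ 2 + 8 * T * n ^ 3) + F ^ 2 * i * n * p ^ 2 * v₂ * w₁ * (6 * M₁ - 6 * T + 4 * T
      * n - 4 * T * n ^ 2) + F * n * p ^ 2 * w₁ * w₂ * (-6 * F * M₁ * i + 12 * F * M₁ * i * n +
      18 * F * M₂ + 6 * F * T * i - 12 * F * T * i * n - 6 * F * g₁ * i + 24 * F₁ * M₁ - 24 * F₁
      * T) + n * p ^ 2 * w₁ ^ 3 * (-6 * F * F₁ * M₁ * i + 12 * F * F₁ * M₁ * i * n + 18 * F * F₁
      * M₂ + 6 * F * F₁ * T * i - 12 * F * F₁ * T * i * n - 6 * F * F₁ * g₁ * i + 6 * F * F₂ * M₁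
      - 6 * F * F₂ * T - 6 * F ^ 2 * M₁ * i ^ 2 + 12 * F ^ 2 * M₁ * i ^ 2 * n - 12 * F ^ 2 * M₂ *
      i + 12 * F ^ 2 * M₂ * i * n + 6 * F ^ 2 * M₃ + 6 * F ^ 2 * T * i ^ 2 - 12 * F ^ 2 * T * i ^
      2 * n + 6 * F ^ 2 * g₁ * i ^ 2 - 6 * F ^ 2 * g₁ * i ^ 2 * n + 6 * F₁ ^ 2 * M₁ - 6 * F₁ ^ 2
      * T) + F ^ 2 * n * p ^ 2 * w₃ * (6 * M₁ - 6 * T)) * hM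

set_option maxHeartbeats 4000000 in
-- Only one `evo` term occurs: the first current of `K₁` is zero, which also removes the correction
-- in `brk_consFlow`.
lemma symmCurB_quad {F F₁ F₂ : JetAlg Ω} (hF : HasGrad m σ F F₁ 0) (hF₁ : HasGrad m σ F₁ F₂ 0) :
      symmCurB m σ (lam m σ) rv (quadA (algebraMap ℝ _ (1 / m)) (hinv m σ) (phi m) F F₁ (curT m
      σ μ g) (dw m σ μ) (dw m σ (dw m σ μ)) (dv m σ g) (wj m σ 1) (wj m σ 2) (vj 1)) (quadB
      (algebraMap ℝ _ (1 / m)) (hinv m σ) (phi m) F F₁ (curT m σ μ g) (dw m σ μ) (dw m σ (dw m σ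
      μ)) (dw m σ (dw m σ (dw m σ μ))) (dv m σ g) (wj m σ 1) (wj m σ 2) (vj 1)) + 6 * (evo
      (consFlow m σ (F * phi m * wj m σ 1) 0) (algebraMap ℝ _ (1 / m) * phi m * F * (curT m σ μ
      g - dw m σ μ) * wj m σ 1)) = symmCurB m σ μ g (quadA (algebraMap ℝ _ (1 / m)) (hinv m σ)
      (phi m) F F₁ (algebraMap ℝ _ m) (algebraMap ℝ _ m) 0 1 (wj m σ 1) (wj m σ 2) (vj 1))
      (quadB (algebraMap ℝ _ (1 / m)) (hinv m σ) (phi m) F F₁ (algebraMap ℝ _ m) (algebraMap ℝ _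
      m) 0 0 1 (wj m σ 1) (wj m σ 2) (vj 1)) := by
  have hκ := rel_lam (Ω := Ω) (m := m) (σ := σ)
  have hτ : (g - μ) * hinv m σ = curT m σ μ g := rfl
  have hx := h.rel_curT_fst
  have hM := m_mul_inv (Ω := Ω) m σ
  have hw1 := totD_wj (Ω := Ω) (m := m) (σ := σ) 1
  have hw2 := totD_wj (Ω := Ω) (m := m) (σ := σ) 2
  have hv0 : totD (rv : JetAlg Ω) = vj 1 := totD_vj 0
  have hv1 := totD_vj (Ω := Ω) 1
  have hv2 := totD_vj (Ω := Ω) 2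
  have ew := evo_wj (Ω := Ω) (m := m) (σ := σ)
  have ev := evo_vj (Ω := Ω)
  simp only [symmCurB, algebraMap_one_sub]
  simp only [quadA, quadB, Derivation.leibniz, Derivation.leibniz_pow, map_add, map_sub, map_neg, smul_eq_mul, nsmul_eq_mul,
    Derivation.map_one_eq_zero, Derivation.map_algebraMap, map_ofNat_eq_zero,
    evo_wj_one, evo_vj_one, ew, ev, Function.iterate_succ_apply', Function.iterate_zero_apply, evo_symmFlow_rv, evo_symmFlow_rw, evo_consFlow_rv, evo_consFlow_rw, hF.totD, hF₁.totD, hF.evo, hF₁.evo,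
    h.grad_fst.totD, h.grad_snd.totD,
    h.grad_dv_snd.totD, h.grad_dv_dv_snd.totD, h.grad_curT.totD, h.grad_dw.totD, h.grad_dw_dw.totD, h.grad_dw_dw_dw.totD,
    (grad_hinv (Ω := Ω) (m := m) (σ := σ)).totD, (grad_phi (Ω := Ω) (m := m) (σ := σ)).totD,
    (grad_lam (Ω := Ω) (m := m) (σ := σ)).totD,
    h.grad_fst.evo, h.grad_snd.evo,
    h.grad_dv_snd.evo, h.grad_dv_dv_snd.evo, h.grad_curT.evo, h.grad_dw.evo, h.grad_dw_dw.evo, h.grad_dw_dw_dw.evo,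
    (grad_hinv (Ω := Ω) (m := m) (σ := σ)).evo, (grad_phi (Ω := Ω) (m := m) (σ := σ)).evo,
    (grad_lam (Ω := Ω) (m := m) (σ := σ)).evo, hw1, hw2, hv0, hv1, hv2, map_zero]
  push_cast
  clear hw1 hw2 hv0 hv1 hv2 ew ev
  generalize dw m σ (dw m σ (dw m σ (dw m σ μ))) = M₄ at *
  generalize dw m σ (dw m σ (dw m σ μ)) = M₃ at *
  generalize dw m σ (dw m σ μ) = M₂ at *
  generalize dw m σ μ = M₁ at *
  generalize dv m σ (dv m σ (dv m σ g)) = g₃ at *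
  generalize dv m σ (dv m σ g) = g₂ at *
  generalize dv m σ g = g₁ at *
  generalize curT m σ μ g = T at *
  generalize (hinv m σ : JetAlg Ω) = i at *
  generalize (phi m : JetAlg Ω) = p at *
  generalize (algebraMap ℝ (JetAlg Ω) (1 / m)) = n at *
  generalize (algebraMap ℝ (JetAlg Ω) m) = M at *
  generalize (wj m σ 1 : JetAlg Ω) = w₁ at *
  generalize (wj m σ 2 : JetAlg Ω) = w₂ at *
  generalize (wj m σ 3 : JetAlg Ω) = w₃ at *
  generalize (vj 1 : JetAlg Ω) = v₁ at *
  generalize (vj 2 : JetAlg Ω) = v₂ at *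
  generalize (vj 3 : JetAlg Ω) = v₃ at *
  linear_combination
    (F * n ^ 2 * p ^ 2 * v₁ * w₁ ^ 2 * (-4 * F * M₁ * i ^ 2 + 28 * F * M₁ * i ^ 2 * n - 34 * F *
      M₁ * i ^ 2 * n ^ 2 + 16 * F * M₁ * i ^ 2 * n ^ 3 + 8 * F * M₂ * i - 18 * F * M₂ * i * n +
      10 * F * M₂ * i * n ^ 2 - 6 * F * M₃ + 6 * F * M₃ * n + 4 * F * T * i ^ 2 - 12 * F * T * i
      ^ 2 * n + 8 * F * T * i ^ 2 * n ^ 3 + 8 * F₁ * M₁ * i - 18 * F₁ * M₁ * i * n + 16 * F₁ * M₁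
      * i * n ^ 2 - 12 * F₁ * M₂ + 12 * F₁ * M₂ * n + 2 * F₁ * T * i - 10 * F₁ * T * i * n + 8 *
      F₁ * T * i * n ^ 2) + F ^ 2 * n ^ 2 * p ^ 2 * v₁ * w₂ * (8 * M₁ * i - 16 * M₁ * i * n + 8 *
      M₁ * i * n ^ 2 - 8 * M₂ + 8 * M₂ * n - 4 * T * i * n + 4 * T * i * n ^ 2) + F * i * n ^ 2 *
      p ^ 2 * v₁ ^ 2 * w₁ * (-2 * F * M₁ * i - 4 * F * M₁ * i * n + 14 * F * M₁ * i * n ^ 2 - 8 *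
      F * M₁ * i * n ^ 3 - 4 * F * M₂ + 12 * F * M₂ * n - 8 * F * M₂ * n ^ 2 + 2 * F * T * i - 2
      * F * T * i * n - 2 * F * T * i * n ^ 2 - 16 * F * T * i * n ^ 3 - 2 * F * g₁ * i * n + 8 *
      F * g₁ * i * n ^ 2 + 4 * F₁ * T * n - 16 * F₁ * T * n ^ 2 - 2 * F₁ * g₁ + 8 * F₁ * g₁ * n)
      + F * n ^ 2 * p ^ 2 * v₂ * w₁ * (4 * F * M₁ * i - 8 * F * M₁ * i * n + 4 * F * M₁ * i * n ^
      2 - 4 * F * M₂ + 4 * F * M₂ * n - 2 * F * T * i * n + 8 * F * T * i * n ^ 2 - 2 * F₁ * T +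
      8 * F₁ * T * n) + F * n ^ 2 * p ^ 2 * w₁ * w₂ * (24 * F * M₁ * i * n + 18 * F * M₂ - 12 * F
      * T * i + 12 * F * T * i * n - 24 * F * T * i * n ^ 2 - 6 * F * g₁ * i + 24 * F₁ * M₁ - 12
      * F₁ * T - 24 * F₁ * T * n) + n ^ 2 * p ^ 2 * w₁ ^ 3 * (2 * F * F₁ * M₁ * i + 28 * F * F₁ *
      M₁ * i * n + 18 * F * F₁ * M₂ - 12 * F * F₁ * T * i + 8 * F * F₁ * T * i * n - 32 * F * F₁
      * T * i * n ^ 2 - 6 * F * F₁ * g₁ * i + 6 * F * F₂ * M₁ - 4 * F * F₂ * T - 8 * F * F₂ * T *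
      n + 6 * F ^ 2 * M₁ * i ^ 2 - 4 * F ^ 2 * M₁ * i ^ 2 * n + 16 * F ^ 2 * M₁ * i ^ 2 * n ^ 2 -
      4 * F ^ 2 * M₂ * i + 16 * F ^ 2 * M₂ * i * n + 6 * F ^ 2 * M₃ - 6 * F ^ 2 * T * i ^ 2 - 4 *
      F ^ 2 * T * i ^ 2 * n + 8 * F ^ 2 * T * i ^ 2 * n ^ 2 - 16 * F ^ 2 * T * i ^ 2 * n ^ 3 - 6
      * F ^ 2 * g₁ * i ^ 2 * n + 6 * F₁ ^ 2 * M₁ - 4 * F₁ ^ 2 * T - 8 * F₁ ^ 2 * T * n) + F ^ 2 *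
      n ^ 2 * p ^ 2 * w₃ * (6 * M₁ - 2 * T - 4 * T * n)) * hκ + (F * i * n ^ 2 * p ^ 2 * v₁ * w₁
      ^ 2 * (3 * F * i - 19 * F * i * M * n + 37 * F * i * M * n ^ 2 - 24 * F * i * M * n ^ 3 - 3
      * F * i * n - 10 * F₁ * M + 28 * F₁ * M * n - 24 * F₁ * M * n ^ 2) + F ^ 2 * i * M * n ^ 2
      * p ^ 2 * v₁ * w₂ * (-8 + 20 * n - 12 * n ^ 2) + F * i * M * n ^ 3 * p ^ 2 * v₁ ^ 2 * w₁ *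
      (6 * F * i - 10 * F * i * n + 16 * F * i * n ^ 2 - 2 * F₁ + 8 * F₁ * n) + F * M * n ^ 2 * p
      ^ 2 * v₂ * w₁ * (-4 * F * i + 10 * F * i * n - 12 * F * i * n ^ 2 + 2 * F₁ - 8 * F₁ * n) +
      F * n ^ 2 * p ^ 2 * w₁ * w₂ * (6 * F * i + 12 * F * i * M - 36 * F * i * M * n + 24 * F * i
      * M * n ^ 2 - 12 * F₁ * M + 24 * F₁ * M * n) + n ^ 2 * p ^ 2 * w₁ ^ 3 * (6 * F * F₁ * i +
      10 * F * F₁ * i * M - 36 * F * F₁ * i * M * n + 32 * F * F₁ * i * M * n ^ 2 - 2 * F * F₂ *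
      M + 8 * F * F₂ * M * n + 8 * F ^ 2 * i ^ 2 * M * n - 24 * F ^ 2 * i ^ 2 * M * n ^ 2 + 16 *
      F ^ 2 * i ^ 2 * M * n ^ 3 + 6 * F ^ 2 * i ^ 2 * n - 2 * F₁ ^ 2 * M + 8 * F₁ ^ 2 * M * n) +
      F ^ 2 * M * n ^ 2 * p ^ 2 * w₃ * (-4 + 4 * n)) * hτ + (F * n * p ^ 2 * v₁ * w₁ ^ 2 * (12 *
      F * M₁ * i ^ 2 + 12 * F * M₁ * i ^ 2 * n - 22 * F * M₁ * i ^ 2 * n ^ 2 + 16 * F * M₁ * i ^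
      2 * n ^ 3 + 6 * F * M₂ * i - 4 * F * M₂ * i * n + 10 * F * M₂ * i * n ^ 2 + 6 * F * M₃ * n
      - 12 * F * T * i ^ 2 - 15 * F * T * i ^ 2 * n + 31 * F * T * i ^ 2 * n ^ 2 - 16 * F * T * i
      ^ 2 * n ^ 3 - 6 * F * g₁ * i ^ 2 + 18 * F₁ * M₁ * i - 10 * F₁ * M₁ * i * n + 16 * F₁ * M₁ *
      i * n ^ 2 + 12 * F₁ * M₂ * n - 18 * F₁ * T * i + 10 * F₁ * T * i * n - 16 * F₁ * T * i * n
      ^ 2) + F ^ 2 * n * p ^ 2 * v₁ * w₂ * (12 * M₁ * i - 8 * M₁ * i * n + 8 * M₁ * i * n ^ 2 + 8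
      * M₂ * n - 12 * T * i + 8 * T * i * n - 8 * T * i * n ^ 2) + F * i * n ^ 2 * p ^ 2 * v₁ ^ 2
      * w₁ * (-2 * F * M₁ * i + 10 * F * M₁ * i * n - 8 * F * M₁ * i * n ^ 2 + 8 * F * M₂ - 8 * F
      * M₂ * n + 2 * F * T * i - 6 * F * T * i * n - 8 * F * T * i * n ^ 2 + 4 * F₁ * T - 16 * F₁
      * T * n) + F ^ 2 * n * p ^ 2 * v₂ * w₁ * (6 * M₁ * i - 4 * M₁ * i * n + 4 * M₁ * i * n ^ 2
      + 4 * M₂ * n - 6 * T * i + 4 * T * i * n - 4 * T * i * n ^ 2) + F * n * p ^ 2 * w₁ * w₂ *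
      (-6 * F * M₁ * i + 12 * F * M₁ * i * n + 6 * F * M₂ + 6 * F * T * i - 12 * F * T * i * n -
      6 * F * g₁ * i + 24 * F₁ * M₁ - 24 * F₁ * T) + n * p ^ 2 * w₁ ^ 3 * (-6 * F * F₁ * M₁ * i +
      12 * F * F₁ * M₁ * i * n + 6 * F * F₁ * M₂ + 6 * F * F₁ * T * i - 12 * F * F₁ * T * i * n -
      6 * F * F₁ * g₁ * i + 6 * F * F₂ * M₁ - 6 * F * F₂ * T - 12 * F ^ 2 * M₁ * i ^ 2 + 18 * F ^
      2 * M₁ * i ^ 2 * n - 6 * F ^ 2 * M₂ * i + 6 * F ^ 2 * M₂ * i * n + 12 * F ^ 2 * T * i ^ 2 -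
      18 * F ^ 2 * T * i ^ 2 * n + 6 * F ^ 2 * g₁ * i ^ 2 - 6 * F ^ 2 * g₁ * i ^ 2 * n + 6 * F₁ ^
      2 * M₁ - 6 * F₁ ^ 2 * T) + F ^ 2 * n * p ^ 2 * w₃ * (6 * M₁ - 6 * T)) * hM

end IsSymm

end

/-! ### Grading by the number of derivatives, and jets with prescribed Riemann invariants -/

section

attribute [-instance] instCharZeroOfIsSemireal IsStrictOrderedRing.toCharZero
  FloorSemiring.instCharZero NumberField.to_charZero SubsemiringClass.instCharZero

variable {Ω : Opens Pt}

/-! ### Homogeneous differential polynomials in the algebra -/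

/-- Two sequences of jets: `e j s` has degree `s`. -/
abbrev JetFrame (Ω : Opens Pt) := Fin 2 → ℕ → JetAlg Ω

/-- Homogeneous differential polynomials of degree one. -/
def HP1 (e : JetFrame Ω) (f : JetAlg Ω) : Prop :=
  ∃ a : Fin 2 → JetAlg Ω, (∀ j, IsCoef (a j)) ∧ f = ∑ j, a j * e j 1

/-- Homogeneous differential polynomials of degree two. -/
def HP2 (e : JetFrame Ω) (f : JetAlg Ω) : Prop :=
  ∃ (a : Fin 2 → JetAlg Ω) (b : Fin 2 → Fin 2 → JetAlg Ω), (∀ j, IsCoef (a j)) ∧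
    (∀ j k, IsCoef (b j k)) ∧ f = ∑ j, a j * e j 2 + ∑ j, ∑ k, b j k * e j 1 * e k 1

/-- Homogeneous differential polynomials of degree three. -/
def HP3 (e : JetFrame Ω) (f : JetAlg Ω) : Prop :=
  ∃ (a : Fin 2 → JetAlg Ω) (b : Fin 2 → Fin 2 → JetAlg Ω)
    (c : Fin 2 → Fin 2 → Fin 2 → JetAlg Ω), (∀ j, IsCoef (a j)) ∧ (∀ j k, IsCoef (b j k)) ∧
    (∀ j k l, IsCoef (c j k l)) ∧ f = ∑ j, a j * e j 3 + ∑ j, ∑ k, b j k * e j 2 * e k 1 +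
      ∑ j, ∑ k, ∑ l, c j k l * e j 1 * e k 1 * e l 1

lemma isCoef_zero : IsCoef (0 : JetAlg Ω) := by
  rw [← map_zero (algebraMap ℝ (JetAlg Ω))]; exact isCoef_algebraMap 0

lemma isCoef_one : IsCoef (1 : JetAlg Ω) := by
  rw [← map_one (algebraMap ℝ (JetAlg Ω))]; exact isCoef_algebraMap 1

variable {e : JetFrame Ω}

lemma HP1.add {f g : JetAlg Ω} (hf : HP1 e f) (hg : HP1 e g) : HP1 e (f + g) := by
  obtain ⟨a, ha, rfl⟩ := hf
  obtain ⟨a', ha', rfl⟩ := hg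
  exact ⟨fun j => a j + a' j, fun j => (ha j).add (ha' j), by
    simp only [add_mul, Finset.sum_add_distrib]⟩

lemma HP2.add {f g : JetAlg Ω} (hf : HP2 e f) (hg : HP2 e g) : HP2 e (f + g) := by
  obtain ⟨a, b, ha, hb, rfl⟩ := hf
  obtain ⟨a', b', ha', hb', rfl⟩ := hg
  exact ⟨fun j => a j + a' j, fun j k => b j k + b' j k, fun j => (ha j).add (ha' j),
    fun j k => (hb j k).add (hb' j k), by
    simp only [add_mul, Finset.sum_add_distrib]; ring⟩

lemma HP3.add {f g : JetAlg Ω} (hf : HP3 e f) (hg : HP3 e g) : HP3 e (f + g) := by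
  obtain ⟨a, b, c, ha, hb, hc, rfl⟩ := hf
  obtain ⟨a', b', c', ha', hb', hc', rfl⟩ := hg
  exact ⟨fun j => a j + a' j, fun j k => b j k + b' j k, fun j k l => c j k l + c' j k l,
    fun j => (ha j).add (ha' j), fun j k => (hb j k).add (hb' j k),
    fun j k l => (hc j k l).add (hc' j k l), by
    simp only [add_mul, Finset.sum_add_distrib]; ring⟩

lemma HP1.coef_mul {f g : JetAlg Ω} (hg : IsCoef g) (hf : HP1 e f) : HP1 e (g * f) := by
  obtain ⟨a, ha, rfl⟩ := hf
  exact ⟨fun j => g * a j, fun j => hg.mul (ha j), by simp only [Finset.mul_sum, mul_assoc]⟩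

lemma HP2.coef_mul {f g : JetAlg Ω} (hg : IsCoef g) (hf : HP2 e f) : HP2 e (g * f) := by
  obtain ⟨a, b, ha, hb, rfl⟩ := hf
  exact ⟨fun j => g * a j, fun j k => g * b j k, fun j => hg.mul (ha j),
    fun j k => hg.mul (hb j k), by simp only [mul_add, Finset.mul_sum, mul_assoc]⟩

lemma HP3.coef_mul {f g : JetAlg Ω} (hg : IsCoef g) (hf : HP3 e f) : HP3 e (g * f) := by
  obtain ⟨a, b, c, ha, hb, hc, rfl⟩ := hf
  exact ⟨fun j => g * a j, fun j k => g * b j k, fun j k l => g * c j k l,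
    fun j => hg.mul (ha j), fun j k => hg.mul (hb j k), fun j k l => hg.mul (hc j k l), by
    simp only [mul_add, Finset.mul_sum, mul_assoc]⟩

lemma HP1.neg {f : JetAlg Ω} (hf : HP1 e f) : HP1 e (-f) := by
  rw [show -f = -1 * f by ring]; exact hf.coef_mul isCoef_one.neg

lemma HP2.neg {f : JetAlg Ω} (hf : HP2 e f) : HP2 e (-f) := by
  rw [show -f = -1 * f by ring]; exact hf.coef_mul isCoef_one.neg

lemma HP3.neg {f : JetAlg Ω} (hf : HP3 e f) : HP3 e (-f) := by
  rw [show -f = -1 * f by ring]; exact hf.coef_mul isCoef_one.neg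

lemma HP1.sub {f g : JetAlg Ω} (hf : HP1 e f) (hg : HP1 e g) : HP1 e (f - g) := by
  rw [sub_eq_add_neg]; exact hf.add hg.neg

lemma HP2.sub {f g : JetAlg Ω} (hf : HP2 e f) (hg : HP2 e g) : HP2 e (f - g) := by
  rw [sub_eq_add_neg]; exact hf.add hg.neg

lemma HP3.sub {f g : JetAlg Ω} (hf : HP3 e f) (hg : HP3 e g) : HP3 e (f - g) := by
  rw [sub_eq_add_neg]; exact hf.add hg.neg

lemma HP1.zero : HP1 e 0 := ⟨0, fun _ => isCoef_zero, by simp⟩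

lemma HP1.gen (j : Fin 2) : HP1 e (e j 1) :=
  ⟨Pi.single j 1, fun i => by
    by_cases h : i = j
    · subst h; rw [Pi.single_eq_same]; exact isCoef_one
    · rw [Pi.single_eq_of_ne h]; exact isCoef_zero, by simp [Pi.single_apply]⟩

lemma HP2.gen (j : Fin 2) : HP2 e (e j 2) :=
  ⟨Pi.single j 1, 0, fun i => by
    by_cases h : i = j
    · subst h; rw [Pi.single_eq_same]; exact isCoef_one
    · rw [Pi.single_eq_of_ne h]; exact isCoef_zero, fun _ _ => isCoef_zero,
    by simp [Pi.single_apply]⟩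

lemma HP3.gen (j : Fin 2) : HP3 e (e j 3) :=
  ⟨Pi.single j 1, 0, 0, fun i => by
    by_cases h : i = j
    · subst h; rw [Pi.single_eq_same]; exact isCoef_one
    · rw [Pi.single_eq_of_ne h]; exact isCoef_zero, fun _ _ => isCoef_zero,
    fun _ _ _ => isCoef_zero, by simp [Pi.single_apply]⟩

lemma HP1.mul {f g : JetAlg Ω} (hf : HP1 e f) (hg : HP1 e g) : HP2 e (f * g) := by
  obtain ⟨a, ha, rfl⟩ := hf
  obtain ⟨a', ha', rfl⟩ := hg
  exact ⟨0, fun j k => a j * a' k, fun j => isCoef_zero, fun j k => (ha j).mul (ha' k), by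
    simp only [Fin.sum_univ_two, Pi.zero_apply]; ring⟩

lemma HP2.mul {f g : JetAlg Ω} (hf : HP2 e f) (hg : HP1 e g) : HP3 e (f * g) := by
  obtain ⟨a, b, ha, hb, rfl⟩ := hf
  obtain ⟨a', ha', rfl⟩ := hg
  exact ⟨0, fun j k => a j * a' k, fun j k l => b j k * a' l, fun j => isCoef_zero,
    fun j k => (ha j).mul (ha' k), fun j k l => (hb j k).mul (ha' l), by
    simp only [Fin.sum_univ_two, Pi.zero_apply]; ring⟩

/-- The jets of a frame are obtained by differentiation. -/
structure IsFrame (e : JetFrame Ω) : Prop where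
  totD_gen : ∀ j s, totD (e j s) = e j (s + 1)
  totD_coef : ∀ f : JetAlg Ω, IsCoef f → HP1 e (totD f)
  coef_gen : ∀ j, IsCoef (e j 0)

namespace IsFrame

variable (he : IsFrame e)
include he

lemma totD_one {f : JetAlg Ω} (hf : HP1 e f) : HP2 e (totD f) := by
  obtain ⟨a, ha, rfl⟩ := hf
  simp only [Fin.sum_univ_two, map_add, Derivation.leibniz, smul_eq_mul, he.totD_gen]
  have h := fun j => ((he.totD_coef _ (ha j)).mul (HP1.gen (e := e) j))
  have h' := fun j => (HP2.gen (e := e) j).coef_mul (ha j)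
  rw [mul_comm _ (totD (a 0)), mul_comm _ (totD (a 1))]
  exact ((h' 0).add (h 0)).add ((h' 1).add (h 1))

lemma totD_two {f : JetAlg Ω} (hf : HP2 e f) : HP3 e (totD f) := by
  obtain ⟨a, b, ha, hb, rfl⟩ := hf
  have h1 : ∀ j, HP3 e (totD (a j * e j 2)) := fun j => by
    rw [Derivation.leibniz, he.totD_gen, smul_eq_mul, smul_eq_mul]
    exact ((HP3.gen j).coef_mul (ha j)).add ((HP2.gen j).mul (he.totD_coef _ (ha j)))
  have h2 : ∀ j k, HP3 e (totD (b j k * e j 1 * e k 1)) := fun j k => by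
    have e1 : totD (b j k * e j 1 * e k 1) = b j k * (e j 2 * e k 1) +
      (b j k * (e k 2 * e j 1) + e j 1 * e k 1 * totD (b j k)) := by
      simp only [Derivation.leibniz, he.totD_gen, smul_eq_mul]; ring
    rw [e1]
    exact (((HP2.gen j).mul (HP1.gen k)).coef_mul (hb j k)).add
      ((((HP2.gen k).mul (HP1.gen j)).coef_mul (hb j k)).add
        (((HP1.gen j).mul (HP1.gen k)).mul (he.totD_coef _ (hb j k))))
  simp only [Fin.sum_univ_two, map_add]
  exact ((h1 0).add (h1 1)).add (((h2 0 0).add (h2 0 1)).add ((h2 1 0).add (h2 1 1)))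

lemma gen_one {e' : JetFrame Ω} (he' : IsFrame e') (j : Fin 2) : HP1 e' (e j 1) := by
  rw [← he.totD_gen]; exact he'.totD_coef _ (he.coef_gen j)

lemma gen_two {e' : JetFrame Ω} (he' : IsFrame e') (j : Fin 2) : HP2 e' (e j 2) := by
  rw [← he.totD_gen]; exact he'.totD_one (he.gen_one he' j)

lemma gen_three {e' : JetFrame Ω} (he' : IsFrame e') (j : Fin 2) : HP3 e' (e j 3) := by
  rw [← he.totD_gen]; exact he'.totD_two (he.gen_two he' j)

/-- The generators of one frame are homogeneous differential polynomials in the other, with the same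
degree. The grading is therefore intrinsic, and polynomials given in the fields may be expanded in
jets of `w` and `v`. -/
lemma change_one {e' : JetFrame Ω} (he' : IsFrame e') {f : JetAlg Ω} (hf : HP1 e f) :
    HP1 e' f := by
  obtain ⟨a, ha, rfl⟩ := hf
  simp only [Fin.sum_univ_two]
  exact ((he.gen_one he' 0).coef_mul (ha 0)).add ((he.gen_one he' 1).coef_mul (ha 1))

lemma change_two {e' : JetFrame Ω} (he' : IsFrame e') {f : JetAlg Ω} (hf : HP2 e f) :
    HP2 e' f := by
  obtain ⟨a, b, ha, hb, rfl⟩ := hf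
  simp only [Fin.sum_univ_two, mul_assoc]
  have h1 := fun j => (he.gen_two he' j).coef_mul (ha j)
  have h2 := fun j k => ((he.gen_one he' j).mul (he.gen_one he' k)).coef_mul (hb j k)
  exact ((h1 0).add (h1 1)).add (((h2 0 0).add (h2 0 1)).add ((h2 1 0).add (h2 1 1)))

lemma change_three {e' : JetFrame Ω} (he' : IsFrame e') {f : JetAlg Ω} (hf : HP3 e f) :
    HP3 e' f := by
  obtain ⟨a, b, c, ha, hb, hc, rfl⟩ := hf
  simp only [Fin.sum_univ_two]
  have h1 := fun j => (he.gen_three he' j).coef_mul (ha j)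
  have h2 : ∀ j k, HP3 e' (b j k * e j 2 * e k 1) := fun j k => by
    rw [mul_assoc]
    exact ((he.gen_two he' j).mul (he.gen_one he' k)).coef_mul (hb j k)
  have h3 : ∀ j k l, HP3 e' (c j k l * e j 1 * e k 1 * e l 1) := fun j k l => by
    rw [mul_assoc, mul_assoc, ← mul_assoc (e j 1)]
    exact (((he.gen_one he' j).mul (he.gen_one he' k)).mul (he.gen_one he' l)).coef_mul
      (hc j k l)
  exact (((h1 0).add (h1 1)).add (((h2 0 0).add (h2 0 1)).add ((h2 1 0).add (h2 1 1)))).add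
    ((((h3 0 0 0).add (h3 0 0 1)).add ((h3 0 1 0).add (h3 0 1 1))).add
      (((h3 1 0 0).add (h3 1 0 1)).add ((h3 1 1 0).add (h3 1 1 1))))

end IsFrame

/-- The jets of the fields. -/
def fieldFrame : JetFrame Ω := fun j s => jetCoord s j

lemma isFrame_field : IsFrame (fieldFrame : JetFrame Ω) where
  totD_gen j s := totD_jetCoord s j
  totD_coef f hf := by
    obtain ⟨f₀, f₁, h0, h1, h⟩ := hf.exists_grad
    refine ⟨![f₀, f₁], fun j => by fin_cases j <;> assumption, ?_⟩
    rw [totD, h]; simp [Fin.sum_univ_two, fieldFrame]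
  coef_gen j := isCoef_jetCoord_zero j

/-- The jets of the Riemann invariants. -/
def riemannFrame (m σ : ℝ) [PosFst Ω] : JetFrame Ω := ![wj m σ, vj]

lemma isFrame_riemann [PosFst Ω] {m σ : ℝ} [Param m σ] :
    IsFrame (riemannFrame m σ : JetFrame Ω) where
  totD_gen j s := by fin_cases j; exacts [totD_wj s, totD_vj s]
  totD_coef f hf := by
    refine ⟨![dw m σ f, dv m σ f], fun j => ?_, ?_⟩
    · fin_cases j; exacts [hf.dw, hf.dv]
    · rw [hf.totD (m := m) (σ := σ)]; simp [Fin.sum_univ_two, riemannFrame]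
  coef_gen j := by fin_cases j; exacts [isCoef_rw m σ, isCoef_rv]

/-! ### Comparison with differential polynomials -/

lemma IsDiffPoly.rep_one {f : Jet → ℝ} (hf : IsDiffPoly Ω 1 f) :
    ∃ f' : JetAlg Ω, HP1 fieldFrame f' ∧ Rep f f' := by
  obtain ⟨a, ha, h⟩ := hf
  refine ⟨_, ⟨fun j => coef (a j) (ha j), fun j => isCoef_coef _ _, rfl⟩, fun z => ?_⟩
  rw [h z.1 z.2, ← evalAt_apply]
  simp only [map_sum, map_mul]; rfl

lemma IsDiffPoly.rep_two {f : Jet → ℝ} (hf : IsDiffPoly Ω 2 f) :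
    ∃ f' : JetAlg Ω, HP2 fieldFrame f' ∧ Rep f f' := by
  obtain ⟨a, b, ha, hb, h⟩ := hf
  refine ⟨_, ⟨fun j => coef (a j) (ha j), fun j k => coef (b j k) (hb j k),
    fun j => isCoef_coef _ _, fun j k => isCoef_coef _ _, rfl⟩, fun z => ?_⟩
  rw [h z.1 z.2, ← evalAt_apply]
  simp only [map_sum, map_mul, map_add]; rfl

lemma IsDiffPoly.rep_three {f : Jet → ℝ} (hf : IsDiffPoly Ω 3 f) :
    ∃ f' : JetAlg Ω, HP3 fieldFrame f' ∧ Rep f f' := by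
  obtain ⟨a, b, c, ha, hb, hc, h⟩ := hf
  refine ⟨_, ⟨fun j => coef (a j) (ha j), fun j k => coef (b j k) (hb j k),
    fun j k l => coef (c j k l) (hc j k l),
    fun j => isCoef_coef _ _, fun j k => isCoef_coef _ _, fun j k l => isCoef_coef _ _, rfl⟩,
    fun z => ?_⟩
  rw [h z.1 z.2, ← evalAt_apply]
  simp only [map_sum, map_mul, map_add]; rfl

lemma IsCoef.isDiffPoly {f : Jet → ℝ} {f' : JetAlg Ω} (h : Rep f f') (hf : IsCoef f') :
    IsDiffPoly Ω 0 f := by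
  obtain ⟨a, ha, h'⟩ := hf
  exact ⟨a, ha, fun z hz => (h ⟨z, hz⟩).trans (h' ⟨z, hz⟩)⟩

lemma HP1.isDiffPoly {f : Jet → ℝ} {f' : JetAlg Ω} (h : Rep f f') (hf : HP1 fieldFrame f') :
    IsDiffPoly Ω 1 f := by
  obtain ⟨a, ha, rfl⟩ := hf
  choose A hA h' using ha
  refine ⟨A, hA, fun z hz => ?_⟩
  rw [h ⟨z, hz⟩, ← evalAt_apply]
  simp only [map_sum, map_mul, evalAt_apply, h']; rfl

lemma HP2.isDiffPoly {f : Jet → ℝ} {f' : JetAlg Ω} (h : Rep f f') (hf : HP2 fieldFrame f') :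
    IsDiffPoly Ω 2 f := by
  obtain ⟨a, b, ha, hb, rfl⟩ := hf
  choose A hA h' using ha
  choose B hB h'' using hb
  refine ⟨A, B, hA, hB, fun z hz => ?_⟩
  rw [h ⟨z, hz⟩, ← evalAt_apply]
  simp only [map_sum, map_mul, map_add, evalAt_apply, h', h'']; rfl

lemma HP3.isDiffPoly {f : Jet → ℝ} {f' : JetAlg Ω} (h : Rep f f') (hf : HP3 fieldFrame f') :
    IsDiffPoly Ω 3 f := by
  obtain ⟨a, b, c, ha, hb, hc, rfl⟩ := hf
  choose A hA h' using ha
  choose B hB h'' using hb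
  choose C hC h''' using hc
  refine ⟨A, B, C, hA, hB, hC, fun z hz => ?_⟩
  rw [h ⟨z, hz⟩, ← evalAt_apply]
  simp only [map_sum, map_mul, map_add, evalAt_apply, h', h'', h''']; rfl

/-! ### Jets with prescribed Riemann invariants -/

/-- `f` depends on derivatives of order at most `N`. -/
def OrdLE (N : ℕ) (f : JetAlg Ω) : Prop :=
  ∃ g : (Fin (N + 1) → Pt) → ℝ, ContDiffOn ℝ ∞ g (truncDom Ω N) ∧ ∀ z, f.1 z = g (trunc N z.1)

lemma OrdLE.congr {N : ℕ} {f : JetAlg Ω} (hf : OrdLE N f) {z z' : JetDom Ω}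
    (h : ∀ s ≤ N, z.1 s = z'.1 s) : evalAt z f = evalAt z' f := by
  obtain ⟨g, -, hg⟩ := hf
  rw [evalAt_apply, evalAt_apply, hg, hg]
  congr 1
  funext s
  exact h s (Nat.lt_succ_iff.1 s.2)

lemma OrdLE.mono {N N' : ℕ} (h : N ≤ N') {f : JetAlg Ω} (hf : OrdLE N f) : OrdLE N' f := by
  obtain ⟨g, hg, hf⟩ := hf
  exact exists_trunc_le h hg hf

lemma OrdLE.comp₂ {N : ℕ} {f f' : JetAlg Ω} (hf : OrdLE N f) (hf' : OrdLE N f')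
    {k : JetAlg Ω} (op : ℝ × ℝ → ℝ) (hop : ContDiff ℝ ∞ op)
    (hk : ∀ z, k.1 z = op (f.1 z, f'.1 z)) : OrdLE N k := by
  obtain ⟨g, hg, h⟩ := hf
  obtain ⟨g', hg', h'⟩ := hf'
  exact ⟨fun y => op (g y, g' y), hop.comp_contDiffOn (hg.prodMk hg'), fun z => by
    simp only [hk, h, h']⟩

lemma OrdLE.add {N : ℕ} {f f' : JetAlg Ω} (hf : OrdLE N f) (hf' : OrdLE N f') :
    OrdLE N (f + f') := hf.comp₂ hf' (fun q => q.1 + q.2) (by fun_prop) fun _ => rfl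

lemma OrdLE.sub {N : ℕ} {f f' : JetAlg Ω} (hf : OrdLE N f) (hf' : OrdLE N f') :
    OrdLE N (f - f') := hf.comp₂ hf' (fun q => q.1 - q.2) (by fun_prop) fun _ => rfl

lemma OrdLE.mul {N : ℕ} {f f' : JetAlg Ω} (hf : OrdLE N f) (hf' : OrdLE N f') :
    OrdLE N (f * f') := hf.comp₂ hf' (fun q => q.1 * q.2) (by fun_prop) fun _ => rfl

lemma ordLE_jetCoord {s N : ℕ} (h : s ≤ N) (i : Fin 2) : OrdLE N (jetCoord s i : JetAlg Ω) := by
  refine OrdLE.mono h ⟨fun y => y (Fin.last s) i, ?_, fun z => rfl⟩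
  have : ContDiff ℝ ∞ fun y : Fin (s + 1) → Pt => y (Fin.last s) i := by fun_prop
  exact this.contDiffOn

lemma IsCoef.ordLE {f : JetAlg Ω} (hf : IsCoef f) (N : ℕ) : OrdLE N f := by
  obtain ⟨a, ha, h⟩ := hf
  refine ⟨fun y => a (y 0), ?_, h⟩
  have h1 : ContDiff ℝ ∞ fun y : Fin (N + 1) → Pt => y 0 := by fun_prop
  exact ha.comp h1.contDiffOn fun y hy => hy

lemma OrdLE.sum {N : ℕ} {ι : Type*} (t : Finset ι) {f : ι → JetAlg Ω}
    (hf : ∀ i ∈ t, OrdLE N (f i)) : OrdLE N (∑ i ∈ t, f i) := by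
  classical
  induction t using Finset.induction_on with
  | empty => rw [Finset.sum_empty]; exact isCoef_zero.ordLE N
  | insert i t hi ih =>
    rw [Finset.sum_insert hi]
    exact (hf i (Finset.mem_insert_self i t)).add
      (ih fun j hj => hf j (Finset.mem_insert_of_mem hj))

lemma OrdLE.totD {N : ℕ} {f : JetAlg Ω} (hf : OrdLE N f) : OrdLE (N + 1) (totD f) := by
  obtain ⟨g, hg, h⟩ := hf
  have hd : ContDiffOn ℝ ∞ (fderiv ℝ g) (truncDom Ω N) :=
    hg.fderiv_of_isOpen (isOpen_truncDom Ω N) (by simp)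
  have hc : ∀ s i, ContDiffOn ℝ ∞ (fun y => fderiv ℝ g y (Pi.single s (Pi.single i 1)))
    (truncDom Ω N) := fun s i => hd.clm_apply contDiffOn_const
  rw [CoxeterFlow.totD, vf_eq_sum hg h (P := fun s i => ⟨fun z =>
    fderiv ℝ g (trunc N z.1) (Pi.single s (Pi.single i 1)), N, _, hc s i, fun _ => rfl⟩)
    fun s i z => rfl]
  refine OrdLE.sum _ fun s _ => OrdLE.sum _ fun i _ => OrdLE.mul ?_ (ordLE_jetCoord ?_ i)
  · exact OrdLE.mono (Nat.le_succ N) ⟨_, hc s i, fun _ => rfl⟩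
  · have := s.2; omega

variable [hΩ : PosFst Ω] {m σ : ℝ} [hP : Param m σ]

/-- Differentiation keeps the top-order part linear with an unchanged coefficient, so passing from
jets of the fields to jets of `(w, v)` is triangular and can be inverted one order at a time. -/
lemma wj_eq (s : ℕ) : ∃ r : JetAlg Ω, OrdLE s r ∧ wj m σ (s + 1) =
    jetCoord (s + 1) 1 - algebraMap ℝ _ (4 * σ * m) * phi m * jetCoord (s + 1) 0 + r := by
  have hκ : IsCoef (algebraMap ℝ (JetAlg Ω) (4 * σ * m) * phi m) :=
    (isCoef_algebraMap _).mul (isCoef_phi m)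
  induction s with
  | zero =>
    refine ⟨0, isCoef_zero.ordLE 0, ?_⟩
    change CoxeterFlow.totD (rw' m σ) = _
    rw [totD, vf_rw, add_zero]
  | succ n ih =>
    obtain ⟨r, hr, h⟩ := ih
    refine ⟨totD r - totD (algebraMap ℝ _ (4 * σ * m) * phi m) * jetCoord (n + 1) 0, ?_, ?_⟩
    · exact hr.totD.sub (((hκ.ordLE 0).totD.mono (by omega)).mul (ordLE_jetCoord le_rfl 0))
    · rw [← totD_wj, h, map_add, map_sub, totD_jetCoord,
        Derivation.leibniz _ _ (jetCoord (n + 1) 0), totD_jetCoord, smul_eq_mul, smul_eq_mul]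
      ring

lemma evalAt_kappa_ne (z : JetDom Ω) :
    evalAt z (algebraMap ℝ (JetAlg Ω) (4 * σ * m) * phi m) ≠ 0 := by
  intro h
  have h1 := congrArg (evalAt z) (rho_mul_phi (Ω := Ω) (m := m) (σ := σ))
  rw [map_mul, h, zero_mul, map_one] at h1
  exact zero_ne_one h1

lemma ordLE_wj (s : ℕ) : OrdLE s (wj m σ s : JetAlg Ω) := by
  induction s with
  | zero => exact (isCoef_rw m σ).ordLE 0
  | succ n ih => rw [← totD_wj]; exact ih.totD

variable (m σ) in
/-- The jets of the Riemann invariants take arbitrary values. -/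
theorem exists_jet {p : Pt} (hp : p ∈ (Ω : Set Pt)) (a b : ℕ → ℝ) (N : ℕ) :
    ∃ z : JetDom Ω, z.1 0 = p ∧
      ∀ s, s < N → evalAt z (wj m σ (s + 1)) = a (s + 1) ∧ evalAt z (vj (s + 1)) = b (s + 1) := by
  induction N with
  | zero => exact ⟨⟨fun _ => p, hp⟩, rfl, by simp⟩
  | succ N ih =>
    obtain ⟨z, hz, h⟩ := ih
    obtain ⟨r, hr, hw⟩ := wj_eq (Ω := Ω) (m := m) (σ := σ) N
    set κ := algebraMap ℝ (JetAlg Ω) (4 * σ * m) * phi m with hκ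
    have hκc : IsCoef κ := (isCoef_algebraMap _).mul (isCoef_phi m)
    have hupd : ∀ q : Pt, (Function.update z.1 (N + 1) q) 0 ∈ (Ω : Set Pt) := fun q => by
      rw [Function.update_of_ne (Nat.succ_ne_zero N).symm]; exact z.2
    -- The top derivatives solve `b - κ u_(N+1) + r = a`. Here `r` depends only on lower orders,
    -- which are left untouched, and `κ` does not vanish.
    let q : Pt := ![(b (N + 1) - a (N + 1) + evalAt z r) / evalAt z κ, b (N + 1)]
    let z' : JetDom Ω := ⟨Function.update z.1 (N + 1) q, hupd q⟩
    have hag : ∀ s ≤ N, z'.1 s = z.1 s := fun s hs =>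
      Function.update_of_ne (by omega) _ _
    refine ⟨z', (hag 0 (Nat.zero_le N)).trans hz, fun s hs => ?_⟩
    rcases Nat.lt_succ_iff_lt_or_eq.1 hs with hs | rfl
    · rw [(ordLE_wj (s + 1)).congr fun t ht => hag t (by omega), vj_eq,
        (ordLE_jetCoord le_rfl 1).congr fun t ht => hag t (by omega), ← vj_eq]
      exact h s hs
    · have e1 : ∀ i, evalAt z' (jetCoord (s + 1) i) = q i := fun i => by
        change Function.update z.1 (s + 1) q (s + 1) i = _
        rw [Function.update_self]
      rw [hw, vj_eq, map_add, map_sub, map_mul, e1, e1, hr.congr hag, (hκc.ordLE s).congr hag]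
      refine ⟨?_, rfl⟩
      have h0 : evalAt z κ ≠ 0 := evalAt_kappa_ne z
      simp only [q, Matrix.cons_val_zero, Matrix.cons_val_one]
      field_simp
      ring

lemma IsCoef.evalAt_congr {f : JetAlg Ω} (hf : IsCoef f) {z z' : JetDom Ω}
    (h : z.1 0 = z'.1 0) : evalAt z f = evalAt z' f :=
  (hf.ordLE 0).congr fun s hs => by rw [Nat.le_zero.1 hs, h]

end

section

attribute [-instance] instCharZeroOfIsSemireal IsStrictOrderedRing.toCharZero
  FloorSemiring.instCharZero NumberField.to_charZero SubsemiringClass.instCharZero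

variable {Ω : Opens Pt}

/-! ### Composition with functions of one variable -/

/-- The composition of a smooth function of one variable with an element of the algebra. -/
def compFn (F : ℝ → ℝ) (k : JetAlg Ω) {I : Set ℝ} (hF : ContDiffOn ℝ ∞ F I)
    (hk : ∀ z, k.1 z ∈ I) (hI : IsOpen I) : JetAlg Ω :=
  ⟨fun z => F (k.1 z), by
    obtain ⟨N, g, hg, h⟩ := k.2
    have hJ : IsOpen (truncDom Ω N ∩ g ⁻¹' I) :=
      hg.continuousOn.isOpen_inter_preimage (isOpen_truncDom Ω N) hI
    -- Every truncated jet over `Ω` extends by zeros to a full jet, so the hypothesis `hk` controls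
    -- `g` on its whole domain.
    have hsub : truncDom Ω N ⊆ g ⁻¹' I := fun y hy => by
      let z : JetDom Ω := ⟨fun s => if hs : s < N + 1 then y ⟨s, hs⟩ else 0, by
        have : (0 : ℕ) < N + 1 := Nat.succ_pos N
        simp only [this, dif_pos]; exact hy⟩
      have hz : trunc N z.1 = y := by
        funext s
        change (if hs : s.1 < N + 1 then y ⟨s, hs⟩ else 0) = y s
        rw [dif_pos s.2]
      have := hk z
      rw [h z, hz] at this
      exact this
    exact ⟨N, fun y => F (g y), hF.comp hg hsub, fun z => congrArg F (h z)⟩⟩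

section compFn

variable {F : ℝ → ℝ} {k : JetAlg Ω} {I : Set ℝ} (hF : ContDiffOn ℝ ∞ F I)
  (hk : ∀ z, k.1 z ∈ I) (hI : IsOpen I)

lemma vf_compFn (V : ℕ → Fin 2 → JetAlg Ω) : vf V (compFn F k hF hk hI) =
    compFn (deriv F) k (hF.deriv_of_isOpen hI (by simp)) hk hI * vf V k := by
  refine JetAlg.ext fun z => ?_
  rw [vf_apply]
  have h1 : HasDerivAt (fun t : ℝ => jetExt k (z.1 + t • jetOf V z)) ((vf V k).1 z) 0 :=
    (differentiableAt_toFun_line k z _).hasDerivAt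
  have h0 : jetExt k (z.1 + (0 : ℝ) • jetOf V z) = k.1 z := by
    rw [zero_smul, add_zero]; exact rep_toFun k z
  have h2 : HasDerivAt F (deriv F (k.1 z)) (jetExt k (z.1 + (0 : ℝ) • jetOf V z)) := by
    rw [h0]
    exact ((hF.contDiffAt (hI.mem_nhds (hk z))).differentiableAt (by simp)).hasDerivAt
  have h3 := h2.comp (0 : ℝ) h1
  refine (h3.congr_of_eventuallyEq ?_).deriv
  filter_upwards [eventually_toFun z (jetOf V z)] with t ht
  simp only [jetExt, ht, dif_pos, Function.comp_apply]; rfl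

lemma IsCoef.compFn (hc : IsCoef k) : IsCoef (compFn F k hF hk hI) := by
  obtain ⟨a, ha, h⟩ := hc
  refine ⟨fun p => F (a p), hF.comp ha fun p hp => ?_, fun z => congrArg F (h z)⟩
  have := hk ⟨fun _ => p, hp⟩
  rwa [h] at this

end compFn

/-! ### Values of jets -/

variable [hΩ : PosFst Ω] {m σ : ℝ} [hP : Param m σ]

variable (m σ) in
-- The tool for comparing coefficients: coefficients keep their value at the base point while the
-- derivatives of `w` and `v` are arbitrary, so evaluating an identity at special jets isolates the
-- coefficients of single monomials.
lemma exists_jet_values (z₀ : JetDom Ω) (w₁ w₂ w₃ w₄ v₁ v₂ v₃ v₄ : ℝ) : ∃ z : JetDom Ω,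
    (∀ f : JetAlg Ω, IsCoef f → evalAt z f = evalAt z₀ f) ∧
    evalAt z (wj m σ 1) = w₁ ∧ evalAt z (wj m σ 2) = w₂ ∧ evalAt z (wj m σ 3) = w₃ ∧
    evalAt z (wj m σ 4) = w₄ ∧ evalAt z (vj 1) = v₁ ∧ evalAt z (vj 2) = v₂ ∧
    evalAt z (vj 3) = v₃ ∧ evalAt z (vj 4) = v₄ := by
  obtain ⟨z, hz, h⟩ := exists_jet m σ z₀.2 (fun s => if s = 1 then w₁ else if s = 2 then w₂ else
    if s = 3 then w₃ else w₄) (fun s => if s = 1 then v₁ else if s = 2 then v₂ else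
    if s = 3 then v₃ else v₄) 4
  refine ⟨z, fun f hf => hf.evalAt_congr hz, ?_⟩
  have h0 := h 0 (by norm_num)
  have h1 := h 1 (by norm_num)
  have h2 := h 2 (by norm_num)
  have h3 := h 3 (by norm_num)
  norm_num at h0 h1 h2 h3
  exact ⟨h0.1, h1.1, h2.1, h3.1, h0.2, h1.2, h2.2, h3.2⟩

lemma rv_sub_lam : rv - lam m σ = (algebraMap ℝ (JetAlg Ω) m) * (rv - rw' m σ) := by
  rw [lam]; ring

lemma evalAt_rv_sub_lam_ne (z : JetDom Ω) : evalAt z (rv - lam m σ) ≠ 0 := by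
  intro h0
  have h1 := congrArg (evalAt z) (rel_lam (Ω := Ω) (m := m) (σ := σ))
  rw [map_mul, h0, zero_mul, AlgHom.commutes] at h1
  exact (Param.pos m σ).ne h1

lemma hinv_ne (z : JetDom Ω) : evalAt z (hinv m σ) ≠ 0 := by
  intro h0
  have h1 := congrArg (evalAt z) (h_mul_hinv (Ω := Ω) (m := m) (σ := σ))
  rw [map_mul, h0, mul_zero, map_one] at h1
  exact zero_ne_one h1

lemma phi_ne (z : JetDom Ω) : evalAt z (phi m : JetAlg Ω) ≠ 0 :=
  (Real.rpow_pos_of_pos (hΩ.pos _ z.2) _).ne'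

lemma totD_rv : totD (rv : JetAlg Ω) = vj 1 := totD_vj 0

lemma totD_rw : totD (rw' m σ : JetAlg Ω) = wj m σ 1 := totD_wj 0

variable (m σ) in
/-- The flow `(2,1)`. -/
def baseFlow : Fin 2 → JetAlg Ω := symmFlow m σ (lam m σ) rv

lemma evo_baseFlow_rv : evo (baseFlow m σ) rv = (rv * vj 1 : JetAlg Ω) := evo_symmFlow_rv _ _

lemma evo_baseFlow_rw : evo (baseFlow m σ) (rw' m σ) = (lam m σ * wj m σ 1 : JetAlg Ω) :=
  evo_symmFlow_rw _ _

lemma HP1.riemann {f : JetAlg Ω} (hf : HP1 fieldFrame f) : ∃ a b : JetAlg Ω, IsCoef a ∧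
    IsCoef b ∧ f = a * wj m σ 1 + b * vj 1 := by
  obtain ⟨a, ha, h⟩ := isFrame_field.change_one (isFrame_riemann (m := m) (σ := σ)) hf
  exact ⟨a 0, a 1, ha 0, ha 1, by rw [h, Fin.sum_univ_two]; rfl⟩

lemma HP1.evo_rw {X : Fin 2 → JetAlg Ω} (hX : ∀ i, HP1 fieldFrame (X i)) :
    HP1 fieldFrame (evo X (rw' m σ)) := by
  rw [CoxeterFlow.evo_rw]
  exact (hX 1).sub ((hX 0).coef_mul ((isCoef_algebraMap _).mul (isCoef_phi m)))

lemma HP2.evo_rw {X : Fin 2 → JetAlg Ω} (hX : ∀ i, HP2 fieldFrame (X i)) :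
    HP2 fieldFrame (evo X (rw' m σ)) := by
  rw [CoxeterFlow.evo_rw]
  exact (hX 1).sub ((hX 0).coef_mul ((isCoef_algebraMap _).mul (isCoef_phi m)))

lemma HP3.evo_rw {X : Fin 2 → JetAlg Ω} (hX : ∀ i, HP3 fieldFrame (X i)) :
    HP3 fieldFrame (evo X (rw' m σ)) := by
  rw [CoxeterFlow.evo_rw]
  exact (hX 1).sub ((hX 0).coef_mul ((isCoef_algebraMap _).mul (isCoef_phi m)))

lemma evo_zero (f : JetAlg Ω) : evo (0 : Fin 2 → JetAlg Ω) f = 0 := by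
  have h := evo_smul_field (0 : ℝ) (0 : Fin 2 → JetAlg Ω)
  rw [zero_smul, zero_smul] at h
  rw [h]; rfl

/-- A flow of hydrodynamic type commuting with the flow `(2,1)` is diagonal in the Riemann
invariants. -/
theorem exists_isSymm {S : Fin 2 → JetAlg Ω} (hS : ∀ i, HP1 fieldFrame (S i))
    (hb : brk (baseFlow m σ) S = 0) : ∃ μ g, IsSymm m σ μ g ∧ S = symmFlow m σ μ g := by
  obtain ⟨b₁, b₂, hb₁, hb₂, ev⟩ := HP1.riemann (m := m) (σ := σ) (hS 1)
  obtain ⟨a₁, a₂, ha₁, ha₂, ew⟩ := HP1.riemann (m := m) (σ := σ) (HP1.evo_rw (m := m) (σ := σ) hS)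
  rw [← evo_rv S] at ev
  have e1 := evo_comm (baseFlow m σ) S rv
  have e2 := evo_comm (baseFlow m σ) S (rw' m σ)
  have hw1 := totD_wj (Ω := Ω) (m := m) (σ := σ) 1
  have hv1 := totD_vj (Ω := Ω) 1
  have gl := grad_lam (Ω := Ω) (m := m) (σ := σ)
  have ga₁ := ha₁.hasGrad (m := m) (σ := σ) rfl rfl
  have ga₂ := ha₂.hasGrad (m := m) (σ := σ) rfl rfl
  have gb₁ := hb₁.hasGrad (m := m) (σ := σ) rfl rfl
  have gb₂ := hb₂.hasGrad (m := m) (σ := σ) rfl rfl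
  rw [hb, evo_zero] at e1 e2
  simp only [evo_baseFlow_rv, evo_baseFlow_rw, ev, ew, Derivation.leibniz, map_add, smul_eq_mul,
    evo_vj_one, evo_wj_one, ga₁.evo, ga₂.evo, gb₁.evo, gb₂.evo, totD_rv, hw1, hv1, gl.evo,
    gl.totD, ga₁.totD, ga₂.totD, gb₁.totD, gb₂.totD] at e1 e2
  have key : ∀ (z₀ : JetDom Ω) (w₁ w₂ v₁ v₂ : ℝ), ∃ z : JetDom Ω,
    (∀ f : JetAlg Ω, IsCoef f → evalAt z f = evalAt z₀ f) ∧ evalAt z (wj m σ 1) = w₁ ∧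
    evalAt z (wj m σ 2) = w₂ ∧ evalAt z (vj 1) = v₁ ∧ evalAt z (vj 2) = v₂ := by
    intro z₀ w₁ w₂ v₁ v₂
    obtain ⟨z, hz, h⟩ := exists_jet_values m σ z₀ w₁ w₂ 0 0 v₁ v₂ 0 0
    exact ⟨z, hz, h.1, h.2.1, h.2.2.2.2.1, h.2.2.2.2.2.1⟩
  -- The only contribution to `w_xx` in the `v`-equation is `b₁` times `λ - v`, which vanishes
  -- nowhere; `v_xx` in the `w`-equation kills `a₂` in the same way.
  have hb₁0 : b₁ = 0 := JetAlg.ext_evalAt fun z₀ => by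
    obtain ⟨z, hz, h1, h2, h3, h4⟩ := key z₀ 0 1 0 0
    have := congrArg (evalAt z) e1
    simp only [map_add, map_sub, map_mul, h1, h2, h3, h4, hz _ hb₁, hz _ isCoef_lam,
      hz _ isCoef_rv, map_zero] at this
    have h0 := evalAt_rv_sub_lam_ne (m := m) (σ := σ) z₀
    rw [map_sub] at h0
    rw [map_zero]
    refine (mul_eq_zero.1 ?_).resolve_left h0
    linear_combination -this
  have ha₂0 : a₂ = 0 := JetAlg.ext_evalAt fun z₀ => by
    obtain ⟨z, hz, h1, h2, h3, h4⟩ := key z₀ 0 0 0 1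
    have := congrArg (evalAt z) e2
    simp only [map_add, map_sub, map_mul, h1, h2, h3, h4, hz _ ha₂, hz _ isCoef_lam,
      hz _ isCoef_rv, map_zero] at this
    have h0 := evalAt_rv_sub_lam_ne (m := m) (σ := σ) z₀
    rw [map_sub] at h0
    rw [map_zero]
    refine (mul_eq_zero.1 ?_).resolve_left h0
    linear_combination this
  subst hb₁0 ha₂0
  simp only [map_zero, zero_mul, mul_zero, add_zero, zero_add] at e1 e2 ev ew
  -- Once the symmetry is diagonal, the `v`-equation consists of the single monomial `w_x v_x`.
  have hdw : dw m σ b₂ = 0 := JetAlg.ext_evalAt fun z₀ => by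
    obtain ⟨z, hz, h1, h2, h3, h4⟩ := key z₀ 1 0 1 0
    have := congrArg (evalAt z) e1
    simp only [map_add, map_sub, map_mul, h1, h2, h3, h4, hz _ hb₂, hz _ isCoef_lam,
      hz _ isCoef_rv, hz _ hb₂.dw, hz _ hb₂.dv, map_zero] at this
    have h0 := evalAt_rv_sub_lam_ne (m := m) (σ := σ) z₀
    rw [map_sub] at h0
    rw [map_zero]
    refine (mul_eq_zero.1 ?_).resolve_left h0
    linear_combination -this
  -- Subtracting the value at `w_x = 1`, `v_x = 0` removes the `w_x²` term of the `w`-equation and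
  -- isolates `w_x v_x`.
  have hdv : (rv - lam m σ) * dv m σ a₁ = (1 - algebraMap ℝ (JetAlg Ω) m) * (b₂ - a₁) := by
    refine JetAlg.ext_evalAt fun z₀ => ?_
    obtain ⟨z, hz, h1, h2, h3, h4⟩ := key z₀ 1 0 1 0
    obtain ⟨z', hz', h1', h2', h3', h4'⟩ := key z₀ 1 0 0 0
    have e := congrArg (evalAt z) e2
    have e' := congrArg (evalAt z') e2
    simp only [map_add, map_sub, map_mul, h1, h2, h3, h4, hz _ hb₂, hz _ isCoef_lam,
      hz _ isCoef_rv, hz _ ha₁, hz _ ha₁.dw, hz _ ha₁.dv, map_zero, AlgHom.commutes, map_one]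
      at e
    simp only [map_add, map_sub, map_mul, h1', h2', h3', h4', hz' _ hb₂, hz' _ isCoef_lam,
      hz' _ isCoef_rv, hz' _ ha₁, hz' _ ha₁.dw, hz' _ ha₁.dv, map_zero, AlgHom.commutes, map_one]
      at e'
    simp only [map_mul, map_sub, AlgHom.commutes, map_one]
    linear_combination e - e'
  refine ⟨a₁, b₂, ⟨ha₁, hb₂, hdw, ?_⟩, ?_⟩
  · have hM := m_mul_inv (Ω := Ω) m σ
    rw [algebraMap_one_sub]
    rw [rv_sub_lam] at hdv
    linear_combination (algebraMap ℝ (JetAlg Ω) (1 / m)) * hinv m σ * hdv -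
      algebraMap ℝ (JetAlg Ω) m * algebraMap ℝ (JetAlg Ω) (1 / m) * dv m σ a₁ *
        h_mul_hinv (Ω := Ω) (m := m) (σ := σ) - (dv m σ a₁ + (b₂ - a₁) * hinv m σ) * hM
  · refine frame_ext (m := m) (σ := σ) ?_ ?_
    · rw [ew, evo_symmFlow_rw]
    · rw [ev, evo_symmFlow_rv]

end

/-! ### The deformed symmetries commute with the normal form -/

section

attribute [-instance] instCharZeroOfIsSemireal IsStrictOrderedRing.toCharZero
  FloorSemiring.instCharZero NumberField.to_charZero SubsemiringClass.instCharZero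

variable {Ω : Opens Pt} [hΩ : PosFst Ω] {m σ : ℝ} [hP : Param m σ]

/-! ### Deformed symmetries -/

variable (m σ) in
/-- The second current at order `ε²` of the deformation of the symmetry `(μ, g)`. -/
def secondA (μ g F F₁ G G₁ f f₁ : JetAlg Ω) : JetAlg Ω :=
  algebraMap ℝ _ (1 / 6) * quadA (algebraMap ℝ _ (1 / m)) (hinv m σ) (phi m) F F₁ (curT m σ μ g)
    (dw m σ μ) (dw m σ (dw m σ μ)) (dv m σ g) (wj m σ 1) (wj m σ 2) (vj 1) +
  algebraMap ℝ _ (1 / 8) * dispA (algebraMap ℝ _ (1 / m)) (hinv m σ) (phi m) G G₁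
    (curT m σ μ g) (dw m σ μ) (wj m σ 1) (wj m σ 2) (vj 1) +
  algebraMap ℝ _ (1 / 8 / (m - 2)) * scalA (algebraMap ℝ _ (1 / m)) (algebraMap ℝ _ m)
    (hinv m σ) f f₁ (curT m σ μ g) (dv m σ g) (dv m σ (dv m σ g)) (wj m σ 1) (vj 1) (vj 2)

variable (m σ) in
/-- The first current at order `ε²` of the deformation of the symmetry `(μ, g)`. -/
def secondB (μ g F F₁ G G₁ f f₁ : JetAlg Ω) : JetAlg Ω :=
  algebraMap ℝ _ (1 / 6) * quadB (algebraMap ℝ _ (1 / m)) (hinv m σ) (phi m) F F₁ (curT m σ μ g)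
    (dw m σ μ) (dw m σ (dw m σ μ)) (dw m σ (dw m σ (dw m σ μ))) (dv m σ g) (wj m σ 1)
    (wj m σ 2) (vj 1) +
  algebraMap ℝ _ (1 / 8) * dispB (algebraMap ℝ _ (1 / m)) (hinv m σ) (phi m) G G₁
    (curT m σ μ g) (dw m σ μ) (dw m σ (dw m σ μ)) (wj m σ 1) (wj m σ 2) (vj 1) +
  algebraMap ℝ _ (1 / 8 / (m - 2)) * scalB (algebraMap ℝ _ (1 / m)) (algebraMap ℝ _ m)
    (hinv m σ) f f₁ (curT m σ μ g) (dv m σ g) (dv m σ (dv m σ g)) (wj m σ 1) (vj 1) (vj 2)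

variable (m σ) in
/-- The deformation of the symmetry `(μ, g)`. -/
def deformed (μ g F F₁ G G₁ f f₁ : JetAlg Ω) : Fin 3 → Fin 2 → JetAlg Ω :=
  ![symmFlow m σ μ g,
    consFlow m σ (algebraMap ℝ _ (1 / m) * phi m * F * curT m σ μ g * wj m σ 1)
      (algebraMap ℝ _ (1 / m) * phi m * F * (curT m σ μ g - dw m σ μ) * wj m σ 1),
    consFlow m σ (secondA m σ μ g F F₁ G G₁ f f₁) (secondB m σ μ g F F₁ G G₁ f f₁)]

lemma consFlow_add (A B A' B' : JetAlg Ω) :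
    consFlow m σ (A + A') (B + B') = consFlow m σ A B + consFlow m σ A' B' := by
  funext i
  fin_cases i <;> simp [consFlow, mul_add]

lemma consFlow_neg (A B : JetAlg Ω) : consFlow m σ (-A) (-B) = -consFlow m σ A B := by
  funext i
  fin_cases i <;> simp [consFlow] <;> ring

lemma consFlow_zero : consFlow m σ (0 : JetAlg Ω) 0 = 0 := by
  funext i
  fin_cases i <;> simp [consFlow]

lemma brk_neg (X Y : Fin 2 → JetAlg Ω) : brk X Y = -brk Y X := by
  funext i
  simp [brk]

lemma symmCurA_add (μ g A A' : JetAlg Ω) :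
    symmCurA m σ μ g (A + A') = symmCurA m σ μ g A + symmCurA m σ μ g A' := by
  simp only [symmCurA, map_add]; ring

lemma symmCurB_add (μ g A A' B B' : JetAlg Ω) :
    symmCurB m σ μ g (A + A') (B + B') = symmCurB m σ μ g A B + symmCurB m σ μ g A' B' := by
  simp only [symmCurB, map_add]; ring

lemma symmCurA_const_mul (μ g A : JetAlg Ω) (c : ℝ) :
    symmCurA m σ μ g (algebraMap ℝ _ c * A) = algebraMap ℝ _ c * symmCurA m σ μ g A := by
  simp only [symmCurA, Derivation.leibniz, Derivation.map_algebraMap, smul_eq_mul]; ring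

lemma symmCurB_const_mul (μ g A B : JetAlg Ω) (c : ℝ) :
    symmCurB m σ μ g (algebraMap ℝ _ c * A) (algebraMap ℝ _ c * B) =
      algebraMap ℝ _ c * symmCurB m σ μ g A B := by
  simp only [symmCurB, Derivation.leibniz, Derivation.map_algebraMap, smul_eq_mul]; ring

lemma algebraMap_six_inv_mul (x : JetAlg Ω) : algebraMap ℝ (JetAlg Ω) (1 / 6) * (6 * x) = x := by
  rw [← mul_assoc, ← map_ofNat (algebraMap ℝ (JetAlg Ω)) 6, ← map_mul]
  norm_num

lemma first_lam (F : JetAlg Ω) : algebraMap ℝ _ (1 / m) * phi m * F * curT m σ (lam m σ) rv *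
    wj m σ 1 = F * phi m * wj m σ 1 := by
  rw [curT_lam]; linear_combination F * phi m * wj m σ 1 * m_mul_inv (Ω := Ω) m σ

lemma first_lam' (F : JetAlg Ω) : algebraMap ℝ _ (1 / m) * phi m * F *
    (curT m σ (lam m σ) rv - dw m σ (lam m σ)) * wj m σ 1 = 0 := by
  rw [curT_lam, dw_lam]; ring

/-- The condition at order `ε²` splits according to the parameters. The terms quadratic in `F`
balance `[K₁, Q₁]`, which fixes the weight `1/6`. The terms in `G` and `f` cancel by themselves, so
any constant weight would do; `1/8` and `1/8/(m - 2)` are the weights that reproduce the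
coefficients of `normalCurrent`. -/
theorem deformed_commute {μ g : JetAlg Ω} (h : IsSymm m σ μ g) {F F₁ F₂ G G₁ G₂ f f₁ f₂ : JetAlg Ω}
    (hF : HasGrad m σ F F₁ 0) (hF₁ : HasGrad m σ F₁ F₂ 0)
    (hG : HasGrad m σ G G₁ 0) (hG₁ : HasGrad m σ G₁ G₂ 0)
    (hf : HasGrad m σ f 0 f₁) (hf₁ : HasGrad m σ f₁ 0 f₂) :
    let K := deformed m σ (lam m σ) rv F F₁ G G₁ f f₁
    let Q := deformed m σ μ g F F₁ G G₁ f f₁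
    brk (K 0) (Q 1) + brk (K 1) (Q 0) = 0 ∧
      brk (K 0) (Q 2) + brk (K 1) (Q 1) + brk (K 2) (Q 0) = 0 := by
  intro K Q
  have hK0 : K 0 = symmFlow m σ (lam m σ) rv := rfl
  have hQ0 : Q 0 = symmFlow m σ μ g := rfl
  have hK1 : K 1 = consFlow m σ (F * phi m * wj m σ 1) 0 := by
    change consFlow _ _ _ _ = _
    rw [first_lam, first_lam']
  have hQ1 : Q 1 = consFlow m σ (algebraMap ℝ _ (1 / m) * phi m * F * curT m σ μ g * wj m σ 1)
      (algebraMap ℝ _ (1 / m) * phi m * F * (curT m σ μ g - dw m σ μ) * wj m σ 1) := rfl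
  have hK2 : K 2 = consFlow m σ (secondA m σ (lam m σ) rv F F₁ G G₁ f f₁)
    (secondB m σ (lam m σ) rv F F₁ G G₁ f f₁) := rfl
  have hQ2 : Q 2 = consFlow m σ (secondA m σ μ g F F₁ G G₁ f f₁)
    (secondB m σ μ g F F₁ G G₁ f f₁) := rfl
  constructor
  · rw [hK0, hQ1, hK1, hQ0, isSymm_lam.brk_consFlow, brk_neg (consFlow _ _ _ _),
      h.brk_consFlow, h.symmCurA_lin hF hF₁, h.symmCurB_lin hF hF₁, add_neg_cancel]
  · rw [hK0, hQ2, hK1, hQ1, hK2, hQ0, isSymm_lam.brk_consFlow, brk_neg _ (symmFlow m σ μ g),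
      h.brk_consFlow, brk_consFlow, ← consFlow_add, ← consFlow_neg, ← consFlow_add]
    have e1 := h.symmCurA_quad hF hF₁
    have e2 := h.symmCurB_quad hF hF₁
    have e3 := h.symmCurA_disp hG hG₁
    have e4 := h.symmCurB_disp hG hG₁
    have e5 := h.symmCurA_scal hf hf₁
    have e6 := h.symmCurB_scal hf hf₁
    have e1' := congrArg (algebraMap ℝ (JetAlg Ω) (1 / 6) * ·) e1
    have e2' := congrArg (algebraMap ℝ (JetAlg Ω) (1 / 6) * ·) e2
    simp only [mul_add, algebraMap_six_inv_mul] at e1' e2'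
    rw [← consFlow_zero (m := m) (σ := σ)]
    congr 1
    · rw [secondA, secondA]
      simp only [symmCurA_add, symmCurA_const_mul, curT_lam, dw_lam, dv_rv, Derivation.map_algebraMap, Derivation.map_one_eq_zero]
      rw [e3, e5]
      linear_combination e1'
    · rw [secondA, secondA, secondB, secondB]
      simp only [symmCurB_add, symmCurB_const_mul, curT_lam, dw_lam, dv_rv, Derivation.map_algebraMap, Derivation.map_one_eq_zero, map_zero]
      rw [e4, e6]
      linear_combination e2'

/-! ### Degrees -/

lemma isCoef_ofNat (k : ℕ) [k.AtLeastTwo] : IsCoef (ofNat(k) : JetAlg Ω) := by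
  rw [← map_ofNat (algebraMap ℝ (JetAlg Ω)) k]; exact isCoef_algebraMap _

lemma hp2_of_coefs (c₁ c₂ c₃ c₄ c₅ : JetAlg Ω) (h₁ : IsCoef c₁) (h₂ : IsCoef c₂)
    (h₃ : IsCoef c₃) (h₄ : IsCoef c₄) (h₅ : IsCoef c₅) : HP2 (riemannFrame m σ)
      (c₁ * wj m σ 2 + c₂ * vj 2 + c₃ * wj m σ 1 ^ 2 + c₄ * wj m σ 1 * vj 1 + c₅ * vj 1 ^ 2) := by
  refine ⟨![c₁, c₂], ![![c₃, c₄], ![0, c₅]], fun j => ?_, fun j k => ?_, ?_⟩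
  · fin_cases j <;> assumption
  · fin_cases j <;> fin_cases k
    exacts [h₃, h₄, isCoef_zero, h₅]
  · simp [Fin.sum_univ_two, riemannFrame]; ring

lemma HP2.riemann {f : JetAlg Ω} (hf : HP2 fieldFrame f) : ∃ c₁ c₂ c₃ c₄ c₅ : JetAlg Ω,
    IsCoef c₁ ∧ IsCoef c₂ ∧ IsCoef c₃ ∧ IsCoef c₄ ∧ IsCoef c₅ ∧
    f = c₁ * wj m σ 2 + c₂ * vj 2 + c₃ * wj m σ 1 ^ 2 + c₄ * wj m σ 1 * vj 1 + c₅ * vj 1 ^ 2 := by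
  obtain ⟨a, b, ha, hb, h⟩ := isFrame_field.change_two (isFrame_riemann (m := m) (σ := σ)) hf
  refine ⟨a 0, a 1, b 0 0, b 0 1 + b 1 0, b 1 1, ha 0, ha 1, hb 0 0, (hb 0 1).add (hb 1 0),
    hb 1 1, ?_⟩
  rw [h]
  simp [Fin.sum_univ_two, riemannFrame]; ring

section Degrees

variable (m σ) in
/-- `f` is a differential polynomial of degree two with leading part `c₁ w_xx + c₂ v_xx`. -/
def Lead (c₁ c₂ f : JetAlg Ω) : Prop :=
  IsCoef c₁ ∧ IsCoef c₂ ∧ ∃ c₃ c₄ c₅ : JetAlg Ω, IsCoef c₃ ∧ IsCoef c₄ ∧ IsCoef c₅ ∧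
    f = c₁ * wj m σ 2 + c₂ * vj 2 + c₃ * wj m σ 1 ^ 2 + c₄ * wj m σ 1 * vj 1 + c₅ * vj 1 ^ 2

namespace Lead

variable {c c₁ c₂ f d₁ d₂ g : JetAlg Ω}

lemma add (hf : Lead m σ c₁ c₂ f) (hg : Lead m σ d₁ d₂ g) :
    Lead m σ (c₁ + d₁) (c₂ + d₂) (f + g) := by
  obtain ⟨h₁, h₂, c₃, c₄, c₅, h₃, h₄, h₅, e⟩ := hf
  obtain ⟨k₁, k₂, d₃, d₄, d₅, k₃, k₄, k₅, e'⟩ := hg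
  exact ⟨h₁.add k₁, h₂.add k₂, c₃ + d₃, c₄ + d₄, c₅ + d₅, h₃.add k₃, h₄.add k₄, h₅.add k₅, by
    rw [e, e']; ring⟩

lemma coef_mul (hc : IsCoef c) (hf : Lead m σ c₁ c₂ f) : Lead m σ (c * c₁) (c * c₂) (c * f) := by
  obtain ⟨h₁, h₂, c₃, c₄, c₅, h₃, h₄, h₅, e⟩ := hf
  exact ⟨hc.mul h₁, hc.mul h₂, c * c₃, c * c₄, c * c₅, hc.mul h₃, hc.mul h₄, hc.mul h₅, by
    rw [e]; ring⟩

lemma sub (hf : Lead m σ c₁ c₂ f) (hg : Lead m σ d₁ d₂ g) :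
    Lead m σ (c₁ - d₁) (c₂ - d₂) (f - g) := by
  obtain ⟨h₁, h₂, c₃, c₄, c₅, h₃, h₄, h₅, e⟩ := hf
  obtain ⟨k₁, k₂, d₃, d₄, d₅, k₃, k₄, k₅, e'⟩ := hg
  exact ⟨h₁.sub k₁, h₂.sub k₂, c₃ - d₃, c₄ - d₄, c₅ - d₅, h₃.sub k₃, h₄.sub k₄, h₅.sub k₅, by
    rw [e, e']; ring⟩

lemma vw (h : IsCoef c) : Lead m σ 0 0 (c * vj 1 * wj m σ 1) :=
  ⟨isCoef_zero, isCoef_zero, 0, c, 0, isCoef_zero, h, isCoef_zero, by ring⟩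

lemma ww (h : IsCoef c) : Lead m σ 0 0 (c * wj m σ 1 ^ 2) :=
  ⟨isCoef_zero, isCoef_zero, c, 0, 0, h, isCoef_zero, isCoef_zero, by ring⟩

lemma vv (h : IsCoef c) : Lead m σ 0 0 (c * vj 1 ^ 2) :=
  ⟨isCoef_zero, isCoef_zero, 0, 0, c, isCoef_zero, isCoef_zero, h, by ring⟩

lemma w (h : IsCoef c) : Lead m σ c 0 (c * wj m σ 2) :=
  ⟨h, isCoef_zero, 0, 0, 0, isCoef_zero, isCoef_zero, isCoef_zero, by ring⟩

lemma v (h : IsCoef c) : Lead m σ 0 c (c * vj 2) :=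
  ⟨isCoef_zero, h, 0, 0, 0, isCoef_zero, isCoef_zero, isCoef_zero, by ring⟩

lemma congr (h : Lead m σ c₁ c₂ f) (e₁ : c₁ = d₁) (e₂ : c₂ = d₂) : Lead m σ d₁ d₂ f := by
  subst e₁ e₂; exact h

lemma hp2 (h : Lead m σ c₁ c₂ f) : HP2 fieldFrame f := by
  obtain ⟨h₁, h₂, c₃, c₄, c₅, h₃, h₄, h₅, rfl⟩ := h
  exact (isFrame_riemann (m := m) (σ := σ)).change_two isFrame_field
    (hp2_of_coefs c₁ c₂ c₃ c₄ c₅ h₁ h₂ h₃ h₄ h₅)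

end Lead

variable {μ g F F₁ G G₁ f f₁ : JetAlg Ω}

set_option maxHeartbeats 800000 in
-- The coefficients of `w_xx` and `v_xx` are kept explicit because `G` and `f` are recovered from
-- them; for the terms quadratic in first derivatives the degree suffices.
lemma lead_secondA (h : IsSymm m σ μ g) (hF : IsCoef F) (hF₁ : IsCoef F₁) (hG : IsCoef G)
    (hG₁ : IsCoef G₁) (hf : IsCoef f) (hf₁ : IsCoef f₁) :
    Lead m σ (algebraMap ℝ _ (1 / m) ^ 2 * phi m ^ 2 * (algebraMap ℝ _ (1 / 6) * (F ^ 2 * hinv m σ *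
      (-6 * dw m σ μ + (2 + 4 * algebraMap ℝ _ (1 / m)) * curT m σ μ g)) - 2 * algebraMap ℝ _ (1 / 8) * G * curT m σ μ g))
      (algebraMap ℝ _ (1 / 8 / (m - 2)) * (f * dv m σ g *
        (2 - 2 * algebraMap ℝ _ m + 4 * algebraMap ℝ _ (1 / m))))
      (secondA m σ μ g F F₁ G G₁ f f₁) := by
  have hp := isCoef_phi (Ω := Ω) m
  have hi := isCoef_hinv (Ω := Ω) m σ
  have hT := h.isCoef_curT
  have hM₁ := h.coef_fst.dw (m := m) (σ := σ)
  have hM₂ := hM₁.dw (m := m) (σ := σ)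
  have hM₃ := hM₂.dw (m := m) (σ := σ)
  have hg₁ := h.coef_snd.dv (m := m) (σ := σ)
  have hg₂ := hg₁.dv (m := m) (σ := σ)
  have hc := isCoef_algebraMap (Ω := Ω)
  have h1 := isCoef_one (Ω := Ω)
  unfold secondA quadA dispA scalA
  with_reducible generalize curT m σ μ g = T at *
  with_reducible generalize dw m σ (dw m σ (dw m σ μ)) = M₃ at *
  with_reducible generalize dw m σ (dw m σ μ) = M₂ at *
  with_reducible generalize dw m σ μ = M₁ at *
  with_reducible generalize dv m σ (dv m σ g) = g₂ at *
  with_reducible generalize dv m σ g = g₁ at *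
  refine (((Lead.coef_mul (hc _) (Lead.coef_mul (((hc _).pow 2).mul (hp.pow 2))
    (((Lead.vw ?_).add (Lead.ww ?_)).add (Lead.w ?_)))).add (Lead.coef_mul (hc _)
    (Lead.coef_mul (((hc _).pow 2).mul (hp.pow 2)) (((Lead.vw ?_).add (Lead.ww ?_)).add
    (Lead.w ?_))))).add (Lead.coef_mul (hc _) (((Lead.vw ?_).add (Lead.vv ?_)).add
    (Lead.v ?_)))).congr (by ring) (by ring)
  all_goals with_reducible repeat' first
    | assumption
    | exact hc _
    | exact isCoef_ofNat _
    | apply IsCoef.add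
    | apply IsCoef.sub
    | apply IsCoef.mul
    | apply IsCoef.neg
    | apply IsCoef.pow

set_option maxHeartbeats 800000 in
lemma lead_secondB (h : IsSymm m σ μ g) (hF : IsCoef F) (hF₁ : IsCoef F₁) (hG : IsCoef G)
    (hG₁ : IsCoef G₁) (hf : IsCoef f) (hf₁ : IsCoef f₁) :
    Lead m σ (algebraMap ℝ _ (1 / m) ^ 2 * phi m ^ 2 * (algebraMap ℝ _ (1 / 6) * (F ^ 2 * (hinv m σ *
      (2 + 4 * algebraMap ℝ _ (1 / m)) * (curT m σ μ g - dw m σ μ) - 4 * dw m σ (dw m σ μ))) +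
      2 * algebraMap ℝ _ (1 / 8) * G * (dw m σ μ - curT m σ μ g)))
      (algebraMap ℝ _ (1 / 8 / (m - 2)) * (f * (curT m σ μ g *
        (2 - 2 * algebraMap ℝ _ (1 / m) - 4 * algebraMap ℝ _ (1 / m) ^ 2) + dv m σ g *
        (2 - 2 * algebraMap ℝ _ m + 4 * algebraMap ℝ _ (1 / m)))))
      (secondB m σ μ g F F₁ G G₁ f f₁) := by
  have hp := isCoef_phi (Ω := Ω) m
  have hi := isCoef_hinv (Ω := Ω) m σ
  have hT := h.isCoef_curT
  have hM₁ := h.coef_fst.dw (m := m) (σ := σ)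
  have hM₂ := hM₁.dw (m := m) (σ := σ)
  have hM₃ := hM₂.dw (m := m) (σ := σ)
  have hg₁ := h.coef_snd.dv (m := m) (σ := σ)
  have hg₂ := hg₁.dv (m := m) (σ := σ)
  have hc := isCoef_algebraMap (Ω := Ω)
  have h1 := isCoef_one (Ω := Ω)
  unfold secondB quadB dispB scalB
  with_reducible generalize curT m σ μ g = T at *
  with_reducible generalize dw m σ (dw m σ (dw m σ μ)) = M₃ at *
  with_reducible generalize dw m σ (dw m σ μ) = M₂ at *
  with_reducible generalize dw m σ μ = M₁ at *
  with_reducible generalize dv m σ (dv m σ g) = g₂ at *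
  with_reducible generalize dv m σ g = g₁ at *
  refine (((Lead.coef_mul (hc _) (Lead.coef_mul (((hc _).pow 2).mul (hp.pow 2))
    (((Lead.vw ?_).add (Lead.ww ?_)).add (Lead.w ?_)))).add (Lead.coef_mul (hc _)
    (Lead.coef_mul (((hc _).pow 2).mul (hp.pow 2)) (((Lead.vw ?_).add (Lead.ww ?_)).add
    (Lead.w ?_))))).add (Lead.coef_mul (hc _) (((Lead.vw ?_).add (Lead.vv ?_)).add
    (Lead.v ?_)))).congr (by ring) (by ring)
  all_goals with_reducible repeat' first
    | assumption
    | exact hc _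
    | exact isCoef_ofNat _
    | apply IsCoef.add
    | apply IsCoef.sub
    | apply IsCoef.mul
    | apply IsCoef.neg
    | apply IsCoef.pow

lemma hp1_wj {c : JetAlg Ω} (h : IsCoef c) : HP1 fieldFrame (c * wj m σ 1) :=
  HP1.coef_mul h ((isFrame_riemann (m := m) (σ := σ)).gen_one isFrame_field 0)

lemma hp1_vj {c : JetAlg Ω} (h : IsCoef c) : HP1 fieldFrame (c * vj 1) := by
  rw [vj_eq]; exact HP1.coef_mul h (HP1.gen (e := fieldFrame) 1)

end Degrees

lemma hp1_symmFlow {μ g : JetAlg Ω} (hμ : IsCoef μ) (hg : IsCoef g) (i : Fin 2) :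
    HP1 fieldFrame (symmFlow m σ μ g i) := by
  fin_cases i
  · exact ((hp1_vj hg).sub (hp1_wj hμ)).coef_mul (isCoef_rho m σ)
  · exact hp1_vj hg

lemma hp2_consFlow {A B : JetAlg Ω} (hA : HP1 fieldFrame A) (hB : HP1 fieldFrame B) (i : Fin 2) :
    HP2 fieldFrame (consFlow m σ A B i) := by
  fin_cases i
  · exact isFrame_field.totD_one (hB.coef_mul (isCoef_rho m σ))
  · exact isFrame_field.totD_one hA

lemma hp3_consFlow {A B : JetAlg Ω} (hA : HP2 fieldFrame A) (hB : HP2 fieldFrame B) (i : Fin 2) :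
    HP3 fieldFrame (consFlow m σ A B i) := by
  fin_cases i
  · exact isFrame_field.totD_two (hB.coef_mul (isCoef_rho m σ))
  · exact isFrame_field.totD_two hA

end

section

attribute [-instance] instCharZeroOfIsSemireal IsStrictOrderedRing.toCharZero
  FloorSemiring.instCharZero NumberField.to_charZero SubsemiringClass.instCharZero

variable {Ω : Opens Pt} [hΩ : PosFst Ω] {m σ : ℝ} [hP : Param m σ]

/-! ### The normal form in the algebra -/

/-- For fixed `u` the affine map `t ↦ (u, t + 4σu^m)` is continuous, and the image is the union over
`u` of the preimages of `Ω` under these maps. -/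
lemma isOpen_image_riemannInv (Ω : Opens Pt) (m σ : ℝ) :
    IsOpen (riemannInv m σ '' (Ω : Set Pt)) := by
  have h : riemannInv m σ '' (Ω : Set Pt) =
      ⋃ u : ℝ, (fun t : ℝ => (![u, t + σ * 4 * u ^ m] : Pt)) ⁻¹' (Ω : Set Pt) := by
    ext t
    simp only [Set.mem_image, Set.mem_iUnion, Set.mem_preimage]
    constructor
    · rintro ⟨p, hp, rfl⟩
      refine ⟨p 0, ?_⟩
      convert hp using 1
      funext i
      fin_cases i <;> simp [riemannInv]
    · rintro ⟨u, hu⟩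
      exact ⟨_, hu, by simp [riemannInv]⟩
  rw [h]
  refine isOpen_iUnion fun u => Ω.isOpen.preimage ?_
  refine continuous_pi fun i => ?_
  fin_cases i
  · exact continuous_const
  · exact continuous_id.add continuous_const

lemma isOpen_image_snd (Ω : Opens Pt) : IsOpen ((fun p : Pt => p 1) '' (Ω : Set Pt)) :=
  isOpenMap_eval 1 _ Ω.isOpen

lemma rw_apply (z : JetDom Ω) : (rw' m σ).1 z = riemannInv m σ (z.1 0) := by
  change z.1 0 1 - 4 * σ * z.1 0 0 ^ m = _
  rw [riemannInv]; ring

variable (m σ) in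
/-- The composition of a function of one variable with the Riemann invariant `w`. -/
def compW (F : ℝ → ℝ) (hF : ContDiffOn ℝ ∞ F (riemannInv m σ '' (Ω : Set Pt))) :
    JetAlg Ω :=
  compFn F (rw' m σ) hF (fun z => ⟨z.1 0, z.2, (rw_apply z).symm⟩) (isOpen_image_riemannInv Ω m σ)

/-- The composition of a function of one variable with the Riemann invariant `v`. -/
def compV (f : ℝ → ℝ) (hf : ContDiffOn ℝ ∞ f ((fun p : Pt => p 1) '' (Ω : Set Pt))) : JetAlg Ω :=
  compFn f rv hf (fun z => ⟨z.1 0, z.2, rfl⟩) (isOpen_image_snd Ω)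

section

variable {F f : ℝ → ℝ} (hF : ContDiffOn ℝ ∞ F (riemannInv m σ '' (Ω : Set Pt)))
  (hf : ContDiffOn ℝ ∞ f ((fun p : Pt => p 1) '' (Ω : Set Pt)))

include hF in
lemma contDiffOn_deriv_w : ContDiffOn ℝ ∞ (deriv F) (riemannInv m σ '' (Ω : Set Pt)) :=
  hF.deriv_of_isOpen (isOpen_image_riemannInv Ω m σ) (by simp)

include hf in
lemma contDiffOn_deriv_v : ContDiffOn ℝ ∞ (deriv f) ((fun p : Pt => p 1) '' (Ω : Set Pt)) :=
  hf.deriv_of_isOpen (isOpen_image_snd Ω) (by simp)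

lemma evalAt_compW (z : JetDom Ω) :
    evalAt z (compW m σ F hF) = F (riemannInv m σ (z.1 0)) := congrArg F (rw_apply z)

lemma evalAt_compV (z : JetDom Ω) : evalAt z (compV f hf) = f (z.1 0 1) := rfl

lemma isCoef_compW : IsCoef (compW m σ F hF) := (isCoef_rw m σ).compFn _ _ _

lemma isCoef_compV : IsCoef (compV f hf) := isCoef_rv.compFn _ _ _

lemma grad_compW : HasGrad m σ (compW m σ F hF) (compW m σ (deriv F) (contDiffOn_deriv_w hF)) 0 :=
  fun V => by rw [zero_mul, add_zero]; exact vf_compFn _ _ _ V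

lemma grad_compV : HasGrad m σ (compV f hf) 0 (compV (deriv f) (contDiffOn_deriv_v hf)) :=
  fun V => by rw [zero_mul, zero_add]; exact vf_compFn _ _ _ V

end

lemma evalAt_phi (z : JetDom Ω) : evalAt z (phi m) = z.1 0 0 ^ (m - 1) := rfl

lemma evalAt_hinv (z : JetDom Ω) : evalAt z (hinv m σ) = σ / 4 * z.1 0 0 ^ (-m) := rfl

lemma evalAt_rho (z : JetDom Ω) : evalAt z (rho m σ) = σ / (4 * m) * z.1 0 0 ^ (1 - m) := rfl

lemma evalAt_jetCoord (z : JetDom Ω) (s : ℕ) (i : Fin 2) : evalAt z (jetCoord s i) = z.1 s i := rfl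

lemma wj_one_eq : (wj m σ 1 : JetAlg Ω) =
    jetCoord 1 1 - algebraMap ℝ _ (4 * σ * m) * phi m * jetCoord 1 0 := by
  rw [← totD_rw, totD, vf_rw]

lemma wj_two_eq : (wj m σ 2 : JetAlg Ω) =
    jetCoord 2 1 - algebraMap ℝ _ (4 * σ * m) * (phi m * jetCoord 2 0 +
      algebraMap ℝ _ (m - 1) * upow (m - 1 - 1) * jetCoord 1 0 ^ 2) := by
  rw [← totD_wj, wj_one_eq, map_sub, totD_jetCoord, mul_assoc, Derivation.leibniz,
    Derivation.map_algebraMap, Derivation.leibniz, totD_jetCoord, phi]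
  have h : totD (upow (m - 1) : JetAlg Ω) =
    algebraMap ℝ _ (m - 1) * upow (m - 1 - 1) * jetCoord 1 0 := vf_upow _ _
  rw [h]
  simp only [smul_eq_mul]
  ring

variable (m σ) in
/-- The normal form. -/
def normalFlow (F G f : ℝ → ℝ) (h : SmoothParams m σ (Ω : Set Pt) F G f) :
    Fin 3 → Fin 2 → JetAlg Ω :=
  deformed m σ (lam m σ) rv (compW m σ F h.1) (compW m σ (deriv F) (contDiffOn_deriv_w h.1))
    -- The term in `w_xx` contributes `σ u^(3m-3)` times this parameter to the coefficient of
    -- `u_xx`; the extra factor `σ` turns it into `u^(3m-3) G`, as in `a23`.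
    (algebraMap ℝ _ σ * compW m σ G h.2.1)
      (algebraMap ℝ _ σ * compW m σ (deriv G) (contDiffOn_deriv_w h.2.1))
    (compV f h.2.2) (compV (deriv f) (contDiffOn_deriv_v h.2.2))

section

variable {F G f : ℝ → ℝ} (h : SmoothParams m σ (Ω : Set Pt) F G f)

lemma rep_normalCurrent_one : RepV (normalCurrent m σ F G f 1)
    ![(0 : JetAlg Ω), compW m σ F h.1 * phi m * wj m σ 1] := by
  intro i z
  fin_cases i
  · rfl
  · rw [← evalAt_apply]
    simp only [Fin.mk_one, Matrix.cons_val_one, Matrix.cons_val, map_mul, evalAt_compW, evalAt_phi, wj_one_eq,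
      map_sub, AlgHom.commutes, evalAt_jetCoord, normalCurrent, Algebra.algebraMap_self, RingHom.id_apply]
    have e : z.1 0 0 ^ (2 * m - 2) = z.1 0 0 ^ (m - 1) * z.1 0 0 ^ (m - 1) := by
      rw [← Real.rpow_add (hΩ.pos _ z.2)]; congr 1; ring
    rw [e]
    ring

/-- Every real power of `u` that occurs becomes rational in `u` and `u^m`, so comparison with the
normal form reduces to identities of rational functions. -/
lemma rpow_rules {u : ℝ} (hu : 0 < u) (m : ℝ) :
    u ^ (m - 1) = u ^ m / u ∧ u ^ (-m) = (u ^ m)⁻¹ ∧ u ^ (1 - m) = u / u ^ m ∧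
    u ^ (m - 2) = u ^ m / u ^ 2 ∧ u ^ (m - 1 - 1) = u ^ m / u ^ 2 ∧ u ^ (m - 3) = u ^ m / u ^ 3 ∧
    u ^ (2 * m - 3) = (u ^ m) ^ 2 / u ^ 3 ∧ u ^ (3 * m - 3) = (u ^ m) ^ 3 / u ^ 3 ∧
    u ^ (2 * m - 2) = (u ^ m) ^ 2 / u ^ 2 ∧ u ^ (3 * m - 4) = (u ^ m) ^ 3 / u ^ 4 ∧
    u ^ (4 * m - 4) = (u ^ m) ^ 4 / u ^ 4 ∧ u ^ (2 * m - 4) = (u ^ m) ^ 2 / u ^ 4 ∧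
    u ^ (m + 1) = u ^ m * u ∧ u ^ (2 * m - 1) = (u ^ m) ^ 2 / u := by
  have hk : ∀ (a : ℝ) (k : ℕ), u ^ (a - k) = u ^ a / u ^ k := fun a k => by
    rw [Real.rpow_sub hu, Real.rpow_natCast]
  have hj : ∀ j : ℕ, u ^ (j * m) = (u ^ m) ^ j := fun j => by
    rw [mul_comm, Real.rpow_mul hu.le, Real.rpow_natCast]
  have h1 := hk m 1
  have h2 := hk m 2
  have h3 := hk m 3
  have j2 := hj 2
  have j3 := hj 3
  have j4 := hj 4
  have a1 := hk (2 * m) 1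
  have a2 := hk (2 * m) 2
  have a3 := hk (2 * m) 3
  have a4 := hk (2 * m) 4
  have b3 := hk (3 * m) 3
  have b4 := hk (3 * m) 4
  have c4 := hk (4 * m) 4
  push_cast at *
  rw [pow_one] at h1 a1
  rw [j2] at a1 a2 a3 a4
  rw [j3] at b3 b4
  rw [j4] at c4
  refine ⟨h1, Real.rpow_neg hu.le m, ?_, h2, ?_, h3, a3, b3, a2, b4, c4, a4, ?_, a1⟩
  · rw [Real.rpow_sub hu, Real.rpow_one]
  · rw [show m - 1 - 1 = m - 2 by ring]; exact h2
  · rw [Real.rpow_add hu, Real.rpow_one]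

variable (hm2 : m ≠ 2)

include hm2 in
set_option maxHeartbeats 2000000 in
-- With `w_x` and `w_xx` written in the fields and the powers rewritten by `rpow_rules`, both sides
-- are rational in `u`, `u^m`, `m`, the jets and the values of the parameters. The assumption `m ≠
-- 2` clears the denominator of the terms in `f`.
lemma rep_normalCurrent_two : RepV (normalCurrent m σ F G f 2) ![rho m σ *
    secondB m σ (lam m σ) rv (compW m σ F h.1) (compW m σ (deriv F) (contDiffOn_deriv_w h.1))
      (algebraMap ℝ _ σ * compW m σ G h.2.1)
      (algebraMap ℝ _ σ * compW m σ (deriv G) (contDiffOn_deriv_w h.2.1))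
      (compV f h.2.2) (compV (deriv f) (contDiffOn_deriv_v h.2.2)),
    secondA m σ (lam m σ) rv (compW m σ F h.1) (compW m σ (deriv F) (contDiffOn_deriv_w h.1))
      (algebraMap ℝ _ σ * compW m σ G h.2.1)
      (algebraMap ℝ _ σ * compW m σ (deriv G) (contDiffOn_deriv_w h.2.1))
      (compV f h.2.2) (compV (deriv f) (contDiffOn_deriv_v h.2.2))] := by
  intro i z
  have hu := hΩ.pos _ z.2
  obtain ⟨r1, r2, r3, r4, r5, r6, r7, r8, r9, r10, r11, r12, r13, r14⟩ := rpow_rules hu m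
  have hP0 := (Real.rpow_pos_of_pos hu m).ne'
  have hu0 := hu.ne'
  have hm0 := (Param.pos m σ).ne'
  have hmm : m - 2 ≠ 0 := sub_ne_zero.2 hm2
  have hs : σ ^ 2 = 1 := by rw [sq]; exact Param.sq m
  fin_cases i
  · rw [← evalAt_apply]
    simp only [Fin.zero_eta, Matrix.cons_val_zero, normalCurrent, Matrix.cons_val, secondB,
      quadB, dispB, scalB, curT_lam, dw_lam, dv_rv, Derivation.map_algebraMap,
      Derivation.map_one_eq_zero, map_mul, map_add, map_sub, map_neg, map_pow, map_zero, map_one,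
      map_ofNat, evalAt_compW, evalAt_compV, evalAt_phi, evalAt_hinv, evalAt_rho, wj_one_eq,
      wj_two_eq, vj_eq, AlgHom.commutes, evalAt_jetCoord, evalAt_upow, Algebra.algebraMap_self,
      RingHom.id_apply, a16, r1, r2, r3, r4, r5, r6, r7, r8, r9, r10, r11, r12, r13, r14]
    generalize z.1 0 0 ^ m = P at *
    generalize F (riemannInv m σ (z.1 0)) = F0 at *
    generalize deriv F (riemannInv m σ (z.1 0)) = F1 at *
    generalize G (riemannInv m σ (z.1 0)) = G0 at *
    generalize deriv G (riemannInv m σ (z.1 0)) = G1 at *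
    generalize f (z.1 0 1) = f0 at *
    generalize deriv f (z.1 0 1) = f1 at *
    rcases hP.sign with rfl | rfl
    · field_simp
      ring
    · field_simp
      ring
  · rw [← evalAt_apply]
    simp only [Fin.mk_one, Matrix.cons_val_one, normalCurrent, Matrix.cons_val, secondA,
      quadA, dispA, scalA, curT_lam, dw_lam, dv_rv, Derivation.map_algebraMap,
      Derivation.map_one_eq_zero, map_mul, map_add, map_sub, map_neg, map_pow, map_zero, map_one,
      map_ofNat, evalAt_compW, evalAt_compV, evalAt_phi, evalAt_hinv, evalAt_rho, wj_one_eq,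
      wj_two_eq, vj_eq, AlgHom.commutes, evalAt_jetCoord, evalAt_upow, Algebra.algebraMap_self,
      RingHom.id_apply, a23, a24, a25, a26, a27, r1, r2, r3, r4, r5, r6, r7, r8, r9, r10, r11,
      r12, r13, r14]
    generalize z.1 0 0 ^ m = P at *
    generalize F (riemannInv m σ (z.1 0)) = F0 at *
    generalize deriv F (riemannInv m σ (z.1 0)) = F1 at *
    generalize G (riemannInv m σ (z.1 0)) = G0 at *
    generalize deriv G (riemannInv m σ (z.1 0)) = G1 at *
    generalize f (z.1 0 1) = f0 at *
    generalize deriv f (z.1 0 1) = f1 at *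
    rcases hP.sign with rfl | rfl
    · field_simp
      ring
    · field_simp
      ring

end

end

section

attribute [-instance] instCharZeroOfIsSemireal IsStrictOrderedRing.toCharZero
  FloorSemiring.instCharZero NumberField.to_charZero SubsemiringClass.instCharZero

/-! ### The dispersionless flow -/

lemma pderiv_eq {f : Pt → ℝ} {f' : Pt →L[ℝ] ℝ} {p : Pt} (h : HasFDerivAt f f' p) (j : Fin 2) :
    pderiv j f p = f' (Pi.single j 1) := by rw [pderiv, h.fderiv]

lemma pderiv_congr {f g : Pt → ℝ} {p : Pt} (h : f =ᶠ[𝓝 p] g) (j : Fin 2) :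
    pderiv j f p = pderiv j g p := by rw [pderiv, pderiv, h.fderiv_eq]

section Potential

variable {m c : ℝ} (hm : 1 < m) {p : Pt} (hp : 0 < p 0)
include hm hp

lemma pderiv_potential_zero : pderiv 0 (potential m c 0) p = p 1 - 2 * c * p 0 ^ m ∧
    pderiv 1 (potential m c 0) p = p 0 := by
  have h0 := hasFDerivAt_apply (𝕜 := ℝ) (0 : Fin 2) p
  have h1 := hasFDerivAt_apply (𝕜 := ℝ) (1 : Fin 2) p
  have h : HasFDerivAt (potential m c 0) _ p := (h0.mul h1).sub
    ((h0.rpow_const (p := m + 1) (Or.inl hp.ne')).const_mul (2 * c / (m + 1)))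
  have hm1 : m + 1 ≠ 0 := by linarith
  rw [pderiv_eq h, pderiv_eq h]
  simp only [add_sub_cancel_right]
  constructor
  · simp; field_simp
  · simp

lemma structureConst_zero : structureConst m c 0 0 0 p = -(2 * c * m * p 0 ^ (m - 1)) ∧
    structureConst m c 0 1 0 p = 1 ∧ structureConst m c 0 0 1 p = 1 ∧
    structureConst m c 0 1 1 p = 0 := by
  have hpos : ∀ᶠ q : Pt in 𝓝 p, 0 < q 0 :=
    (continuous_apply (0 : Fin 2)).continuousAt.eventually (lt_mem_nhds hp)
  have e0 : pderiv 0 (potential m c 0) =ᶠ[𝓝 p] fun q => q 1 - 2 * c * q 0 ^ m := by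
    filter_upwards [hpos] with q hq using (pderiv_potential_zero hm hq).1
  have e1 : pderiv 1 (potential m c 0) =ᶠ[𝓝 p] fun q => q 0 := by
    filter_upwards [hpos] with q hq using (pderiv_potential_zero hm hq).2
  have h0 := hasFDerivAt_apply (𝕜 := ℝ) (0 : Fin 2) p
  have h1 := hasFDerivAt_apply (𝕜 := ℝ) (1 : Fin 2) p
  have h : HasFDerivAt (fun q : Pt => q 1 - 2 * c * q 0 ^ m) _ p := h1.sub
    ((h0.rpow_const (p := m) (Or.inl hp.ne')).const_mul (2 * c))
  simp only [structureConst]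
  rw [pderiv_congr e0, pderiv_congr e0, pderiv_congr e1, pderiv_congr e1, pderiv_eq h,
    pderiv_eq h, pderiv_eq h0, pderiv_eq h0]
  refine ⟨?_, ?_, ?_, ?_⟩ <;> simp
  ring

/-- With `c² = 4` the coefficient of `u^(2m)` in the second potential vanishes. This is the point
where the special value of `c` decouples the equation for `v`. -/
lemma structureConst_one {σ : ℝ} (hσ : σ * σ = 1) (j k : Fin 2) :
    structureConst m (2 * σ) 1 j k p = if j = 1 ∧ k = 1 then 1 else 0 := by
  have hc : -(2 * m / (4 * (2 * m) - 4)) * (2 * σ) ^ 2 + 2 * m / (2 * m - 1) = 0 := by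
    have h1 : 2 * m - 1 ≠ 0 := by linarith
    rw [show 4 * (2 * m) - 4 = 4 * (2 * m - 1) by ring, mul_pow, sq σ, hσ]
    field_simp
    ring
  have hA : potential m (2 * σ) 1 = fun p => p 1 ^ 2 * (1 / 2) := by
    funext p
    change p 1 ^ 2 / 2 + _ * p 0 ^ (2 * m) = _
    rw [hc]
    ring
  have h1 := fun q : Pt => hasFDerivAt_apply (𝕜 := ℝ) (1 : Fin 2) q
  have h2 : ∀ q : Pt, HasFDerivAt (fun p : Pt => p 1 ^ 2 * (1 / 2)) _ q := fun q =>
    ((h1 q).pow 2).mul_const (1 / 2)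
  have e1 : pderiv k (potential m (2 * σ) 1) = fun q => if k = 1 then q 1 else 0 := by
    funext q
    rw [hA, pderiv_eq (h2 q)]
    fin_cases k <;> simp
  rw [structureConst, e1]
  fin_cases k
  · simp [pderiv]
  · simp only [Fin.mk_one, if_true]
    rw [pderiv_eq (h1 p)]
    fin_cases j <;> simp

end Potential

variable {Ω : Opens Pt} [hΩ : PosFst Ω] {m σ : ℝ} [hP : Param m σ]

lemma baseFlow_zero : baseFlow m σ 0 = (rv - algebraMap ℝ _ (4 * σ * m) * upow m) * jetCoord 1 0 +
    (jetCoord 0 0 * jetCoord 1 1 : JetAlg Ω) := by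
  refine JetAlg.ext_evalAt fun z => ?_
  have hu := hΩ.pos _ z.2
  obtain ⟨r1, r2, r3, -⟩ := rpow_rules hu m
  have hP0 := (Real.rpow_pos_of_pos hu m).ne'
  have hu0 := hu.ne'
  have hm0 := (Param.pos m σ).ne'
  simp only [baseFlow, symmFlow, ofFrame, Matrix.cons_val_zero, lam, rw', wj_one_eq, vj_eq,
    map_mul, map_sub, map_add, evalAt_rho, evalAt_phi, evalAt_upow, AlgHom.commutes,
    evalAt_jetCoord, Algebra.algebraMap_self, RingHom.id_apply, r1, r3]
  change _ = (z.1 0 1 - _) * _ + _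
  change _ * (z.1 0 1 * _ - (z.1 0 1 - _ * (z.1 0 1 - (z.1 0 1 - _))) * _) = _
  rcases hP.sign with rfl | rfl
  · field_simp; ring
  · field_simp; ring

lemma baseFlow_one : baseFlow m σ 1 = (rv * jetCoord 1 1 : JetAlg Ω) := by
  rw [← vj_eq]; rfl

lemma rep_flow21 : RepV (Ω := Ω) (flow21 m (2 * σ)) (baseFlow m σ) := by
  intro i z
  have hu := hΩ.pos _ z.2
  have hm := hP.one_lt
  rw [← evalAt_apply]
  obtain ⟨h1, h2, h3, h4⟩ := structureConst_zero (c := 2 * σ) hm hu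
  fin_cases i
  · simp only [Fin.zero_eta, baseFlow_zero, flow21, Fin.sum_univ_two, h1, h2, h3, h4, map_add,
      map_mul, map_sub, evalAt_upow, AlgHom.commutes, evalAt_jetCoord, Algebra.algebraMap_self,
      RingHom.id_apply]
    change _ = (z.1 0 1 - _) * _ + _
    have e : z.1 0 0 ^ m = z.1 0 0 ^ (m - 1) * z.1 0 0 := by
      rw [← Real.rpow_add_one hu.ne']; congr 1; ring
    rw [e]; ring
  · have h := structureConst_one hm hu (Param.sq m (σ := σ))
    simp only [Fin.mk_one, flow21, Fin.sum_univ_two, h, baseFlow_one, map_mul, evalAt_jetCoord]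
    change _ = z.1 0 1 * _
    simp

lemma rep_normalForm_zero {F G f : ℝ → ℝ} :
    RepV (Ω := Ω) (normalForm m σ F G f 0) (baseFlow m σ) := by
  have h0 : Rep (fun z => normalCurrent m σ F G f 0 z 0)
    (-(algebraMap ℝ _ (σ * 4 * m / (m + 1)) * upow (m + 1)) + jetCoord 0 0 * jetCoord 0 1 :
      JetAlg Ω) := fun z => by
    change -(σ * 4 * m * z.1 0 0 ^ (m + 1) / (m + 1)) + z.1 0 0 * z.1 0 1 =
      -(σ * 4 * m / (m + 1) * z.1 0 0 ^ (m + 1)) + z.1 0 0 * z.1 0 1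
    ring
  have h1 : Rep (fun z => normalCurrent m σ F G f 0 z 1)
    (algebraMap ℝ _ (1 / 2) * jetCoord 0 1 ^ 2 : JetAlg Ω) := fun z => by
    change z.1 0 1 ^ 2 / 2 = 1 / 2 * z.1 0 1 ^ 2
    ring
  have hm1 : m + 1 ≠ 0 := by have := Param.pos m σ; positivity
  intro i z
  fin_cases i
  · refine (h0.totalD z).trans (congrArg (fun f : JetAlg Ω => f.1 z) ?_)
    have e : totD (upow (m + 1) : JetAlg Ω) =
      algebraMap ℝ _ (m + 1) * upow (m + 1 - 1) * jetCoord 1 0 := vf_upow _ _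
    simp only [Fin.zero_eta, baseFlow_zero, map_add, map_neg, Derivation.leibniz,
      Derivation.map_algebraMap, totD_jetCoord, e, smul_eq_mul, smul_zero, add_zero]
    have e2 : algebraMap ℝ (JetAlg Ω) (σ * 4 * m / (m + 1)) * algebraMap ℝ _ (m + 1) =
      algebraMap ℝ _ (4 * σ * m) := by rw [← map_mul]; congr 1; field_simp
    rw [show m + 1 - 1 = m by ring]
    rw [map_add] at e2
    have e3 : (rv : JetAlg Ω) = jetCoord 0 1 := rfl
    rw [e3]
    linear_combination -(upow m * jetCoord 1 0) * e2
  · refine (h1.totalD z).trans (congrArg (fun f : JetAlg Ω => f.1 z) ?_)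
    simp only [Fin.mk_one, baseFlow_one, Derivation.leibniz, Derivation.leibniz_pow,
      Derivation.map_algebraMap, totD_jetCoord, smul_eq_mul, smul_zero, add_zero, nsmul_eq_mul]
    have e3 : (rv : JetAlg Ω) = jetCoord 0 1 := rfl
    have e2 : algebraMap ℝ (JetAlg Ω) (1 / 2) * 2 = 1 := by
      rw [← map_ofNat (algebraMap ℝ (JetAlg Ω)) 2, ← map_mul]; norm_num
    rw [e3]
    push_cast
    linear_combination (jetCoord 0 1 * jetCoord 1 1) * e2

lemma RepV.totalD {α : Jet → Pt} {a : Fin 2 → JetAlg Ω} (h : RepV α a) :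
    RepV (fun z i => totalD (fun z' => α z' i) z) fun i => totD (a i) := fun i => (h i).totalD

/-- The normal form in the algebra. -/
theorem rep_normalForm {F G f : ℝ → ℝ} (h : SmoothParams m σ (Ω : Set Pt) F G f) (hm2 : m ≠ 2)
    (n : Fin 3) : RepV (normalForm m σ F G f n) (normalFlow m σ F G f h n) := by
  fin_cases n
  · exact rep_normalForm_zero
  · have h1 := (rep_normalCurrent_one h).totalD
    intro i z
    refine (h1 i z).trans ?_
    have e : normalFlow m σ F G f h 1 = consFlow m σ (compW m σ F h.1 * phi m * wj m σ 1) 0 := by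
      change consFlow _ _ _ _ = _
      rw [first_lam, first_lam']
    rw [Fin.mk_one, e]
    fin_cases i
    · change (totD (0 : JetAlg Ω)).1 z = (totD (rho m σ * 0)).1 z
      rw [mul_zero]
    · rfl
  · have h1 := (rep_normalCurrent_two h hm2).totalD
    intro i z
    refine (h1 i z).trans ?_
    fin_cases i <;> rfl

lemma HasGrad.const_mul {f a b : JetAlg Ω} (h : HasGrad m σ f a b) (c : ℝ) :
    HasGrad m σ (algebraMap ℝ _ c * f) (algebraMap ℝ _ c * a) (algebraMap ℝ _ c * b) := fun V => by
  rw [Derivation.leibniz, vf_algebraMap, h V]; simp only [smul_eq_mul]; ring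

lemma IsCoef.const_mul {f : JetAlg Ω} (h : IsCoef f) (c : ℝ) : IsCoef (algebraMap ℝ _ c * f) :=
  (isCoef_algebraMap c).mul h

lemma commute_iff {K Q : Fin 3 → Jet → Pt} {K' Q' : Fin 3 → Fin 2 → JetAlg Ω}
    (hK : ∀ n, RepV (K n) (K' n)) (hQ : ∀ n, RepV (Q n) (Q' n)) :
    Commute (Ω : Set Pt) K Q ↔ brk (K' 0) (Q' 0) = 0 ∧
      brk (K' 0) (Q' 1) + brk (K' 1) (Q' 0) = 0 ∧
      brk (K' 0) (Q' 2) + brk (K' 1) (Q' 1) + brk (K' 2) (Q' 0) = 0 := by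
  have hb := fun a b => (hK a).bracket (hQ b)
  have s0 : (Finset.univ.filter fun ab : Fin 3 × Fin 3 => ab.1.val + ab.2.val = 0) = {(0, 0)} := by
    decide
  have s1 : (Finset.univ.filter fun ab : Fin 3 × Fin 3 => ab.1.val + ab.2.val = 1) =
    {(0, 1), (1, 0)} := by decide
  have s2 : (Finset.univ.filter fun ab : Fin 3 × Fin 3 => ab.1.val + ab.2.val = 2) =
    {(0, 2), (1, 1), (2, 0)} := by decide
  have key : ∀ (z : JetDom Ω) (i : Fin 2) (a b : Fin 3), bracket (K a) (Q b) z.1 i =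
    (brk (K' a) (Q' b) i).1 z := fun z i a b => hb a b i z
  constructor
  · intro h
    refine ⟨?_, ?_, ?_⟩
    · funext i
      refine JetAlg.ext fun z => ?_
      have := h 0 z.1 z.2 i
      rw [show (0 : Fin 3).val = 0 from rfl, s0] at this
      simp only [Finset.sum_singleton, key] at this
      exact this
    · funext i
      refine JetAlg.ext fun z => ?_
      have := h 1 z.1 z.2 i
      rw [show (1 : Fin 3).val = 1 from rfl, s1, Finset.sum_pair (by decide)] at this
      simp only [key] at this
      exact this
    · funext i
      refine JetAlg.ext fun z => ?_
      have := h 2 z.1 z.2 i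
      rw [show (2 : Fin 3).val = 2 from rfl, s2, Finset.sum_insert (by decide),
        Finset.sum_pair (by decide)] at this
      simp only [key] at this
      rw [← add_assoc] at this
      exact this
  · rintro ⟨h0, h1, h2⟩ n z hz i
    fin_cases n
    · simp only [Fin.zero_eta, s0, Finset.sum_singleton]
      rw [key ⟨z, hz⟩, h0]; rfl
    · simp only [Fin.mk_one, show (1 : Fin 3).val = 1 from rfl, s1]
      rw [Finset.sum_pair (by decide), key ⟨z, hz⟩, key ⟨z, hz⟩]
      exact congrArg (fun X : Fin 2 → JetAlg Ω => (X i).1 ⟨z, hz⟩) h1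
    · simp only [Fin.reduceFinMk, show (2 : Fin 3).val = 2 from rfl, s2]
      rw [Finset.sum_insert (by decide), Finset.sum_pair (by decide), key ⟨z, hz⟩, key ⟨z, hz⟩,
        key ⟨z, hz⟩, ← add_assoc]
      exact congrArg (fun X : Fin 2 → JetAlg Ω => (X i).1 ⟨z, hz⟩) h2

lemma repV_jetExt (X : Fin 2 → JetAlg Ω) : RepV (fun z i => jetExt (X i) z) X :=
  fun i => rep_toFun (X i)

/-- Every hydrodynamic symmetry is diagonal by `exists_isSymm`, hence given by a pair `(μ, g)` to
which the formulas of `deformed` apply. -/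
theorem integrable_normalForm {F G f : ℝ → ℝ} (h : SmoothParams m σ (Ω : Set Pt) F G f)
    (hm2 : m ≠ 2) : Integrable (Ω : Set Pt) (normalForm m σ F G f) := by
  intro S hS hb
  have hK := rep_normalForm h hm2
  choose S' hS' hrep using fun i => (hS i).rep_one
  have hbr : brk (baseFlow m σ) S' = 0 := by
    funext i
    refine JetAlg.ext fun z => ?_
    exact ((hK 0).bracket (Y := S) hrep i z).symm.trans (hb z.1 z.2 i)
  obtain ⟨μ, g, hs, rfl⟩ := exists_isSymm hS' hbr
  let Q' := deformed m σ μ g (compW m σ F h.1) (compW m σ (deriv F) (contDiffOn_deriv_w h.1))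
    (algebraMap ℝ _ σ * compW m σ G h.2.1)
    (algebraMap ℝ _ σ * compW m σ (deriv G) (contDiffOn_deriv_w h.2.1))
    (compV f h.2.2) (compV (deriv f) (contDiffOn_deriv_v h.2.2))
  have hGσ := (grad_compW h.2.1).const_mul σ
  have hGσ' := (grad_compW (contDiffOn_deriv_w h.2.1)).const_mul σ
  rw [mul_zero] at hGσ hGσ'
  have hc := deformed_commute hs (grad_compW h.1) (grad_compW (contDiffOn_deriv_w h.1)) hGσ hGσ'
    (grad_compV (m := m) (σ := σ) h.2.2) (grad_compV (contDiffOn_deriv_v h.2.2))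
  have hF := isCoef_compW h.1
  have hF₁ := isCoef_compW (contDiffOn_deriv_w h.1)
  have hG := (isCoef_compW h.2.1).const_mul σ
  have hG₁ := (isCoef_compW (contDiffOn_deriv_w h.2.1)).const_mul σ
  have hf := isCoef_compV h.2.2
  have hf₁ := isCoef_compV (contDiffOn_deriv_v h.2.2)
  refine ⟨fun n z i => jetExt (Q' n i) z, fun n i => ?_, fun z hz => ?_,
    (commute_iff hK fun n => repV_jetExt (Q' n)).2 ⟨hbr, hc⟩⟩
  · have hp := isCoef_phi (Ω := Ω) m
    have hT := hs.isCoef_curT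
    have hM := hs.coef_fst.dw (m := m) (σ := σ)
    have hn := isCoef_algebraMap (Ω := Ω) (1 / m)
    fin_cases n
    · exact (hp1_symmFlow hs.coef_fst hs.coef_snd i).isDiffPoly (rep_toFun _)
    · exact (hp2_consFlow (hp1_wj (((hn.mul hp).mul hF).mul hT))
        (hp1_wj (((hn.mul hp).mul hF).mul (hT.sub hM))) i).isDiffPoly (rep_toFun _)
    · exact (hp3_consFlow (lead_secondA hs hF hF₁ hG hG₁ hf hf₁).hp2
        (lead_secondB hs hF hF₁ hG hG₁ hf hf₁).hp2 i).isDiffPoly (rep_toFun _)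
  · funext i
    exact (rep_toFun (symmFlow m σ μ g i) ⟨z, hz⟩).trans (hrep i ⟨z, hz⟩).symm

theorem isDeformation_normalForm {F G f : ℝ → ℝ} (h : SmoothParams m σ (Ω : Set Pt) F G f)
    (hm2 : m ≠ 2) : IsDeformation m (2 * σ) (Ω : Set Pt) (normalForm m σ F G f) := by
  refine ⟨fun z hz => funext fun i => ?_, normalCurrent m σ F G f, fun n i => ?_,
    fun n z _ i => rfl⟩
  · exact (rep_normalForm_zero i ⟨z, hz⟩).trans (rep_flow21 i ⟨z, hz⟩).symm
  · have hF := isCoef_compW h.1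
    have hF₁ := isCoef_compW (contDiffOn_deriv_w h.1)
    have hG := (isCoef_compW h.2.1).const_mul σ
    have hG₁ := (isCoef_compW (contDiffOn_deriv_w h.2.1)).const_mul σ
    have hf := isCoef_compV h.2.2
    have hf₁ := isCoef_compV (contDiffOn_deriv_v h.2.2)
    fin_cases n
    · fin_cases i
      · exact IsCoef.isDiffPoly (f' := -(algebraMap ℝ _ (σ * 4 * m / (m + 1)) * upow (m + 1)) +
          jetCoord 0 0 * jetCoord 0 1) (fun z => by
            change -(σ * 4 * m * z.1 0 0 ^ (m + 1) / (m + 1)) + z.1 0 0 * z.1 0 1 =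
              -(σ * 4 * m / (m + 1) * z.1 0 0 ^ (m + 1)) + z.1 0 0 * z.1 0 1
            ring) (((isCoef_upow _).const_mul _).neg.add
            ((isCoef_jetCoord_zero 0).mul (isCoef_jetCoord_zero 1)))
      · exact IsCoef.isDiffPoly (f' := algebraMap ℝ _ (1 / 2) * jetCoord 0 1 ^ 2) (fun z => by
          change z.1 0 1 ^ 2 / 2 = 1 / 2 * z.1 0 1 ^ 2
          ring) (((isCoef_jetCoord_zero 1).pow 2).const_mul _)
    · have h1 := rep_normalCurrent_one h
      fin_cases i
      · exact HP1.zero.isDiffPoly (h1 0)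
      · exact (hp1_wj (hF.mul (isCoef_phi m))).isDiffPoly (h1 1)
    · have h1 := rep_normalCurrent_two h hm2
      fin_cases i
      · exact ((lead_secondB isSymm_lam hF hF₁ hG hG₁ hf hf₁).hp2.coef_mul
          (isCoef_rho m σ)).isDiffPoly (h1 0)
      · exact (lead_secondA isSymm_lam hF hF₁ hG hG₁ hf hf₁).hp2.isDiffPoly (h1 1)

end

/-! ### Miura transformations modulo `ε³` as Lie series -/

section

attribute [-instance] instCharZeroOfIsSemireal IsStrictOrderedRing.toCharZero
  FloorSemiring.instCharZero NumberField.to_charZero SubsemiringClass.instCharZero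

variable {Ω : Opens Pt}

/-! ### Expansion of a transformed system in `ε` -/

/-- The second order Taylor expansion along a quadratic curve. -/
lemma isLittleO_quadratic_curve {E : Type*} [NormedAddCommGroup E] [NormedSpace ℝ E] {s : Set E}
    (hs : IsOpen s) {g : E → ℝ} (hg : ContDiffOn ℝ ∞ g s) {y : E} (hy : y ∈ s) (a b : E) :
    (fun t : ℝ => g (y + t • a + t ^ 2 • b) - (g y + t * fderiv ℝ g y a +
      t ^ 2 * (fderiv ℝ g y b + 1 / 2 * fderiv ℝ (fderiv ℝ g) y a a))) =o[𝓝 0]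
      fun t : ℝ => t ^ 2 := by
  let c : ℝ → E := fun t => y + t • a + t ^ 2 • b
  have hc : ∀ t, HasDerivAt c (a + (2 * t) • b) t := fun t => by
    have h1 := ((hasDerivAt_id t).smul_const a).const_add y
    have h2 := ((hasDerivAt_id t).pow 2).smul_const b
    refine (h1.add h2).congr_deriv ?_
    simp
  have hc0 : c 0 = y := by simp [c]
  have hev : ∀ᶠ t in 𝓝 (0 : ℝ), c t ∈ s :=
    (hc 0).continuousAt.preimage_mem_nhds (hs.mem_nhds (by rwa [hc0]))
  obtain ⟨r, hr, hball⟩ := Metric.eventually_nhds_iff_ball.1 hev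
  have hd : ContDiffOn ℝ ∞ (fderiv ℝ g) s := hg.fderiv_of_isOpen hs (by simp)
  have hgd : ∀ x ∈ s, HasFDerivAt g (fderiv ℝ g x) x := fun x hx =>
    ((hg.contDiffAt (hs.mem_nhds hx)).differentiableAt (by simp)).hasFDerivAt
  have h2 : HasFDerivAt (fderiv ℝ g) (fderiv ℝ (fderiv ℝ g) y) (c 0) := by
    rw [hc0]
    exact ((hd.contDiffAt (hs.mem_nhds hy)).differentiableAt (by simp)).hasFDerivAt
  have h3 := h2.comp_hasDerivAt (0 : ℝ) (hc 0)
  have h4 : HasDerivAt (fun t : ℝ => a + (2 * t) • b) ((2 : ℝ) • b) 0 := by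
    simpa using (((hasDerivAt_id (0 : ℝ)).const_mul 2).smul_const b).const_add a
  have h5 := (h3.clm_apply h4).isLittleO
  let p : ℝ → ℝ := fun t => g (c t) - (t * fderiv ℝ g y a +
      t ^ 2 * (fderiv ℝ g y b + 1 / 2 * fderiv ℝ (fderiv ℝ g) y a a))
  -- The derivative of the remainder is `o(t)`, because `fderiv ℝ g` is differentiable along the
  -- curve at zero; integrating on a ball improves this to `o(t²)`.
  have key := Convex.isLittleO_pow_succ_real (f := p) (n := 1) (convex_ball (0 : ℝ) r)
    (Metric.mem_ball_self hr) (f' := fun t => fderiv ℝ g (c t) (a + (2 * t) • b) -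
      (fderiv ℝ g y a + (2 * t) * (fderiv ℝ g y b + 1 / 2 * fderiv ℝ (fderiv ℝ g) y a a)))
    (fun t ht => by
      have h6 := (hgd _ (hball t ht)).comp_hasDerivAt t (hc t)
      have h7 := (hasDerivAt_id t).mul_const (fderiv ℝ g y a)
      have h8 := ((hasDerivAt_id t).pow 2).mul_const
        (fderiv ℝ g y b + 1 / 2 * fderiv ℝ (fderiv ℝ g) y a a)
      refine ((h6.sub (h7.add h8)).congr_deriv ?_).hasDerivWithinAt
      simp) (by
      refine (h5.mono nhdsWithin_le_nhds).congr (fun t => ?_) fun t => by simp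
      simp only [Function.comp_apply, hc0, map_add, map_smul, smul_eq_mul, mul_zero, zero_smul,
        add_zero, sub_zero]
      ring)
  rw [Metric.isOpen_ball.nhdsWithin_eq (Metric.mem_ball_self hr)] at key
  refine key.congr (fun t => ?_) fun t => by simp
  simp only [p, hc0]
  change g (c t) - _ - _ = g (c t) - _
  ring

/-- By `vf_vf` the Hessian in the direction of `X` equals `X(X f)` minus the derivative of `f` along
the system with components `X(X^i)`. The second Taylor coefficient thus involves evolutionary
derivations only. -/
lemma isLittleO_expansion {f : Jet → ℝ} {f' : JetAlg Ω} (hf : Rep f f')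
    (X Y : Fin 2 → JetAlg Ω) (z : JetDom Ω) :
    (fun t : ℝ => f (z.1 + t • jetOf (fun s i => totD^[s] (X i)) z +
        t ^ 2 • jetOf (fun s i => totD^[s] (Y i)) z) -
      (evalAt z f' + t * evalAt z (evo X f') + t ^ 2 * evalAt z (evo Y f' +
        algebraMap ℝ _ (1 / 2) * (evo X (evo X f') - evo (fun i => evo X (X i)) f'))))
      =o[𝓝 0] fun t : ℝ => t ^ 2 := by
  obtain ⟨N, g, hg, h⟩ := f'.2
  set V : ℕ → Fin 2 → JetAlg Ω := fun s i => totD^[s] (X i) with hV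
  set W : ℕ → Fin 2 → JetAlg Ω := fun s i => totD^[s] (Y i) with hW
  have key := isLittleO_quadratic_curve (isOpen_truncDom Ω N) hg (trunc_mem N z)
    (trunc N (jetOf V z)) (trunc N (jetOf W z))
  have h1 : ∀ U : ℕ → Fin 2 → JetAlg Ω, fderiv ℝ g (trunc N z.1) (trunc N (jetOf U z)) =
      (vf U f').1 z := fun U => ((hasDerivAt_toFun_line hg h z (jetOf U z)).deriv).symm
  have h2 := vf_vf hg h V V z
  have h3 : (fun s i => vf V (V s i)) = fun s i => totD^[s] (evo X (X i)) := by
    funext s i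
    exact evo_totD_iterate X (X i) s
  rw [h3] at h2
  have h4 : evalAt z (evo Y f' +
        algebraMap ℝ _ (1 / 2) * (evo X (evo X f') - evo (fun i => evo X (X i)) f')) =
      fderiv ℝ g (trunc N z.1) (trunc N (jetOf W z)) + 1 / 2 *
        fderiv ℝ (fderiv ℝ g) (trunc N z.1) (trunc N (jetOf V z)) (trunc N (jetOf V z)) := by
    rw [h1, map_add, map_mul, map_sub, AlgHom.commutes]
    have : (evo X (evo X f')).1 z = _ := h2
    rw [evalAt_apply, evalAt_apply, evalAt_apply, this]
    simp only [evo, hV, hW, Algebra.algebraMap_self_apply]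
    ring
  rw [h4]
  have hev : ∀ᶠ t : ℝ in 𝓝 0, (z.1 + t • jetOf V z + t ^ 2 • jetOf W z) 0 ∈ (Ω : Set Pt) := by
    have : ContinuousAt (fun t : ℝ => z.1 0 + t • jetOf V z 0 + t ^ 2 • jetOf W z 0) 0 := by
      fun_prop
    exact this.preimage_mem_nhds (Ω.isOpen.mem_nhds (by simpa using z.2))
  refine key.congr' ?_ EventuallyEq.rfl
  filter_upwards [hev] with t ht
  rw [hf ⟨_, ht⟩, h, h1 V, evalAt_apply, evalAt_apply, h z]
  rfl

lemma isLittleO_quadratic_id {a b c : ℝ}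
    (h : (fun t : ℝ => a + t * b + t ^ 2 * c) =o[𝓝 0] (fun t : ℝ => t)) : a = 0 ∧ b = 0 := by
  have hp : HasDerivAt (fun t : ℝ => a + t * b + t ^ 2 * c) b 0 := by
    have h1 := (((hasDerivAt_id (0 : ℝ)).mul_const b).const_add a).add
      (((hasDerivAt_id (0 : ℝ)).pow 2).mul_const c)
    refine h1.congr_deriv ?_
    simp
  have h0 : a = 0 := by
    have h1 := (Asymptotics.isLittleO_one_iff ℝ).1
      (h.trans_isBigO ((continuous_id.tendsto (0 : ℝ)).isBigO_one ℝ))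
    simpa using tendsto_nhds_unique hp.continuousAt h1
  subst h0
  refine ⟨rfl, hp.unique ?_⟩
  rw [hasDerivAt_iff_isLittleO]
  simpa using h

lemma isLittleO_quadratic_iff {a b c : ℝ} :
    (fun t : ℝ => a + t * b + t ^ 2 * c) =o[𝓝 0] (fun t : ℝ => t ^ 2) ↔
      a = 0 ∧ b = 0 ∧ c = 0 := by
  constructor
  · intro h
    obtain ⟨rfl, rfl⟩ := isLittleO_quadratic_id (h.trans (Asymptotics.isLittleO_pow_id one_lt_two))
    refine ⟨rfl, rfl, ?_⟩
    by_contra hc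
    have h6 : (fun t : ℝ => t ^ 2) =o[𝓝 0] (fun t : ℝ => t ^ 2) := by
      refine (h.const_mul_left c⁻¹).congr (fun t => ?_) fun t => rfl
      field_simp
      ring
    have h7 : ∃ᶠ t : ℝ in 𝓝[≠] 0, t ^ 2 ≠ 0 := Eventually.frequently (by
      filter_upwards [self_mem_nhdsWithin] with t ht using pow_ne_zero 2 ht)
    exact Asymptotics.isLittleO_irrefl (h7.filter_mono nhdsWithin_le_nhds) h6
  · rintro ⟨rfl, rfl, rfl⟩
    simp

section Carries

variable {X K L : Fin 3 → Jet → Pt} {X₁ X₂ : Fin 2 → JetAlg Ω} {K' L' : Fin 3 → Fin 2 → JetAlg Ω}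

/-- The coefficients of the expansion of the transformed system. -/
lemma carries_expansion (hX : ∀ z, X 0 z = z 0) (hX₁ : RepV (X 1) X₁) (hX₂ : RepV (X 2) X₂)
    (hK : ∀ n, RepV (K n) (K' n)) (hL : ∀ n, RepV (L n) (L' n)) (z : JetDom Ω) (i : Fin 2) :
    (fun t : ℝ => ((∑ n : Fin 3, t ^ n.val * L n (miuraJet X t z.1) i) -
        ∑ a : Fin 3, ∑ b : Fin 3, t ^ (a.val + b.val) * evol (K a) (fun z' => X b z' i) z.1) -
      (evalAt z (L' 0 i - K' 0 i) +
        t * evalAt z (L' 1 i - K' 1 i + (evo X₁ (L' 0 i) - evo (K' 0) (X₁ i))) +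
        t ^ 2 * evalAt z (L' 2 i - K' 2 i + (evo X₁ (L' 1 i) - evo (K' 1) (X₁ i)) +
          (evo X₂ (L' 0 i) - evo (K' 0) (X₂ i)) + algebraMap ℝ _ (1 / 2) *
            (evo X₁ (evo X₁ (L' 0 i)) - evo (fun i => evo X₁ (X₁ i)) (L' 0 i)))))
      =o[𝓝 0] fun t : ℝ => t ^ 2 := by
  have hX0 : RepV (Ω := Ω) (X 0) (fun i => jetCoord 0 i) := fun i z => congrFun (hX z.1) i
  have hp0 : prolong (X 0) z.1 = z.1 := by
    rw [hX0.prolong]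
    funext s i
    have : ∀ s, totD^[s] (jetCoord 0 i : JetAlg Ω) = jetCoord s i := fun s => by
      induction s with
      | zero => rfl
      | succ s ih => rw [Function.iterate_succ_apply', ih, totD_jetCoord]
    change (totD^[s] (jetCoord 0 i : JetAlg Ω)).1 z = _
    rw [this]; rfl
  have hmj : ∀ t : ℝ, miuraJet X t z.1 = z.1 + t • jetOf (fun s i => totD^[s] (X₁ i)) z +
      t ^ 2 • jetOf (fun s i => totD^[s] (X₂ i)) z := fun t => by
    rw [miuraJet, Fin.sum_univ_three, hp0, hX₁.prolong, hX₂.prolong]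
    simp
  have e := fun n => isLittleO_expansion (hL n i) X₁ X₂ z
  have ev0 : ∀ a, evol (K a) (fun z' => X 0 z' i) z.1 = evalAt z (K' a i) := fun a => by
    rw [(hK a).evol (hX0 i) z, evo_jetCoord_zero]; rfl
  have ev1 : ∀ a, evol (K a) (fun z' => X 1 z' i) z.1 = evalAt z (evo (K' a) (X₁ i)) := fun a =>
    (hK a).evol (hX₁ i) z
  have ev2 : ∀ a, evol (K a) (fun z' => X 2 z' i) z.1 = evalAt z (evo (K' a) (X₂ i)) := fun a =>
    (hK a).evol (hX₂ i) z
  have hcub : ∀ c d : ℝ, (fun t : ℝ => t ^ 3 * (c + t * d)) =o[𝓝 0] fun t : ℝ => t ^ 2 :=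
    fun c d => by
    have h1 : (fun t : ℝ => t ^ 3) =o[𝓝 0] (fun t : ℝ => t ^ 2) :=
      Asymptotics.isLittleO_pow_pow (by norm_num)
    have h2 : (fun t : ℝ => c + t * d) =O[𝓝 0] (fun _ => (1 : ℝ)) :=
      (Continuous.tendsto (by fun_prop) 0).isBigO_one ℝ
    simpa using h1.mul_isBigO h2
  have hb1 : (fun t : ℝ => t) =O[𝓝 0] (fun _ => (1 : ℝ)) :=
    (Continuous.tendsto (by fun_prop) 0).isBigO_one ℝ
  have hb2 : (fun t : ℝ => t ^ 2) =O[𝓝 0] (fun _ => (1 : ℝ)) :=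
    (Continuous.tendsto (by fun_prop) 0).isBigO_one ℝ
  have e1 := hb1.mul_isLittleO (e 1)
  have e2 := hb2.mul_isLittleO (e 2)
  simp only [one_mul] at e1 e2
  set R : Fin 3 → ℝ := fun n => evalAt z (evo X₂ (L' n i) + algebraMap ℝ _ (1 / 2) *
    (evo X₁ (evo X₁ (L' n i)) - evo (fun i => evo X₁ (X₁ i)) (L' n i))) with hR
  -- The added term gathers the contributions of order `t³` and `t⁴` arising from the products of
  -- the expansions.
  have tot := (((e 0).add e1).add e2).add (hcub (R 1 + evalAt z (evo X₁ (L' 2 i)) -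
    evalAt z (evo (K' 1) (X₂ i)) - evalAt z (evo (K' 2) (X₁ i)))
    (R 2 - evalAt z (evo (K' 2) (X₂ i))))
  refine tot.congr (fun t => ?_) fun t => rfl
  rw [← hmj]
  simp only [Fin.sum_univ_three, ev0, ev1, ev2, hR, map_add, map_sub, map_mul]
  simp only [Fin.val_zero, Fin.val_one, Fin.val_two]
  ring

/-- The time-one flow of `ε X₁ + ε² Y` has `ε²`-term `Y + ½ X₁(X₁)`, so `X₂ - ½ X₁(X₁)` is the
second-order generator. In terms of generators the transformed system is the Lie series of the
original one. -/
lemma carries_coeff_two (hL0 : L' 0 = K' 0) (hL1 : L' 1 = K' 1 + brk (K' 0) X₁) (i : Fin 2) :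
    L' 2 i - K' 2 i + (evo X₁ (L' 1 i) - evo (K' 1) (X₁ i)) +
      (evo X₂ (L' 0 i) - evo (K' 0) (X₂ i)) + algebraMap ℝ _ (1 / 2) *
        (evo X₁ (evo X₁ (L' 0 i)) - evo (fun i => evo X₁ (X₁ i)) (L' 0 i)) =
    L' 2 i - (K' 2 + brk (K' 1) X₁ + (1 / 2 : ℝ) • brk (brk (K' 0) X₁) X₁ +
      brk (K' 0) (X₂ - (1 / 2 : ℝ) • fun i => evo X₁ (X₁ i))) i := by
  have h2 : (algebraMap ℝ (JetAlg Ω) (1 / 2)) * 2 = 1 := by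
    rw [← map_ofNat (algebraMap ℝ (JetAlg Ω)) 2, ← map_mul]; norm_num
  have hs : evo (X₂ - (1 / 2 : ℝ) • fun i => evo X₁ (X₁ i)) (K' 0 i) = evo X₂ (K' 0 i) -
      algebraMap ℝ _ (1 / 2) * evo (fun i => evo X₁ (X₁ i)) (K' 0 i) := by
    have h3 : X₂ - (1 / 2 : ℝ) • (fun i => evo X₁ (X₁ i)) =
      X₂ + (-(1 / 2) : ℝ) • fun i => evo X₁ (X₁ i) := by module
    rw [h3, evo_add_field, evo_smul_field, Derivation.add_apply,
      Derivation.smul_apply, Algebra.smul_def, map_neg]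
    ring
  have hl : evo (brk (K' 0) X₁) (X₁ i) = evo (K' 0) (evo X₁ (X₁ i)) - evo X₁ (evo (K' 0) (X₁ i)) :=
    (evo_comm _ _ _).symm
  rw [hL0, hL1]
  simp only [Pi.add_apply, Pi.smul_apply, brk, hs, hl, map_add, map_sub, Pi.sub_apply,
    Derivation.map_smul]
  simp only [Algebra.smul_def]
  linear_combination (evo X₁ (evo (K' 0) (X₁ i)) - evo X₁ (evo X₁ (K' 0 i))) * (-h2)

theorem carries_two_iff (hX : ∀ z, X 0 z = z 0) (hX₁ : RepV (X 1) X₁) (hX₂ : RepV (X 2) X₂)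
    (hK : ∀ n, RepV (K n) (K' n)) (hL : ∀ n, RepV (L n) (L' n)) :
    Carries 2 (Ω : Set Pt) X K L ↔ L' 0 = K' 0 ∧ L' 1 = K' 1 + brk (K' 0) X₁ ∧
      L' 2 = K' 2 + brk (K' 1) X₁ + (1 / 2 : ℝ) • brk (brk (K' 0) X₁) X₁ +
        brk (K' 0) (X₂ - (1 / 2 : ℝ) • fun i => evo X₁ (X₁ i)) := by
  have e := carries_expansion hX hX₁ hX₂ hK hL
  constructor
  · intro h
    have h' := fun (z : JetDom Ω) i => isLittleO_quadratic_iff.1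
      (((h z.1 z.2 i).sub (e z i)).congr_left fun t => sub_sub_cancel _ _)
    have h0 : L' 0 = K' 0 := funext fun i => sub_eq_zero.1 (JetAlg.ext_evalAt fun z => by
      rw [(h' z i).1, map_zero])
    have h1 : L' 1 = K' 1 + brk (K' 0) X₁ := funext fun i => sub_eq_zero.1
      (JetAlg.ext_evalAt fun z => by
        rw [map_zero, ← (h' z i).2.1, h0]
        congr 1
        simp only [Pi.add_apply, brk]; ring)
    refine ⟨h0, h1, funext fun i => sub_eq_zero.1 (JetAlg.ext_evalAt fun z => ?_)⟩
    rw [← carries_coeff_two h0 h1, (h' z i).2.2, map_zero]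
  · rintro ⟨h0, h1, h2⟩ z hz i
    refine (e ⟨z, hz⟩ i).congr_left fun t => ?_
    rw [carries_coeff_two h0 h1, ← h2, h0, h1, sub_self, sub_self, map_zero]
    have : (K' 1 + brk (K' 0) X₁) i - K' 1 i + (evo X₁ (K' 0 i) - evo (K' 0) (X₁ i)) = 0 := by
      simp only [Pi.add_apply, brk]; ring
    rw [this, map_zero]
    ring

theorem Carries.order_one (h : Carries 1 (Ω : Set Pt) X K L) (hX : ∀ z, X 0 z = z 0)
    (hX₁ : RepV (X 1) X₁) (hX₂ : RepV (X 2) X₂) (hK : ∀ n, RepV (K n) (K' n))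
    (hL : ∀ n, RepV (L n) (L' n)) : L' 0 = K' 0 ∧ L' 1 = K' 1 + brk (K' 0) X₁ := by
  have e := carries_expansion hX hX₁ hX₂ hK hL
  have h' := fun (z : JetDom Ω) i => isLittleO_quadratic_id
    (((((h z.1 z.2 i).congr_right fun t => pow_one t).sub
      ((e z i).trans (Asymptotics.isLittleO_pow_id one_lt_two)))).congr_left fun t => by
        rw [sub_sub_cancel])
  have h0 : L' 0 = K' 0 := funext fun i => sub_eq_zero.1 (JetAlg.ext_evalAt fun z => by
    rw [(h' z i).1, map_zero])
  refine ⟨h0, funext fun i => sub_eq_zero.1 (JetAlg.ext_evalAt fun z => ?_)⟩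
  rw [map_zero, ← (h' z i).2, h0]
  congr 1
  simp only [Pi.add_apply, brk]; ring

end Carries

end

section

attribute [-instance] instCharZeroOfIsSemireal IsStrictOrderedRing.toCharZero
  FloorSemiring.instCharZero NumberField.to_charZero SubsemiringClass.instCharZero

variable {Ω : Opens Pt} [hΩ : PosFst Ω] {m σ : ℝ} [hP : Param m σ]

/-! ### The functional parameters are invariants -/

lemma evo_wj_two (X : Fin 2 → JetAlg Ω) :
    evo X (wj m σ 2) = totD (totD (evo X (rw' m σ))) := evo_wj X 2

lemma evo_vj_two (X : Fin 2 → JetAlg Ω) : evo X (vj 2) = totD (totD (evo X rv)) := evo_vj X 2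

lemma brk_apply_rv (X Y : Fin 2 → JetAlg Ω) : brk X Y 1 = evo (brk X Y) rv := (evo_rv _).symm

/-- At such a jet only the coefficient of `w_xxx` could survive. Its two contributions are the same
multiple of `λ`, because the leading part of the flow is diagonal, and they cancel. Brackets with
the flow `(2,1)` are therefore invisible in this coefficient. -/
lemma evalAt_brk_baseFlow_rw {Y : Fin 2 → JetAlg Ω} (hY : HP2 fieldFrame (evo Y (rw' m σ)))
    {z : JetDom Ω} (hw1 : evalAt z (wj m σ 1) = 0) (hw2 : evalAt z (wj m σ 2) = 0)
    (hv1 : evalAt z (vj 1) = 0) (hv2 : evalAt z (vj 2) = 0) (hv3 : evalAt z (vj 3) = 0) :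
    evalAt z (evo (brk (baseFlow m σ) Y) (rw' m σ)) = 0 := by
  obtain ⟨c₁, c₂, c₃, c₄, c₅, h₁, h₂, h₃, h₄, h₅, e⟩ := HP2.riemann (m := m) (σ := σ) hY
  have g₁ := h₁.hasGrad (m := m) (σ := σ) rfl rfl
  have g₂ := h₂.hasGrad (m := m) (σ := σ) rfl rfl
  have g₃ := h₃.hasGrad (m := m) (σ := σ) rfl rfl
  have g₄ := h₄.hasGrad (m := m) (σ := σ) rfl rfl
  have g₅ := h₅.hasGrad (m := m) (σ := σ) rfl rfl
  have gl := grad_lam (Ω := Ω) (m := m) (σ := σ)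
  rw [← evo_comm, evo_baseFlow_rw]
  simp only [e, Derivation.leibniz, Derivation.leibniz_pow, map_add, smul_eq_mul, evo_vj_one,
    evo_wj_one, evo_wj_two, evo_vj_two, evo_baseFlow_rv, evo_baseFlow_rw, g₁.evo, g₂.evo, g₃.evo,
    g₄.evo, g₅.evo, g₁.totD, g₂.totD, g₃.totD, g₄.totD, g₅.totD, gl.evo, gl.totD, totD_wj,
    totD_vj, totD_rv, map_sub, map_mul, hw1, hw2, hv1, hv2, hv3, nsmul_eq_mul, map_pow,
    Derivation.map_algebraMap, Derivation.map_one_eq_zero]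
  ring

lemma evalAt_brk_baseFlow_rv {Y : Fin 2 → JetAlg Ω} (hY : HP2 fieldFrame (Y 1))
    {z : JetDom Ω} (hw1 : evalAt z (wj m σ 1) = 0) (hw2 : evalAt z (wj m σ 2) = 0)
    (hv1 : evalAt z (vj 1) = 0) (hv2 : evalAt z (vj 2) = 0) (hw3 : evalAt z (wj m σ 3) = 0) :
    evalAt z (brk (baseFlow m σ) Y 1) = 0 := by
  rw [← evo_rv Y] at hY
  obtain ⟨c₁, c₂, c₃, c₄, c₅, h₁, h₂, h₃, h₄, h₅, e⟩ := HP2.riemann (m := m) (σ := σ) hY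
  have g₁ := h₁.hasGrad (m := m) (σ := σ) rfl rfl
  have g₂ := h₂.hasGrad (m := m) (σ := σ) rfl rfl
  have g₃ := h₃.hasGrad (m := m) (σ := σ) rfl rfl
  have g₄ := h₄.hasGrad (m := m) (σ := σ) rfl rfl
  have g₅ := h₅.hasGrad (m := m) (σ := σ) rfl rfl
  have gl := grad_lam (Ω := Ω) (m := m) (σ := σ)
  rw [brk_apply_rv, ← evo_comm, evo_baseFlow_rv]
  simp only [e, Derivation.leibniz, Derivation.leibniz_pow, map_add, smul_eq_mul, evo_vj_one,
    evo_wj_one, evo_wj_two, evo_vj_two, evo_baseFlow_rv, evo_baseFlow_rw, g₁.evo, g₂.evo, g₃.evo,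
    g₄.evo, g₅.evo, g₁.totD, g₂.totD, g₃.totD, g₄.totD, g₅.totD, gl.evo, gl.totD, totD_wj,
    totD_vj, totD_rv, map_sub, map_mul, hw1, hw2, hv1, hv2, hw3, nsmul_eq_mul, map_pow,
    Derivation.map_algebraMap, Derivation.map_one_eq_zero]
  ring

/-- In the `w`-component the two contributions to `w_xxx` are both `a μ` and cancel. In the
`v`-component they are `a g` and `a μ`, so `w_xxx` has to be zero there. -/
lemma evalAt_brk_consFlow_symmFlow {μ g a : JetAlg Ω} (hs : IsSymm m σ μ g) (ha : IsCoef a)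
    {z : JetDom Ω} (hw1 : evalAt z (wj m σ 1) = 0) (hw2 : evalAt z (wj m σ 2) = 0)
    (hv1 : evalAt z (vj 1) = 0) (hv2 : evalAt z (vj 2) = 0) :
    evalAt z (evo (brk (consFlow m σ (a * wj m σ 1) 0) (symmFlow m σ μ g)) (rw' m σ)) = 0 ∧
    (evalAt z (wj m σ 3) = 0 →
      evalAt z (brk (consFlow m σ (a * wj m σ 1) 0) (symmFlow m σ μ g) 1) = 0) := by
  have ga := ha.hasGrad (m := m) (σ := σ) rfl rfl
  have ga₁ := (ha.dw (m := m) (σ := σ)).hasGrad (m := m) (σ := σ) rfl rfl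
  have ga₂ := (ha.dv (m := m) (σ := σ)).hasGrad (m := m) (σ := σ) rfl rfl
  have gμ := hs.coef_fst.hasGrad (m := m) (σ := σ) rfl rfl
  have gg := hs.coef_snd.hasGrad (m := m) (σ := σ) rfl rfl
  constructor
  · rw [← evo_comm, evo_consFlow_rw, evo_symmFlow_rw]
    simp only [map_zero, mul_zero, zero_mul, sub_zero, add_zero, evo_totD]
    simp only [Derivation.leibniz, Derivation.leibniz_pow, map_add, smul_eq_mul, evo_vj_one,
      evo_wj_one, evo_wj_two, evo_consFlow_rw, evo_consFlow_rv, evo_symmFlow_rw, evo_symmFlow_rv,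
      ga.evo, ga.totD, ga₁.evo, ga₁.totD, ga₂.evo, ga₂.totD, gμ.evo, gμ.totD, totD_wj, totD_vj,
      map_zero, map_sub, map_mul, mul_zero, zero_mul, sub_zero, hw1, hw2, hv1, hv2, zero_add,
      add_zero]
    ring
  · intro hw3
    rw [brk_apply_rv, ← evo_comm, evo_consFlow_rv, evo_symmFlow_rv, evo_totD]
    simp only [Derivation.leibniz, Derivation.leibniz_pow, map_add, smul_eq_mul, evo_vj_one,
      evo_wj_one, evo_wj_two, evo_consFlow_rw, evo_consFlow_rv, evo_symmFlow_rw, evo_symmFlow_rv,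
      ga.evo, ga.totD, ga₁.evo, ga₁.totD, ga₂.evo, ga₂.totD, gμ.evo, gμ.totD, gg.evo, gg.totD,
      totD_wj, totD_vj, map_zero, map_sub, map_mul, mul_zero, zero_mul, sub_zero, hw1, hw2, hv1,
      hv2, hw3, zero_add, add_zero]

lemma Lead.evalAt_totD {c₁ c₂ f : JetAlg Ω} (hf : Lead m σ c₁ c₂ f) {z : JetDom Ω}
    (hw1 : evalAt z (wj m σ 1) = 0) (hw2 : evalAt z (wj m σ 2) = 0)
    (hv1 : evalAt z (vj 1) = 0) (hv2 : evalAt z (vj 2) = 0) : evalAt z f = 0 ∧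
    evalAt z (totD f) = evalAt z c₁ * evalAt z (wj m σ 3) + evalAt z c₂ * evalAt z (vj 3) := by
  obtain ⟨h₁, h₂, c₃, c₄, c₅, h₃, h₄, h₅, rfl⟩ := hf
  have g₁ := h₁.hasGrad (m := m) (σ := σ) rfl rfl
  have g₂ := h₂.hasGrad (m := m) (σ := σ) rfl rfl
  have g₃ := h₃.hasGrad (m := m) (σ := σ) rfl rfl
  have g₄ := h₄.hasGrad (m := m) (σ := σ) rfl rfl
  have g₅ := h₅.hasGrad (m := m) (σ := σ) rfl rfl
  simp only [Derivation.leibniz, Derivation.leibniz_pow, map_add, smul_eq_mul, g₁.totD, g₂.totD,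
    g₃.totD, g₄.totD, g₅.totD, totD_wj, totD_vj, map_mul, map_pow, nsmul_eq_mul, hw1, hw2, hv1,
    hv2]
  constructor <;> ring

section

variable {F G f F' G' f' : ℝ → ℝ} (h : SmoothParams m σ (Ω : Set Pt) F G f)
  (h' : SmoothParams m σ (Ω : Set Pt) F' G' f')

lemma normalFlow_one : normalFlow m σ F G f h 1 =
    consFlow m σ (compW m σ F h.1 * phi m * wj m σ 1) 0 := by
  change consFlow _ _ _ _ = _
  rw [first_lam, first_lam']

lemma exists_jetDom {p : Pt} (hp : p ∈ (Ω : Set Pt)) : ∃ z : JetDom Ω, z.1 0 = p :=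
  ⟨⟨fun _ => p, hp⟩, rfl⟩

/-- The parameter `F` is determined at the first order. -/
theorem eqOn_of_order_one {X : Fin 2 → JetAlg Ω} (hX : ∀ i, HP1 fieldFrame (X i))
    (e : normalFlow m σ F' G' f' h' 1 = normalFlow m σ F G f h 1 + brk (baseFlow m σ) X) :
    Set.EqOn F F' (riemannInv m σ '' (Ω : Set Pt)) := by
  rintro _ ⟨p, hp, rfl⟩
  obtain ⟨z₀, rfl⟩ := exists_jetDom hp
  rw [normalFlow_one, normalFlow_one] at e
  have e1 := congrArg (fun Y => evo Y (rw' m σ)) e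
  obtain ⟨a₁, a₂, ha₁, ha₂, ew⟩ := HP1.riemann (m := m) (σ := σ) (HP1.evo_rw (m := m) (σ := σ) hX)
  have g₁ := ha₁.hasGrad (m := m) (σ := σ) rfl rfl
  have g₂ := ha₂.hasGrad (m := m) (σ := σ) rfl rfl
  have gl := grad_lam (Ω := Ω) (m := m) (σ := σ)
  have hF := isCoef_compW h.1
  have hF' := isCoef_compW h'.1
  have hp := isCoef_phi (Ω := Ω) m
  have gF := (hF.mul hp).hasGrad (m := m) (σ := σ) rfl rfl
  have gF' := (hF'.mul hp).hasGrad (m := m) (σ := σ) rfl rfl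
  -- Only `w_xx` is nonzero at this jet. The bracket with the flow contributes `λ a₁ - λ a₁`, which
  -- leaves `F φ = F' φ`.
  obtain ⟨z, hz, hw1, hw2, -, -, hv1, hv2, -, -⟩ := exists_jet_values m σ z₀ 0 1 0 0 0 0 0 0
  simp only [evo_add_field, Derivation.add_apply, ← evo_comm, evo_consFlow_rw, ew,
    evo_baseFlow_rw, Derivation.leibniz (totD) (_ * _) (wj m σ 1), gF.totD, gF'.totD] at e1
  simp only [map_zero, mul_zero, zero_mul, sub_zero, add_zero, map_add, Derivation.leibniz,
    evo_wj_one, evo_vj_one, evo_baseFlow_rw, evo_baseFlow_rv, ew, smul_eq_mul, g₁.evo, g₂.evo,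
    g₁.totD, g₂.totD, gl.evo, gl.totD, totD_rv, totD_wj, totD_vj] at e1
  have e2 := congrArg (evalAt z) e1
  simp only [map_add, map_sub, map_mul, hw1, hw2, hv1, hv2, mul_zero, zero_mul, add_zero,
    zero_add, mul_one, hz _ hF, hz _ hF', hz _ hp, evalAt_compW] at e2
  refine (mul_right_cancel₀ (phi_ne (m := m) z₀) ?_).symm
  linear_combination e2

lemma compW_congr (hF : ContDiffOn ℝ ∞ F (riemannInv m σ '' (Ω : Set Pt)))
    (hF' : ContDiffOn ℝ ∞ F' (riemannInv m σ '' (Ω : Set Pt)))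
    (e : Set.EqOn F F' (riemannInv m σ '' (Ω : Set Pt))) :
    compW m σ F hF = compW m σ F' hF' ∧ compW m σ (deriv F) (contDiffOn_deriv_w hF) =
      compW m σ (deriv F') (contDiffOn_deriv_w hF') := by
  have hI := isOpen_image_riemannInv Ω m σ
  refine ⟨JetAlg.ext_evalAt fun z => ?_, JetAlg.ext_evalAt fun z => ?_⟩
  · rw [evalAt_compW, evalAt_compW, e ⟨_, z.2, rfl⟩]
  · rw [evalAt_compW, evalAt_compW]
    exact (e.eventuallyEq_of_mem (hI.mem_nhds ⟨_, z.2, rfl⟩)).deriv_eq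

/-- The parameters `G` and `f` are determined at the second order. -/
theorem eqOn_of_order_two (hm2 : m ≠ 2) {X Y : Fin 2 → JetAlg Ω} (hX : ∀ i, HP1 fieldFrame (X i))
    (hY : ∀ i, HP2 fieldFrame (Y i))
    (e1 : normalFlow m σ F' G' f' h' 1 = normalFlow m σ F G f h 1 + brk (baseFlow m σ) X)
    (e2 : normalFlow m σ F' G' f' h' 2 = normalFlow m σ F G f h 2 +
      brk (normalFlow m σ F G f h 1) X + (1 / 2 : ℝ) • brk (brk (baseFlow m σ) X) X +
        brk (baseFlow m σ) Y) :
    Set.EqOn G G' (riemannInv m σ '' (Ω : Set Pt)) ∧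
      Set.EqOn f f' ((fun p : Pt => p 1) '' (Ω : Set Pt)) := by
  obtain ⟨c1, c2⟩ := compW_congr h.1 h'.1 (eqOn_of_order_one h h' hX e1)
  -- Equality of the first-order parameters leaves `[K₀, X] = 0`: the first-order part of the
  -- transformation is a hydrodynamic symmetry, and the double bracket drops out.
  rw [normalFlow_one, normalFlow_one, c1, left_eq_add] at e1
  obtain ⟨μ, g, hs, rfl⟩ := exists_isSymm hX e1
  have hF := isCoef_compW h'.1
  have hF₁ := isCoef_compW (contDiffOn_deriv_w h'.1)
  have hp := isCoef_phi (Ω := Ω) m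
  have hb0 : brk (0 : Fin 2 → JetAlg Ω) (symmFlow m σ μ g) = 0 := by
    funext i; simp [brk, evo_zero]
  rw [e1, hb0, smul_zero, add_zero, normalFlow_one, c1] at e2
  have hA : HP2 fieldFrame (evo Y (rw' m σ)) := HP2.evo_rw hY
  have hG := (isCoef_compW h.2.1).const_mul σ
  have hG₁ := (isCoef_compW (contDiffOn_deriv_w h.2.1)).const_mul σ
  have hG' := (isCoef_compW h'.2.1).const_mul σ
  have hG₁' := (isCoef_compW (contDiffOn_deriv_w h'.2.1)).const_mul σ
  have hf := isCoef_compV h.2.2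
  have hf₁ := isCoef_compV (contDiffOn_deriv_v h.2.2)
  have hf' := isCoef_compV h'.2.2
  have hf₁' := isCoef_compV (contDiffOn_deriv_v h'.2.2)
  have hN : normalFlow m σ F G f h 2 = consFlow m σ
    (secondA m σ (lam m σ) rv (compW m σ F h.1) (compW m σ (deriv F) (contDiffOn_deriv_w h.1))
      (algebraMap ℝ _ σ * compW m σ G h.2.1)
      (algebraMap ℝ _ σ * compW m σ (deriv G) (contDiffOn_deriv_w h.2.1))
      (compV f h.2.2) (compV (deriv f) (contDiffOn_deriv_v h.2.2)))
    (secondB m σ (lam m σ) rv (compW m σ F h.1) (compW m σ (deriv F) (contDiffOn_deriv_w h.1))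
      (algebraMap ℝ _ σ * compW m σ G h.2.1)
      (algebraMap ℝ _ σ * compW m σ (deriv G) (contDiffOn_deriv_w h.2.1))
      (compV f h.2.2) (compV (deriv f) (contDiffOn_deriv_v h.2.2))) := rfl
  have hN' : normalFlow m σ F' G' f' h' 2 = consFlow m σ
    (secondA m σ (lam m σ) rv (compW m σ F' h'.1) (compW m σ (deriv F') (contDiffOn_deriv_w h'.1))
      (algebraMap ℝ _ σ * compW m σ G' h'.2.1)
      (algebraMap ℝ _ σ * compW m σ (deriv G') (contDiffOn_deriv_w h'.2.1))
      (compV f' h'.2.2) (compV (deriv f') (contDiffOn_deriv_v h'.2.2)))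
    (secondB m σ (lam m σ) rv (compW m σ F' h'.1) (compW m σ (deriv F') (contDiffOn_deriv_w h'.1))
      (algebraMap ℝ _ σ * compW m σ G' h'.2.1)
      (algebraMap ℝ _ σ * compW m σ (deriv G') (contDiffOn_deriv_w h'.2.1))
      (compV f' h'.2.2) (compV (deriv f') (contDiffOn_deriv_v h'.2.2))) := rfl
  rw [hN, hN', c1, c2] at e2
  have lA := lead_secondA (isSymm_lam (Ω := Ω) (m := m) (σ := σ)) hF hF₁ hG hG₁ hf hf₁
  have lB := lead_secondB (isSymm_lam (Ω := Ω) (m := m) (σ := σ)) hF hF₁ hG hG₁ hf hf₁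
  have lA' := lead_secondA (isSymm_lam (Ω := Ω) (m := m) (σ := σ)) hF hF₁ hG' hG₁' hf' hf₁'
  have lB' := lead_secondB (isSymm_lam (Ω := Ω) (m := m) (σ := σ)) hF hF₁ hG' hG₁' hf' hf₁'
  have hFp := hF.mul hp
  have hm0 := (Param.pos m σ).ne'
  constructor
  · rintro _ ⟨p, hp', rfl⟩
    obtain ⟨z₀, rfl⟩ := exists_jetDom hp'
    -- With only `w_xxx` nonzero, the `w`-equation compares the leading coefficients of the two
    -- second-order parts; the terms in `F` agree and those in `G` remain.
    obtain ⟨z, hz, hw1, hw2, hw3, -, hv1, hv2, hv3, -⟩ :=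
      exists_jet_values m σ z₀ 0 0 1 0 0 0 0 0
    have e3 := congrArg (fun Y => evalAt z (evo Y (rw' m σ))) e2
    simp only [evo_add_field, Derivation.add_apply, map_add,
      evalAt_brk_baseFlow_rw hA hw1 hw2 hv1 hv2 hv3,
      (evalAt_brk_consFlow_symmFlow hs hFp hw1 hw2 hv1 hv2).1, evo_consFlow_rw, map_sub,
      (lA.evalAt_totD hw1 hw2 hv1 hv2).2, (lB.evalAt_totD hw1 hw2 hv1 hv2).2,
      (lA'.evalAt_totD hw1 hw2 hv1 hv2).2, (lB'.evalAt_totD hw1 hw2 hv1 hv2).2, map_mul, hv1,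
      hw1, hw3, hv3, curT_lam, dw_lam, map_neg, map_pow, AlgHom.commutes, hz _ hG, hz _ hG',
      hz _ hF, hz _ hp, hz _ (isCoef_hinv m σ), evalAt_compW, Algebra.algebraMap_self_apply,
      map_ofNat] at e3
    have hp0 := phi_ne (m := m) z₀
    have hσ : σ ≠ 0 := fun h0 => by simpa [h0] using Param.sq (σ := σ) m
    generalize evalAt z₀ (phi m) = P at *
    generalize evalAt z₀ (hinv m σ) = I at *
    have e4 : (1 / m * P) ^ 2 * m * σ * (G (riemannInv m σ (z₀.1 0)) -
        G' (riemannInv m σ (z₀.1 0))) = 0 := by linear_combination 4 * e3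
    refine sub_eq_zero.1 ((mul_eq_zero.1 e4).resolve_left ?_)
    positivity
  · rintro _ ⟨p, hp', rfl⟩
    obtain ⟨z₀, rfl⟩ := exists_jetDom hp'
    -- With only `v_xxx` nonzero, the `v`-equation sees the coefficient of `v_xx` in the second
    -- current, which contains `f` alone.
    obtain ⟨z, hz, hw1, hw2, hw3, -, hv1, hv2, hv3, -⟩ :=
      exists_jet_values m σ z₀ 0 0 0 0 0 0 1 0
    have e3 := congrArg (fun Y => evalAt z (Y 1)) e2
    have t : ∀ A B : JetAlg Ω, consFlow m σ A B 1 = totD A := fun _ _ => rfl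
    simp only [Pi.add_apply, map_add, t,
      evalAt_brk_baseFlow_rv (hY 1) hw1 hw2 hv1 hv2 hw3,
      (evalAt_brk_consFlow_symmFlow hs hFp hw1 hw2 hv1 hv2).2 hw3,
      (lA.evalAt_totD hw1 hw2 hv1 hv2).2, (lA'.evalAt_totD hw1 hw2 hv1 hv2).2, map_mul,
      hw3, hv3, dv_rv, map_sub, map_ofNat, map_one, AlgHom.commutes, hz _ hf, hz _ hf',
      evalAt_compV, Algebra.algebraMap_self_apply] at e3
    have hmm : m - 2 ≠ 0 := sub_ne_zero.2 hm2
    have hm1 : m + 1 ≠ 0 := by linarith [Param.pos m σ]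
    -- The factors come from `2 - 2m + 4/m = -2 (m - 2) (m + 1) / m`.
    have e4 : (m - 2) * (m + 1) * (f (z₀.1 0 1) - f' (z₀.1 0 1)) = 0 := by
      field_simp at e3
      linear_combination 1 / 12 * e3
    exact sub_eq_zero.1 ((mul_eq_zero.1 e4).resolve_left (mul_ne_zero hmm hm1))

end

end

/-! ### The test symmetry and the action of the flow `(2,1)` on jets -/

section

attribute [-instance] instCharZeroOfIsSemireal IsStrictOrderedRing.toCharZero
  FloorSemiring.instCharZero NumberField.to_charZero SubsemiringClass.instCharZero

variable {Ω : Opens Pt} [hΩ : PosFst Ω] {m σ : ℝ} [hP : Param m σ]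

/-! ### Constraints at the first order -/

/-- With `g = 0` the condition on `μ` is the equation satisfied by `u^(m-1)`. The necessary
conditions are all extracted from this one symmetry, which leaves `v` at rest and keeps the
coefficient equations short. -/
lemma isSymm_phi : IsSymm m σ (phi m : JetAlg Ω) 0 where
  coef_fst := isCoef_phi m
  coef_snd := isCoef_zero
  dw_snd := map_zero _
  dv_fst := by rw [dv_phi]; ring

lemma totD_wj_one : totD (wj m σ 1 : JetAlg Ω) = wj m σ 2 := totD_wj 1

lemma totD_wj_two : totD (wj m σ 2 : JetAlg Ω) = wj m σ 3 := totD_wj 2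

lemma totD_wj_three : totD (wj m σ 3 : JetAlg Ω) = wj m σ 4 := totD_wj 3

lemma totD_vj_one : totD (vj 1 : JetAlg Ω) = vj 2 := totD_vj 1

lemma totD_vj_two : totD (vj 2 : JetAlg Ω) = vj 3 := totD_vj 2

lemma totD_vj_three : totD (vj 3 : JetAlg Ω) = vj 4 := totD_vj 3

/-- The velocity of `v` in the commutator with the flow `(2,1)`. -/
lemma evo_brk_baseFlow_rv (Q : Fin 2 → JetAlg Ω) : evo (brk (baseFlow m σ) Q) rv =
    evo (baseFlow m σ) (evo Q rv) - (evo Q rv * vj 1 + rv * totD (evo Q rv)) := by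
  rw [← evo_comm, evo_baseFlow_rv, Derivation.leibniz, evo_vj_one, smul_eq_mul, smul_eq_mul]
  ring

/-- The velocity of `w` in the commutator with the flow `(2,1)`. -/
lemma evo_brk_baseFlow_rw (Q : Fin 2 → JetAlg Ω) : evo (brk (baseFlow m σ) Q) (rw' m σ) =
    evo (baseFlow m σ) (evo Q (rw' m σ)) - ((algebraMap ℝ _ m * evo Q (rw' m σ) +
      (1 - algebraMap ℝ _ m) * evo Q rv) * wj m σ 1 + lam m σ * totD (evo Q (rw' m σ))) := by
  rw [← evo_comm, evo_baseFlow_rw, Derivation.leibniz, evo_wj_one, smul_eq_mul, smul_eq_mul,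
    grad_lam.evo]
  ring

variable (m σ) in
/-- The derivative along the flow `(2,1)` in the frame moving with the speed `v`. -/
def devV : Derivation ℝ (JetAlg Ω) (JetAlg Ω) := evo (baseFlow m σ) - (rv : JetAlg Ω) • totD

variable (m σ) in
/-- The derivative along the flow `(2,1)` in the frame moving with the speed `λ`. -/
def devW : Derivation ℝ (JetAlg Ω) (JetAlg Ω) := evo (baseFlow m σ) - (lam m σ : JetAlg Ω) • totD

lemma devV_apply (f : JetAlg Ω) : devV m σ f = evo (baseFlow m σ) f - rv * totD f := rfl

lemma devW_apply (f : JetAlg Ω) : devW m σ f = evo (baseFlow m σ) f - lam m σ * totD f := rfl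

lemma evo_brk_baseFlow_rv' (Q : Fin 2 → JetAlg Ω) : evo (brk (baseFlow m σ) Q) rv =
    devV m σ (evo Q rv) - evo Q rv * vj 1 := by
  rw [evo_brk_baseFlow_rv, devV_apply]; ring

lemma evo_brk_baseFlow_rw' (Q : Fin 2 → JetAlg Ω) : evo (brk (baseFlow m σ) Q) (rw' m σ) =
    devW m σ (evo Q (rw' m σ)) - (algebraMap ℝ _ m * evo Q (rw' m σ) +
      (1 - algebraMap ℝ _ m) * evo Q rv) * wj m σ 1 := by
  rw [evo_brk_baseFlow_rw, devW_apply]; ring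

lemma IsCoef.devV {f : JetAlg Ω} (hf : IsCoef f) :
    CoxeterFlow.devV m σ f = -(CoxeterFlow.dw m σ f * (rv - lam m σ) * wj m σ 1) := by
  rw [devV_apply, hf.evo (m := m) (σ := σ), hf.totD (m := m) (σ := σ), evo_baseFlow_rv,
    evo_baseFlow_rw]
  ring

lemma IsCoef.devW {f : JetAlg Ω} (hf : IsCoef f) :
    CoxeterFlow.devW m σ f = CoxeterFlow.dv m σ f * (rv - lam m σ) * vj 1 := by
  rw [devW_apply, hf.evo (m := m) (σ := σ), hf.totD (m := m) (σ := σ), evo_baseFlow_rv,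
    evo_baseFlow_rw]
  ring

lemma evo_baseFlow_vj_one : evo (baseFlow m σ) (vj 1 : JetAlg Ω) = rv * vj 2 + vj 1 ^ 2 := by
  rw [evo_vj_one, evo_baseFlow_rv, Derivation.leibniz, totD_rv, totD_vj_one]
  simp only [smul_eq_mul]; ring

lemma evo_baseFlow_vj_two : evo (baseFlow m σ) (vj 2 : JetAlg Ω) =
    rv * vj 3 + 3 * vj 1 * vj 2 := by
  rw [← totD_vj_one, evo_totD, evo_baseFlow_vj_one]
  simp only [Derivation.leibniz, Derivation.leibniz_pow, map_add, totD_rv, totD_vj_one,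
    totD_vj_two, smul_eq_mul, nsmul_eq_mul]
  push_cast; ring

lemma evo_baseFlow_vj_three : evo (baseFlow m σ) (vj 3 : JetAlg Ω) =
    rv * vj 4 + 4 * vj 1 * vj 3 + 3 * vj 2 ^ 2 := by
  rw [← totD_vj_two, evo_totD, evo_baseFlow_vj_two]
  simp only [Derivation.leibniz, map_ofNat_eq_zero, map_add, totD_rv, totD_vj_one,
    totD_vj_two, totD_vj_three, smul_eq_mul]
  ring

variable (m σ) in
/-- The derivatives of the speed `λ`. -/
def lamj (s : ℕ) : JetAlg Ω := algebraMap ℝ _ m * wj m σ s + (1 - algebraMap ℝ _ m) * vj s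

lemma totD_lam : totD (lam m σ : JetAlg Ω) = lamj m σ 1 := grad_lam.totD

lemma totD_lamj (s : ℕ) : totD (lamj m σ s : JetAlg Ω) = lamj m σ (s + 1) := by
  simp only [lamj, map_add, map_sub, Derivation.leibniz, Derivation.map_algebraMap,
    Derivation.map_one_eq_zero, totD_wj, totD_vj, smul_eq_mul, mul_zero, sub_zero, add_zero]

lemma evo_baseFlow_wj_one : evo (baseFlow m σ) (wj m σ 1 : JetAlg Ω) =
    lam m σ * wj m σ 2 + lamj m σ 1 * wj m σ 1 := by
  rw [evo_wj_one, evo_baseFlow_rw, Derivation.leibniz, totD_lam, totD_wj_one]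
  simp only [smul_eq_mul]; ring

lemma evo_baseFlow_wj_two : evo (baseFlow m σ) (wj m σ 2 : JetAlg Ω) =
    lam m σ * wj m σ 3 + 2 * lamj m σ 1 * wj m σ 2 + lamj m σ 2 * wj m σ 1 := by
  rw [← totD_wj_one, evo_totD, evo_baseFlow_wj_one]
  simp only [Derivation.leibniz, map_add, totD_lam, totD_lamj, totD_wj_one, totD_wj_two,
    smul_eq_mul]
  ring

lemma evo_baseFlow_wj_three : evo (baseFlow m σ) (wj m σ 3 : JetAlg Ω) =
    lam m σ * wj m σ 4 + 3 * lamj m σ 1 * wj m σ 3 + 3 * lamj m σ 2 * wj m σ 2 +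
      lamj m σ 3 * wj m σ 1 := by
  rw [← totD_wj_two, evo_totD, evo_baseFlow_wj_two]
  simp only [Derivation.leibniz, map_ofNat_eq_zero, map_add, totD_lam, totD_lamj, totD_wj_one,
    totD_wj_two, totD_wj_three, smul_eq_mul]
  ring

lemma devV_vj_one : devV m σ (vj 1 : JetAlg Ω) = vj 1 ^ 2 := by
  rw [devV_apply, evo_baseFlow_vj_one, totD_vj_one]; ring

lemma devV_vj_two : devV m σ (vj 2 : JetAlg Ω) = 3 * vj 1 * vj 2 := by
  rw [devV_apply, evo_baseFlow_vj_two, totD_vj_two]; ring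

lemma devV_vj_three : devV m σ (vj 3 : JetAlg Ω) = 4 * vj 1 * vj 3 + 3 * vj 2 ^ 2 := by
  rw [devV_apply, evo_baseFlow_vj_three, totD_vj_three]; ring

lemma devW_vj_one : devW m σ (vj 1 : JetAlg Ω) = (rv - lam m σ) * vj 2 + vj 1 ^ 2 := by
  rw [devW_apply, evo_baseFlow_vj_one, totD_vj_one]; ring

lemma devW_vj_two : devW m σ (vj 2 : JetAlg Ω) = (rv - lam m σ) * vj 3 + 3 * vj 1 * vj 2 := by
  rw [devW_apply, evo_baseFlow_vj_two, totD_vj_two]; ring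

lemma devW_vj_three : devW m σ (vj 3 : JetAlg Ω) =
    (rv - lam m σ) * vj 4 + 4 * vj 1 * vj 3 + 3 * vj 2 ^ 2 := by
  rw [devW_apply, evo_baseFlow_vj_three, totD_vj_three]; ring

lemma devW_wj_one : devW m σ (wj m σ 1 : JetAlg Ω) = lamj m σ 1 * wj m σ 1 := by
  rw [devW_apply, evo_baseFlow_wj_one, totD_wj_one]; ring

lemma devW_wj_two : devW m σ (wj m σ 2 : JetAlg Ω) =
    2 * lamj m σ 1 * wj m σ 2 + lamj m σ 2 * wj m σ 1 := by
  rw [devW_apply, evo_baseFlow_wj_two, totD_wj_two]; ring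

lemma devW_wj_three : devW m σ (wj m σ 3 : JetAlg Ω) = 3 * lamj m σ 1 * wj m σ 3 +
    3 * lamj m σ 2 * wj m σ 2 + lamj m σ 3 * wj m σ 1 := by
  rw [devW_apply, evo_baseFlow_wj_three, totD_wj_three]; ring

lemma devV_wj_one : devV m σ (wj m σ 1 : JetAlg Ω) =
    -((rv - lam m σ) * wj m σ 2) + lamj m σ 1 * wj m σ 1 := by
  rw [devV_apply, evo_baseFlow_wj_one, totD_wj_one]; ring

lemma devV_wj_two : devV m σ (wj m σ 2 : JetAlg Ω) = -((rv - lam m σ) * wj m σ 3) +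
    2 * lamj m σ 1 * wj m σ 2 + lamj m σ 2 * wj m σ 1 := by
  rw [devV_apply, evo_baseFlow_wj_two, totD_wj_two]; ring

lemma devV_wj_three : devV m σ (wj m σ 3 : JetAlg Ω) = -((rv - lam m σ) * wj m σ 4) +
    3 * lamj m σ 1 * wj m σ 3 + 3 * lamj m σ 2 * wj m σ 2 + lamj m σ 3 * wj m σ 1 := by
  rw [devV_apply, evo_baseFlow_wj_three, totD_wj_three]; ring

variable (m σ) in
/-- The jet over `z₀ 0` with the given derivatives of the Riemann invariants. -/
def jetAt (z₀ : JetDom Ω) (w₁ w₂ w₃ w₄ v₁ v₂ v₃ v₄ : ℝ) : JetDom Ω :=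
  (exists_jet_values m σ z₀ w₁ w₂ w₃ w₄ v₁ v₂ v₃ v₄).choose

section

variable (z₀ : JetDom Ω) (w₁ w₂ w₃ w₄ v₁ v₂ v₃ v₄ : ℝ)

local notation "jz" => jetAt m σ z₀ w₁ w₂ w₃ w₄ v₁ v₂ v₃ v₄

lemma IsCoef.evalAt_jetAt {f : JetAlg Ω} (hf : IsCoef f) : evalAt jz f = evalAt z₀ f :=
  (exists_jet_values m σ z₀ w₁ w₂ w₃ w₄ v₁ v₂ v₃ v₄).choose_spec.1 f hf

lemma jetAt_w₁ : evalAt jz (wj m σ 1) = w₁ :=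
  (exists_jet_values m σ z₀ w₁ w₂ w₃ w₄ v₁ v₂ v₃ v₄).choose_spec.2.1

lemma jetAt_w₂ : evalAt jz (wj m σ 2) = w₂ :=
  (exists_jet_values m σ z₀ w₁ w₂ w₃ w₄ v₁ v₂ v₃ v₄).choose_spec.2.2.1

lemma jetAt_w₃ : evalAt jz (wj m σ 3) = w₃ :=
  (exists_jet_values m σ z₀ w₁ w₂ w₃ w₄ v₁ v₂ v₃ v₄).choose_spec.2.2.2.1

lemma jetAt_w₄ : evalAt jz (wj m σ 4) = w₄ :=
  (exists_jet_values m σ z₀ w₁ w₂ w₃ w₄ v₁ v₂ v₃ v₄).choose_spec.2.2.2.2.1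

lemma jetAt_v₁ : evalAt jz (vj 1) = v₁ :=
  (exists_jet_values m σ z₀ w₁ w₂ w₃ w₄ v₁ v₂ v₃ v₄).choose_spec.2.2.2.2.2.1

lemma jetAt_v₂ : evalAt jz (vj 2) = v₂ :=
  (exists_jet_values m σ z₀ w₁ w₂ w₃ w₄ v₁ v₂ v₃ v₄).choose_spec.2.2.2.2.2.2.1

lemma jetAt_v₃ : evalAt jz (vj 3) = v₃ :=
  (exists_jet_values m σ z₀ w₁ w₂ w₃ w₄ v₁ v₂ v₃ v₄).choose_spec.2.2.2.2.2.2.2.1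

lemma jetAt_v₄ : evalAt jz (vj 4) = v₄ :=
  (exists_jet_values m σ z₀ w₁ w₂ w₃ w₄ v₁ v₂ v₃ v₄).choose_spec.2.2.2.2.2.2.2.2

end


end

/-! ### Elimination of the first correction of the test symmetry -/

section

attribute [-instance] instCharZeroOfIsSemireal IsStrictOrderedRing.toCharZero
  FloorSemiring.instCharZero NumberField.to_charZero SubsemiringClass.instCharZero

variable {Ω : Opens Pt} [hΩ : PosFst Ω] {m σ : ℝ} [hP : Param m σ]

lemma rv_sub_lam_mul_hinv : (rv - lam m σ) * hinv m σ = (algebraMap ℝ (JetAlg Ω) m) := by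
  rw [rv_sub_lam, mul_assoc, h_mul_hinv, mul_one]

lemma two_mul_cancel {f g : JetAlg Ω} (h : 2 * f = 2 * g) : f = g := JetAlg.ext_evalAt fun z => by
  have := congrArg (evalAt z) h
  simp only [map_mul, map_ofNat] at this
  linarith

set_option maxHeartbeats 1000000 in
/-- The constraints imposed at the first order by the symmetry `w_τ = φ w_x`, `v_τ = 0`. -/
theorem first_order {A B : JetAlg Ω} (hA : HP1 fieldFrame A) (hB : HP1 fieldFrame B)
    {Q : Fin 2 → JetAlg Ω} (hQ : ∀ i, HP2 fieldFrame (Q i))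
    (e : brk (baseFlow m σ) Q = brk (symmFlow m σ (phi m) 0) (consFlow m σ A B)) :
    ∃ c a d : JetAlg Ω, IsCoef c ∧ IsCoef a ∧ IsCoef d ∧ A = c * wj m σ 1 ∧
      B = (c - a) * wj m σ 1 + d * vj 1 ∧
      dv m σ a = (1 - algebraMap ℝ _ (1 / m)) * a * hinv m σ := by
  obtain ⟨c, b, hc, hb, eA⟩ := HP1.riemann (m := m) (σ := σ) hA
  obtain ⟨c', d, hc', hd, eB⟩ := HP1.riemann (m := m) (σ := σ) hB
  have h1 := hQ 1
  rw [← evo_rv Q] at h1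
  obtain ⟨q₁, q₂, q₃, q₄, q₅, hq₁, hq₂, hq₃, hq₄, hq₅, eq⟩ := HP2.riemann (m := m) (σ := σ) h1
  obtain ⟨p₁, p₂, p₃, p₄, p₅, hp₁, hp₂, hp₃, hp₄, hp₅, ep⟩ :=
    HP2.riemann (m := m) (σ := σ) (HP2.evo_rw (m := m) (σ := σ) hQ)
  rw [isSymm_phi.brk_consFlow] at e
  have e1 := congrArg (fun Y => evo Y rv) e
  have e2 := congrArg (fun Y => evo Y (rw' m σ)) e
  simp only [evo_brk_baseFlow_rv', evo_brk_baseFlow_rw', evo_consFlow_rv, evo_consFlow_rw]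
    at e1 e2
  have gp := grad_phi (Ω := Ω) (m := m) (σ := σ)
  have gi := grad_hinv (Ω := Ω) (m := m) (σ := σ)
  simp (maxDischargeDepth := 5) only [symmCurA, symmCurB, eA, eB, eq, ep, Derivation.leibniz, Derivation.leibniz_pow,
    map_add, map_sub, map_neg, map_zero, smul_eq_mul, nsmul_eq_mul, evo_vj_one, evo_wj_one,
    evo_symmFlow_rv, evo_symmFlow_rw, devV_vj_one, devV_vj_two, devV_wj_one, devV_wj_two,
    devW_vj_one, devW_vj_two, devW_wj_one, devW_wj_two, lamj,
    totD_wj_one, totD_wj_two, totD_vj_one, totD_vj_two, gp.evo, gp.totD,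
    gi.evo, gi.totD, IsCoef.devV, IsCoef.devW, IsCoef.evo (m := m) (σ := σ),
    IsCoef.totD (m := m) (σ := σ), hc, hb, hc', hd, hq₁, hq₂, hq₃, hq₄, hq₅, hp₁, hp₂, hp₃, hp₄,
    hp₅, IsCoef.dw, IsCoef.dv, Derivation.map_algebraMap,
    Derivation.map_one_eq_zero, zero_mul, mul_zero, zero_add, add_zero, sub_zero, zero_sub,
    Nat.reduceSub, pow_one, Nat.cast_ofNat]
    at e1 e2
  -- Both sides are homogeneous of degree three. Values at jets with prescribed derivatives, and
  -- differences of such values, extract the coefficients of monomials at the base point.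
  have E1 := fun z₀ w₁ w₂ w₃ v₁ v₂ v₃ => congrArg (evalAt (jetAt m σ z₀ w₁ w₂ w₃ 0 v₁ v₂ v₃ 0)) e1
  have E2 := fun z₀ w₁ w₂ w₃ v₁ v₂ v₃ => congrArg (evalAt (jetAt m σ z₀ w₁ w₂ w₃ 0 v₁ v₂ v₃ 0)) e2
  simp (maxDischargeDepth := 5) only [map_add, map_sub, map_neg, map_mul, map_pow, map_natCast, map_zero, map_one,
    map_ofNat, AlgHom.commutes, Algebra.algebraMap_self_apply, jetAt_w₁, jetAt_w₂, jetAt_w₃,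
    jetAt_v₁, jetAt_v₂, jetAt_v₃, IsCoef.evalAt_jetAt, isCoef_phi, isCoef_hinv, isCoef_rv,
    isCoef_lam, hc, hb, hc', hd, hq₁, hq₂, hq₃, hq₄, hq₅, hp₁, hp₂, hp₃, hp₄, hp₅, IsCoef.dw,
    IsCoef.dv] at E1 E2
  have hK := rv_sub_lam_mul_hinv (Ω := Ω) (m := m) (σ := σ)
  have hM := m_mul_inv (Ω := Ω) m σ
  have hMK : (rv - lam m σ) * (algebraMap ℝ _ (1 / m) * hinv m σ) = (1 : JetAlg Ω) := by
    linear_combination algebraMap ℝ _ (1 / m) * hK + hM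
  -- The coefficient of `v_xxx` in the `w`-equation.
  have H2 : p₂ = algebraMap ℝ _ (1 / m) * phi m * hinv m σ * (d - b) := by
    have : (rv - lam m σ) * p₂ = phi m * (d - b) := JetAlg.ext_evalAt fun z₀ => by
      simp only [map_mul, map_sub]
      linear_combination E2 z₀ 0 0 0 0 0 1
    linear_combination algebraMap ℝ _ (1 / m) * hinv m σ * this -
      algebraMap ℝ _ (1 / m) * p₂ * hK - p₂ * hM
  have H2v : dv m σ p₂ = algebraMap ℝ _ (1 / m) * phi m * hinv m σ *
      (-(algebraMap ℝ _ (1 / m) * hinv m σ * (d - b)) + dv m σ d - dv m σ b) := by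
    rw [H2]
    simp only [Derivation.leibniz, dv_phi, dv_hinv, Derivation.map_algebraMap, map_sub,
      smul_eq_mul, map_one]
    ring
  -- The coefficient of `v_x v_xx` in the `w`-equation, with `p₂` already known.
  have H5 : p₅ = algebraMap ℝ _ (1 / m) * phi m * hinv m σ * (dv m σ d - dv m σ b -
      hinv m σ * (d - algebraMap ℝ _ (1 / m) * b)) := by
    have : 2 * (rv - lam m σ) * p₅ = -(rv - lam m σ) * dv m σ p₂ - 3 * p₂ -
        phi m * (3 * (dv m σ b - dv m σ d) +
          2 * (1 - algebraMap ℝ _ (1 / m)) * hinv m σ * d) := JetAlg.ext_evalAt fun z₀ => by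
      simp only [map_mul, map_sub, map_neg, map_add, map_ofNat, map_one, AlgHom.commutes,
        Algebra.algebraMap_self_apply]
      linear_combination E2 z₀ 0 0 0 1 1 0 - E2 z₀ 0 0 0 1 0 0
    refine two_mul_cancel ?_
    linear_combination algebraMap ℝ _ (1 / m) * hinv m σ * this -
      2 * algebraMap ℝ _ (1 / m) * p₅ * hK - 2 * p₅ * hM -
      3 * algebraMap ℝ _ (1 / m) * hinv m σ * H2 -
      algebraMap ℝ _ (1 / m) * hinv m σ * (rv - lam m σ) * H2v -
      algebraMap ℝ _ (1 / m) ^ 2 * phi m * hinv m σ *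
      (-(algebraMap ℝ _ (1 / m) * hinv m σ * (d - b)) + dv m σ d - dv m σ b) * hK -
      algebraMap ℝ _ (1 / m) * phi m * hinv m σ *
      (-(algebraMap ℝ _ (1 / m) * hinv m σ * (d - b)) + dv m σ d - dv m σ b) * hM
  have H5v : dv m σ p₅ = algebraMap ℝ _ (1 / m) * phi m * hinv m σ *
      (-(algebraMap ℝ _ (1 / m) * hinv m σ) * (dv m σ d - dv m σ b -
      hinv m σ * (d - algebraMap ℝ _ (1 / m) * b)) + dv m σ (dv m σ d) - dv m σ (dv m σ b) +
      hinv m σ ^ 2 * (d - algebraMap ℝ _ (1 / m) * b) -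
      hinv m σ * (dv m σ d - algebraMap ℝ _ (1 / m) * dv m σ b)) := by
    rw [H5]
    simp only [Derivation.leibniz, dv_phi, dv_hinv, Derivation.map_algebraMap, map_sub,
      smul_eq_mul, map_one]
    ring
  -- The coefficient of `v_x³` overdetermines `p₅`. The terms in `d` cancel and a multiple of `b`
  -- remains, with factor containing `1 - 1/m`; it is nonzero because `m > 1`.
  have hb0 : b = 0 := by
    have : algebraMap ℝ _ (1 / m) * (1 - algebraMap ℝ _ (1 / m)) * phi m * hinv m σ ^ 2 * b = 0 := by
      have : (rv - lam m σ) * dv m σ p₅ + 2 * p₅ = phi m * (dv m σ (dv m σ d) - dv m σ (dv m σ b) -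
          (1 - algebraMap ℝ _ (1 / m)) * (hinv m σ * dv m σ d - hinv m σ ^ 2 * d)) :=
        JetAlg.ext_evalAt fun z₀ => by
        simp only [map_mul, map_sub, map_neg, map_add, map_ofNat, map_one, map_pow,
          AlgHom.commutes, Algebra.algebraMap_self_apply]
        linear_combination E2 z₀ 0 0 0 1 0 0
      rw [H5v, H5] at this
      linear_combination -this + (-(algebraMap ℝ _ (1 / m) * hinv m σ) * (dv m σ d - dv m σ b -
      hinv m σ * (d - algebraMap ℝ _ (1 / m) * b)) + dv m σ (dv m σ d) - dv m σ (dv m σ b) +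
      hinv m σ ^ 2 * (d - algebraMap ℝ _ (1 / m) * b) -
      hinv m σ * (dv m σ d - algebraMap ℝ _ (1 / m) * dv m σ b)) * phi m * hMK
    refine JetAlg.ext_evalAt fun z => ?_
    have h0 := congrArg (evalAt z) this
    simp only [map_mul, map_pow, map_sub, map_one, map_zero, AlgHom.commutes,
      Algebra.algebraMap_self_apply] at h0 ⊢
    have hm1 := hP.one_lt
    refine (mul_eq_zero.1 h0).resolve_left ?_
    refine mul_ne_zero (mul_ne_zero (mul_ne_zero (by positivity) (sub_ne_zero.2 ?_))
      (phi_ne z)) (pow_ne_zero 2 (hinv_ne z))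
    rw [ne_eq, eq_comm, div_eq_one_iff_eq (by positivity)]
    exact hm1.ne
  subst hb0
  simp only [map_zero, mul_zero, zero_mul, add_zero, zero_add, sub_zero] at E2
  -- The coefficient of `w_xxx` in the `v`-equation; it enters the `w`-equation through the
  -- dependence of `λ` on `v`.
  have J1 : q₁ = -(algebraMap ℝ _ (1 / m) * phi m * hinv m σ * c) := by
    have : -((rv - lam m σ) * q₁) = c * phi m := JetAlg.ext_evalAt fun z₀ => by
      simp only [map_mul, map_sub, map_neg]
      linear_combination E1 z₀ 0 0 1 0 0 0
    linear_combination -(algebraMap ℝ _ (1 / m) * hinv m σ) * this - q₁ * hMK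
  -- The coefficient of `w_x w_xx` in the `w`-equation.
  have H1 : p₁ = -(algebraMap ℝ _ (1 / m) * (1 - algebraMap ℝ _ (1 / m)) * phi m * hinv m σ *
      (c - c')) := by
    refine two_mul_cancel ?_
    have : 2 * algebraMap ℝ _ m * p₁ = (1 - algebraMap ℝ _ m) * q₁ -
        (1 - algebraMap ℝ _ (1 / m)) * phi m * hinv m σ * (2 * (c - c') + c) :=
        JetAlg.ext_evalAt fun z₀ => by
      simp only [map_mul, map_sub, map_neg, map_add, map_ofNat, map_one, AlgHom.commutes,
        Algebra.algebraMap_self_apply]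
      linear_combination E2 z₀ 1 1 0 0 0 0 - E2 z₀ 1 0 0 0 0 0
    linear_combination algebraMap ℝ _ (1 / m) * this - 2 * p₁ * hM +
      algebraMap ℝ _ (1 / m) * (1 - algebraMap ℝ _ m) * J1 +
      algebraMap ℝ _ (1 / m) * phi m * hinv m σ * c * hM
  have H1v : dv m σ p₁ = -(algebraMap ℝ _ (1 / m) * (1 - algebraMap ℝ _ (1 / m)) * phi m *
      hinv m σ * (dv m σ c - dv m σ c' - algebraMap ℝ _ (1 / m) * hinv m σ * (c - c'))) := by
    rw [H1]
    simp only [Derivation.leibniz, dv_phi, dv_hinv, Derivation.map_algebraMap, map_sub, map_neg,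
      smul_eq_mul, map_one, Derivation.map_one_eq_zero]
    ring
  refine ⟨c, c - c', d, hc, hc.sub hc', hd, by rw [eA]; ring, by rw [eB]; ring, ?_⟩
  -- The coefficient of `v_x w_xx` in the `w`-equation; with `p₁` inserted it becomes a transport
  -- equation in `v` for `c - c'`.
  have : (rv - lam m σ) * dv m σ p₁ + 2 * (1 - algebraMap ℝ _ m) * p₁ =
      (1 - algebraMap ℝ _ (1 / m)) * phi m * hinv m σ * 2 * (c - c') -
        phi m * (dv m σ c - dv m σ c') := JetAlg.ext_evalAt fun z₀ => by
    simp only [map_mul, map_sub, map_neg, map_add, map_ofNat, map_one, AlgHom.commutes,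
      Algebra.algebraMap_self_apply]
    linear_combination E2 z₀ 0 1 0 1 0 0 - E2 z₀ 0 0 0 1 0 0
  rw [H1v, H1] at this
  have key : algebraMap ℝ _ (1 / m) * phi m * (dv m σ (c - c') -
      (1 - algebraMap ℝ _ (1 / m)) * (c - c') * hinv m σ) = 0 := by
    rw [map_sub]
    linear_combination this + (1 - algebraMap ℝ _ (1 / m)) * phi m *
      (dv m σ c - dv m σ c' - algebraMap ℝ _ (1 / m) * hinv m σ * (c - c')) * hMK -
      2 * (1 - algebraMap ℝ _ (1 / m)) * phi m * hinv m σ * (c - c') * hM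
  refine JetAlg.ext_evalAt fun z => ?_
  have h0 := congrArg (evalAt z) key
  rw [map_mul, map_mul, map_sub, map_zero, AlgHom.commutes, Algebra.algebraMap_self_apply] at h0
  have hm1 := hP.one_lt
  exact sub_eq_zero.1 ((mul_eq_zero.1 h0).resolve_left
    (mul_ne_zero (by positivity) (phi_ne z)))

end

/-! ### Absence of symmetries of degree two -/

section

attribute [-instance] instCharZeroOfIsSemireal IsStrictOrderedRing.toCharZero
  FloorSemiring.instCharZero NumberField.to_charZero SubsemiringClass.instCharZero

variable {Ω : Opens Pt} [hΩ : PosFst Ω] {m σ : ℝ} [hP : Param m σ]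

lemma rv_sub_lam_mul_inv :
    (rv - lam m σ) * (algebraMap ℝ _ (1 / m) * hinv m σ) = (1 : JetAlg Ω) := by
  linear_combination algebraMap ℝ _ (1 / m) * rv_sub_lam_mul_hinv (Ω := Ω) (m := m) (σ := σ) +
    m_mul_inv (Ω := Ω) m σ

lemma eq_zero_of_mul {f g : JetAlg Ω} (hf : ∀ z, evalAt z f ≠ 0) (h : f * g = 0) : g = 0 :=
  JetAlg.ext_evalAt fun z => by
    have h0 := congrArg (evalAt z) h
    rw [map_mul, map_zero] at h0
    rw [(mul_eq_zero.1 h0).resolve_left (hf z), map_zero]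

lemma eq_zero_of_rv_sub_lam_mul {f : JetAlg Ω} (h : (rv - lam m σ) * f = 0) : f = 0 :=
  eq_zero_of_mul evalAt_rv_sub_lam_ne h

lemma eq_zero_of_algebraMap_mul {c : ℝ} (hc : c ≠ 0) {f : JetAlg Ω}
    (h : algebraMap ℝ _ c * f = 0) : f = 0 :=
  eq_zero_of_mul (fun z => by rwa [AlgHom.commutes]) h

lemma eq_zero_of_ofNat_mul {c : ℕ} [c.AtLeastTwo] {f : JetAlg Ω}
    (h : (OfNat.ofNat c : JetAlg Ω) * f = 0) : f = 0 :=
  eq_zero_of_mul (fun z => by rw [map_ofNat]; exact NeZero.ne _) h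

variable (m σ) in
lemma eq_zero_of_unit_mul (a b c : ℕ) {f : JetAlg Ω}
    (h : algebraMap ℝ _ (1 / m) ^ a * phi m ^ b * hinv m σ ^ c * f = 0) : f = 0 :=
  eq_zero_of_mul (fun z => by
    rw [map_mul, map_mul, map_pow, map_pow, map_pow, AlgHom.commutes]
    exact mul_ne_zero (mul_ne_zero (pow_ne_zero _ (one_div_ne_zero (Param.pos m σ).ne'))
      (pow_ne_zero _ (phi_ne z))) (pow_ne_zero _ (hinv_ne z))) h

set_option maxHeartbeats 1000000 in
-- On derivatives of `w` the operator `devV` raises the order with the factor `λ - v`, which is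
-- never zero; on derivatives of `v` it acts on the top terms by positive integers that exceed the
-- weight of the subtracted `v_x`. The coefficients are killed one after another.
lemma eq_zero_of_devV {q₁ q₂ q₃ q₄ q₅ : JetAlg Ω} (hq₁ : IsCoef q₁) (hq₂ : IsCoef q₂) (hq₃ : IsCoef q₃) (hq₄ : IsCoef q₄) (hq₅ : IsCoef q₅)
    (e : devV m σ (q₁ * wj m σ 2 + q₂ * vj 2 + q₃ * wj m σ 1 ^ 2 + q₄ * wj m σ 1 * vj 1 + q₅ * vj 1 ^ 2) -
      (q₁ * wj m σ 2 + q₂ * vj 2 + q₃ * wj m σ 1 ^ 2 + q₄ * wj m σ 1 * vj 1 + q₅ * vj 1 ^ 2) * vj 1 = 0) :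
    q₁ = 0 ∧ q₂ = 0 ∧ q₃ = 0 ∧ q₄ = 0 ∧ q₅ = 0 := by
  have gp := grad_phi (Ω := Ω) (m := m) (σ := σ)
  have gi := grad_hinv (Ω := Ω) (m := m) (σ := σ)
  simp (maxDischargeDepth := 6) only [symmCurA, symmCurB, Derivation.leibniz, Derivation.leibniz_pow,
    map_add, map_sub, map_neg, map_zero, smul_eq_mul, nsmul_eq_mul, evo_vj_one, evo_wj_one,
    evo_vj_two, evo_wj_two, evo_symmFlow_rv, evo_symmFlow_rw, devV_vj_one, devV_vj_two,
    devV_vj_three, devV_wj_one, devV_wj_two, devV_wj_three, devW_vj_one, devW_vj_two,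
    devW_vj_three, devW_wj_one, devW_wj_two, devW_wj_three, lamj, totD_wj_one, totD_wj_two,
    totD_wj_three, totD_vj_one, totD_vj_two, totD_vj_three, gp.evo, gp.totD, gi.evo, gi.totD,
    IsCoef.devV, IsCoef.devW, IsCoef.evo (m := m) (σ := σ), IsCoef.totD (m := m) (σ := σ),
    hq₁, hq₂, hq₃, hq₄, hq₅, IsCoef.dw, IsCoef.dv, Derivation.map_algebraMap,
    Derivation.map_one_eq_zero, map_ofNat_eq_zero, zero_mul, mul_zero, zero_add, add_zero,
    sub_zero, zero_sub,
    Nat.reduceSub, pow_one, Nat.cast_ofNat] at e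
  have E := fun z₀ w₁ w₂ w₃ w₄ v₁ v₂ v₃ v₄ =>
    congrArg (evalAt (jetAt m σ z₀ w₁ w₂ w₃ w₄ v₁ v₂ v₃ v₄)) e
  simp (maxDischargeDepth := 6) only [map_add, map_sub, map_neg, map_mul, map_pow, map_zero,
    map_one, map_ofNat, AlgHom.commutes, Algebra.algebraMap_self_apply, jetAt_w₁, jetAt_w₂,
    jetAt_w₃, jetAt_w₄, jetAt_v₁, jetAt_v₂, jetAt_v₃, jetAt_v₄, IsCoef.evalAt_jetAt, isCoef_phi,
    isCoef_hinv, isCoef_rv, isCoef_lam, hq₁, hq₂, hq₃, hq₄, hq₅, IsCoef.dw, IsCoef.dv] at E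
  obtain rfl : q₁ = 0 := eq_zero_of_rv_sub_lam_mul (m := m) (σ := σ) <| JetAlg.ext_evalAt fun z₀ => by
    simp only [map_mul, map_sub, map_zero, map_one, AlgHom.commutes, Algebra.algebraMap_self_apply]
    linear_combination (-1) * (E z₀ 0 0 1 0 0 0 0 0)
  simp only [map_zero, mul_zero, zero_mul, add_zero, zero_add, sub_zero, zero_sub, neg_zero] at E
  obtain rfl : q₃ = 0 := eq_zero_of_rv_sub_lam_mul (m := m) (σ := σ) <| JetAlg.ext_evalAt fun z₀ => by
    simp only [map_mul, map_sub, map_zero, map_one, AlgHom.commutes, Algebra.algebraMap_self_apply]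
    linear_combination (-1/2) * (E z₀ 1 1 0 0 0 0 0 0 - E z₀ 1 0 0 0 0 0 0 0)
  simp only [map_zero, mul_zero, zero_mul, add_zero, zero_add, sub_zero, zero_sub, neg_zero] at E
  obtain rfl : q₄ = 0 := eq_zero_of_rv_sub_lam_mul (m := m) (σ := σ) <| JetAlg.ext_evalAt fun z₀ => by
    simp only [map_mul, map_sub, map_zero, map_one, AlgHom.commutes, Algebra.algebraMap_self_apply]
    linear_combination (-1) * (E z₀ 0 1 0 0 1 0 0 0 - E z₀ 0 0 0 0 1 0 0 0)
  simp only [map_zero, mul_zero, zero_mul, add_zero, zero_add, sub_zero, zero_sub, neg_zero] at E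
  obtain rfl : q₂ = 0 := eq_zero_of_mul (f := 1) (fun z => by rw [map_one]; exact one_ne_zero) <| JetAlg.ext_evalAt fun z₀ => by
    simp only [map_mul, map_sub, map_zero, map_one, AlgHom.commutes, Algebra.algebraMap_self_apply]
    linear_combination (1/2) * (E z₀ 0 0 0 0 1 1 0 0 - E z₀ 0 0 0 0 1 0 0 0)
  simp only [map_zero, mul_zero, zero_mul, add_zero, zero_add, sub_zero, zero_sub, neg_zero] at E
  obtain rfl : q₅ = 0 := eq_zero_of_mul (f := 1) (fun z => by rw [map_one]; exact one_ne_zero) <| JetAlg.ext_evalAt fun z₀ => by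
    simp only [map_mul, map_sub, map_zero, map_one, AlgHom.commutes, Algebra.algebraMap_self_apply]
    linear_combination (1) * (E z₀ 0 0 0 0 1 0 0 0)
  simp only [map_zero, mul_zero, zero_mul, add_zero, zero_add, sub_zero, zero_sub, neg_zero] at E
  exact ⟨rfl, rfl, rfl, rfl, rfl⟩

set_option maxHeartbeats 1000000 in
-- The mirror image of `eq_zero_of_devV`: the factor `v - λ` eliminates the monomials containing
-- derivatives of `v`, and positive multiples of `m` eliminate those in `w` alone.
lemma eq_zero_of_devW {p₁ p₂ p₃ p₄ p₅ : JetAlg Ω} (hp₁ : IsCoef p₁) (hp₂ : IsCoef p₂) (hp₃ : IsCoef p₃) (hp₄ : IsCoef p₄) (hp₅ : IsCoef p₅)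
    (e : devW m σ (p₁ * wj m σ 2 + p₂ * vj 2 + p₃ * wj m σ 1 ^ 2 + p₄ * wj m σ 1 * vj 1 + p₅ * vj 1 ^ 2) -
      (algebraMap ℝ _ m * (p₁ * wj m σ 2 + p₂ * vj 2 + p₃ * wj m σ 1 ^ 2 + p₄ * wj m σ 1 * vj 1 + p₅ * vj 1 ^ 2) +
        (1 - algebraMap ℝ _ m) * 0) * wj m σ 1 = 0) :
    p₁ = 0 ∧ p₂ = 0 ∧ p₃ = 0 ∧ p₄ = 0 ∧ p₅ = 0 := by
  have gp := grad_phi (Ω := Ω) (m := m) (σ := σ)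
  have gi := grad_hinv (Ω := Ω) (m := m) (σ := σ)
  simp (maxDischargeDepth := 6) only [symmCurA, symmCurB, Derivation.leibniz, Derivation.leibniz_pow,
    map_add, map_sub, map_neg, map_zero, smul_eq_mul, nsmul_eq_mul, evo_vj_one, evo_wj_one,
    evo_vj_two, evo_wj_two, evo_symmFlow_rv, evo_symmFlow_rw, devV_vj_one, devV_vj_two,
    devV_vj_three, devV_wj_one, devV_wj_two, devV_wj_three, devW_vj_one, devW_vj_two,
    devW_vj_three, devW_wj_one, devW_wj_two, devW_wj_three, lamj, totD_wj_one, totD_wj_two,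
    totD_wj_three, totD_vj_one, totD_vj_two, totD_vj_three, gp.evo, gp.totD, gi.evo, gi.totD,
    IsCoef.devV, IsCoef.devW, IsCoef.evo (m := m) (σ := σ), IsCoef.totD (m := m) (σ := σ),
    hp₁, hp₂, hp₃, hp₄, hp₅, IsCoef.dw, IsCoef.dv, Derivation.map_algebraMap,
    Derivation.map_one_eq_zero, map_ofNat_eq_zero, zero_mul, mul_zero, zero_add, add_zero,
    sub_zero, zero_sub,
    Nat.reduceSub, pow_one, Nat.cast_ofNat] at e
  have E := fun z₀ w₁ w₂ w₃ w₄ v₁ v₂ v₃ v₄ =>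
    congrArg (evalAt (jetAt m σ z₀ w₁ w₂ w₃ w₄ v₁ v₂ v₃ v₄)) e
  simp (maxDischargeDepth := 6) only [map_add, map_sub, map_neg, map_mul, map_pow, map_zero,
    map_one, map_ofNat, AlgHom.commutes, Algebra.algebraMap_self_apply, jetAt_w₁, jetAt_w₂,
    jetAt_w₃, jetAt_w₄, jetAt_v₁, jetAt_v₂, jetAt_v₃, jetAt_v₄, IsCoef.evalAt_jetAt, isCoef_phi,
    isCoef_hinv, isCoef_rv, isCoef_lam, hp₁, hp₂, hp₃, hp₄, hp₅, IsCoef.dw, IsCoef.dv] at E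
  obtain rfl : p₂ = 0 := eq_zero_of_rv_sub_lam_mul (m := m) (σ := σ) <| JetAlg.ext_evalAt fun z₀ => by
    simp only [map_mul, map_sub, map_zero, map_one, AlgHom.commutes, Algebra.algebraMap_self_apply]
    linear_combination (1) * (E z₀ 0 0 0 0 0 0 1 0)
  simp only [map_zero, mul_zero, zero_mul, add_zero, zero_add, sub_zero, zero_sub, neg_zero] at E
  obtain rfl : p₅ = 0 := eq_zero_of_rv_sub_lam_mul (m := m) (σ := σ) <| JetAlg.ext_evalAt fun z₀ => by
    simp only [map_mul, map_sub, map_zero, map_one, AlgHom.commutes, Algebra.algebraMap_self_apply]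
    linear_combination (1/2) * (E z₀ 0 0 0 0 1 1 0 0 - E z₀ 0 0 0 0 1 0 0 0)
  simp only [map_zero, mul_zero, zero_mul, add_zero, zero_add, sub_zero, zero_sub, neg_zero] at E
  obtain rfl : p₁ = 0 := eq_zero_of_algebraMap_mul (Param.pos m σ).ne' <| JetAlg.ext_evalAt fun z₀ => by
    simp only [map_mul, map_sub, map_zero, map_one, AlgHom.commutes, Algebra.algebraMap_self_apply]
    linear_combination (1/2) * (E z₀ 1 1 0 0 0 0 0 0 - E z₀ 1 0 0 0 0 0 0 0)
  simp only [map_zero, mul_zero, zero_mul, add_zero, zero_add, sub_zero, zero_sub, neg_zero] at E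
  obtain rfl : p₄ = 0 := eq_zero_of_rv_sub_lam_mul (m := m) (σ := σ) <| JetAlg.ext_evalAt fun z₀ => by
    simp only [map_mul, map_sub, map_zero, map_one, AlgHom.commutes, Algebra.algebraMap_self_apply]
    linear_combination (1) * (E z₀ 1 0 0 0 0 1 0 0 - E z₀ 1 0 0 0 0 0 0 0)
  simp only [map_zero, mul_zero, zero_mul, add_zero, zero_add, sub_zero, zero_sub, neg_zero] at E
  obtain rfl : p₃ = 0 := eq_zero_of_algebraMap_mul (Param.pos m σ).ne' <| JetAlg.ext_evalAt fun z₀ => by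
    simp only [map_mul, map_sub, map_zero, map_one, AlgHom.commutes, Algebra.algebraMap_self_apply]
    linear_combination (1) * (E z₀ 1 0 0 0 0 0 0 0)
  simp only [map_zero, mul_zero, zero_mul, add_zero, zero_add, sub_zero, zero_sub, neg_zero] at E
  exact ⟨rfl, rfl, rfl, rfl, rfl⟩

/-- The flow `(2,1)` has no symmetries of degree two. -/
theorem eq_zero_of_brk_baseFlow {Q : Fin 2 → JetAlg Ω} (hQ : ∀ i, HP2 fieldFrame (Q i))
    (e : brk (baseFlow m σ) Q = 0) : Q = 0 := by
  have h1 := hQ 1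
  rw [← evo_rv Q] at h1
  obtain ⟨q₁, q₂, q₃, q₄, q₅, hq₁, hq₂, hq₃, hq₄, hq₅, eq⟩ := HP2.riemann (m := m) (σ := σ) h1
  obtain ⟨p₁, p₂, p₃, p₄, p₅, hp₁, hp₂, hp₃, hp₄, hp₅, ep⟩ :=
    HP2.riemann (m := m) (σ := σ) (HP2.evo_rw (m := m) (σ := σ) hQ)
  have e1 := congrArg (fun Y => evo Y rv) e
  have e2 := congrArg (fun Y => evo Y (rw' m σ)) e
  simp only [evo_brk_baseFlow_rv', evo_brk_baseFlow_rw', evo_zero] at e1 e2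
  rw [eq] at e1
  -- The `v`-equation decouples, so the `v`-component vanishes first and then disappears from the
  -- `w`-equation.
  obtain ⟨rfl, rfl, rfl, rfl, rfl⟩ := eq_zero_of_devV hq₁ hq₂ hq₃ hq₄ hq₅ e1
  have eq0 : evo Q rv = 0 := by rw [eq]; ring
  rw [ep, eq0] at e2
  obtain ⟨rfl, rfl, rfl, rfl, rfl⟩ := eq_zero_of_devW hp₁ hp₂ hp₃ hp₄ hp₅ e2
  refine frame_ext (m := m) (σ := σ) ?_ ?_
  · rw [ep, evo_zero]; ring
  · rw [eq0, evo_zero]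

end

/-! ### Coefficient equations for the second correction of the test symmetry -/

section

attribute [-instance] instCharZeroOfIsSemireal IsStrictOrderedRing.toCharZero
  FloorSemiring.instCharZero NumberField.to_charZero SubsemiringClass.instCharZero

variable {Ω : Opens Pt} [hΩ : PosFst Ω] {m σ : ℝ} [hP : Param m σ]

/-! ### Constraints at the second order -/

section

set_option maxHeartbeats 2000000 in
-- The monomials `w_xxxx` and `v_x v_xxx` do not occur on the right, which forces `r₁ = r₂ = 0`. The
-- coefficient of `w_x v_xxx` then consists of `φ ∂_w a₂` alone.
lemma dw_eq_zero_of_devV {r₁ r₂ r₃ r₄ r₅ r₆ r₇ r₈ r₉ r₀ a₂ a₃ a₄ : JetAlg Ω} (hr₁ : IsCoef r₁) (hr₂ : IsCoef r₂) (hr₃ : IsCoef r₃) (hr₄ : IsCoef r₄) (hr₅ : IsCoef r₅) (hr₆ : IsCoef r₆) (hr₇ : IsCoef r₇) (hr₈ : IsCoef r₈) (hr₉ : IsCoef r₉) (hr₀ : IsCoef r₀)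
    (ha₂ : IsCoef a₂) (ha₃ : IsCoef a₃) (ha₄ : IsCoef a₄)
    (e : devV m σ (r₁ * wj m σ 3 + r₂ * vj 3 + r₃ * wj m σ 1 * wj m σ 2 + r₄ * vj 1 * wj m σ 2 + r₅ * wj m σ 1 * vj 2 +
      r₆ * vj 1 * vj 2 + r₇ * wj m σ 1 ^ 3 + r₈ * wj m σ 1 ^ 2 * vj 1 + r₉ * wj m σ 1 * vj 1 ^ 2 +
      r₀ * vj 1 ^ 3) -
      (r₁ * wj m σ 3 + r₂ * vj 3 + r₃ * wj m σ 1 * wj m σ 2 + r₄ * vj 1 * wj m σ 2 + r₅ * wj m σ 1 * vj 2 +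
      r₆ * vj 1 * vj 2 + r₇ * wj m σ 1 ^ 3 + r₈ * wj m σ 1 ^ 2 * vj 1 + r₉ * wj m σ 1 * vj 1 ^ 2 +
      r₀ * vj 1 ^ 3) * vj 1 =
      totD (symmCurA m σ (phi m) 0 (a₂ * vj 2 + a₃ * wj m σ 1 ^ 2 + a₄ * wj m σ 1 * vj 1))) :
    r₁ = 0 ∧ dw m σ a₂ = 0 := by
  have gp := grad_phi (Ω := Ω) (m := m) (σ := σ)
  have gi := grad_hinv (Ω := Ω) (m := m) (σ := σ)
  simp (maxDischargeDepth := 6) only [symmCurA, symmCurB, Derivation.leibniz, Derivation.leibniz_pow,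
    map_add, map_sub, map_neg, map_zero, smul_eq_mul, nsmul_eq_mul, evo_vj_one, evo_wj_one,
    evo_vj_two, evo_wj_two, evo_symmFlow_rv, evo_symmFlow_rw, devV_vj_one, devV_vj_two,
    devV_vj_three, devV_wj_one, devV_wj_two, devV_wj_three, devW_vj_one, devW_vj_two,
    devW_vj_three, devW_wj_one, devW_wj_two, devW_wj_three, lamj, totD_wj_one, totD_wj_two,
    totD_wj_three, totD_vj_one, totD_vj_two, totD_vj_three, gp.evo, gp.totD, gi.evo, gi.totD,
    IsCoef.devV, IsCoef.devW, IsCoef.evo (m := m) (σ := σ), IsCoef.totD (m := m) (σ := σ),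
    hr₁, hr₂, hr₃, hr₄, hr₅, hr₆, hr₇, hr₈, hr₉, hr₀, ha₂, ha₃, ha₄, IsCoef.dw, IsCoef.dv, Derivation.map_algebraMap,
    Derivation.map_one_eq_zero, map_ofNat_eq_zero, zero_mul, mul_zero, zero_add, add_zero,
    sub_zero, zero_sub,
    Nat.reduceSub, pow_one, Nat.cast_ofNat] at e
  have E := fun z₀ w₁ w₂ w₃ w₄ v₁ v₂ v₃ v₄ =>
    congrArg (evalAt (jetAt m σ z₀ w₁ w₂ w₃ w₄ v₁ v₂ v₃ v₄)) e
  simp (maxDischargeDepth := 6) only [map_add, map_sub, map_neg, map_mul, map_pow, map_zero,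
    map_one, map_ofNat, AlgHom.commutes, Algebra.algebraMap_self_apply, jetAt_w₁, jetAt_w₂,
    jetAt_w₃, jetAt_w₄, jetAt_v₁, jetAt_v₂, jetAt_v₃, jetAt_v₄, IsCoef.evalAt_jetAt, isCoef_phi,
    isCoef_hinv, isCoef_rv, isCoef_lam, hr₁, hr₂, hr₃, hr₄, hr₅, hr₆, hr₇, hr₈, hr₉, hr₀, ha₂, ha₃, ha₄, IsCoef.dw, IsCoef.dv] at E
  have hK := rv_sub_lam_mul_hinv (Ω := Ω) (m := m) (σ := σ)
  have hM := m_mul_inv (Ω := Ω) m σ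
  have hMK := rv_sub_lam_mul_inv (Ω := Ω) (m := m) (σ := σ)
  obtain rfl : r₁ = 0 := eq_zero_of_rv_sub_lam_mul (m := m) (σ := σ) <| JetAlg.ext_evalAt fun z₀ => by
    simp only [map_mul, map_sub, map_zero, map_one, AlgHom.commutes, Algebra.algebraMap_self_apply]
    linear_combination (-1) * (E z₀ 0 0 0 1 0 0 0 0)
  simp only [map_zero, mul_zero, zero_mul, add_zero, zero_add, sub_zero, zero_sub, neg_zero] at E
  obtain rfl : r₂ = 0 := eq_zero_of_mul (f := 1) (fun z => by rw [map_one]; exact one_ne_zero) <| JetAlg.ext_evalAt fun z₀ => by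
    simp only [map_mul, map_sub, map_zero, map_one, AlgHom.commutes, Algebra.algebraMap_self_apply]
    linear_combination (1/3) * (E z₀ 0 0 0 0 1 0 1 0 - E z₀ 0 0 0 0 1 0 0 0)
  simp only [map_zero, mul_zero, zero_mul, add_zero, zero_add, sub_zero, zero_sub, neg_zero] at E
  refine ⟨rfl, eq_zero_of_mul (f := phi m) phi_ne (JetAlg.ext_evalAt fun z₀ => ?_)⟩
  simp only [map_mul, map_zero]
  linear_combination -(E z₀ 1 0 0 0 0 0 1 0 - E z₀ 1 0 0 0 0 0 0 0)

set_option maxHeartbeats 2000000 in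
-- The coefficient of `w_x w_xxx` determines `s₁` from `b₁`, and that of `v_x w_xxx` then yields a
-- transport equation in `v`. The vanishing of `r₁` keeps the `v`-component of the unknown
-- correction out of the first of these.
lemma dv_eq_of_devW {s₁ s₂ s₃ s₄ s₅ s₆ s₇ s₈ s₉ s₀ r₁ r₂ r₃ r₄ r₅ r₆ r₇ r₈ r₉ r₀ a₂ a₃ a₄ b₁ b₄ b₅ : JetAlg Ω} (hs₁ : IsCoef s₁) (hs₂ : IsCoef s₂) (hs₃ : IsCoef s₃) (hs₄ : IsCoef s₄) (hs₅ : IsCoef s₅) (hs₆ : IsCoef s₆) (hs₇ : IsCoef s₇) (hs₈ : IsCoef s₈) (hs₉ : IsCoef s₉) (hs₀ : IsCoef s₀) (hr₁ : IsCoef r₁) (hr₂ : IsCoef r₂) (hr₃ : IsCoef r₃) (hr₄ : IsCoef r₄) (hr₅ : IsCoef r₅) (hr₆ : IsCoef r₆) (hr₇ : IsCoef r₇) (hr₈ : IsCoef r₈) (hr₉ : IsCoef r₉) (hr₀ : IsCoef r₀)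
    (ha₂ : IsCoef a₂) (ha₃ : IsCoef a₃) (ha₄ : IsCoef a₄) (hb₁ : IsCoef b₁) (hb₄ : IsCoef b₄)
    (hb₅ : IsCoef b₅) (hr : r₁ = 0)
    (e : devW m σ (s₁ * wj m σ 3 + s₂ * vj 3 + s₃ * wj m σ 1 * wj m σ 2 + s₄ * vj 1 * wj m σ 2 + s₅ * wj m σ 1 * vj 2 +
      s₆ * vj 1 * vj 2 + s₇ * wj m σ 1 ^ 3 + s₈ * wj m σ 1 ^ 2 * vj 1 + s₉ * wj m σ 1 * vj 1 ^ 2 +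
      s₀ * vj 1 ^ 3) -
      (algebraMap ℝ _ m * (s₁ * wj m σ 3 + s₂ * vj 3 + s₃ * wj m σ 1 * wj m σ 2 + s₄ * vj 1 * wj m σ 2 + s₅ * wj m σ 1 * vj 2 +
      s₆ * vj 1 * vj 2 + s₇ * wj m σ 1 ^ 3 + s₈ * wj m σ 1 ^ 2 * vj 1 + s₉ * wj m σ 1 * vj 1 ^ 2 +
      s₀ * vj 1 ^ 3) +
        (1 - algebraMap ℝ _ m) * (r₁ * wj m σ 3 + r₂ * vj 3 + r₃ * wj m σ 1 * wj m σ 2 + r₄ * vj 1 * wj m σ 2 + r₅ * wj m σ 1 * vj 2 +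
      r₆ * vj 1 * vj 2 + r₇ * wj m σ 1 ^ 3 + r₈ * wj m σ 1 ^ 2 * vj 1 + r₉ * wj m σ 1 * vj 1 ^ 2 +
      r₀ * vj 1 ^ 3)) * wj m σ 1 =
      totD (symmCurA m σ (phi m) 0 (a₂ * vj 2 + a₃ * wj m σ 1 ^ 2 + a₄ * wj m σ 1 * vj 1)) -
        totD (symmCurB m σ (phi m) 0 (a₂ * vj 2 + a₃ * wj m σ 1 ^ 2 + a₄ * wj m σ 1 * vj 1)
          (b₁ * wj m σ 2 + b₄ * wj m σ 1 * vj 1 + b₅ * vj 1 ^ 2)) +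
        algebraMap ℝ _ (1 - 1 / m) *
          symmCurB m σ (phi m) 0 (a₂ * vj 2 + a₃ * wj m σ 1 ^ 2 + a₄ * wj m σ 1 * vj 1)
          (b₁ * wj m σ 2 + b₄ * wj m σ 1 * vj 1 + b₅ * vj 1 ^ 2) * (vj 1 - wj m σ 1) * hinv m σ) :
    dv m σ b₁ = 2 * (1 - algebraMap ℝ _ (1 / m)) * hinv m σ * b₁ := by
  subst hr
  have gp := grad_phi (Ω := Ω) (m := m) (σ := σ)
  have gi := grad_hinv (Ω := Ω) (m := m) (σ := σ)
  simp (maxDischargeDepth := 6) only [symmCurA, symmCurB, Derivation.leibniz, Derivation.leibniz_pow,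
    map_add, map_sub, map_neg, map_zero, smul_eq_mul, nsmul_eq_mul, evo_vj_one, evo_wj_one,
    evo_vj_two, evo_wj_two, evo_symmFlow_rv, evo_symmFlow_rw, devV_vj_one, devV_vj_two,
    devV_vj_three, devV_wj_one, devV_wj_two, devV_wj_three, devW_vj_one, devW_vj_two,
    devW_vj_three, devW_wj_one, devW_wj_two, devW_wj_three, lamj, totD_wj_one, totD_wj_two,
    totD_wj_three, totD_vj_one, totD_vj_two, totD_vj_three, gp.evo, gp.totD, gi.evo, gi.totD,
    IsCoef.devV, IsCoef.devW, IsCoef.evo (m := m) (σ := σ), IsCoef.totD (m := m) (σ := σ),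
    hs₁, hs₂, hs₃, hs₄, hs₅, hs₆, hs₇, hs₈, hs₉, hs₀, hr₁, hr₂, hr₃, hr₄, hr₅, hr₆, hr₇, hr₈, hr₉, hr₀, ha₂, ha₃, ha₄, hb₁, hb₄, hb₅, IsCoef.dw, IsCoef.dv, Derivation.map_algebraMap,
    Derivation.map_one_eq_zero, map_ofNat_eq_zero, zero_mul, mul_zero, zero_add, add_zero,
    sub_zero, zero_sub,
    Nat.reduceSub, pow_one, Nat.cast_ofNat] at e
  have E := fun z₀ w₁ w₂ w₃ w₄ v₁ v₂ v₃ v₄ =>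
    congrArg (evalAt (jetAt m σ z₀ w₁ w₂ w₃ w₄ v₁ v₂ v₃ v₄)) e
  simp (maxDischargeDepth := 6) only [map_add, map_sub, map_neg, map_mul, map_pow, map_zero,
    map_one, map_ofNat, AlgHom.commutes, Algebra.algebraMap_self_apply, jetAt_w₁, jetAt_w₂,
    jetAt_w₃, jetAt_w₄, jetAt_v₁, jetAt_v₂, jetAt_v₃, jetAt_v₄, IsCoef.evalAt_jetAt, isCoef_phi,
    isCoef_hinv, isCoef_rv, isCoef_lam, hs₁, hs₂, hs₃, hs₄, hs₅, hs₆, hs₇, hs₈, hs₉, hs₀, hr₁, hr₂, hr₃, hr₄, hr₅, hr₆, hr₇, hr₈, hr₉, hr₀, ha₂, ha₃, ha₄, hb₁, hb₄, hb₅, IsCoef.dw, IsCoef.dv] at E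
  have hK := rv_sub_lam_mul_hinv (Ω := Ω) (m := m) (σ := σ)
  have hM := m_mul_inv (Ω := Ω) m σ
  have hMK := rv_sub_lam_mul_inv (Ω := Ω) (m := m) (σ := σ)
  have T₁ : 3 * (algebraMap ℝ _ m * s₁) = 3 * ((1 - algebraMap ℝ _ (1 / m)) * phi m * hinv m σ * b₁) := JetAlg.ext_evalAt fun z₀ => by
      simp only [map_mul, map_sub, map_neg, map_add, map_ofNat, map_one, map_pow, map_zero,
        AlgHom.commutes, Algebra.algebraMap_self_apply]
      linear_combination E z₀ 1 0 1 0 0 0 0 0 - E z₀ 1 0 0 0 0 0 0 0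
  have H₁ : s₁ = algebraMap ℝ _ (1 / m) * (1 - algebraMap ℝ _ (1 / m)) * phi m * hinv m σ * b₁ := by
    refine sub_eq_zero.1 (eq_zero_of_ofNat_mul (c := 3) ?_)
    linear_combination algebraMap ℝ _ (1 / m) * T₁ - 3 * s₁ * hM
  have H₁v : dv m σ s₁ = algebraMap ℝ _ (1 / m) * (1 - algebraMap ℝ _ (1 / m)) * phi m * hinv m σ * (dv m σ b₁ - algebraMap ℝ _ (1 / m) * hinv m σ * b₁) := by
    rw [H₁]
    simp only [Derivation.leibniz, dv_phi, dv_hinv, Derivation.map_algebraMap, map_add, map_sub,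
      map_neg, map_ofNat_eq_zero, smul_eq_mul, map_one, Derivation.map_one_eq_zero]
    ring
  have T₂ : (rv - lam m σ) * dv m σ s₁ + 3 * (1 - algebraMap ℝ _ m) * s₁ = phi m * dv m σ b₁ - 3 * (1 - algebraMap ℝ _ (1 / m)) * phi m * hinv m σ * b₁ := JetAlg.ext_evalAt fun z₀ => by
      simp only [map_mul, map_sub, map_neg, map_add, map_ofNat, map_one, map_pow, map_zero,
        AlgHom.commutes, Algebra.algebraMap_self_apply]
      linear_combination E z₀ 0 0 1 0 1 0 0 0 - E z₀ 0 0 0 0 1 0 0 0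
  rw [H₁v, H₁] at T₂
  refine sub_eq_zero.1 (eq_zero_of_unit_mul m σ 1 1 0 ?_)
  linear_combination -T₂ + (1 - algebraMap ℝ _ (1 / m)) * phi m * (dv m σ b₁ - algebraMap ℝ _ (1 / m) * hinv m σ * b₁) * hMK - 3 * (1 - algebraMap ℝ _ (1 / m)) * phi m * hinv m σ * b₁ * hM

set_option maxHeartbeats 2000000 in
-- For `a₃`, the monomials `w_x w_xxx` and `w_x² w_xx` determine `r₃` and `r₇`, and `w_x⁴` then
-- leaves a nonzero multiple of `a₃`. For `a₄`, the monomials `v_x w_xxx` and `w_xx v_xx` determine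
-- `r₄` and `r₅`, and `w_x v_x v_xx` leaves a nonzero multiple of `a₄`.
lemma eq_zero_of_devV_quadratic {r₁ r₂ r₃ r₄ r₅ r₆ r₇ r₈ r₉ r₀ a₃ a₄ : JetAlg Ω} (hr₁ : IsCoef r₁) (hr₂ : IsCoef r₂) (hr₃ : IsCoef r₃) (hr₄ : IsCoef r₄) (hr₅ : IsCoef r₅) (hr₆ : IsCoef r₆) (hr₇ : IsCoef r₇) (hr₈ : IsCoef r₈) (hr₉ : IsCoef r₉) (hr₀ : IsCoef r₀)
    (ha₃ : IsCoef a₃) (ha₄ : IsCoef a₄)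
    (e : devV m σ (r₁ * wj m σ 3 + r₂ * vj 3 + r₃ * wj m σ 1 * wj m σ 2 + r₄ * vj 1 * wj m σ 2 + r₅ * wj m σ 1 * vj 2 +
      r₆ * vj 1 * vj 2 + r₇ * wj m σ 1 ^ 3 + r₈ * wj m σ 1 ^ 2 * vj 1 + r₉ * wj m σ 1 * vj 1 ^ 2 +
      r₀ * vj 1 ^ 3) -
      (r₁ * wj m σ 3 + r₂ * vj 3 + r₃ * wj m σ 1 * wj m σ 2 + r₄ * vj 1 * wj m σ 2 + r₅ * wj m σ 1 * vj 2 +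
      r₆ * vj 1 * vj 2 + r₇ * wj m σ 1 ^ 3 + r₈ * wj m σ 1 ^ 2 * vj 1 + r₉ * wj m σ 1 * vj 1 ^ 2 +
      r₀ * vj 1 ^ 3) * vj 1 =
      totD (symmCurA m σ (phi m) 0 (a₃ * wj m σ 1 ^ 2 + a₄ * wj m σ 1 * vj 1))) :
    a₃ = 0 ∧ a₄ = 0 := by
  have gp := grad_phi (Ω := Ω) (m := m) (σ := σ)
  have gi := grad_hinv (Ω := Ω) (m := m) (σ := σ)
  simp (maxDischargeDepth := 6) only [symmCurA, symmCurB, Derivation.leibniz, Derivation.leibniz_pow,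
    map_add, map_sub, map_neg, map_zero, smul_eq_mul, nsmul_eq_mul, evo_vj_one, evo_wj_one,
    evo_vj_two, evo_wj_two, evo_symmFlow_rv, evo_symmFlow_rw, devV_vj_one, devV_vj_two,
    devV_vj_three, devV_wj_one, devV_wj_two, devV_wj_three, devW_vj_one, devW_vj_two,
    devW_vj_three, devW_wj_one, devW_wj_two, devW_wj_three, lamj, totD_wj_one, totD_wj_two,
    totD_wj_three, totD_vj_one, totD_vj_two, totD_vj_three, gp.evo, gp.totD, gi.evo, gi.totD,
    IsCoef.devV, IsCoef.devW, IsCoef.evo (m := m) (σ := σ), IsCoef.totD (m := m) (σ := σ),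
    hr₁, hr₂, hr₃, hr₄, hr₅, hr₆, hr₇, hr₈, hr₉, hr₀, ha₃, ha₄, IsCoef.dw, IsCoef.dv, Derivation.map_algebraMap,
    Derivation.map_one_eq_zero, map_ofNat_eq_zero, zero_mul, mul_zero, zero_add, add_zero,
    sub_zero, zero_sub,
    Nat.reduceSub, pow_one, Nat.cast_ofNat] at e
  have E := fun z₀ w₁ w₂ w₃ w₄ v₁ v₂ v₃ v₄ =>
    congrArg (evalAt (jetAt m σ z₀ w₁ w₂ w₃ w₄ v₁ v₂ v₃ v₄)) e
  simp (maxDischargeDepth := 6) only [map_add, map_sub, map_neg, map_mul, map_pow, map_zero,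
    map_one, map_ofNat, AlgHom.commutes, Algebra.algebraMap_self_apply, jetAt_w₁, jetAt_w₂,
    jetAt_w₃, jetAt_w₄, jetAt_v₁, jetAt_v₂, jetAt_v₃, jetAt_v₄, IsCoef.evalAt_jetAt, isCoef_phi,
    isCoef_hinv, isCoef_rv, isCoef_lam, hr₁, hr₂, hr₃, hr₄, hr₅, hr₆, hr₇, hr₈, hr₉, hr₀, ha₃, ha₄, IsCoef.dw, IsCoef.dv] at E
  have hK := rv_sub_lam_mul_hinv (Ω := Ω) (m := m) (σ := σ)
  have hM := m_mul_inv (Ω := Ω) m σ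
  have hMK := rv_sub_lam_mul_inv (Ω := Ω) (m := m) (σ := σ)
  obtain rfl : r₁ = 0 := eq_zero_of_rv_sub_lam_mul (m := m) (σ := σ) <| JetAlg.ext_evalAt fun z₀ => by
    simp only [map_mul, map_sub, map_zero, map_one, AlgHom.commutes, Algebra.algebraMap_self_apply]
    linear_combination (-1) * (E z₀ 0 0 0 1 0 0 0 0)
  simp only [map_zero, mul_zero, zero_mul, add_zero, zero_add, sub_zero, zero_sub, neg_zero] at E
  obtain rfl : r₂ = 0 := eq_zero_of_mul (f := 1) (fun z => by rw [map_one]; exact one_ne_zero) <| JetAlg.ext_evalAt fun z₀ => by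
    simp only [map_mul, map_sub, map_zero, map_one, AlgHom.commutes, Algebra.algebraMap_self_apply]
    linear_combination (1/3) * (E z₀ 0 0 0 0 1 0 1 0 - E z₀ 0 0 0 0 1 0 0 0)
  simp only [map_zero, mul_zero, zero_mul, add_zero, zero_add, sub_zero, zero_sub, neg_zero] at E
  have T₃ : -((rv - lam m σ) * r₃) = 2 * phi m * a₃ := JetAlg.ext_evalAt fun z₀ => by
      simp only [map_mul, map_sub, map_neg, map_add, map_ofNat, map_one, map_pow, map_zero,
        AlgHom.commutes, Algebra.algebraMap_self_apply]
      linear_combination E z₀ 1 0 1 0 0 0 0 0 - E z₀ 1 0 0 0 0 0 0 0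
  have H₃ : r₃ = -(2 * algebraMap ℝ _ (1 / m) * phi m * hinv m σ * a₃) := by
    linear_combination -(algebraMap ℝ _ (1 / m) * hinv m σ) * T₃ - r₃ * hMK
  have H₃w : dw m σ r₃ = -(2 * algebraMap ℝ _ (1 / m) * phi m * hinv m σ * (dw m σ a₃ + algebraMap ℝ _ (1 / m) * hinv m σ * a₃)) := by
    rw [H₃]
    simp only [Derivation.leibniz, dw_phi, dw_hinv, Derivation.map_algebraMap, map_add, map_sub,
      map_neg, map_ofNat_eq_zero, smul_eq_mul, map_one, Derivation.map_one_eq_zero]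
    ring
  have T₇ : 4 * algebraMap ℝ _ m * r₃ - (rv - lam m σ) * dw m σ r₃ - 3 * (rv - lam m σ) * r₇ = phi m * (5 * dw m σ a₃ - 8 * (1 - algebraMap ℝ _ (1 / m)) * hinv m σ * a₃) := JetAlg.ext_evalAt fun z₀ => by
      simp only [map_mul, map_sub, map_neg, map_add, map_ofNat, map_one, map_pow, map_zero,
        AlgHom.commutes, Algebra.algebraMap_self_apply]
      linear_combination E z₀ 1 1 0 0 0 0 0 0 - E z₀ 1 0 0 0 0 0 0 0 - E z₀ 0 1 0 0 0 0 0 0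
  have H₇ : r₇ = -(algebraMap ℝ _ (1 / m) * phi m * hinv m σ * (2 * algebraMap ℝ _ (1 / m) * hinv m σ * a₃ + dw m σ a₃)) := by
    refine sub_eq_zero.1 (eq_zero_of_ofNat_mul (c := 3) ?_)
    linear_combination -(algebraMap ℝ _ (1 / m) * hinv m σ) * T₇ - 3 * r₇ * hMK + 4 * algebraMap ℝ _ m * algebraMap ℝ _ (1 / m) * hinv m σ * H₃ -
      algebraMap ℝ _ (1 / m) * hinv m σ * (rv - lam m σ) * H₃w - 8 * algebraMap ℝ _ (1 / m) * phi m * hinv m σ ^ 2 * a₃ * hM +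
      2 * algebraMap ℝ _ (1 / m) * phi m * hinv m σ * (dw m σ a₃ + algebraMap ℝ _ (1 / m) * hinv m σ * a₃) * hMK
  have H₇w : dw m σ r₇ = -(algebraMap ℝ _ (1 / m) * phi m * hinv m σ * (algebraMap ℝ _ (1 / m) * hinv m σ * (2 * algebraMap ℝ _ (1 / m) * hinv m σ * a₃ + dw m σ a₃) + (2 * algebraMap ℝ _ (1 / m) * hinv m σ ^ 2 * a₃ + 2 * algebraMap ℝ _ (1 / m) * hinv m σ * dw m σ a₃ + dw m σ (dw m σ a₃)))) := by
    rw [H₇]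
    simp only [Derivation.leibniz, dw_phi, dw_hinv, Derivation.map_algebraMap, map_add, map_sub,
      map_neg, map_ofNat_eq_zero, smul_eq_mul, map_one, Derivation.map_one_eq_zero]
    ring
  have T₈ : -((rv - lam m σ) * dw m σ r₇) + 3 * algebraMap ℝ _ m * r₇ = phi m * (-((1 - algebraMap ℝ _ (1 / m)) * hinv m σ * (dw m σ a₃ - 2 * (1 - algebraMap ℝ _ (1 / m)) * hinv m σ * a₃)) + dw m σ (dw m σ a₃) - 2 * (1 - algebraMap ℝ _ (1 / m)) * hinv m σ ^ 2 * a₃ - 2 * (1 - algebraMap ℝ _ (1 / m)) * hinv m σ * dw m σ a₃) := JetAlg.ext_evalAt fun z₀ => by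
      simp only [map_mul, map_sub, map_neg, map_add, map_ofNat, map_one, map_pow, map_zero,
        AlgHom.commutes, Algebra.algebraMap_self_apply]
      linear_combination E z₀ 1 0 0 0 0 0 0 0
  obtain rfl : a₃ = 0 := by
    rw [H₇w, H₇] at T₈
    refine eq_zero_of_ofNat_mul (c := 2) (eq_zero_of_unit_mul m σ 1 1 2 ?_)
    linear_combination -T₈ + phi m * (algebraMap ℝ _ (1 / m) * hinv m σ * (2 * algebraMap ℝ _ (1 / m) * hinv m σ * a₃ + dw m σ a₃) + (2 * algebraMap ℝ _ (1 / m) * hinv m σ ^ 2 * a₃ + 2 * algebraMap ℝ _ (1 / m) * hinv m σ * dw m σ a₃ + dw m σ (dw m σ a₃))) * hMK - 3 * phi m * hinv m σ * (2 * algebraMap ℝ _ (1 / m) * hinv m σ * a₃ + dw m σ a₃) * hM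
  simp only [map_zero, mul_zero, zero_mul, add_zero, zero_add, sub_zero, zero_sub, neg_zero] at E
  obtain rfl : r₆ = 0 := eq_zero_of_mul (f := 1) (fun z => by rw [map_one]; exact one_ne_zero) <| JetAlg.ext_evalAt fun z₀ => by
    simp only [map_mul, map_sub, map_zero, map_one, AlgHom.commutes, Algebra.algebraMap_self_apply]
    linear_combination (1/3) * (E z₀ 0 0 0 0 1 1 0 0 - E z₀ 0 0 0 0 1 0 0 0 - E z₀ 0 0 0 0 0 1 0 0)
  simp only [map_zero, mul_zero, zero_mul, add_zero, zero_add, sub_zero, zero_sub, neg_zero] at E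
  have T₄ : -((rv - lam m σ) * r₄) = phi m * a₄ := JetAlg.ext_evalAt fun z₀ => by
      simp only [map_mul, map_sub, map_neg, map_add, map_ofNat, map_one, map_pow, map_zero,
        AlgHom.commutes, Algebra.algebraMap_self_apply]
      linear_combination E z₀ 0 0 1 0 1 0 0 0 - E z₀ 0 0 0 0 1 0 0 0
  have T₅ : -((rv - lam m σ) * r₅) = phi m * a₄ := JetAlg.ext_evalAt fun z₀ => by
      simp only [map_mul, map_sub, map_neg, map_add, map_ofNat, map_one, map_pow, map_zero,
        AlgHom.commutes, Algebra.algebraMap_self_apply]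
      linear_combination E z₀ 0 1 0 0 0 1 0 0 - E z₀ 0 1 0 0 0 0 0 0 - E z₀ 0 0 0 0 0 1 0 0
  have H₄ : r₄ = -(algebraMap ℝ _ (1 / m) * phi m * hinv m σ * a₄) := by
    linear_combination -(algebraMap ℝ _ (1 / m) * hinv m σ) * T₄ - r₄ * hMK
  have H₅ : r₅ = -(algebraMap ℝ _ (1 / m) * phi m * hinv m σ * a₄) := by
    linear_combination -(algebraMap ℝ _ (1 / m) * hinv m σ) * T₅ - r₅ * hMK
  have T₆ : (1 - algebraMap ℝ _ m) * r₄ + (3 - algebraMap ℝ _ m) * r₅ = 2 * (1 - algebraMap ℝ _ (1 / m)) * phi m * hinv m σ * a₄ := JetAlg.ext_evalAt fun z₀ => by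
      simp only [map_mul, map_sub, map_neg, map_add, map_ofNat, map_one, map_pow, map_zero,
        AlgHom.commutes, Algebra.algebraMap_self_apply]
      linear_combination E z₀ 1 0 0 0 1 1 0 0 - E z₀ 1 0 0 0 1 0 0 0 - E z₀ 1 0 0 0 0 1 0 0 - E z₀ 0 0 0 0 1 1 0 0 + E z₀ 1 0 0 0 0 0 0 0 + E z₀ 0 0 0 0 1 0 0 0 + E z₀ 0 0 0 0 0 1 0 0
  rw [H₄, H₅] at T₆
  refine ⟨rfl, eq_zero_of_ofNat_mul (c := 2) (eq_zero_of_unit_mul m σ 1 1 1 ?_)⟩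
  linear_combination -T₆ + 2 * phi m * hinv m σ * a₄ * hM

set_option maxHeartbeats 2000000 in
-- The elimination of `eq_zero_of_devV` one degree higher: `v - λ` removes the monomials containing
-- derivatives of `w`, and the factors `3`, `3`, `2` remove `v_xxx`, `v_x v_xx`, `v_x³`.
lemma eq_zero_of_devV_cubic {r₁ r₂ r₃ r₄ r₅ r₆ r₇ r₈ r₉ r₀ : JetAlg Ω} (hr₁ : IsCoef r₁) (hr₂ : IsCoef r₂) (hr₃ : IsCoef r₃) (hr₄ : IsCoef r₄) (hr₅ : IsCoef r₅) (hr₆ : IsCoef r₆) (hr₇ : IsCoef r₇) (hr₈ : IsCoef r₈) (hr₉ : IsCoef r₉) (hr₀ : IsCoef r₀)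
    (e : devV m σ (r₁ * wj m σ 3 + r₂ * vj 3 + r₃ * wj m σ 1 * wj m σ 2 + r₄ * vj 1 * wj m σ 2 + r₅ * wj m σ 1 * vj 2 +
      r₆ * vj 1 * vj 2 + r₇ * wj m σ 1 ^ 3 + r₈ * wj m σ 1 ^ 2 * vj 1 + r₉ * wj m σ 1 * vj 1 ^ 2 +
      r₀ * vj 1 ^ 3) -
      (r₁ * wj m σ 3 + r₂ * vj 3 + r₃ * wj m σ 1 * wj m σ 2 + r₄ * vj 1 * wj m σ 2 + r₅ * wj m σ 1 * vj 2 +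
      r₆ * vj 1 * vj 2 + r₇ * wj m σ 1 ^ 3 + r₈ * wj m σ 1 ^ 2 * vj 1 + r₉ * wj m σ 1 * vj 1 ^ 2 +
      r₀ * vj 1 ^ 3) * vj 1 = 0) :
    r₁ * wj m σ 3 + r₂ * vj 3 + r₃ * wj m σ 1 * wj m σ 2 + r₄ * vj 1 * wj m σ 2 + r₅ * wj m σ 1 * vj 2 +
      r₆ * vj 1 * vj 2 + r₇ * wj m σ 1 ^ 3 + r₈ * wj m σ 1 ^ 2 * vj 1 + r₉ * wj m σ 1 * vj 1 ^ 2 +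
      r₀ * vj 1 ^ 3 = 0 := by
  have gp := grad_phi (Ω := Ω) (m := m) (σ := σ)
  have gi := grad_hinv (Ω := Ω) (m := m) (σ := σ)
  simp (maxDischargeDepth := 6) only [symmCurA, symmCurB, Derivation.leibniz, Derivation.leibniz_pow,
    map_add, map_sub, map_neg, map_zero, smul_eq_mul, nsmul_eq_mul, evo_vj_one, evo_wj_one,
    evo_vj_two, evo_wj_two, evo_symmFlow_rv, evo_symmFlow_rw, devV_vj_one, devV_vj_two,
    devV_vj_three, devV_wj_one, devV_wj_two, devV_wj_three, devW_vj_one, devW_vj_two,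
    devW_vj_three, devW_wj_one, devW_wj_two, devW_wj_three, lamj, totD_wj_one, totD_wj_two,
    totD_wj_three, totD_vj_one, totD_vj_two, totD_vj_three, gp.evo, gp.totD, gi.evo, gi.totD,
    IsCoef.devV, IsCoef.devW, IsCoef.evo (m := m) (σ := σ), IsCoef.totD (m := m) (σ := σ),
    hr₁, hr₂, hr₃, hr₄, hr₅, hr₆, hr₇, hr₈, hr₉, hr₀, IsCoef.dw, IsCoef.dv, Derivation.map_algebraMap,
    Derivation.map_one_eq_zero, map_ofNat_eq_zero, zero_mul, mul_zero, zero_add, add_zero,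
    sub_zero, zero_sub,
    Nat.reduceSub, pow_one, Nat.cast_ofNat] at e
  have E := fun z₀ w₁ w₂ w₃ w₄ v₁ v₂ v₃ v₄ =>
    congrArg (evalAt (jetAt m σ z₀ w₁ w₂ w₃ w₄ v₁ v₂ v₃ v₄)) e
  simp (maxDischargeDepth := 6) only [map_add, map_sub, map_neg, map_mul, map_pow, map_zero,
    map_one, map_ofNat, AlgHom.commutes, Algebra.algebraMap_self_apply, jetAt_w₁, jetAt_w₂,
    jetAt_w₃, jetAt_w₄, jetAt_v₁, jetAt_v₂, jetAt_v₃, jetAt_v₄, IsCoef.evalAt_jetAt, isCoef_phi,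
    isCoef_hinv, isCoef_rv, isCoef_lam, hr₁, hr₂, hr₃, hr₄, hr₅, hr₆, hr₇, hr₈, hr₉, hr₀, IsCoef.dw, IsCoef.dv] at E
  obtain rfl : r₁ = 0 := eq_zero_of_rv_sub_lam_mul (m := m) (σ := σ) <| JetAlg.ext_evalAt fun z₀ => by
    simp only [map_mul, map_sub, map_zero, map_one, AlgHom.commutes, Algebra.algebraMap_self_apply]
    linear_combination (-1) * (E z₀ 0 0 0 1 0 0 0 0)
  simp only [map_zero, mul_zero, zero_mul, add_zero, zero_add, sub_zero, zero_sub, neg_zero] at E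
  obtain rfl : r₃ = 0 := eq_zero_of_rv_sub_lam_mul (m := m) (σ := σ) <| JetAlg.ext_evalAt fun z₀ => by
    simp only [map_mul, map_sub, map_zero, map_one, AlgHom.commutes, Algebra.algebraMap_self_apply]
    linear_combination (-1) * (E z₀ 1 0 1 0 0 0 0 0 - E z₀ 1 0 0 0 0 0 0 0)
  simp only [map_zero, mul_zero, zero_mul, add_zero, zero_add, sub_zero, zero_sub, neg_zero] at E
  obtain rfl : r₇ = 0 := eq_zero_of_rv_sub_lam_mul (m := m) (σ := σ) <| JetAlg.ext_evalAt fun z₀ => by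
    simp only [map_mul, map_sub, map_zero, map_one, AlgHom.commutes, Algebra.algebraMap_self_apply]
    linear_combination (-1/3) * (E z₀ 1 1 0 0 0 0 0 0 - E z₀ 1 0 0 0 0 0 0 0 - E z₀ 0 1 0 0 0 0 0 0)
  simp only [map_zero, mul_zero, zero_mul, add_zero, zero_add, sub_zero, zero_sub, neg_zero] at E
  obtain rfl : r₄ = 0 := eq_zero_of_rv_sub_lam_mul (m := m) (σ := σ) <| JetAlg.ext_evalAt fun z₀ => by
    simp only [map_mul, map_sub, map_zero, map_one, AlgHom.commutes, Algebra.algebraMap_self_apply]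
    linear_combination (-1) * (E z₀ 0 0 1 0 1 0 0 0 - E z₀ 0 0 0 0 1 0 0 0)
  simp only [map_zero, mul_zero, zero_mul, add_zero, zero_add, sub_zero, zero_sub, neg_zero] at E
  obtain rfl : r₅ = 0 := eq_zero_of_rv_sub_lam_mul (m := m) (σ := σ) <| JetAlg.ext_evalAt fun z₀ => by
    simp only [map_mul, map_sub, map_zero, map_one, AlgHom.commutes, Algebra.algebraMap_self_apply]
    linear_combination (-1) * (E z₀ 0 1 0 0 0 1 0 0 - E z₀ 0 1 0 0 0 0 0 0 - E z₀ 0 0 0 0 0 1 0 0)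
  simp only [map_zero, mul_zero, zero_mul, add_zero, zero_add, sub_zero, zero_sub, neg_zero] at E
  obtain rfl : r₈ = 0 := eq_zero_of_rv_sub_lam_mul (m := m) (σ := σ) <| JetAlg.ext_evalAt fun z₀ => by
    simp only [map_mul, map_sub, map_zero, map_one, AlgHom.commutes, Algebra.algebraMap_self_apply]
    linear_combination (-1/2) * (E z₀ 1 1 0 0 1 0 0 0 - E z₀ 1 1 0 0 0 0 0 0 - E z₀ 1 0 0 0 1 0 0 0 - E z₀ 0 1 0 0 1 0 0 0 + E z₀ 1 0 0 0 0 0 0 0 + E z₀ 0 1 0 0 0 0 0 0 + E z₀ 0 0 0 0 1 0 0 0)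
  simp only [map_zero, mul_zero, zero_mul, add_zero, zero_add, sub_zero, zero_sub, neg_zero] at E
  obtain rfl : r₉ = 0 := eq_zero_of_rv_sub_lam_mul (m := m) (σ := σ) <| JetAlg.ext_evalAt fun z₀ => by
    simp only [map_mul, map_sub, map_zero, map_one, AlgHom.commutes, Algebra.algebraMap_self_apply]
    linear_combination (-1) * (E z₀ 0 1 0 0 1 0 0 0 - E z₀ 0 0 0 0 1 0 0 0 - E z₀ 0 1 0 0 0 0 0 0)
  simp only [map_zero, mul_zero, zero_mul, add_zero, zero_add, sub_zero, zero_sub, neg_zero] at E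
  obtain rfl : r₂ = 0 := eq_zero_of_mul (f := 1) (fun z => by rw [map_one]; exact one_ne_zero) <| JetAlg.ext_evalAt fun z₀ => by
    simp only [map_mul, map_sub, map_zero, map_one, AlgHom.commutes, Algebra.algebraMap_self_apply]
    linear_combination (1/3) * (E z₀ 0 0 0 0 1 0 1 0 - E z₀ 0 0 0 0 1 0 0 0)
  simp only [map_zero, mul_zero, zero_mul, add_zero, zero_add, sub_zero, zero_sub, neg_zero] at E
  obtain rfl : r₆ = 0 := eq_zero_of_mul (f := 1) (fun z => by rw [map_one]; exact one_ne_zero) <| JetAlg.ext_evalAt fun z₀ => by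
    simp only [map_mul, map_sub, map_zero, map_one, AlgHom.commutes, Algebra.algebraMap_self_apply]
    linear_combination (1/3) * (E z₀ 0 0 0 0 1 1 0 0 - E z₀ 0 0 0 0 1 0 0 0 - E z₀ 0 0 0 0 0 1 0 0)
  simp only [map_zero, mul_zero, zero_mul, add_zero, zero_add, sub_zero, zero_sub, neg_zero] at E
  obtain rfl : r₀ = 0 := eq_zero_of_mul (f := 1) (fun z => by rw [map_one]; exact one_ne_zero) <| JetAlg.ext_evalAt fun z₀ => by
    simp only [map_mul, map_sub, map_zero, map_one, AlgHom.commutes, Algebra.algebraMap_self_apply]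
    linear_combination (1/2) * (E z₀ 0 0 0 0 1 0 0 0)
  simp only [map_zero, mul_zero, zero_mul, add_zero, zero_add, sub_zero, zero_sub, neg_zero] at E
  ring

set_option maxHeartbeats 2000000 in
-- For `b₄`, the monomial `w_xx v_xx` determines `s₄`, and `w_x w_xx v_x` contradicts it unless `b₄
-- = 0`. For `b₅`, the monomials `v_x v_xxx` and `v_x² v_xx` determine `s₆` and `s₀`, and `v_x⁴`
-- leaves a nonzero multiple of `b₅`.
lemma eq_zero_of_devW_quadratic {s₁ s₂ s₃ s₄ s₅ s₆ s₇ s₈ s₉ s₀ b₄ b₅ : JetAlg Ω} (hs₁ : IsCoef s₁) (hs₂ : IsCoef s₂) (hs₃ : IsCoef s₃) (hs₄ : IsCoef s₄) (hs₅ : IsCoef s₅) (hs₆ : IsCoef s₆) (hs₇ : IsCoef s₇) (hs₈ : IsCoef s₈) (hs₉ : IsCoef s₉) (hs₀ : IsCoef s₀)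
    (hb₄ : IsCoef b₄) (hb₅ : IsCoef b₅)
    (e : devW m σ (s₁ * wj m σ 3 + s₂ * vj 3 + s₃ * wj m σ 1 * wj m σ 2 + s₄ * vj 1 * wj m σ 2 + s₅ * wj m σ 1 * vj 2 +
      s₆ * vj 1 * vj 2 + s₇ * wj m σ 1 ^ 3 + s₈ * wj m σ 1 ^ 2 * vj 1 + s₉ * wj m σ 1 * vj 1 ^ 2 +
      s₀ * vj 1 ^ 3) -
      (algebraMap ℝ _ m * (s₁ * wj m σ 3 + s₂ * vj 3 + s₃ * wj m σ 1 * wj m σ 2 + s₄ * vj 1 * wj m σ 2 + s₅ * wj m σ 1 * vj 2 +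
      s₆ * vj 1 * vj 2 + s₇ * wj m σ 1 ^ 3 + s₈ * wj m σ 1 ^ 2 * vj 1 + s₉ * wj m σ 1 * vj 1 ^ 2 +
      s₀ * vj 1 ^ 3) +
        (1 - algebraMap ℝ _ m) * 0) * wj m σ 1 =
      totD (symmCurA m σ (phi m) 0 0) -
        totD (symmCurB m σ (phi m) 0 0 (b₄ * wj m σ 1 * vj 1 + b₅ * vj 1 ^ 2)) +
        algebraMap ℝ _ (1 - 1 / m) *
          symmCurB m σ (phi m) 0 0 (b₄ * wj m σ 1 * vj 1 + b₅ * vj 1 ^ 2) *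
          (vj 1 - wj m σ 1) * hinv m σ) :
    b₄ = 0 ∧ b₅ = 0 := by
  have gp := grad_phi (Ω := Ω) (m := m) (σ := σ)
  have gi := grad_hinv (Ω := Ω) (m := m) (σ := σ)
  simp (maxDischargeDepth := 6) only [symmCurA, symmCurB, Derivation.leibniz, Derivation.leibniz_pow,
    map_add, map_sub, map_neg, map_zero, smul_eq_mul, nsmul_eq_mul, evo_vj_one, evo_wj_one,
    evo_vj_two, evo_wj_two, evo_symmFlow_rv, evo_symmFlow_rw, devV_vj_one, devV_vj_two,
    devV_vj_three, devV_wj_one, devV_wj_two, devV_wj_three, devW_vj_one, devW_vj_two,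
    devW_vj_three, devW_wj_one, devW_wj_two, devW_wj_three, lamj, totD_wj_one, totD_wj_two,
    totD_wj_three, totD_vj_one, totD_vj_two, totD_vj_three, gp.evo, gp.totD, gi.evo, gi.totD,
    IsCoef.devV, IsCoef.devW, IsCoef.evo (m := m) (σ := σ), IsCoef.totD (m := m) (σ := σ),
    hs₁, hs₂, hs₃, hs₄, hs₅, hs₆, hs₇, hs₈, hs₉, hs₀, hb₄, hb₅, IsCoef.dw, IsCoef.dv, Derivation.map_algebraMap,
    Derivation.map_one_eq_zero, map_ofNat_eq_zero, zero_mul, mul_zero, zero_add, add_zero,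
    sub_zero, zero_sub,
    Nat.reduceSub, pow_one, Nat.cast_ofNat] at e
  have E := fun z₀ w₁ w₂ w₃ w₄ v₁ v₂ v₃ v₄ =>
    congrArg (evalAt (jetAt m σ z₀ w₁ w₂ w₃ w₄ v₁ v₂ v₃ v₄)) e
  simp (maxDischargeDepth := 6) only [map_add, map_sub, map_neg, map_mul, map_pow, map_zero,
    map_one, map_ofNat, AlgHom.commutes, Algebra.algebraMap_self_apply, jetAt_w₁, jetAt_w₂,
    jetAt_w₃, jetAt_w₄, jetAt_v₁, jetAt_v₂, jetAt_v₃, jetAt_v₄, IsCoef.evalAt_jetAt, isCoef_phi,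
    isCoef_hinv, isCoef_rv, isCoef_lam, hs₁, hs₂, hs₃, hs₄, hs₅, hs₆, hs₇, hs₈, hs₉, hs₀, hb₄, hb₅, IsCoef.dw, IsCoef.dv] at E
  have hK := rv_sub_lam_mul_hinv (Ω := Ω) (m := m) (σ := σ)
  have hM := m_mul_inv (Ω := Ω) m σ
  have hMK := rv_sub_lam_mul_inv (Ω := Ω) (m := m) (σ := σ)
  obtain rfl : s₁ = 0 := eq_zero_of_algebraMap_mul (Param.pos m σ).ne' <| JetAlg.ext_evalAt fun z₀ => by
    simp only [map_mul, map_sub, map_zero, map_one, AlgHom.commutes, Algebra.algebraMap_self_apply]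
    linear_combination (1/3) * (E z₀ 1 0 1 0 0 0 0 0 - E z₀ 1 0 0 0 0 0 0 0)
  simp only [map_zero, mul_zero, zero_mul, add_zero, zero_add, sub_zero, zero_sub, neg_zero] at E
  obtain rfl : s₃ = 0 := eq_zero_of_algebraMap_mul (Param.pos m σ).ne' <| JetAlg.ext_evalAt fun z₀ => by
    simp only [map_mul, map_sub, map_zero, map_one, AlgHom.commutes, Algebra.algebraMap_self_apply]
    linear_combination (1/3) * (E z₀ 1 1 0 0 0 0 0 0 - E z₀ 1 0 0 0 0 0 0 0 - E z₀ 0 1 0 0 0 0 0 0)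
  simp only [map_zero, mul_zero, zero_mul, add_zero, zero_add, sub_zero, zero_sub, neg_zero] at E
  have T₄ : (rv - lam m σ) * s₄ = phi m * b₄ := JetAlg.ext_evalAt fun z₀ => by
      simp only [map_mul, map_sub, map_neg, map_add, map_ofNat, map_one, map_pow, map_zero,
        AlgHom.commutes, Algebra.algebraMap_self_apply]
      linear_combination E z₀ 0 1 0 0 0 1 0 0 - E z₀ 0 1 0 0 0 0 0 0 - E z₀ 0 0 0 0 0 1 0 0
  have H₄ : s₄ = algebraMap ℝ _ (1 / m) * phi m * hinv m σ * b₄ := by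
    linear_combination algebraMap ℝ _ (1 / m) * hinv m σ * T₄ - s₄ * hMK
  have T₅ : 2 * algebraMap ℝ _ m * s₄ = 2 * (1 - algebraMap ℝ _ (1 / m)) * phi m * hinv m σ * b₄ := JetAlg.ext_evalAt fun z₀ => by
      simp only [map_mul, map_sub, map_neg, map_add, map_ofNat, map_one, map_pow, map_zero,
        AlgHom.commutes, Algebra.algebraMap_self_apply]
      linear_combination E z₀ 1 1 0 0 1 0 0 0 - E z₀ 1 1 0 0 0 0 0 0 - E z₀ 1 0 0 0 1 0 0 0 - E z₀ 0 1 0 0 1 0 0 0 + E z₀ 1 0 0 0 0 0 0 0 + E z₀ 0 1 0 0 0 0 0 0 + E z₀ 0 0 0 0 1 0 0 0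
  obtain rfl : b₄ = 0 := by
    rw [H₄] at T₅
    refine eq_zero_of_ofNat_mul (c := 2) (eq_zero_of_unit_mul m σ 1 1 1 ?_)
    linear_combination T₅ - 2 * phi m * hinv m σ * b₄ * hM
  simp only [map_zero, mul_zero, zero_mul, add_zero, zero_add, sub_zero, zero_sub, neg_zero] at E
  obtain rfl : s₂ = 0 := eq_zero_of_rv_sub_lam_mul (m := m) (σ := σ) <| JetAlg.ext_evalAt fun z₀ => by
    simp only [map_mul, map_sub, map_zero, map_one, AlgHom.commutes, Algebra.algebraMap_self_apply]
    linear_combination (1) * (E z₀ 0 0 0 0 0 0 0 1)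
  simp only [map_zero, mul_zero, zero_mul, add_zero, zero_add, sub_zero, zero_sub, neg_zero] at E
  have T₆ : (rv - lam m σ) * s₆ = 2 * phi m * b₅ := JetAlg.ext_evalAt fun z₀ => by
      simp only [map_mul, map_sub, map_neg, map_add, map_ofNat, map_one, map_pow, map_zero,
        AlgHom.commutes, Algebra.algebraMap_self_apply]
      linear_combination E z₀ 0 0 0 0 1 0 1 0 - E z₀ 0 0 0 0 1 0 0 0
  have H₆ : s₆ = 2 * algebraMap ℝ _ (1 / m) * phi m * hinv m σ * b₅ := by
    linear_combination algebraMap ℝ _ (1 / m) * hinv m σ * T₆ - s₆ * hMK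
  have H₆v : dv m σ s₆ = 2 * algebraMap ℝ _ (1 / m) * phi m * hinv m σ * (dv m σ b₅ - algebraMap ℝ _ (1 / m) * hinv m σ * b₅) := by
    rw [H₆]
    simp only [Derivation.leibniz, dv_phi, dv_hinv, Derivation.map_algebraMap, map_add, map_sub,
      map_neg, map_ofNat_eq_zero, smul_eq_mul, map_one, Derivation.map_one_eq_zero]
    ring
  have T₀ : 4 * s₆ + (rv - lam m σ) * dv m σ s₆ + 3 * (rv - lam m σ) * s₀ = phi m * (5 * dv m σ b₅ - 3 * (1 - algebraMap ℝ _ (1 / m)) * hinv m σ * b₅) := JetAlg.ext_evalAt fun z₀ => by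
      simp only [map_mul, map_sub, map_neg, map_add, map_ofNat, map_one, map_pow, map_zero,
        AlgHom.commutes, Algebra.algebraMap_self_apply]
      linear_combination E z₀ 0 0 0 0 1 1 0 0 - E z₀ 0 0 0 0 1 0 0 0 - E z₀ 0 0 0 0 0 1 0 0
  have H₀ : s₀ = algebraMap ℝ _ (1 / m) * phi m * hinv m σ * (dv m σ b₅ - (1 + algebraMap ℝ _ (1 / m)) * hinv m σ * b₅) := by
    refine sub_eq_zero.1 (eq_zero_of_ofNat_mul (c := 3) ?_)
    linear_combination algebraMap ℝ _ (1 / m) * hinv m σ * T₀ - 3 * s₀ * hMK - 4 * algebraMap ℝ _ (1 / m) * hinv m σ * H₆ -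
      algebraMap ℝ _ (1 / m) * hinv m σ * (rv - lam m σ) * H₆v - 2 * algebraMap ℝ _ (1 / m) * phi m * hinv m σ * (dv m σ b₅ - algebraMap ℝ _ (1 / m) * hinv m σ * b₅) * hMK
  have H₀v : dv m σ s₀ = algebraMap ℝ _ (1 / m) * phi m * hinv m σ * (-(algebraMap ℝ _ (1 / m) * hinv m σ * (dv m σ b₅ - (1 + algebraMap ℝ _ (1 / m)) * hinv m σ * b₅)) + (dv m σ (dv m σ b₅) + (1 + algebraMap ℝ _ (1 / m)) * hinv m σ ^ 2 * b₅ - (1 + algebraMap ℝ _ (1 / m)) * hinv m σ * dv m σ b₅)) := by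
    rw [H₀]
    simp only [Derivation.leibniz, dv_phi, dv_hinv, Derivation.map_algebraMap, map_add, map_sub,
      map_neg, map_ofNat_eq_zero, smul_eq_mul, map_one, Derivation.map_one_eq_zero]
    ring
  have T₈ : (rv - lam m σ) * dv m σ s₀ + 3 * s₀ = phi m * (dv m σ (dv m σ b₅) + (1 - algebraMap ℝ _ (1 / m)) * hinv m σ ^ 2 * b₅ - (1 - algebraMap ℝ _ (1 / m)) * hinv m σ * dv m σ b₅) := JetAlg.ext_evalAt fun z₀ => by
      simp only [map_mul, map_sub, map_neg, map_add, map_ofNat, map_one, map_pow, map_zero,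
        AlgHom.commutes, Algebra.algebraMap_self_apply]
      linear_combination E z₀ 0 0 0 0 1 0 0 0
  rw [H₀v, H₀] at T₈
  refine ⟨rfl, eq_zero_of_ofNat_mul (c := 2) (eq_zero_of_unit_mul m σ 2 1 2 ?_)⟩
  linear_combination -T₈ + phi m * (-(algebraMap ℝ _ (1 / m) * hinv m σ * (dv m σ b₅ - (1 + algebraMap ℝ _ (1 / m)) * hinv m σ * b₅)) + (dv m σ (dv m σ b₅) + (1 + algebraMap ℝ _ (1 / m)) * hinv m σ ^ 2 * b₅ - (1 + algebraMap ℝ _ (1 / m)) * hinv m σ * dv m σ b₅)) * hMK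

end

end

section

attribute [-instance] instCharZeroOfIsSemireal IsStrictOrderedRing.toCharZero
  FloorSemiring.instCharZero NumberField.to_charZero SubsemiringClass.instCharZero

variable {Ω : Opens Pt} [hΩ : PosFst Ω] {m σ : ℝ} [hP : Param m σ]

/-! ### Degrees of commutators -/

lemma evo_fieldFrame_one (X : Fin 2 → JetAlg Ω) (j : Fin 2) :
    evo X (fieldFrame j 1) = totD (X j) := by
  rw [fieldFrame, ← totD_jetCoord, evo_totD, evo_jetCoord_zero]

lemma evo_fieldFrame_two (X : Fin 2 → JetAlg Ω) (j : Fin 2) :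
    evo X (fieldFrame j 2) = totD (totD (X j)) := by
  rw [fieldFrame, ← totD_jetCoord, evo_totD, ← totD_jetCoord, evo_totD, evo_jetCoord_zero]

lemma IsCoef.exists_evo {f : JetAlg Ω} (hf : IsCoef f) : ∃ f₀ f₁ : JetAlg Ω,
    IsCoef f₀ ∧ IsCoef f₁ ∧ ∀ X, CoxeterFlow.evo X f = f₀ * X 0 + f₁ * X 1 := by
  obtain ⟨f₀, f₁, h0, h1, h⟩ := hf.exists_grad
  exact ⟨f₀, f₁, h0, h1, fun X => h _⟩

lemma IsCoef.hp1_evo {X : Fin 2 → JetAlg Ω} (hX : ∀ i, HP1 fieldFrame (X i)) {f : JetAlg Ω}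
    (hf : IsCoef f) : HP1 fieldFrame (CoxeterFlow.evo X f) := by
  obtain ⟨f₀, f₁, h0, h1, h⟩ := hf.exists_evo
  rw [h]; exact ((hX 0).coef_mul h0).add ((hX 1).coef_mul h1)

lemma IsCoef.hp2_evo {X : Fin 2 → JetAlg Ω} (hX : ∀ i, HP2 fieldFrame (X i)) {f : JetAlg Ω}
    (hf : IsCoef f) : HP2 fieldFrame (CoxeterFlow.evo X f) := by
  obtain ⟨f₀, f₁, h0, h1, h⟩ := hf.exists_evo
  rw [h]; exact ((hX 0).coef_mul h0).add ((hX 1).coef_mul h1)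

lemma HP1.hp2_evo {X : Fin 2 → JetAlg Ω} (hX : ∀ i, HP1 fieldFrame (X i)) {f : JetAlg Ω}
    (hf : HP1 fieldFrame f) : HP2 fieldFrame (evo X f) := by
  obtain ⟨a, ha, rfl⟩ := hf
  have h : ∀ j, HP2 fieldFrame (evo X (a j * fieldFrame j 1)) := fun j => by
    rw [Derivation.leibniz, evo_fieldFrame_one]
    exact ((isFrame_field.totD_one (hX j)).coef_mul (ha j)).add
      ((HP1.gen j).mul ((ha j).hp1_evo hX))
  rw [Fin.sum_univ_two, map_add]
  exact (h 0).add (h 1)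

lemma HP1.hp3_evo {X : Fin 2 → JetAlg Ω} (hX : ∀ i, HP2 fieldFrame (X i)) {f : JetAlg Ω}
    (hf : HP1 fieldFrame f) : HP3 fieldFrame (evo X f) := by
  obtain ⟨a, ha, rfl⟩ := hf
  have h : ∀ j, HP3 fieldFrame (evo X (a j * fieldFrame j 1)) := fun j => by
    rw [Derivation.leibniz, evo_fieldFrame_one, smul_eq_mul (fieldFrame j 1), mul_comm (fieldFrame j 1)]
    exact ((isFrame_field.totD_two (hX j)).coef_mul (ha j)).add
      (((ha j).hp2_evo hX).mul (HP1.gen j))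
  rw [Fin.sum_univ_two, map_add]
  exact (h 0).add (h 1)

lemma HP2.hp3_evo {X : Fin 2 → JetAlg Ω} (hX : ∀ i, HP1 fieldFrame (X i)) {f : JetAlg Ω}
    (hf : HP2 fieldFrame f) : HP3 fieldFrame (evo X f) := by
  obtain ⟨a, b, ha, hb, rfl⟩ := hf
  have h : ∀ j, HP3 fieldFrame (evo X (a j * fieldFrame j 2)) := fun j => by
    rw [Derivation.leibniz, evo_fieldFrame_two]
    exact ((isFrame_field.totD_two (isFrame_field.totD_one (hX j))).coef_mul (ha j)).add
      ((HP2.gen j).mul ((ha j).hp1_evo hX))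
  have h' : ∀ j k, HP3 fieldFrame (evo X (b j k * fieldFrame j 1 * fieldFrame k 1)) := fun j k => by
    have hg : ∀ j, HP2 fieldFrame (evo X (fieldFrame j 1)) := fun j => by
      rw [evo_fieldFrame_one]; exact isFrame_field.totD_one (hX j)
    rw [mul_assoc, Derivation.leibniz, Derivation.leibniz, smul_eq_mul, smul_eq_mul, smul_eq_mul,
      smul_eq_mul, mul_comm (fieldFrame j 1), mul_comm (fieldFrame k 1)]
    exact ((((hg k).mul (HP1.gen j)).add ((hg j).mul (HP1.gen k))).coef_mul (hb j k)).add
      (((HP1.gen j).mul (HP1.gen k)).mul ((hb j k).hp1_evo hX))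
  simp only [Fin.sum_univ_two, map_add]
  exact ((h 0).add (h 1)).add (((h' 0 0).add (h' 0 1)).add ((h' 1 0).add (h' 1 1)))

lemma hp2_brk {X Y : Fin 2 → JetAlg Ω} (hX : ∀ i, HP1 fieldFrame (X i))
    (hY : ∀ i, HP1 fieldFrame (Y i)) (i : Fin 2) : HP2 fieldFrame (brk X Y i) :=
  ((hY i).hp2_evo hX).sub ((hX i).hp2_evo hY)

lemma hp3_brk {X Y : Fin 2 → JetAlg Ω} (hX : ∀ i, HP2 fieldFrame (X i))
    (hY : ∀ i, HP1 fieldFrame (Y i)) (i : Fin 2) : HP3 fieldFrame (brk X Y i) :=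
  ((hY i).hp3_evo hX).sub ((hX i).hp3_evo hY)

lemma HP3.riemann {f : JetAlg Ω} (hf : HP3 fieldFrame f) :
    ∃ r₁ r₂ r₃ r₄ r₅ r₆ r₇ r₈ r₉ r₀ : JetAlg Ω, IsCoef r₁ ∧ IsCoef r₂ ∧ IsCoef r₃ ∧ IsCoef r₄ ∧ IsCoef r₅ ∧ IsCoef r₆ ∧ IsCoef r₇ ∧ IsCoef r₈ ∧ IsCoef r₉ ∧ IsCoef r₀ ∧
    f = r₁ * wj m σ 3 + r₂ * vj 3 + r₃ * wj m σ 1 * wj m σ 2 + r₄ * vj 1 * wj m σ 2 + r₅ * wj m σ 1 * vj 2 +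
      r₆ * vj 1 * vj 2 + r₇ * wj m σ 1 ^ 3 + r₈ * wj m σ 1 ^ 2 * vj 1 + r₉ * wj m σ 1 * vj 1 ^ 2 +
      r₀ * vj 1 ^ 3 := by
  obtain ⟨a, b, c, ha, hb, hc, h⟩ := isFrame_field.change_three (isFrame_riemann (m := m) (σ := σ)) hf
  refine ⟨a 0, a 1, b 0 0, b 0 1, b 1 0, b 1 1, c 0 0 0, c 0 0 1 + c 0 1 0 + c 1 0 0,
    c 0 1 1 + c 1 0 1 + c 1 1 0, c 1 1 1, ha 0, ha 1, hb 0 0, hb 0 1, hb 1 0, hb 1 1, hc _ _ _,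
    ((hc _ _ _).add (hc _ _ _)).add (hc _ _ _), ((hc _ _ _).add (hc _ _ _)).add (hc _ _ _),
    hc _ _ _, ?_⟩
  rw [h]
  simp [Fin.sum_univ_two, riemannFrame]; ring

/-! ### The Lie algebra of evolutionary systems -/

section

variable (X Y Z : Fin 2 → JetAlg Ω)

lemma brk_add_left : brk (X + Y) Z = brk X Z + brk Y Z := by
  funext i; simp only [brk, evo_add_field, Pi.add_apply, map_add, Derivation.add_apply]; ring

lemma brk_add_right : brk X (Y + Z) = brk X Y + brk X Z := by
  funext i; simp only [brk, evo_add_field, Pi.add_apply, map_add, Derivation.add_apply]; ring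

lemma brk_smul_left (c : ℝ) : brk (c • X) Y = c • brk X Y := by
  funext i
  simp only [brk, evo_smul_field, Pi.smul_apply, Derivation.map_smul, Derivation.smul_apply,
    smul_sub]

lemma brk_smul_right (c : ℝ) : brk X (c • Y) = c • brk X Y := by
  funext i
  simp only [brk, evo_smul_field, Pi.smul_apply, Derivation.map_smul, Derivation.smul_apply,
    smul_sub]

lemma brk_sub_right : brk X (Y - Z) = brk X Y - brk X Z := by
  rw [sub_eq_add_neg, brk_add_right, ← neg_one_smul ℝ Z, brk_smul_right,
    neg_one_smul ℝ (brk _ _), sub_eq_add_neg]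

lemma brk_zero_left : brk 0 X = 0 := by
  have := brk_smul_left 0 X (0 : ℝ)
  rwa [zero_smul, zero_smul] at this

/-- The Jacobi identity. -/
lemma brk_brk (Z : Fin 2 → JetAlg Ω) : brk (brk X Y) Z = brk (brk X Z) Y + brk X (brk Y Z) := by
  funext i
  have h : ∀ X Y Z : Fin 2 → JetAlg Ω, brk (brk X Y) Z i = evo X (evo Y (Z i)) - evo Y (evo X (Z i)) -
      (evo Z (evo X (Y i)) - evo Z (evo Y (X i))) := fun X Y Z => by
    rw [evo_comm, ← map_sub]; rfl
  rw [Pi.add_apply, brk_neg X (brk Y Z), Pi.neg_apply, h, h, h]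
  ring

end

/-! ### Reduction at the second order -/

lemma devV_coef_mul_wj {p : JetAlg Ω} (hp : IsCoef p) : devV m σ (p * wj m σ 1) =
    -(p * (rv - lam m σ)) * wj m σ 2 + (algebraMap ℝ _ m * p - dw m σ p * (rv - lam m σ)) *
      wj m σ 1 ^ 2 + (1 - algebraMap ℝ _ m) * p * wj m σ 1 * vj 1 := by
  rw [Derivation.leibniz, hp.devV, devV_wj_one, lamj, smul_eq_mul, smul_eq_mul]; ring

lemma devV_coef_mul_vj {q : JetAlg Ω} (hq : IsCoef q) : devV m σ (q * vj 1) =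
    q * vj 1 ^ 2 - dw m σ q * (rv - lam m σ) * wj m σ 1 * vj 1 := by
  rw [Derivation.leibniz, hq.devV, devV_vj_one, smul_eq_mul, smul_eq_mul]; ring

lemma devW_coef_mul_wj {p : JetAlg Ω} (hp : IsCoef p) : devW m σ (p * wj m σ 1) =
    algebraMap ℝ _ m * p * wj m σ 1 ^ 2 + ((1 - algebraMap ℝ _ m) * p +
      dv m σ p * (rv - lam m σ)) * wj m σ 1 * vj 1 := by
  rw [Derivation.leibniz, hp.devW, devW_wj_one, lamj, smul_eq_mul, smul_eq_mul]; ring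

lemma devW_coef_mul_vj {q : JetAlg Ω} (hq : IsCoef q) : devW m σ (q * vj 1) =
    q * (rv - lam m σ) * vj 2 + (q + dv m σ q * (rv - lam m σ)) * vj 1 ^ 2 := by
  rw [Derivation.leibniz, hq.devW, devW_vj_one, smul_eq_mul, smul_eq_mul]; ring

lemma totD_coef_mul_wj {p : JetAlg Ω} (hp : IsCoef p) : totD (p * wj m σ 1) =
    p * wj m σ 2 + dw m σ p * wj m σ 1 ^ 2 + dv m σ p * wj m σ 1 * vj 1 := by
  rw [Derivation.leibniz, hp.totD (m := m) (σ := σ), totD_wj_one, smul_eq_mul, smul_eq_mul]; ring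

lemma totD_coef_mul_vj {q : JetAlg Ω} (hq : IsCoef q) : totD (q * vj 1) =
    q * vj 2 + dw m σ q * wj m σ 1 * vj 1 + dv m σ q * vj 1 ^ 2 := by
  rw [Derivation.leibniz, hq.totD (m := m) (σ := σ), totD_vj_one, smul_eq_mul, smul_eq_mul]; ring

lemma symmCurA_lam (A : JetAlg Ω) : symmCurA m σ (lam m σ) rv A = devV m σ A := rfl

lemma symmCurB_lam (A B : JetAlg Ω) : symmCurB m σ (lam m σ) rv A B =
    devW m σ B - (rv - lam m σ) * totD A - (algebraMap ℝ _ m - 1) * vj 1 * B := by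
  rw [symmCurB, rv_sub_lam_mul_hinv, devW_apply, algebraMap_one_sub, baseFlow]
  linear_combination vj 1 * B * m_mul_inv (Ω := Ω) m σ

/-- The converse of `exists_isSymm`: the condition on `∂_v μ` is the vanishing of the `w_x v_x`
term, and independence of `g` from `w` is that of the `v`-equation. -/
lemma brk_baseFlow_symmFlow {μ g : JetAlg Ω} (h : IsSymm m σ μ g) :
    brk (baseFlow m σ) (symmFlow m σ μ g) = 0 := by
  refine frame_ext (m := m) (σ := σ) ?_ ?_
  · rw [evo_brk_baseFlow_rw', evo_symmFlow_rw, evo_symmFlow_rv, devW_coef_mul_wj h.coef_fst,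
      h.dv_fst, algebraMap_one_sub, evo_zero]
    linear_combination -(1 - algebraMap ℝ _ (1 / m)) * (g - μ) * wj m σ 1 * vj 1 *
      rv_sub_lam_mul_hinv (Ω := Ω) (m := m) (σ := σ) + (g - μ) * wj m σ 1 * vj 1 *
      m_mul_inv (Ω := Ω) m σ
  · rw [evo_brk_baseFlow_rv', evo_symmFlow_rv, devV_coef_mul_vj h.coef_snd, h.dw_snd, evo_zero]
    ring

/-- Normalization of the currents at the second order. -/
lemma exists_reduction {a₁ a₂ b₁ b₂ A B : JetAlg Ω} (hA : Lead m σ a₁ a₂ A)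
    (hB : Lead m σ b₁ b₂ B) : ∃ α β a₃ a₄ b₄ b₅ : JetAlg Ω, HP1 fieldFrame α ∧ HP1 fieldFrame β ∧
    IsCoef a₃ ∧ IsCoef a₄ ∧ IsCoef b₄ ∧ IsCoef b₅ ∧
    A + symmCurA m σ (lam m σ) rv α = a₂ * vj 2 + a₃ * wj m σ 1 ^ 2 + a₄ * wj m σ 1 * vj 1 ∧
    B + symmCurB m σ (lam m σ) rv α β =
      (b₁ - a₁) * wj m σ 2 + b₄ * wj m σ 1 * vj 1 + b₅ * vj 1 ^ 2 := by
  obtain ⟨h₁, h₂, c₃, c₄, c₅, h₃, h₄, h₅, rfl⟩ := hA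
  obtain ⟨k₁, k₂, d₃, d₄, d₅, k₃, k₄, k₅, rfl⟩ := hB
  have hi := isCoef_hinv (Ω := Ω) m σ
  have hc := fun c => isCoef_algebraMap (Ω := Ω) c
  have hs : IsCoef (rv - lam m σ : JetAlg Ω) := isCoef_rv.sub isCoef_lam
  -- The leading term of `devV (p w_x)` is `-(v - λ) p w_xx`, so this `p` removes `w_xx` from the
  -- second current.
  obtain ⟨p, hp, ep⟩ : ∃ p : JetAlg Ω, IsCoef p ∧ p * (rv - lam m σ) = a₁ :=
    ⟨algebraMap ℝ _ (1 / m) * hinv m σ * a₁, ((hc _).mul hi).mul h₁, by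
      linear_combination a₁ * rv_sub_lam_mul_inv (Ω := Ω) (m := m) (σ := σ)⟩
  -- The term `-c₅ v_x` of `α` is spent on `v_x²` in the second current and adds `(v - λ) c₅ v_xx`
  -- to the first; `q` cancels that together with `b₂ v_xx`.
  obtain ⟨q, hq, eq⟩ : ∃ q : JetAlg Ω, IsCoef q ∧ (q + c₅) * (rv - lam m σ) = -b₂ :=
    ⟨-c₅ - algebraMap ℝ _ (1 / m) * hinv m σ * b₂, h₅.neg.sub (((hc _).mul hi).mul k₂), by
      linear_combination -b₂ * rv_sub_lam_mul_inv (Ω := Ω) (m := m) (σ := σ)⟩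
  -- This remaining freedom removes `w_x²` from the first current.
  obtain ⟨p', hp', ep'⟩ : ∃ p' : JetAlg Ω, IsCoef p' ∧
      algebraMap ℝ _ m * p' = (rv - lam m σ) * dw m σ p - d₃ :=
    ⟨algebraMap ℝ _ (1 / m) * ((rv - lam m σ) * dw m σ p - d₃),
      (hc _).mul ((hs.mul (hp.dw (m := m) (σ := σ))).sub k₃), by
      linear_combination ((rv - lam m σ) * dw m σ p - d₃) * m_mul_inv (Ω := Ω) m σ⟩
  refine ⟨p * wj m σ 1 + -c₅ * vj 1, p' * wj m σ 1 + q * vj 1,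
    c₃ + algebraMap ℝ _ m * p - dw m σ p * (rv - lam m σ),
    c₄ + (1 - algebraMap ℝ _ m) * p + dw m σ c₅ * (rv - lam m σ),
    d₄ + (1 - algebraMap ℝ _ m) * p' + dv m σ p' * (rv - lam m σ) -
      (rv - lam m σ) * (dv m σ p - dw m σ c₅) - (algebraMap ℝ _ m - 1) * p',
    d₅ + q + dv m σ q * (rv - lam m σ) + (rv - lam m σ) * dv m σ c₅ - (algebraMap ℝ _ m - 1) * q,
    (hp1_wj hp).add (hp1_vj h₅.neg), (hp1_wj hp').add (hp1_vj hq),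
    (h₃.add ((hc m).mul hp)).sub ((hp.dw (m := m) (σ := σ)).mul hs),
    (h₄.add ((isCoef_one.sub (hc m)).mul hp)).add ((h₅.dw (m := m) (σ := σ)).mul hs),
    (((k₄.add ((isCoef_one.sub (hc m)).mul hp')).add ((hp'.dv (m := m) (σ := σ)).mul hs)).sub
      (hs.mul ((hp.dv (m := m) (σ := σ)).sub (h₅.dw (m := m) (σ := σ))))).sub (((hc m).sub isCoef_one).mul hp'),
    (((k₅.add hq).add ((hq.dv (m := m) (σ := σ)).mul hs)).add (hs.mul (h₅.dv (m := m) (σ := σ)))).sub (((hc m).sub isCoef_one).mul hq),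
    ?_, ?_⟩
  · rw [symmCurA_lam, map_add, devV_coef_mul_wj hp, devV_coef_mul_vj h₅.neg, map_neg]
    linear_combination -(wj m σ 2 : JetAlg Ω) * ep
  · rw [symmCurB_lam, map_add, map_add, devW_coef_mul_wj hp', devW_coef_mul_vj hq,
      totD_coef_mul_wj (m := m) (σ := σ) hp, totD_coef_mul_vj (m := m) (σ := σ) h₅.neg, map_neg, map_neg]
    linear_combination -(wj m σ 2 : JetAlg Ω) * ep + vj 2 * eq + wj m σ 1 ^ 2 * ep'

/-- The constraints imposed at the second order by the symmetry `w_τ = φ w_x`, `v_τ = 0`. -/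
theorem second_order {a₁ a₂ b₁ b₂ A B : JetAlg Ω} (hA : Lead m σ a₁ a₂ A)
    (hB : Lead m σ b₁ b₂ B) {R : Fin 2 → JetAlg Ω} (hR : ∀ i, HP3 fieldFrame (R i))
    (e : brk (baseFlow m σ) R = brk (symmFlow m σ (phi m) 0) (consFlow m σ A B)) :
    dw m σ a₂ = 0 ∧
      dv m σ (b₁ - a₁) = 2 * (1 - algebraMap ℝ _ (1 / m)) * hinv m σ * (b₁ - a₁) ∧
      (a₂ = 0 → b₁ - a₁ = 0 → ∃ α β, HP1 fieldFrame α ∧ HP1 fieldFrame β ∧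
        consFlow m σ A B + brk (baseFlow m σ) (consFlow m σ α β) = 0) := by
  obtain ⟨α, β, a₃, a₄, b₄, b₅, hα, hβ, h₃, h₄, h₄', h₅', eA, eB⟩ := exists_reduction hA hB
  have hab := hB.1.sub hA.1
  have hsum : consFlow m σ A B + brk (baseFlow m σ) (consFlow m σ α β) = consFlow m σ
      (a₂ * vj 2 + a₃ * wj m σ 1 ^ 2 + a₄ * wj m σ 1 * vj 1)
      ((b₁ - a₁) * wj m σ 2 + b₄ * wj m σ 1 * vj 1 + b₅ * vj 1 ^ 2) := by
    rw [baseFlow, isSymm_lam.brk_consFlow, ← consFlow_add, eA, eB]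
  -- The reduction adds `[K₀, Y]` to the second-order part. Since `[K₀, S] = 0`, the Jacobi identity
  -- gives `[[K₀, Y], S] = [K₀, [Y, S]]`, and replacing `R` by `R - [Y, S]` preserves the equation.
  obtain ⟨R', hR', e'⟩ : ∃ R' : Fin 2 → JetAlg Ω, (∀ i, HP3 fieldFrame (R' i)) ∧
      brk (baseFlow m σ) R' = brk (symmFlow m σ (phi m) 0) (consFlow m σ
        (a₂ * vj 2 + a₃ * wj m σ 1 ^ 2 + a₄ * wj m σ 1 * vj 1)
        ((b₁ - a₁) * wj m σ 2 + b₄ * wj m σ 1 * vj 1 + b₅ * vj 1 ^ 2)) := by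
    refine ⟨R - brk (consFlow m σ α β) (symmFlow m σ (phi m) 0), fun i => (hR i).sub
      (hp3_brk (hp2_consFlow hα hβ) (hp1_symmFlow (isCoef_phi m) isCoef_zero) i), ?_⟩
    have hS : brk (baseFlow m σ) (symmFlow m σ (phi m) 0) = (0 : Fin 2 → JetAlg Ω) :=
      brk_baseFlow_symmFlow isSymm_phi
    have hJ := brk_brk (baseFlow m σ) (consFlow m σ α β) (symmFlow m σ (phi m) 0)
    rw [hS, brk_zero_left, zero_add] at hJ
    rw [← hsum, brk_add_right, brk_sub_right, e, ← hJ, brk_neg (symmFlow m σ (phi m) 0)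
      (brk _ _), sub_eq_add_neg]
  have h1 := hR' 1
  rw [← evo_rv R'] at h1
  obtain ⟨r₁, r₂, r₃, r₄, r₅, r₆, r₇, r₈, r₉, r₀, hr₁, hr₂, hr₃, hr₄, hr₅, hr₆, hr₇, hr₈, hr₉, hr₀, er⟩ := HP3.riemann (m := m) (σ := σ) h1
  obtain ⟨s₁, s₂, s₃, s₄, s₅, s₆, s₇, s₈, s₉, s₀, hs₁, hs₂, hs₃, hs₄, hs₅, hs₆, hs₇, hs₈, hs₉, hs₀, es⟩ := HP3.riemann (m := m) (σ := σ) (HP3.evo_rw (m := m) (σ := σ) hR')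
  rw [isSymm_phi.brk_consFlow] at e'
  have e1 := congrArg (fun Y => evo Y rv) e'
  have e2 := congrArg (fun Y => evo Y (rw' m σ)) e'
  simp only [evo_brk_baseFlow_rv', evo_brk_baseFlow_rw', evo_consFlow_rv, evo_consFlow_rw]
    at e1 e2
  rw [er] at e1 e2
  rw [es] at e2
  obtain ⟨hr, ha₂⟩ := dw_eq_zero_of_devV hr₁ hr₂ hr₃ hr₄ hr₅ hr₆ hr₇ hr₈ hr₉ hr₀ hA.2.1 h₃ h₄ e1
  refine ⟨ha₂, dv_eq_of_devW hs₁ hs₂ hs₃ hs₄ hs₅ hs₆ hs₇ hs₈ hs₉ hs₀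
    hr₁ hr₂ hr₃ hr₄ hr₅ hr₆ hr₇ hr₈ hr₉ hr₀ hA.2.1 h₃ h₄ hab h₄' h₅' hr e2, ?_⟩
  intro ha hb
  refine ⟨α, β, hα, hβ, hsum.trans ?_⟩
  rw [ha, zero_mul, zero_add] at e1 e2 ⊢
  rw [hb, zero_mul, zero_add] at e2 ⊢
  -- With the two leading coefficients gone the system decouples: first the second current vanishes,
  -- then the `v`-component of `R'`, and finally the first current.
  obtain ⟨rfl, rfl⟩ := eq_zero_of_devV_quadratic hr₁ hr₂ hr₃ hr₄ hr₅ hr₆ hr₇ hr₈ hr₉ hr₀ h₃ h₄ e1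
  have hz : (0 * wj m σ 1 ^ 2 + 0 * wj m σ 1 * vj 1 : JetAlg Ω) = 0 := by ring
  rw [hz] at e1 e2 ⊢
  have hcur : symmCurA m σ (phi m) 0 (0 : JetAlg Ω) = 0 := by
    rw [symmCurA, map_zero, map_zero, mul_zero, sub_zero]
  rw [hcur, map_zero] at e1
  rw [eq_zero_of_devV_cubic hr₁ hr₂ hr₃ hr₄ hr₅ hr₆ hr₇ hr₈ hr₉ hr₀ e1] at e2
  obtain ⟨rfl, rfl⟩ := eq_zero_of_devW_quadratic hs₁ hs₂ hs₃ hs₄ hs₅ hs₆ hs₇ hs₈ hs₉ hs₀ h₄' h₅' e2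
  rw [show (0 * wj m σ 1 * vj 1 + 0 * vj 1 ^ 2 : JetAlg Ω) = 0 by ring, consFlow_zero]

end

/-! ### Choice of the functional parameters on a solvable domain -/

section

attribute [-instance] instCharZeroOfIsSemireal IsStrictOrderedRing.toCharZero
  FloorSemiring.instCharZero NumberField.to_charZero SubsemiringClass.instCharZero

variable {Ω : Opens Pt} [hΩ : PosFst Ω] {m σ : ℝ} [hP : Param m σ]

/-! ### Reduction to the normal form -/

variable (Ω m σ) in
/-- On `Ω` the equations `∂g/∂w = f` and `∂g/∂v = f` have smooth solutions, and a function that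
does not depend on one of the Riemann invariants is a function of the other. -/
structure Solvable : Prop where
  dw_surj : ∀ f : JetAlg Ω, IsCoef f → ∃ g : JetAlg Ω, IsCoef g ∧ dw m σ g = f
  dv_surj : ∀ f : JetAlg Ω, IsCoef f → ∃ g : JetAlg Ω, IsCoef g ∧ dv m σ g = f
  of_dv : ∀ f : JetAlg Ω, IsCoef f → dv m σ f = 0 → ∃ F hF, f = compW m σ F hF
  of_dw : ∀ f : JetAlg Ω, IsCoef f → dw m σ f = 0 → ∃ F hF, f = compV F hF

/-- The function `ρ` satisfies the same linear equation with the opposite sign, so the `k`-th power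
of `ρ` is an integrating factor. The case `k = 1` produces `F`, the case `k = 2` produces `G`. -/
lemma dv_mul_rho_pow {a : JetAlg Ω} (k : ℕ)
    (h : dv m σ a = (k : JetAlg Ω) * ((1 - algebraMap ℝ _ (1 / m)) * hinv m σ) * a) :
    dv m σ (a * rho m σ ^ k) = 0 := by
  rw [Derivation.leibniz, h, Derivation.leibniz_pow, dv_rho, algebraMap_one_sub]
  simp only [smul_eq_mul, nsmul_eq_mul]
  rcases k with _ | k
  · push_cast; ring
  · rw [Nat.add_sub_cancel, pow_succ]; push_cast; ring

lemma IsCoef.hp1_totD {f : JetAlg Ω} (hf : IsCoef f) : HP1 fieldFrame (CoxeterFlow.totD f) := by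
  obtain ⟨f₀, f₁, h₀, h₁, h⟩ := hf.exists_grad
  rw [CoxeterFlow.totD, h]
  exact ((HP1.gen (e := fieldFrame) 0).coef_mul h₀).add ((HP1.gen (e := fieldFrame) 1).coef_mul h₁)

lemma consFlow_const_mul (c : ℝ) (A B : JetAlg Ω) :
    consFlow m σ (algebraMap ℝ _ c * A) (algebraMap ℝ _ c * B) = c • consFlow m σ A B := by
  simp only [← Algebra.smul_def]
  funext i
  fin_cases i <;> simp [consFlow]

lemma mul_rho_mul_phi (a : JetAlg Ω) : a * rho m σ * (algebraMap ℝ _ (4 * σ * m) * phi m) = a := by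
  linear_combination a * rho_mul_phi (Ω := Ω) (m := m) (σ := σ)

lemma algebraMap_mul_compW (c : ℝ) {F : ℝ → ℝ}
    (hF : ContDiffOn ℝ ∞ F (riemannInv m σ '' (Ω : Set Pt))) :
    algebraMap ℝ _ c * compW m σ F hF = compW m σ (fun t => c * F t) (contDiffOn_const.mul hF) :=
  JetAlg.ext_evalAt fun z => by
    rw [map_mul, evalAt_compW, evalAt_compW, AlgHom.commutes]; rfl

lemma algebraMap_mul_compV (c : ℝ) {f : ℝ → ℝ}
    (hf : ContDiffOn ℝ ∞ f ((fun p : Pt => p 1) '' (Ω : Set Pt))) :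
    algebraMap ℝ _ c * compV f hf = compV (fun t => c * f t) (contDiffOn_const.mul hf) :=
  JetAlg.ext_evalAt fun z => by
    rw [map_mul, evalAt_compV, evalAt_compV, AlgHom.commutes]; rfl

/-- Normalization at the first order. -/
theorem exists_normal_one (hs : Solvable Ω m σ) {A B : JetAlg Ω} (hA : HP1 fieldFrame A)
    (hB : HP1 fieldFrame B) {Q : Fin 2 → JetAlg Ω} (hQ : ∀ i, HP2 fieldFrame (Q i))
    (e : brk (baseFlow m σ) Q = brk (symmFlow m σ (phi m) 0) (consFlow m σ A B)) :
    ∃ F hF, ∃ M N : JetAlg Ω, IsCoef M ∧ IsCoef N ∧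
      consFlow m σ A B + brk (baseFlow m σ) (consFlow m σ M N) =
        consFlow m σ (compW m σ F hF * phi m * wj m σ 1) 0 := by
  obtain ⟨c, a, d, hc, ha, hd, rfl, rfl, hv⟩ := first_order hA hB hQ e
  have hr := isCoef_rho (Ω := Ω) m σ
  have hn := fun c : ℝ => isCoef_algebraMap (Ω := Ω) c
  have hi := isCoef_hinv (Ω := Ω) m σ
  -- The product `4σm a ρ` is `a / φ`, which does not depend on `v`.
  obtain ⟨F, hF, eF⟩ := hs.of_dv (algebraMap ℝ _ (4 * σ * m) * (a * rho m σ ^ 1))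
    ((hn _).mul (ha.mul (hr.pow 1))) (by
      rw [Derivation.leibniz, dv_mul_rho_pow 1 (by rw [hv, Nat.cast_one]; ring),
        Derivation.map_algebraMap, smul_zero, smul_zero, add_zero])
  -- Here `1/(m (v - w))` is `1/(v - λ)`. The bracket with `M` contributes `-(v - λ) ∂_w M w_x` to
  -- both currents, which removes their common part `c - a`.
  obtain ⟨M, hM, eM⟩ := hs.dw_surj ((c - a) * (algebraMap ℝ _ (1 / m) * hinv m σ))
    ((hc.sub ha).mul ((hn _).mul hi))
  -- The equation for the remaining current is linear of first order in `v`, and `4σm φ` solves its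
  -- homogeneous part. Writing the unknown as `4σm φ N` leaves a pure `v`-derivative, chosen so as
  -- to remove `d v_x`.
  obtain ⟨N, hN, eN⟩ := hs.dv_surj (rho m σ * (dv m σ M - algebraMap ℝ _ (1 / m) * hinv m σ * d))
    (hr.mul (hM.dv.sub (((hn _).mul hi).mul hd)))
  have hN' : IsCoef (algebraMap ℝ _ (4 * σ * m) * phi m * N) :=
    ((hn _).mul (isCoef_phi m)).mul hN
  refine ⟨F, hF, M, algebraMap ℝ _ (4 * σ * m) * phi m * N, hM, hN', ?_⟩
  have eF' : compW m σ F hF * phi m = a := by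
    rw [← eF]; linear_combination mul_rho_mul_phi (m := m) (σ := σ) a
  have ev : dv m σ (algebraMap ℝ _ (4 * σ * m) * phi m * N) =
      (1 - algebraMap ℝ _ (1 / m)) * hinv m σ * (algebraMap ℝ _ (4 * σ * m) * phi m * N) +
        (dv m σ M - algebraMap ℝ _ (1 / m) * hinv m σ * d) := by
    rw [Derivation.leibniz, Derivation.leibniz, Derivation.map_algebraMap, eN, dv_phi,
      algebraMap_one_sub]
    simp only [smul_eq_mul]
    linear_combination (dv m σ M - algebraMap ℝ _ (1 / m) * hinv m σ * d) *
      rho_mul_phi (Ω := Ω) (m := m) (σ := σ)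
  rw [baseFlow, isSymm_lam.brk_consFlow, ← consFlow_add, symmCurA_lam, symmCurB_lam, hM.devV,
    hN'.devW, hM.totD (m := m) (σ := σ), eM, ev, eF']
  generalize algebraMap ℝ _ (4 * σ * m) * phi m * N = N'
  have e0 := rv_sub_lam_mul_inv (Ω := Ω) (m := m) (σ := σ)
  have e1 := rv_sub_lam_mul_hinv (Ω := Ω) (m := m) (σ := σ)
  have e2 := m_mul_inv (Ω := Ω) m σ
  congr 1
  · linear_combination -(c - a) * wj m σ 1 * e0
  · linear_combination -(c - a) * wj m σ 1 * e0 - vj 1 * d * e0 + 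
      (1 - algebraMap ℝ _ (1 / m)) * N' * vj 1 * e1 - N' * vj 1 * e2

/-- The leading coefficients of the normal form at the second order. -/
lemma lead_normalFlow (hm2 : m ≠ 2) {F G f : ℝ → ℝ} (h : SmoothParams m σ (Ω : Set Pt) F G f) :
    ∃ A B p p' q : JetAlg Ω, normalFlow m σ F G f h 2 = consFlow m σ A B ∧
      Lead m σ p (algebraMap ℝ _ (-((m + 1) / (4 * m))) * compV f h.2.2) A ∧ Lead m σ p' q B ∧
      p' - p = algebraMap ℝ _ (1 / m) ^ 2 * phi m ^ 2 * (algebraMap ℝ _ (1 / 6) *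
        compW m σ F h.1 ^ 2 * hinv m σ * algebraMap ℝ _ m * (4 - 4 * algebraMap ℝ _ (1 / m))) +
        algebraMap ℝ _ (1 / (4 * m)) * phi m ^ 2 * (algebraMap ℝ _ σ * compW m σ G h.2.1) := by
  have hF := isCoef_compW h.1
  have hF₁ := isCoef_compW (contDiffOn_deriv_w h.1)
  have hG := (isCoef_compW h.2.1).const_mul σ
  have hG₁ := (isCoef_compW (contDiffOn_deriv_w h.2.1)).const_mul σ
  have hf := isCoef_compV h.2.2
  have hf₁ := isCoef_compV (contDiffOn_deriv_v h.2.2)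
  have hm0 := (Param.pos m σ).ne'
  refine ⟨_, _, _, _, _, rfl, (lead_secondA isSymm_lam hF hF₁ hG hG₁ hf hf₁).congr rfl ?_,
    lead_secondB isSymm_lam hF hF₁ hG hG₁ hf hf₁, ?_⟩
  · refine JetAlg.ext_evalAt fun z => ?_
    have hmm : m - 2 ≠ 0 := sub_ne_zero.2 hm2
    simp only [dv_rv, map_mul, map_sub, map_add, map_one, map_ofNat, AlgHom.commutes,
      Algebra.algebraMap_self_apply]
    field_simp
    ring
  · refine JetAlg.ext_evalAt fun z => ?_
    simp only [dw_lam, curT_lam, Derivation.map_algebraMap, map_mul, map_sub, map_add,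
      map_neg, map_pow, map_zero, map_one, map_ofNat, AlgHom.commutes, Algebra.algebraMap_self_apply]
    field_simp
    ring

/-- The symmetry `w_τ = φ w_x`, `v_τ = 0` extends to the normal form. -/
lemma exists_symm_normalFlow {F : ℝ → ℝ} (hF : ContDiffOn ℝ ∞ F (riemannInv m σ '' (Ω : Set Pt))) :
    ∃ Q₁ : Fin 2 → JetAlg Ω, (∀ i, HP2 fieldFrame (Q₁ i)) ∧
      brk (baseFlow m σ) Q₁ + brk (consFlow m σ (compW m σ F hF * phi m * wj m σ 1) 0)
        (symmFlow m σ (phi m) 0) = 0 ∧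
      ∀ (G f : ℝ → ℝ) (h : SmoothParams m σ (Ω : Set Pt) F G f),
        ∃ Q₂ : Fin 2 → JetAlg Ω, (∀ i, HP3 fieldFrame (Q₂ i)) ∧
          brk (baseFlow m σ) Q₂ + brk (normalFlow m σ F G f h 1) Q₁ +
            brk (normalFlow m σ F G f h 2) (symmFlow m σ (phi m) 0) = 0 := by
  have hs := isSymm_phi (Ω := Ω) (m := m) (σ := σ)
  have hT := hs.isCoef_curT
  have hM := hs.coef_fst.dw (m := m) (σ := σ)
  have hn := isCoef_algebraMap (Ω := Ω) (1 / m)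
  have hp := isCoef_phi (Ω := Ω) m
  have hcF := isCoef_compW hF
  have key : ∀ (G f : ℝ → ℝ) (h : SmoothParams m σ (Ω : Set Pt) F G f), _ := fun G f h => by
    have hGσ := (grad_compW h.2.1).const_mul σ
    have hGσ' := (grad_compW (contDiffOn_deriv_w h.2.1)).const_mul σ
    rw [mul_zero] at hGσ hGσ'
    exact deformed_commute hs (grad_compW h.1) (grad_compW (contDiffOn_deriv_w h.1)) hGσ hGσ'
      (grad_compV (m := m) (σ := σ) h.2.2) (grad_compV (contDiffOn_deriv_v h.2.2))
  refine ⟨consFlow m σ (algebraMap ℝ _ (1 / m) * phi m * compW m σ F hF * curT m σ (phi m) 0 *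
      wj m σ 1) (algebraMap ℝ _ (1 / m) * phi m * compW m σ F hF *
      (curT m σ (phi m) 0 - dw m σ (phi m)) * wj m σ 1),
    hp2_consFlow (hp1_wj (((hn.mul hp).mul hcF).mul hT))
      (hp1_wj (((hn.mul hp).mul hcF).mul (hT.sub hM))), ?_, fun G f h => ⟨_, fun i => ?_,
      (key G f h).2⟩⟩
  · have h : SmoothParams m σ (Ω : Set Pt) F (fun _ => 0) fun _ => 0 :=
      ⟨hF, contDiffOn_const, contDiffOn_const⟩
    rw [← normalFlow_one h]
    exact (key _ _ h).1
  · exact hp3_consFlow (lead_secondA hs hcF (isCoef_compW (contDiffOn_deriv_w h.1))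
      ((isCoef_compW h.2.1).const_mul σ)
      ((isCoef_compW (contDiffOn_deriv_w h.2.1)).const_mul σ) (isCoef_compV h.2.2)
      (isCoef_compV (contDiffOn_deriv_v h.2.2))).hp2
      (lead_secondB hs hcF (isCoef_compW (contDiffOn_deriv_w h.1))
      ((isCoef_compW h.2.1).const_mul σ)
      ((isCoef_compW (contDiffOn_deriv_w h.2.1)).const_mul σ) (isCoef_compV h.2.2)
      (isCoef_compV (contDiffOn_deriv_v h.2.2))).hp2 i

/-- Normalization at the second order. -/
theorem exists_normal_two (hs : Solvable Ω m σ) (hm2 : m ≠ 2) {F : ℝ → ℝ}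
    (hF : ContDiffOn ℝ ∞ F (riemannInv m σ '' (Ω : Set Pt))) {A B : JetAlg Ω}
    (hA : HP2 fieldFrame A) (hB : HP2 fieldFrame B) {Q₁ Q₂ : Fin 2 → JetAlg Ω}
    (hQ₁ : ∀ i, HP2 fieldFrame (Q₁ i)) (hQ₂ : ∀ i, HP3 fieldFrame (Q₂ i))
    (e₁ : brk (baseFlow m σ) Q₁ + brk (consFlow m σ (compW m σ F hF * phi m * wj m σ 1) 0)
      (symmFlow m σ (phi m) 0) = 0)
    (e₂ : brk (baseFlow m σ) Q₂ + brk (consFlow m σ (compW m σ F hF * phi m * wj m σ 1) 0) Q₁ +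
      brk (consFlow m σ A B) (symmFlow m σ (phi m) 0) = 0) :
    ∃ G f, ∃ h : SmoothParams m σ (Ω : Set Pt) F G f, ∃ α β, HP1 fieldFrame α ∧
      HP1 fieldFrame β ∧ normalFlow m σ F G f h 2 = consFlow m σ A B +
        brk (baseFlow m σ) (consFlow m σ α β) := by
  obtain ⟨N₁, hN₁, d₁, hN⟩ := exists_symm_normalFlow hF
  -- Both corrections of the symmetry solve the same inhomogeneous equation, and the flow `(2,1)`
  -- has no symmetries of degree two.
  obtain rfl : Q₁ = N₁ := sub_eq_zero.1 (eq_zero_of_brk_baseFlow (m := m) (σ := σ)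
    (fun i => (hQ₁ i).sub (hN₁ i)) (by
      rw [brk_sub_right]; exact sub_eq_zero.2 (add_right_cancel (e₁.trans d₁.symm))))
  obtain ⟨a₁, a₂, a₃, a₄, a₅, h₁, h₂, h₃, h₄, h₅, eA⟩ := HP2.riemann (m := m) (σ := σ) hA
  obtain ⟨b₁, b₂, b₃, b₄, b₅, k₁, k₂, k₃, k₄, k₅, eB⟩ := HP2.riemann (m := m) (σ := σ) hB
  have lA : Lead m σ a₁ a₂ A := ⟨h₁, h₂, a₃, a₄, a₅, h₃, h₄, h₅, eA⟩
  have lB : Lead m σ b₁ b₂ B := ⟨k₁, k₂, b₃, b₄, b₅, k₃, k₄, k₅, eB⟩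
  have hm0 := Param.pos m σ
  -- Here `δ` and `ε` measure how far the leading coefficients `b₁ - a₁` and `a₂` are from those of
  -- the normal form. Whatever `G` and `f` are, `second_order` applies to the difference. It is used
  -- with `G = f = 0` to find the parameters, and then with the parameters found, where `δ = ε = 0`.
  have step : ∀ (G f : ℝ → ℝ) (h : SmoothParams m σ (Ω : Set Pt) F G f) (δ ε : JetAlg Ω),
      δ = b₁ - a₁ - algebraMap ℝ _ (1 / m) ^ 2 * phi m ^ 2 * (algebraMap ℝ _ (1 / 6) *
        compW m σ F h.1 ^ 2 * hinv m σ * algebraMap ℝ _ m * (4 - 4 * algebraMap ℝ _ (1 / m))) -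
        algebraMap ℝ _ (1 / (4 * m)) * phi m ^ 2 * (algebraMap ℝ _ σ * compW m σ G h.2.1) →
      ε = a₂ - algebraMap ℝ _ (-((m + 1) / (4 * m))) * compV f h.2.2 →
      IsCoef δ ∧ IsCoef ε ∧ dw m σ ε = 0 ∧
      dv m σ δ = 2 * (1 - algebraMap ℝ _ (1 / m)) * hinv m σ * δ ∧
      (ε = 0 → δ = 0 → ∃ α β, HP1 fieldFrame α ∧ HP1 fieldFrame β ∧
        normalFlow m σ F G f h 2 = consFlow m σ A B +
          brk (baseFlow m σ) (consFlow m σ α β)) := by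
    intro G f h δ ε hδ hε
    obtain ⟨A', B', p, p', q, eN, lA', lB', ep⟩ := lead_normalFlow hm2 h
    obtain ⟨N₂, hN₂, d₂⟩ := hN G f h
    have hδ' : b₁ - p' - (a₁ - p) = δ := by rw [hδ]; linear_combination -ep
    have hdiff : consFlow m σ (A - A') (B - B') =
        consFlow m σ A B - normalFlow m σ F G f h 2 := by
      rw [eN, sub_eq_add_neg, sub_eq_add_neg B, consFlow_add, consFlow_neg, ← sub_eq_add_neg]
    have e : brk (baseFlow m σ) (Q₂ - N₂) =
        brk (symmFlow m σ (phi m) 0) (consFlow m σ (A - A') (B - B')) := by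
      rw [hdiff, brk_sub_right, brk_sub_right, brk_neg (symmFlow _ _ _ _),
        brk_neg (symmFlow _ _ _ _) (normalFlow _ _ _ _ _ _ _)]
      rw [normalFlow_one] at d₂
      linear_combination (exp := 1) e₂ - d₂
    obtain ⟨r₁, r₂, r₃⟩ := second_order (lA.sub lA') (lB.sub lB')
      (fun i => (hQ₂ i).sub (hN₂ i)) e
    rw [hδ'] at r₂ r₃
    rw [← hε] at r₁ r₃
    refine ⟨?_, ?_, r₁, r₂, fun h0 h0' => ?_⟩
    · rw [← hδ']; exact (k₁.sub lB'.1).sub (h₁.sub lA'.1)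
    · rw [hε]; exact h₂.sub lA'.2.1
    · obtain ⟨α, β, hα, hβ, r⟩ := r₃ h0 h0'
      refine ⟨α, β, hα, hβ, ?_⟩
      rw [hdiff] at r
      linear_combination (exp := 1) -r
  have hm1 : m + 1 ≠ 0 := by linarith
  have h0 : SmoothParams m σ (Ω : Set Pt) F (fun _ => 0) fun _ => 0 :=
    ⟨hF, contDiffOn_const, contDiffOn_const⟩
  obtain ⟨s₁, -, -, s₂, -⟩ := step _ _ h0 _ _ rfl rfl
  obtain ⟨-, s₃, s₄, -, -⟩ := step _ _ h0 _ _ rfl rfl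
  have z₁ : compW m σ (fun _ => 0) h0.2.1 = 0 := JetAlg.ext_evalAt fun z => by
    rw [evalAt_compW, map_zero]
  have z₂ : compV (fun _ => 0) h0.2.2 = 0 := JetAlg.ext_evalAt fun z => by
    rw [evalAt_compV, map_zero]
  rw [z₁, mul_zero, mul_zero, sub_zero] at s₁ s₂
  rw [z₂, mul_zero, sub_zero] at s₃ s₄
  obtain ⟨f₀, hf₀, ef⟩ := hs.of_dw _ s₃ s₄
  obtain ⟨G₀, hG₀, eG⟩ := hs.of_dv _ (s₁.mul ((isCoef_rho m σ).pow 2))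
    (dv_mul_rho_pow 2 (by rw [s₂]; push_cast; ring))
  -- The coefficient of `G` is `σ φ² / (4m)`, while `b₁ - a₁` minus the `F`-term equals `16 m² φ²
  -- G₀` because `(4σm φ ρ)² = 1`. The coefficient of `f` is `-(m + 1)/(4m)`.
  refine ⟨fun t => 64 * σ * m ^ 3 * G₀ t, fun t => -(4 * m / (m + 1)) * f₀ t,
    ⟨hF, contDiffOn_const.mul hG₀, contDiffOn_const.mul hf₀⟩, ?_⟩
  refine (step _ _ _ _ _ rfl rfl).2.2.2.2 ?_ ?_
  · rw [← algebraMap_mul_compV _ hf₀, ← ef]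
    refine JetAlg.ext_evalAt fun z => ?_
    simp only [map_sub, map_mul, map_zero, AlgHom.commutes, Algebra.algebraMap_self_apply]
    field_simp
    ring
  · rw [← algebraMap_mul_compW _ hG₀, ← eG]
    have hr : (algebraMap ℝ (JetAlg Ω) (4 * σ * m) * phi m * rho m σ) ^ 2 = 1 := by
      rw [rho_mul_phi, one_pow]
    have hc : algebraMap ℝ (JetAlg Ω) (1 / (4 * m)) * (algebraMap ℝ _ σ *
        algebraMap ℝ _ (64 * σ * m ^ 3)) = algebraMap ℝ _ (4 * σ * m) ^ 2 := by
      rw [← map_mul, ← map_mul, ← map_pow]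
      congr 1
      field_simp
      ring
    generalize b₁ - a₁ - _ = δ
    linear_combination -phi m ^ 2 * δ * rho m σ ^ 2 * hc - δ * hr

/-- Reduction of a deformation that commutes with an extension of the symmetry `w_τ = φ w_x`,
`v_τ = 0`. -/
theorem exists_normalFlow (hs : Solvable Ω m σ) (hm2 : m ≠ 2) {A₁ B₁ A₂ B₂ : JetAlg Ω}
    (hA₁ : HP1 fieldFrame A₁) (hB₁ : HP1 fieldFrame B₁) (hA₂ : HP2 fieldFrame A₂)
    (hB₂ : HP2 fieldFrame B₂) {Q₁ Q₂ : Fin 2 → JetAlg Ω} (hQ₁ : ∀ i, HP2 fieldFrame (Q₁ i))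
    (hQ₂ : ∀ i, HP3 fieldFrame (Q₂ i))
    (e₁ : brk (baseFlow m σ) Q₁ + brk (consFlow m σ A₁ B₁) (symmFlow m σ (phi m) 0) = 0)
    (e₂ : brk (baseFlow m σ) Q₂ + brk (consFlow m σ A₁ B₁) Q₁ +
      brk (consFlow m σ A₂ B₂) (symmFlow m σ (phi m) 0) = 0) :
    ∃ F G f, ∃ h : SmoothParams m σ (Ω : Set Pt) F G f, ∃ M N α β : JetAlg Ω,
      IsCoef M ∧ IsCoef N ∧ HP1 fieldFrame α ∧ HP1 fieldFrame β ∧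
      normalFlow m σ F G f h 1 =
        consFlow m σ A₁ B₁ + brk (baseFlow m σ) (consFlow m σ M N) ∧
      normalFlow m σ F G f h 2 = consFlow m σ A₂ B₂ +
        brk (consFlow m σ A₁ B₁) (consFlow m σ M N) +
        (1 / 2 : ℝ) • brk (brk (baseFlow m σ) (consFlow m σ M N)) (consFlow m σ M N) +
        brk (baseFlow m σ) (consFlow m σ α β) := by
  obtain ⟨F, hF, M, N, hM, hN, e⟩ := exists_normal_one hs hA₁ hB₁ hQ₁ (by
    rw [brk_neg (symmFlow _ _ _ _)]; exact eq_neg_of_add_eq_zero_left e₁)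
  have hx : ∀ i, HP1 fieldFrame (consFlow m σ M N i) := fun i => by
    fin_cases i
    · exact ((isCoef_rho m σ).mul hN).hp1_totD
    · exact hM.hp1_totD
  have hS := hp1_symmFlow (m := m) (σ := σ) (isCoef_phi (Ω := Ω) m) isCoef_zero
  have hb := hp1_symmFlow (m := m) (σ := σ) (isCoef_lam (Ω := Ω) (m := m) (σ := σ)) isCoef_rv
  have hK := hp2_consFlow (m := m) (σ := σ) hA₁ hB₁
  have hb0 : brk (baseFlow m σ) (symmFlow m σ (phi m) 0) = (0 : Fin 2 → JetAlg Ω) :=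
    brk_baseFlow_symmFlow isSymm_phi
  -- The second-order part of the Lie series is `K₂ + ½ ([K₁, X] + [K₁ + [K₀, X], X])`. The outer
  -- brackets are between systems of conservation laws, the inner sum being the normalized
  -- first-order part, so the result again has currents.
  obtain ⟨A, B, hA, hB, e'⟩ : ∃ A B : JetAlg Ω, HP2 fieldFrame A ∧ HP2 fieldFrame B ∧
      consFlow m σ A B = consFlow m σ A₂ B₂ + brk (consFlow m σ A₁ B₁) (consFlow m σ M N) +
        (1 / 2 : ℝ) • brk (brk (baseFlow m σ) (consFlow m σ M N)) (consFlow m σ M N) := by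
    have hw : HP1 fieldFrame (compW m σ F hF * phi m * wj m σ 1) :=
      hp1_wj ((isCoef_compW hF).mul (isCoef_phi m))
    have hcur : ∀ A B : JetAlg Ω, HP1 fieldFrame A → HP1 fieldFrame B → ∃ A' B' : JetAlg Ω,
        HP2 fieldFrame A' ∧ HP2 fieldFrame B' ∧
        brk (consFlow m σ A B) (consFlow m σ M N) = consFlow m σ A' B' := fun A B hA hB =>
      ⟨_, _, (hM.hp2_evo (hp2_consFlow hA hB)).sub (hA.hp2_evo hx),
        ((hN.hp2_evo (hp2_consFlow hA hB)).sub (hB.hp2_evo hx)).sub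
        ((((isFrame_field.totD_one hB).coef_mul hN).sub (hB.mul hN.hp1_totD)).coef_mul
          ((isCoef_algebraMap _).mul (isCoef_hinv m σ))), brk_consFlow _ _ _ _⟩
    obtain ⟨A₃, B₃, hA₃, hB₃, e₃⟩ := hcur _ _ hA₁ hB₁
    obtain ⟨A₄, B₄, hA₄, hB₄, e₄⟩ := hcur _ _ hw HP1.zero
    refine ⟨A₂ + algebraMap ℝ _ (1 / 2) * (A₃ + A₄), B₂ + algebraMap ℝ _ (1 / 2) * (B₃ + B₄),
      hA₂.add ((hA₃.add hA₄).coef_mul (isCoef_algebraMap _)),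
      hB₂.add ((hB₃.add hB₄).coef_mul (isCoef_algebraMap _)), ?_⟩
    rw [← e, brk_add_left] at e₄
    rw [consFlow_add, consFlow_const_mul, consFlow_add, ← e₃, ← e₄]
    module
  -- Bracketing the commutation relations with `X` and expanding by the Jacobi identity gives the
  -- terms needed to see that the deformation and its symmetry, transformed by the same Lie series,
  -- still commute through order `ε²`.
  have j₁ := congrArg (fun Y => brk Y (consFlow m σ M N)) e₁
  have j₀ := congrArg (fun Y => brk (brk Y (consFlow m σ M N)) (consFlow m σ M N)) hb0
  have j₂ := congrArg (fun Y => brk Y (consFlow m σ M N)) hb0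
  simp only [brk_zero_left, brk_add_left, brk_brk _ (symmFlow _ _ _ _), brk_brk _ Q₁,
    brk_brk _ (brk _ _)] at j₀ j₁ j₂
  obtain ⟨G, f, h, α, β, hα, hβ, eN⟩ := exists_normal_two hs hm2 hF hA hB
    (Q₁ := Q₁ + brk (symmFlow m σ (phi m) 0) (consFlow m σ M N))
    (Q₂ := Q₂ + brk Q₁ (consFlow m σ M N) +
      (1 / 2 : ℝ) • brk (brk (symmFlow m σ (phi m) 0) (consFlow m σ M N)) (consFlow m σ M N))
    (fun i => (hQ₁ i).add (hp2_brk hS hx i))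
    (fun i => ((hQ₂ i).add (hp3_brk hQ₁ hx i)).add (by
      rw [Pi.smul_apply, Algebra.smul_def]
      exact (hp3_brk (hp2_brk hS hx) hx i).coef_mul (isCoef_algebraMap _)))
    (by
      rw [← e]
      simp only [brk_add_left, brk_add_right]
      linear_combination (exp := 1) e₁ + j₂)
    (by
      rw [← e, e']
      simp only [brk_add_left, brk_add_right, brk_smul_left, brk_smul_right]
      linear_combination (norm := module) e₂ + j₁ + (1 / 2 : ℝ) • j₀)
  refine ⟨F, G, f, h, M, N, α, β, hM, hN, hα, hβ, ?_, ?_⟩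
  · rw [normalFlow_one, e]
  · rw [eN, e']

end

/-! ### Primitives in the Riemann invariants on small squares -/

section

/-! ### Local solvability -/

section Primitive

open MeasureTheory

/-- A primitive from `-∞` is a convolution with the Heaviside function, so smoothness of
convolutions with parameters applies to primitives. -/
lemma convolution_heaviside {g : ℝ → ℝ} (x : ℝ) :
    MeasureTheory.convolution ((Set.Ioi (0 : ℝ)).indicator fun _ => (1 : ℝ)) g
      (ContinuousLinearMap.mul ℝ ℝ) volume x = ∫ t in Set.Iic x, g t := by
  rw [MeasureTheory.convolution_eq_swap, integral_Iic_eq_integral_Iio,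
    ← integral_indicator measurableSet_Iio]
  congr 1
  funext t
  by_cases h : t < x
  · simp [Set.indicator, h]
  · simp [Set.indicator, h]

/-- Smooth dependence of a primitive on parameters. -/
lemma contDiffOn_primitive {h : ℝ × ℝ → ℝ} {c R : ℝ} {J : Set ℝ} (hJ : IsOpen J)
    (hh : ContDiffOn ℝ ∞ h (Metric.ball c R ×ˢ J)) :
    ContDiffOn ℝ ∞ (fun x : ℝ × ℝ => ∫ s in c..x.1, h (s, x.2)) (Metric.ball c R ×ˢ J) := by
  rintro ⟨w, v⟩ ⟨hw, hv⟩
  have hr : dist w c < R := hw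
  obtain ⟨r, hwr, hrR⟩ := exists_between hr
  obtain ⟨r', hrr, hrR'⟩ := exists_between hrR
  -- The cut-off makes the integrand globally smooth in `s` with support in a fixed compact ball. It
  -- equals one on the ball of radius `r`, so primitives based at `c` are unchanged near `w`.
  let χ : ContDiffBump c := ⟨r, r', dist_nonneg.trans_lt hwr, hrr⟩
  let g : ℝ → ℝ → ℝ := fun v s => χ s * h (s, v)
  have hg0 : ∀ (v s : ℝ), v ∈ J → s ∉ Metric.closedBall c r' → g v s = 0 := fun v s _ hs => by
    have : s ∉ Function.support χ := by
      rw [χ.support_eq]; exact fun h => hs (Metric.ball_subset_closedBall h)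
    simp only [g, Function.notMem_support.1 this, zero_mul]
  have hgs : ContDiffOn ℝ ∞ (Function.uncurry g) (J ×ˢ Set.univ) := by
    rintro ⟨y, s⟩ ⟨hy, -⟩
    by_cases hs : s ∈ Metric.ball c R
    · refine ContDiffAt.contDiffWithinAt ?_
      have h1 : ContDiffAt ℝ ∞ h (s, y) :=
        hh.contDiffAt ((Metric.isOpen_ball.prod hJ).mem_nhds ⟨hs, hy⟩)
      have h2 : ContDiffAt ℝ ∞ (fun q : ℝ × ℝ => (q.2, q.1)) (y, s) := by fun_prop
      exact (χ.contDiff.contDiffAt.comp (y, s) contDiffAt_snd).mul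
        (ContDiffAt.comp (y, s) h1 h2)
    · refine ContDiffAt.contDiffWithinAt ?_
      have hs' : s ∈ (Metric.closedBall c r')ᶜ := fun h =>
        hs (Metric.closedBall_subset_ball hrR' h)
      refine (contDiffAt_const (c := (0 : ℝ))).congr_of_eventuallyEq ?_
      filter_upwards [(hJ.prod Metric.isClosed_closedBall.isOpen_compl).mem_nhds ⟨hy, hs'⟩]
        with q hq using hg0 q.1 q.2 hq.1 hq.2
  have hcont : ∀ y ∈ J, Continuous (g y) := fun y hy => by
    have h1 := hgs.continuousOn.comp_continuous (f := fun s : ℝ => (y, s)) (by fun_prop)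
      fun s => ⟨hy, Set.mem_univ _⟩
    exact h1
  have hcomp : ∀ y ∈ J, HasCompactSupport (g y) := fun y hy =>
    HasCompactSupport.intro (isCompact_closedBall c r') fun s hs => hg0 y s hy hs
  have hloc : LocallyIntegrable ((Set.Ioi (0 : ℝ)).indicator fun _ => (1 : ℝ)) volume :=
    (locallyIntegrable_const 1).indicator measurableSet_Ioi
  have key := contDiffOn_convolution_right_with_param (n := ⊤) (μ := volume)
    (ContinuousLinearMap.mul ℝ ℝ) hJ (isCompact_closedBall c r') hg0 hloc hgs
  simp only [convolution_heaviside] at key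
  have h1 : ContDiffAt ℝ ∞ (fun x : ℝ × ℝ => ∫ t in Set.Iic x.1, g x.2 t) (w, v) :=
    ContDiffAt.comp (w, v) (f := fun x : ℝ × ℝ => (x.2, x.1))
      (key.contDiffAt ((hJ.prod isOpen_univ).mem_nhds ⟨hv, Set.mem_univ _⟩)) (by fun_prop)
  have h2 : ContDiffAt ℝ ∞ (fun x : ℝ × ℝ => ∫ t in Set.Iic c, g x.2 t) (w, v) :=
    ContDiffAt.comp (w, v) (f := fun x : ℝ × ℝ => (x.2, c))
      (key.contDiffAt ((hJ.prod isOpen_univ).mem_nhds ⟨hv, Set.mem_univ _⟩)) (by fun_prop)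
  refine ((h1.sub h2).congr_of_eventuallyEq ?_).contDiffWithinAt
  filter_upwards [(Metric.isOpen_ball.prod hJ).mem_nhds
    (⟨hwr, hv⟩ : (w, v) ∈ Metric.ball c r ×ˢ J)] with x hx
  have hi := (hcont _ hx.2).integrable_of_hasCompactSupport (μ := volume) (hcomp _ hx.2)
  rw [intervalIntegral.integral_Iic_sub_Iic hi.integrableOn hi.integrableOn]
  refine intervalIntegral.integral_congr fun s hs => ?_
  have hs' : s ∈ Metric.closedBall c r := by
    have hc : c ∈ Metric.closedBall c r := Metric.mem_closedBall_self (dist_nonneg.trans hwr.le)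
    rw [Real.closedBall_eq_Icc] at hc ⊢
    have hx1 := Metric.ball_subset_closedBall hx.1
    rw [Real.closedBall_eq_Icc] at hx1
    exact Set.uIcc_subset_Icc hc hx1 hs
  simp only [g, χ.one_of_mem_closedBall hs', one_mul]

lemma hasDerivAt_primitive {h : ℝ × ℝ → ℝ} {c R : ℝ} {J : Set ℝ}
    (hh : ContDiffOn ℝ ∞ h (Metric.ball c R ×ˢ J)) {x : ℝ × ℝ} (hx : x ∈ Metric.ball c R ×ˢ J) :
    HasDerivAt (fun t => ∫ s in c..t, h (s, x.2)) (h x) x.1 := by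
  have hc : ContinuousOn (fun s => h (s, x.2)) (Metric.ball c R) :=
    hh.continuousOn.comp (by fun_prop) fun s hs => ⟨hs, hx.2⟩
  refine intervalIntegral.integral_hasDerivAt_right ?_ ?_
    (hc.continuousAt (Metric.isOpen_ball.mem_nhds hx.1))
  · refine ContinuousOn.intervalIntegrable (hc.mono ?_)
    have hc0 : c ∈ Metric.ball c R := Metric.mem_ball_self (dist_nonneg.trans_lt hx.1)
    have hx1 := hx.1
    rw [Real.ball_eq_Ioo] at hc0 hx1 ⊢
    exact (Set.ordConnected_Ioo).uIcc_subset hc0 hx1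
  · exact hc.stronglyMeasurableAtFilter Metric.isOpen_ball _ hx.1

end Primitive

section Chart

variable {Ω : Opens Pt}

lemma Rep.hasDerivAt_line {f : Jet → ℝ} {f' : JetAlg Ω} (hf : Rep f f')
    (V : ℕ → Fin 2 → JetAlg Ω) (z : JetDom Ω) :
    HasDerivAt (fun t : ℝ => f (z.1 + t • jetOf V z)) ((vf V f').1 z) 0 := by
  rw [← deriv_line_eq hf V z]
  refine DifferentiableAt.hasDerivAt
    ((differentiableAt_toFun_line f' z (jetOf V z)).congr_of_eventuallyEq ?_)
  filter_upwards [eventually_toFun z (jetOf V z)] with t ht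
  exact (hf ⟨_, ht⟩).trans (rep_toFun f' ⟨_, ht⟩).symm

/-- The Riemann invariants `(w, v)`. -/
def riemannMap (m σ : ℝ) (p : Pt) : ℝ × ℝ := (riemannInv m σ p, p 1)

/-- The fields as functions of the Riemann invariants. -/
def riemannChart (m σ : ℝ) (x : ℝ × ℝ) : Pt := ![(σ * (x.2 - x.1) / 4) ^ (1 / m), x.2]

variable {m σ : ℝ} [hP : Param m σ]

lemma riemannChart_riemannMap {p : Pt} (hp : 0 < p 0) :
    riemannChart m σ (riemannMap m σ p) = p := by
  have h : σ * (p 1 - (p 1 - σ * 4 * p 0 ^ m)) / 4 = p 0 ^ m := by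
    linear_combination p 0 ^ m * Param.sq (σ := σ) m
  funext i
  fin_cases i
  · change (σ * (p 1 - (p 1 - σ * 4 * p 0 ^ m)) / 4) ^ (1 / m) = p 0
    rw [h, one_div, Real.rpow_rpow_inv hp.le (Param.pos m σ).ne']
  · rfl

lemma riemannMap_riemannChart {x : ℝ × ℝ} (hx : 0 < σ * (x.2 - x.1)) :
    riemannMap m σ (riemannChart m σ x) = x := by
  refine Prod.ext ?_ rfl
  change x.2 - σ * 4 * ((σ * (x.2 - x.1) / 4) ^ (1 / m)) ^ m = x.1
  rw [one_div, Real.rpow_inv_rpow (by positivity) (Param.pos m σ).ne']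
  linear_combination -(x.2 - x.1) * Param.sq (σ := σ) m

lemma contDiffAt_riemannChart {x : ℝ × ℝ} (hx : 0 < σ * (x.2 - x.1)) :
    ContDiffAt ℝ ∞ (riemannChart m σ) x := by
  refine contDiffAt_pi.2 fun i => ?_
  fin_cases i
  · have h : ContDiffAt ℝ ∞ (fun x : ℝ × ℝ => σ * (x.2 - x.1) / 4) x := by fun_prop
    exact h.rpow_const_of_ne (by positivity)
  · exact contDiffAt_snd

lemma contDiffAt_riemannMap {p : Pt} (hp : 0 < p 0) : ContDiffAt ℝ ∞ (riemannMap m σ) p := by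
  have h : ContDiffAt ℝ ∞ (fun p : Pt => p 0) p := by fun_prop
  have h' : ContDiffAt ℝ ∞ (fun p : Pt => p 1) p := by fun_prop
  exact (h'.sub (contDiffAt_const.mul (h.rpow_const_of_ne hp.ne'))).prodMk h'

variable [hΩ : PosFst Ω]

lemma contDiffOn_comp_riemannMap {H : ℝ × ℝ → ℝ} {B : Set (ℝ × ℝ)} (hB : IsOpen B)
    (hH : ContDiffOn ℝ ∞ H B) (hΦ : ∀ p ∈ (Ω : Set Pt), riemannMap m σ p ∈ B) :
    ContDiffOn ℝ ∞ (fun p => H (riemannMap m σ p)) (Ω : Set Pt) := fun p hp =>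
  (ContDiffAt.comp p (hH.contDiffAt (hB.mem_nhds (hΦ p hp)))
    (contDiffAt_riemannMap (hΩ.pos p hp))).contDiffWithinAt

lemma vf_comp_riemannMap {H : ℝ × ℝ → ℝ} {B : Set (ℝ × ℝ)} (hB : IsOpen B)
    (hH : ContDiffOn ℝ ∞ H B) (hΦ : ∀ p ∈ (Ω : Set Pt), riemannMap m σ p ∈ B) {f : JetAlg Ω}
    (hf : ∀ z, f.1 z = H (riemannMap m σ (z.1 0))) (V : ℕ → Fin 2 → JetAlg Ω) (z : JetDom Ω) :
    (vf V f).1 z = fderiv ℝ H (riemannMap m σ (z.1 0))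
      ((vf V (rw' m σ)).1 z, (vf V rv).1 z) := by
  have h1 : HasDerivAt (fun t : ℝ => riemannMap m σ ((z.1 + t • jetOf V z) 0))
      ((vf V (rw' m σ)).1 z, (vf V rv).1 z) 0 :=
    (Rep.hasDerivAt_line (f := fun z => riemannInv m σ (z 0)) (fun z => (rw_apply z).symm)
      V z).prodMk (Rep.hasDerivAt_line (f := fun z => z 0 1) (f' := rv) (fun z => rfl) V z)
  have h2 : HasFDerivAt H (fderiv ℝ H (riemannMap m σ (z.1 0)))
      (riemannMap m σ ((z.1 + (0 : ℝ) • jetOf V z) 0)) := by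
    rw [zero_smul, add_zero]
    exact ((hH.contDiffAt (hB.mem_nhds (hΦ _ z.2))).differentiableAt (by simp)).hasFDerivAt
  exact (Rep.hasDerivAt_line (f := fun z => H (riemannMap m σ (z 0))) (fun z => (hf z).symm)
    V z).unique (h2.comp_hasDerivAt 0 h1)

lemma dw_comp_riemannMap {H : ℝ × ℝ → ℝ} {B : Set (ℝ × ℝ)} (hB : IsOpen B)
    (hH : ContDiffOn ℝ ∞ H B) (hΦ : ∀ p ∈ (Ω : Set Pt), riemannMap m σ p ∈ B) {f : JetAlg Ω}
    (hf : ∀ z, f.1 z = H (riemannMap m σ (z.1 0))) (z : JetDom Ω) :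
    (dw m σ f).1 z = fderiv ℝ H (riemannMap m σ (z.1 0)) (1, 0) := by
  have h1 := dw_rw (Ω := Ω) (m := m) (σ := σ)
  have h2 := dw_rv (Ω := Ω) (m := m) (σ := σ)
  rw [dw] at h1 h2 ⊢
  rw [vf_comp_riemannMap hB hH hΦ hf, h1, h2]
  rfl

lemma dv_comp_riemannMap {H : ℝ × ℝ → ℝ} {B : Set (ℝ × ℝ)} (hB : IsOpen B)
    (hH : ContDiffOn ℝ ∞ H B) (hΦ : ∀ p ∈ (Ω : Set Pt), riemannMap m σ p ∈ B) {f : JetAlg Ω}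
    (hf : ∀ z, f.1 z = H (riemannMap m σ (z.1 0))) (z : JetDom Ω) :
    (dv m σ f).1 z = fderiv ℝ H (riemannMap m σ (z.1 0)) (0, 1) := by
  have h1 := dv_rw (Ω := Ω) (m := m) (σ := σ)
  have h2 := dv_rv (Ω := Ω) (m := m) (σ := σ)
  rw [dv] at h1 h2 ⊢
  rw [vf_comp_riemannMap hB hH hΦ hf, h1, h2]
  rfl

/-- A domain that is a square in the Riemann invariants is solvable. -/
theorem solvable_of_square {w₀ v₀ R : ℝ} (hR : 0 < R)
    (hΦ : ∀ p ∈ (Ω : Set Pt), riemannMap m σ p ∈ Metric.ball w₀ R ×ˢ Metric.ball v₀ R)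
    (hΨ : ∀ x ∈ Metric.ball w₀ R ×ˢ Metric.ball v₀ R,
      0 < σ * (x.2 - x.1) ∧ riemannChart m σ x ∈ (Ω : Set Pt)) : Solvable Ω m σ := by
  have hB : IsOpen (Metric.ball w₀ R ×ˢ Metric.ball v₀ R) := Metric.isOpen_ball.prod Metric.isOpen_ball
  have hcoef : ∀ f : JetAlg Ω, IsCoef f → ∃ h : ℝ × ℝ → ℝ,
      ContDiffOn ℝ ∞ h (Metric.ball w₀ R ×ˢ Metric.ball v₀ R) ∧
      ∀ z, f.1 z = h (riemannMap m σ (z.1 0)) := by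
    rintro f ⟨a, ha, e⟩
    refine ⟨fun x => a (riemannChart m σ x), fun x hx => ?_, fun z => ?_⟩
    · exact (ContDiffAt.comp x (ha.contDiffAt (Ω.isOpen.mem_nhds (hΨ x hx).2))
        (contDiffAt_riemannChart (hΨ x hx).1)).contDiffWithinAt
    · rw [e]
      exact congrArg a (riemannChart_riemannMap (hΩ.pos _ z.2)).symm
  have hjet : ∀ x ∈ Metric.ball w₀ R ×ˢ Metric.ball v₀ R,
      ∃ z : JetDom Ω, riemannMap m σ (z.1 0) = x := fun x hx =>
    ⟨⟨fun _ => riemannChart m σ x, (hΨ x hx).2⟩, riemannMap_riemannChart (hΨ x hx).1⟩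
  have hdiff : ∀ h : ℝ × ℝ → ℝ, ContDiffOn ℝ ∞ h (Metric.ball w₀ R ×ˢ Metric.ball v₀ R) →
      ∀ x ∈ Metric.ball w₀ R ×ˢ Metric.ball v₀ R, HasFDerivAt h (fderiv ℝ h x) x :=
    fun h hh x hx => ((hh.contDiffAt (hB.mem_nhds hx)).differentiableAt (by simp)).hasFDerivAt
  have hw : ∀ h : ℝ × ℝ → ℝ, ContDiffOn ℝ ∞ h (Metric.ball w₀ R ×ˢ Metric.ball v₀ R) →
      ∀ x ∈ Metric.ball w₀ R ×ˢ Metric.ball v₀ R,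
        HasDerivAt (fun t => h (t, x.2)) (fderiv ℝ h x (1, 0)) x.1 := fun h hh x hx =>
    (hdiff h hh x hx).comp_hasDerivAt x.1 (f := fun t => (t, x.2))
      ((hasDerivAt_id x.1).prodMk (hasDerivAt_const x.1 x.2))
  have hv : ∀ h : ℝ × ℝ → ℝ, ContDiffOn ℝ ∞ h (Metric.ball w₀ R ×ˢ Metric.ball v₀ R) →
      ∀ x ∈ Metric.ball w₀ R ×ˢ Metric.ball v₀ R,
        HasDerivAt (fun t => h (x.1, t)) (fderiv ℝ h x (0, 1)) x.2 := fun h hh x hx =>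
    (hdiff h hh x hx).comp_hasDerivAt x.2 (f := fun t => (x.1, t))
      ((hasDerivAt_const x.2 x.1).prodMk (hasDerivAt_id x.2))
  refine ⟨fun f hf => ?_, fun f hf => ?_, fun f hf h0 => ?_, fun f hf h0 => ?_⟩
  · obtain ⟨h, hh, e⟩ := hcoef f hf
    have hp := contDiffOn_primitive Metric.isOpen_ball hh
    refine ⟨coef _ (contDiffOn_comp_riemannMap hB hp hΦ), isCoef_coef _ _, JetAlg.ext fun z => ?_⟩
    rw [dw_comp_riemannMap hB hp hΦ (fun z => rfl) z, e]
    exact (hw _ hp _ (hΦ _ z.2)).unique (hasDerivAt_primitive hh (hΦ _ z.2))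
  · obtain ⟨h, hh, e⟩ := hcoef f hf
    -- A primitive in `v` is a primitive in the first variable after swapping the two factors of the
    -- square.
    have hh' : ContDiffOn ℝ ∞ (fun x => h x.swap) (Metric.ball v₀ R ×ˢ Metric.ball w₀ R) :=
      hh.comp (f := Prod.swap) (contDiff_snd.prodMk contDiff_fst).contDiffOn
        fun x hx => ⟨hx.2, hx.1⟩
    have hp := (contDiffOn_primitive Metric.isOpen_ball hh').comp (f := Prod.swap)
      (s := Metric.ball w₀ R ×ˢ Metric.ball v₀ R) (contDiff_snd.prodMk contDiff_fst).contDiffOn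
        fun x hx => ⟨hx.2, hx.1⟩
    refine ⟨coef _ (contDiffOn_comp_riemannMap hB hp hΦ), isCoef_coef _ _, JetAlg.ext fun z => ?_⟩
    rw [dv_comp_riemannMap hB hp hΦ (fun z => rfl) z, e]
    exact (hv _ hp _ (hΦ _ z.2)).unique (hasDerivAt_primitive hh'
      (x := (riemannMap m σ (z.1 0)).swap) ⟨(hΦ _ z.2).2, (hΦ _ z.2).1⟩)
  · obtain ⟨h, hh, e⟩ := hcoef f hf
    have hv0 : v₀ ∈ Metric.ball v₀ R := Metric.mem_ball_self hR
    have hF : ContDiffOn ℝ ∞ (fun w => h (w, v₀)) (riemannInv m σ '' (Ω : Set Pt)) := by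
      refine hh.comp (f := fun w => (w, v₀)) (by fun_prop) ?_
      rintro _ ⟨p, hp, rfl⟩
      exact ⟨(hΦ p hp).1, hv0⟩
    refine ⟨_, hF, JetAlg.ext_evalAt fun z => ?_⟩
    rw [evalAt_compW, evalAt_apply, e]
    have hz := hΦ _ z.2
    -- Every point of the square comes from a point of `Ω`, so the vanishing derivative holds along
    -- the whole segment through the given point, which is connected and meets the line `v = v₀`.
    have hd : ∀ t ∈ Metric.ball v₀ R,
        HasDerivAt (fun t => h ((riemannMap m σ (z.1 0)).1, t)) 0 t := fun t ht => by
      have hx : ((riemannMap m σ (z.1 0)).1, t) ∈ Metric.ball w₀ R ×ˢ Metric.ball v₀ R :=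
        ⟨hz.1, ht⟩
      obtain ⟨z', hz'⟩ := hjet _ hx
      have h1 := hv h hh _ hx
      have h2 := dv_comp_riemannMap hB hh hΦ e z'
      rw [h0, hz'] at h2
      rwa [← h2] at h1
    exact Metric.isOpen_ball.is_const_of_deriv_eq_zero
      (convex_ball v₀ R).isPreconnected (fun t ht => (hd t ht).differentiableAt.differentiableWithinAt)
      (fun t ht => (hd t ht).deriv) hz.2 hv0
  · obtain ⟨h, hh, e⟩ := hcoef f hf
    have hw0 : w₀ ∈ Metric.ball w₀ R := Metric.mem_ball_self hR
    have hF : ContDiffOn ℝ ∞ (fun v => h (w₀, v)) ((fun p : Pt => p 1) '' (Ω : Set Pt)) := by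
      refine hh.comp (f := fun v => (w₀, v)) (by fun_prop) ?_
      rintro _ ⟨p, hp, rfl⟩
      exact ⟨hw0, (hΦ p hp).2⟩
    refine ⟨_, hF, JetAlg.ext_evalAt fun z => ?_⟩
    rw [evalAt_compV, evalAt_apply, e]
    have hz := hΦ _ z.2
    have hd : ∀ t ∈ Metric.ball w₀ R,
        HasDerivAt (fun t => h (t, (riemannMap m σ (z.1 0)).2)) 0 t := fun t ht => by
      have hx : (t, (riemannMap m σ (z.1 0)).2) ∈ Metric.ball w₀ R ×ˢ Metric.ball v₀ R :=
        ⟨ht, hz.2⟩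
      obtain ⟨z', hz'⟩ := hjet _ hx
      have h1 := hw h hh _ hx
      have h2 := dw_comp_riemannMap hB hh hΦ e z'
      rw [h0, hz'] at h2
      rwa [← h2] at h1
    exact Metric.isOpen_ball.is_const_of_deriv_eq_zero
      (convex_ball w₀ R).isPreconnected (fun t ht => (hd t ht).differentiableAt.differentiableWithinAt)
      (fun t ht => (hd t ht).deriv) hz.1 hw0

variable (m σ) in
/-- Every point has a solvable neighbourhood. -/
theorem exists_solvable {p : Pt} (hp : p ∈ (Ω : Set Pt)) : ∃ U : Opens Pt, p ∈ (U : Set Pt) ∧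
    (U : Set Pt) ⊆ Ω ∧ ∃ _ : PosFst U, Solvable U m σ := by
  have hp0 := hΩ.pos p hp
  have hx : 0 < σ * ((riemannMap m σ p).2 - (riemannMap m σ p).1) := by
    have : σ * (p 1 - (p 1 - σ * 4 * p 0 ^ m)) = 4 * p 0 ^ m := by
      linear_combination 4 * p 0 ^ m * Param.sq (σ := σ) m
    change 0 < σ * (p 1 - (p 1 - σ * 4 * p 0 ^ m))
    rw [this]; positivity
  have h1 : ∀ᶠ x in 𝓝 (riemannMap m σ p), 0 < σ * (x.2 - x.1) :=
    (show ContinuousAt (fun x : ℝ × ℝ => σ * (x.2 - x.1)) (riemannMap m σ p) by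
      fun_prop).eventually (lt_mem_nhds hx)
  have h2 : ∀ᶠ x in 𝓝 (riemannMap m σ p), riemannChart m σ x ∈ (Ω : Set Pt) :=
    (contDiffAt_riemannChart hx).continuousAt.eventually
      (by rw [riemannChart_riemannMap hp0]; exact Ω.isOpen.mem_nhds hp)
  obtain ⟨R, hR, hsub⟩ := Metric.eventually_nhds_iff_ball.1 (h1.and h2)
  -- Balls of the product metric are squares, which is the shape `solvable_of_square` requires.
  rw [← ball_prod_same] at hsub
  have hopen : IsOpen {q : Pt | 0 < q 0 ∧ riemannMap m σ q ∈
      Metric.ball (riemannMap m σ p).1 R ×ˢ Metric.ball (riemannMap m σ p).2 R} := by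
    rw [isOpen_iff_mem_nhds]
    rintro q ⟨hq, hq'⟩
    exact ((continuous_apply (0 : Fin 2)).continuousAt.eventually (lt_mem_nhds hq)).and
      ((contDiffAt_riemannMap hq).continuousAt.eventually
        ((Metric.isOpen_ball.prod Metric.isOpen_ball).mem_nhds hq'))
  have hU : PosFst ⟨_, hopen⟩ := ⟨fun q hq => hq.1⟩
  refine ⟨⟨_, hopen⟩, ⟨hp0, Metric.mem_ball_self hR, Metric.mem_ball_self hR⟩, fun q hq => ?_, hU,
    solvable_of_square hR (fun q hq => hq.2) fun x hx => ⟨(hsub x hx).1, ?_⟩⟩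
  · rw [← riemannChart_riemannMap (m := m) (σ := σ) hq.1]
    exact (hsub _ hq.2).2
  · refine ⟨hΩ.pos _ (hsub x hx).2, ?_⟩
    rw [riemannMap_riemannChart (hsub x hx).1]
    exact hx

end Chart

end

/-! ### Return from the algebra to deformations and Miura transformations -/

section

attribute [-instance] instCharZeroOfIsSemireal IsStrictOrderedRing.toCharZero
  FloorSemiring.instCharZero NumberField.to_charZero SubsemiringClass.instCharZero

/-! ### The classification of integrable deformations -/

lemma IsDiffPoly.mono {U V : Set Pt} (h : U ⊆ V) {d : Fin 4} {f : Jet → ℝ}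
    (hf : IsDiffPoly V d f) : IsDiffPoly U d f := by
  fin_cases d
  · obtain ⟨a, ha, e⟩ := hf
    exact ⟨a, ha.mono h, fun z hz => e z (h hz)⟩
  · obtain ⟨a, ha, e⟩ := hf
    exact ⟨a, fun j => (ha j).mono h, fun z hz => e z (h hz)⟩
  · obtain ⟨a, b, ha, hb, e⟩ := hf
    exact ⟨a, b, fun j => (ha j).mono h, fun j k => (hb j k).mono h, fun z hz => e z (h hz)⟩
  · obtain ⟨a, b, c, ha, hb, hc, e⟩ := hf
    exact ⟨a, b, c, fun j => (ha j).mono h, fun j k => (hb j k).mono h,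
      fun j k l => (hc j k l).mono h, fun z hz => e z (h hz)⟩

lemma Commute.mono {U V : Set Pt} (h : U ⊆ V) {K Q : Fin 3 → Jet → Pt} (hc : Commute V K Q) :
    Commute U K Q := fun n z hz => hc n z (h hz)

lemma IsDeformation.mono {m c : ℝ} {U V : Set Pt} (h : U ⊆ V) {K : Fin 3 → Jet → Pt}
    (hK : IsDeformation m c V K) : IsDeformation m c U K := by
  obtain ⟨h0, α, hα, e⟩ := hK
  exact ⟨fun z hz => h0 z (h hz), α, fun n i => (hα n i).mono h, fun n z hz => e n z (h hz)⟩

/-- The symmetry `w_τ = u ^ (m - 1) w_x`, `v_τ = 0` in the fields. -/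
def riemannSymm (m σ : ℝ) (z : Jet) : Pt :=
  ![-(σ / (4 * m) * z 0 0 ^ (1 - m) *
    (z 0 0 ^ (m - 1) * (z 1 1 - 4 * σ * m * z 0 0 ^ (m - 1) * z 1 0))), 0]

variable {Ω : Opens Pt} [hΩ : PosFst Ω] {m σ : ℝ} [hP : Param m σ]

lemma rep_riemannSymm : RepV (Ω := Ω) (riemannSymm m σ) (symmFlow m σ (phi m) 0) := by
  intro i z
  rw [← evalAt_apply]
  fin_cases i
  · simp only [Fin.zero_eta, symmFlow, ofFrame, Matrix.cons_val_zero, riemannSymm, map_mul,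
      map_sub, map_zero, evalAt_rho, evalAt_phi, wj_one_eq, AlgHom.commutes, evalAt_jetCoord,
      Algebra.algebraMap_self_apply]
    ring
  · simp [riemannSymm, symmFlow, ofFrame]

lemma IsDeformation.rep_zero {K : Fin 3 → Jet → Pt}
    (hK : IsDeformation m (2 * σ) (Ω : Set Pt) K) : RepV (Ω := Ω) (K 0) (baseFlow m σ) :=
  fun i z => (congrFun (hK.1 z.1 z.2) i).trans (rep_flow21 i z)

/-- Since `ρ` is invertible with inverse `4σm φ`, any current of `u` can be written as `ρ B`. -/
lemma exists_consFlow {X α : Jet → Pt} {a : Fin 2 → JetAlg Ω} (ha : RepV α a)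
    (e : ∀ z : Jet, z 0 ∈ (Ω : Set Pt) → ∀ i, X z i = totalD (fun z' => α z' i) z) :
    RepV X (consFlow m σ (a 1) (algebraMap ℝ _ (4 * σ * m) * phi m * a 0)) := by
  intro i z
  refine (e z.1 z.2 i).trans (((ha i).totalD z).trans ?_)
  fin_cases i
  · have : rho m σ * (algebraMap ℝ _ (4 * σ * m) * phi m * a 0) = a 0 := by
      linear_combination a 0 * rho_mul_phi (Ω := Ω) (m := m) (σ := σ)
    change _ = (totD (rho m σ * (algebraMap ℝ _ (4 * σ * m) * phi m * a 0))).1 z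
    rw [this]; rfl
  · rfl

/-- The conservative Miura transformation with given currents at both orders. -/
def conservativeMiura (a b : Fin 2 → JetAlg Ω) : Fin 3 → Jet → Pt :=
  ![fun z => z 0, fun z i => jetExt (totD (a i)) z, fun z i => jetExt (totD (b i)) z]

lemma isConservativeMiura_conservativeMiura {a b : Fin 2 → JetAlg Ω} (ha : ∀ i, IsCoef (a i))
    (hb : ∀ i, HP1 fieldFrame (b i)) :
    IsConservativeMiura (Ω : Set Pt) (conservativeMiura a b) := by
  refine ⟨⟨fun z => rfl, fun n i => ?_⟩, fun z i => jetExt (a i) z, fun z i => jetExt (b i) z,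
    fun i => (ha i).isDiffPoly (rep_toFun _), fun i => (hb i).isDiffPoly (rep_toFun _),
    fun z hz i => ⟨?_, ?_⟩⟩
  · fin_cases n
    · exact ⟨fun p => p i, by fun_prop, fun _ _ => rfl⟩
    · exact (ha i).hp1_totD.isDiffPoly (rep_toFun _)
    · exact (isFrame_field.totD_one (hb i)).isDiffPoly (rep_toFun _)
  · exact (rep_toFun (totD (a i)) ⟨z, hz⟩).trans ((rep_toFun (a i)).totalD ⟨z, hz⟩).symm
  · exact (rep_toFun (totD (b i)) ⟨z, hz⟩).trans ((rep_toFun (b i)).totalD ⟨z, hz⟩).symm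

lemma exists_repV {K : Fin 3 → Jet → Pt} {X₀ X₁ X₂ : Fin 2 → JetAlg Ω} (h₀ : RepV (K 0) X₀)
    (h₁ : RepV (K 1) X₁) (h₂ : RepV (K 2) X₂) : ∃ K' : Fin 3 → Fin 2 → JetAlg Ω,
      K' 0 = X₀ ∧ K' 1 = X₁ ∧ K' 2 = X₂ ∧ ∀ n, RepV (K n) (K' n) := by
  refine ⟨![X₀, X₁, X₂], rfl, rfl, rfl, fun n => ?_⟩
  fin_cases n
  exacts [h₀, h₁, h₂]

/-- Reduction of an integrable deformation on a solvable domain. -/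
theorem exists_carries_normalForm (hs : Solvable Ω m σ) (hm2 : m ≠ 2) {K Q : Fin 3 → Jet → Pt}
    (hK : IsDeformation m (2 * σ) (Ω : Set Pt) K)
    (hQ : ∀ (n : Fin 3) (i : Fin 2), IsDiffPoly (Ω : Set Pt) n.succ (fun z => Q n z i))
    (hQ0 : ∀ z : Jet, z 0 ∈ (Ω : Set Pt) → Q 0 z = riemannSymm m σ z)
    (hc : Commute (Ω : Set Pt) K Q) : ∃ (F G f : ℝ → ℝ) (X : Fin 3 → Jet → Pt),
      SmoothParams m σ (Ω : Set Pt) F G f ∧ IsConservativeMiura (Ω : Set Pt) X ∧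
        Carries 2 (Ω : Set Pt) X K (normalForm m σ F G f) := by
  have hK0 := hK.rep_zero
  obtain ⟨-, α, hα, e⟩ := hK
  choose a₁ ha₁ ra₁ using fun i => (hα 1 i).rep_one
  choose a₂ ha₂ ra₂ using fun i => (hα 2 i).rep_two
  choose q₁ hq₁ rq₁ using fun i => (hQ 1 i).rep_two
  choose q₂ hq₂ rq₂ using fun i => (hQ 2 i).rep_three
  have hK1 := exists_consFlow (m := m) (σ := σ) (X := K 1) (α := α 1) ra₁ (e 1)
  have hK2 := exists_consFlow (m := m) (σ := σ) (X := K 2) (α := α 2) ra₂ (e 2)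
  have hS : RepV (Ω := Ω) (Q 0) (symmFlow m σ (phi m) 0) := fun i z =>
    (congrFun (hQ0 z.1 z.2) i).trans (rep_riemannSymm i z)
  have hcoef : IsCoef (algebraMap ℝ _ (4 * σ * m) * phi m : JetAlg Ω) :=
    (isCoef_algebraMap _).mul (isCoef_phi m)
  obtain ⟨K', k₀, k₁, k₂, hKr⟩ : ∃ K' : Fin 3 → Fin 2 → JetAlg Ω, K' 0 = baseFlow m σ ∧
      K' 1 = consFlow m σ (a₁ 1) (algebraMap ℝ _ (4 * σ * m) * phi m * a₁ 0) ∧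
      K' 2 = consFlow m σ (a₂ 1) (algebraMap ℝ _ (4 * σ * m) * phi m * a₂ 0) ∧
      ∀ n, RepV (K n) (K' n) := exists_repV hK0 hK1 hK2
  obtain ⟨Q', l₀, l₁, l₂, hQr⟩ : ∃ Q' : Fin 3 → Fin 2 → JetAlg Ω,
      Q' 0 = symmFlow m σ (phi m) 0 ∧ Q' 1 = q₁ ∧ Q' 2 = q₂ ∧ ∀ n, RepV (Q n) (Q' n) :=
    exists_repV hS rq₁ rq₂
  obtain ⟨-, c₁, c₂⟩ := (commute_iff hKr hQr).1 hc
  rw [k₀, k₁, l₀, l₁] at c₁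
  rw [k₀, k₁, k₂, l₀, l₁, l₂] at c₂
  obtain ⟨F, G, f, h, M, N, A, B, hM, hN, hA, hB, e₁, e₂⟩ := exists_normalFlow hs hm2 (ha₁ 1)
    ((ha₁ 0).coef_mul hcoef) (ha₂ 1) ((ha₂ 0).coef_mul hcoef) hq₁ hq₂ c₁ c₂
  have hr := isCoef_rho (Ω := Ω) m σ
  have hx : consFlow m σ M N = fun i => totD ((![rho m σ * N, M] : Fin 2 → JetAlg Ω) i) := by
    funext i; fin_cases i <;> rfl
  have hMi : ∀ i, IsCoef ((![rho m σ * N, M] : Fin 2 → JetAlg Ω) i) := fun i => by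
    fin_cases i
    exacts [hr.mul hN, hM]
  have hxd : ∀ i, HP1 fieldFrame (consFlow m σ M N i) := fun i => by
    rw [hx]; exact (hMi i).hp1_totD
  -- The second-order generator of the transformation is `X₂ - ½ X₁(X₁)`. As `X₁` is a total
  -- derivative, so is `X₁(X₁)`, and the extra half restores it within the current, so the
  -- transformation stays conservative.
  let b : Fin 2 → JetAlg Ω := fun i => (![rho m σ * B, A] : Fin 2 → JetAlg Ω) i +
    algebraMap ℝ _ (1 / 2) * evo (consFlow m σ M N) ((![rho m σ * N, M] : Fin 2 → JetAlg Ω) i)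
  have hb : ∀ i, HP1 fieldFrame (b i) := fun i => by
    refine HP1.add ?_ (((hMi i).hp1_evo hxd).coef_mul (isCoef_algebraMap _))
    fin_cases i
    exacts [hB.coef_mul hr, hA]
  have hY : (fun i => totD (b i)) - (1 / 2 : ℝ) • (fun i => evo (consFlow m σ M N)
      (consFlow m σ M N i)) = consFlow m σ A B := by
    funext i
    have h1 : evo (consFlow m σ M N) (consFlow m σ M N i) =
      totD (evo (consFlow m σ M N) ((![rho m σ * N, M] : Fin 2 → JetAlg Ω) i)) := by
      rw [← evo_totD]; congr 1; rw [hx]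
    rw [Pi.sub_apply, Pi.smul_apply, h1]
    simp only [b, map_add, ← Algebra.smul_def, Derivation.map_smul, add_sub_cancel_right]
    fin_cases i <;> rfl
  refine ⟨F, G, f, conservativeMiura ![rho m σ * N, M] b, h,
    isConservativeMiura_conservativeMiura hMi hb,
    (carries_two_iff (X₁ := consFlow m σ M N) (X₂ := fun i => totD (b i)) (fun z => rfl) ?_
      (fun i => rep_toFun _) hKr (rep_normalForm h hm2)).2 ⟨?_, ?_, ?_⟩⟩
  · rw [hx]; exact fun i => rep_toFun _
  · rw [k₀]; rfl
  · rw [k₀, k₁]; exact e₁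
  · rw [k₀, k₁, k₂, hY]; exact e₂

/-- An integrable deformation is locally reducible to the normal form. -/
theorem Integrable.exists_normalForm (hm2 : m ≠ 2) {K : Fin 3 → Jet → Pt}
    (hK : IsDeformation m (2 * σ) (Ω : Set Pt) K) (hI : Integrable (Ω : Set Pt) K) {p : Pt}
    (hp : p ∈ (Ω : Set Pt)) : ∃ U : Set Pt, IsOpen U ∧ p ∈ U ∧ U ⊆ Ω ∧
      ∃ (F G f : ℝ → ℝ) (X : Fin 3 → Jet → Pt), SmoothParams m σ U F G f ∧
        IsConservativeMiura U X ∧ Carries 2 U X K (normalForm m σ F G f) := by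
  -- Integrability is invoked for the single symmetry `w_τ = u^(m-1) w_x`, `v_τ = 0`, on all of `Ω`;
  -- only afterwards is the domain shrunk.
  obtain ⟨Q, hQ, hQ0, hc⟩ := hI (riemannSymm m σ)
    (fun i => (hp1_symmFlow (isCoef_phi m) isCoef_zero i).isDiffPoly
      (rep_riemannSymm (Ω := Ω) (m := m) (σ := σ) i))
    (fun z hz i => (hK.rep_zero.bracket rep_riemannSymm i ⟨z, hz⟩).trans (by
      rw [brk_baseFlow_symmFlow isSymm_phi]; rfl))
  obtain ⟨U, hpU, hU, hpos, hs⟩ := exists_solvable m σ hp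
  exact ⟨U, U.isOpen, hpU, hU, exists_carries_normalForm hs hm2 (hK.mono hU)
    (fun n i => (hQ n i).mono hU) (fun z hz => hQ0 z (hU hz)) (hc.mono hU)⟩

/-- The functional parameters of the normal form are essential. -/
theorem eqOn_of_carries (hm2 : m ≠ 2) {F G f F' G' f' : ℝ → ℝ}
    (h : SmoothParams m σ (Ω : Set Pt) F G f) (h' : SmoothParams m σ (Ω : Set Pt) F' G' f')
    {X : Fin 3 → Jet → Pt} (hX : IsMiura (Ω : Set Pt) X) :
    (Carries 1 (Ω : Set Pt) X (normalForm m σ F G f) (normalForm m σ F' G' f') →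
      Set.EqOn F F' (riemannInv m σ '' (Ω : Set Pt))) ∧
    (Carries 2 (Ω : Set Pt) X (normalForm m σ F G f) (normalForm m σ F' G' f') →
      Set.EqOn F F' (riemannInv m σ '' (Ω : Set Pt)) ∧
      Set.EqOn G G' (riemannInv m σ '' (Ω : Set Pt)) ∧
      Set.EqOn f f' ((fun p : Pt => p 1) '' (Ω : Set Pt))) := by
  choose X₁ hX₁ r₁ using fun i => (hX.2 1 i).rep_one
  choose X₂ hX₂ r₂ using fun i => (hX.2 2 i).rep_two
  have hK := rep_normalForm h hm2
  have hL := rep_normalForm h' hm2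
  refine ⟨fun hc => eqOn_of_order_one h h' hX₁ (hc.order_one hX.1 r₁ r₂ hK hL).2, fun hc => ?_⟩
  obtain ⟨-, e₁, e₂⟩ := (carries_two_iff hX.1 r₁ r₂ hK hL).1 hc
  refine ⟨eqOn_of_order_one h h' hX₁ e₁, eqOn_of_order_two h h' hm2 hX₁ (fun i => ?_) e₁ e₂⟩
  -- The generator `X₂ - ½ X₁(X₁)` has degree two: differentiating a polynomial of degree one along
  -- a system of degree one raises the degree by one.
  refine (hX₂ i).sub ?_
  rw [Pi.smul_apply, Algebra.smul_def]
  exact ((hX₁ i).hp2_evo hX₁).coef_mul (isCoef_algebraMap _)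

end

end CoxeterFlow

end


theorem mainTheorem9 (m σ : ℝ) (hm : 1 < m) (hm2 : m ≠ 2) (hσ : σ = 1 ∨ σ = -1)
    (Ω : Set CoxeterFlow.Pt) (hΩ : IsOpen Ω) (hu : ∀ p ∈ Ω, 0 < p 0) :
    -- every integrable deformation is locally reducible to the normal form
    (∀ K : Fin 3 → CoxeterFlow.Jet → CoxeterFlow.Pt,
      CoxeterFlow.IsDeformation m (2 * σ) Ω K → CoxeterFlow.Integrable Ω K →
      ∀ p ∈ Ω, ∃ U : Set CoxeterFlow.Pt, IsOpen U ∧ p ∈ U ∧ U ⊆ Ω ∧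
        ∃ (F G f : ℝ → ℝ) (X : Fin 3 → CoxeterFlow.Jet → CoxeterFlow.Pt),
          CoxeterFlow.SmoothParams m σ U F G f ∧
          CoxeterFlow.IsConservativeMiura U X ∧
          CoxeterFlow.Carries 2 U X K (CoxeterFlow.normalForm m σ F G f)) ∧
    -- every normal form is an integrable deformation
    (∀ F G f : ℝ → ℝ, CoxeterFlow.SmoothParams m σ Ω F G f →
      CoxeterFlow.IsDeformation m (2 * σ) Ω (CoxeterFlow.normalForm m σ F G f) ∧
      CoxeterFlow.Integrable Ω (CoxeterFlow.normalForm m σ F G f)) ∧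
    -- no Miura transformation with identical leading term changes the functional parameters:
    -- `F` is determined at the first order, `G` and `f` at the second
    (∀ F G f F' G' f' : ℝ → ℝ,
      CoxeterFlow.SmoothParams m σ Ω F G f → CoxeterFlow.SmoothParams m σ Ω F' G' f' →
      ∀ X : Fin 3 → CoxeterFlow.Jet → CoxeterFlow.Pt, CoxeterFlow.IsMiura Ω X →
        (CoxeterFlow.Carries 1 Ω X (CoxeterFlow.normalForm m σ F G f)
            (CoxeterFlow.normalForm m σ F' G' f') →
          Set.EqOn F F' (CoxeterFlow.riemannInv m σ '' Ω)) ∧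
        (CoxeterFlow.Carries 2 Ω X (CoxeterFlow.normalForm m σ F G f)
            (CoxeterFlow.normalForm m σ F' G' f') →
          Set.EqOn F F' (CoxeterFlow.riemannInv m σ '' Ω) ∧
          Set.EqOn G G' (CoxeterFlow.riemannInv m σ '' Ω) ∧
          Set.EqOn f f' ((fun p : CoxeterFlow.Pt => p 1) '' Ω))) := by
  have : CoxeterFlow.PosFst ⟨Ω, hΩ⟩ := ⟨hu⟩
  have : CoxeterFlow.Param m σ := ⟨hm, hσ⟩
  exact ⟨fun K hK hI p hp =>
      CoxeterFlow.Integrable.exists_normalForm (Ω := ⟨Ω, hΩ⟩) hm2 hK hI hp,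
    fun F G f h => ⟨CoxeterFlow.isDeformation_normalForm (Ω := ⟨Ω, hΩ⟩) h hm2,
      CoxeterFlow.integrable_normalForm (Ω := ⟨Ω, hΩ⟩) h hm2⟩,
    fun F G f F' G' f' h h' X hX =>
      CoxeterFlow.eqOn_of_carries (Ω := ⟨Ω, hΩ⟩) hm2 h h' hX⟩
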